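/- Let $N\in\mathbb N$, $\alpha\in\mathbb R$, and let $\mathfrak{su}(N)$ be the skew-Hermitian traceless $N\times N$ matrices. Let $\Delta_N A=-\sum_{a=1}^3[S_a,[S_a,A]]$ be the Hoppe–Yau Laplacian, $S_a$ being the standard generators of the spin-$\frac{N-1}{2}$ representation of $\mathfrak{so}(3)$; it is invertible on traceless matrices, and $\Delta_N^{-1}$ is extended by $0$ to multiples of the identity. The quantized Hazeltine equations for $(W,\Theta,\chi)\in\mathfrak{su}(N)^3$ are $$\dot W=[W,M_1]+[\Theta,M_2],\quad \dot\Theta=[\Theta,M_1]-\alpha[\Theta,\chi],\quad \dot\chi=[\chi,M_1]+[\Theta,M_2],\qquad M_1=\Delta_N^{-1}W,\ M_2=\Delta_N\Theta,$$ with $H=\frac12\mathrm{tr}(WM_1+\Theta M_2-\alpha\chi^2)$. Identify $(W,\Theta,\chi)$ with an element of the dual of the Lie algebra $\mathfrak f=\mathfrak{su}(N)\oplus(\mathfrak{su}(N)\ltimes\mathfrak{su}(N)^*)$ by $\langle(W,\Theta,\chi),(\xi,v,a)\rangle=\langle W-\chi,\xi\rangle+\langle\chi,v\rangle+\langle\Theta,a\rangle$,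 where $\langle A,B\rangle=\mathrm{tr}(A^\dagger B)$ and $[(\xi,v,a),(\eta,w,b)]=([\xi,\eta],[v,w],[v,b]+[a,w])$; $\mathfrak f^*$ carries the Lie–Poisson bracket $\{F,G\}(x)=\langle x,[dF(x),dG(x)]\rangle$. A step of size $h$ of the scheme, $(W_n,\Theta_n,\chi_n)\mapsto(W_{n+1},\Theta_{n+1},\chi_{n+1})$, is given by a skew-Hermitian stage $(\tilde W,\tilde\Theta,\tilde\chi)$ (not required to be traceless) with $\tilde M_1=\Delta_N^{-1}\tilde W$, $\tilde M_2=\Delta_N\tilde\Theta$, $\tilde M_3=\tilde M_1-\alpha\tilde\chi$ and $$\begin{aligned} \Theta_n&=\tilde\Theta-\tfrac h2[\tilde\Theta,\tilde M_3]-\tfrac{h^2}4\tilde M_3\tilde\Theta\tilde M_3,\qquad \Theta_{n+1}=\Theta_n+h[\tilde\Theta,\tilde M_3],\\ W_n&=\tilde W-\tfrac h2[\tilde W,\tilde M_1]-\tfrac h2[\tilde\Theta,\tilde M_2]-\tfrac{h^2}4\big(\tilde M_1\tilde W\tilde M_1+\tilde M_2\tilde\Theta\tilde M_3+\tilde M_3\tilde\Theta\tilde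 M_2-\alpha\tilde M_1\tilde\chi^2-\alpha\tilde\chi^2\tilde M_1+\alpha^2\tilde\chi^3\big),\\ W_{n+1}&=W_n+h[\tilde W,\tilde M_1]+h[\tilde\Theta,\tilde M_2],\\ \chi_n&=\tilde\chi-\tfrac h2[\tilde\chi,\tilde M_3]-\tfrac h2[\tilde\Theta,\tilde M_2]-\tfrac{h^2}4\big(\tilde M_3\tilde\chi\tilde M_3+\tilde M_2\tilde\Theta\tilde M_3+\tilde M_3\tilde\Theta\tilde M_2\big),\\ \chi_{n+1}&=\chi_n+h[\tilde\chi,\tilde M_3]+h[\tilde\Theta,\tilde M_2]. \end{aligned}$$ **Theorem.** 1. The quantized Hazeltine equations are the Hamiltonian system of $H$ for the Lie–Poisson bracket. 2. A triple is a step of the scheme exactly when it is an isospectral midpoint step for $\Psi=W-\chi$, namely $\Psi_n=\tilde\Psi-\frac h2[\tilde\Psi,\tilde M_1]-\frac{h^2}4\tilde M_1\tilde\Psi\tilde M_1$, $\Psi_{n+1}=\Psi_n+h[\tilde\Psi,\tilde M_1]$, together with the magnetic midpoint step for $(\Theta,\chi)$, namely the four equations for $\Theta$ and $\chi$ above. 3.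 Every step, of any size $h\in\mathbb R$, that starts in $\mathfrak{su}(N)^3$ ends in $\mathfrak{su}(N)^3$, on the same coadjoint orbit of $SU(N)\times(SU(N)\ltimes\mathfrak{su}(N)^*)$, and for all functions $K,F,G:\mathbb C\to\mathbb C$ (applied to skew-Hermitian matrices by functional calculus) $$\mathrm{tr}K(W_n-\chi_n)=\mathrm{tr}K(W_{n+1}-\chi_{n+1}),\quad \mathrm{tr}F(\Theta_n)=\mathrm{tr}F(\Theta_{n+1}),\quad \mathrm{tr}(\chi_nG(\Theta_n))=\mathrm{tr}(\chi_{n+1}G(\Theta_{n+1})).$$ 4. Let $R>0$, and use the maximum over the three components of the operator norm on triples. There are $h_0>0$ and maps $\phi_h$ such that for $|h|<h_0$ and $\|x\|<R$ there is exactly one stage of norm less than $2R$ for $x$, and $\phi_h(x)$ is the result of the corresponding step; $(h,x)\mapsto\phi_h(x)$ is smooth; and * (integrator) $\|\phi_h(\gamma(0))-\gamma(h)\|\le C|h|^3$ for solutions $\gamma$ of the quantized Hazeltine equations between times $0$ and $h$ with $\|\gamma(0)\|<R$; * (Lie–Poisson) on the ball of radius $R$, $\phi_h$ preserves the coadjoint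 orbits, is symplectic on them, and preserves the Lie–Poisson bracket; * (near preservation of $H$ in the sense of backward error analysis) there are $C,c>0$ and, for $0<h<h_0$, smooth modified Hamiltonians $\tilde H_h$ such that for $\|x\|<R$: $|\tilde H_h(x)-H(x)|\le Ch^2$, $|\tilde H_h(\phi_h(x))-\tilde H_h(x)|\le Che^{-c/h}$, and $\phi_h(x)$ differs by at most $Che^{-c/h}$ from the value at time $h$ of any solution on $[0,h]$, starting at $x$, of the Lie–Poisson system with Hamiltonian $\tilde H_h$; moreover, along numerical trajectories $x_{k+1}=\phi_h(x_k)$ with $x_0,\dots,x_n$ in the ball of radius $R$ and $nh\le e^{c/(2h)}$, $|\tilde H_h(x_n)-\tilde H_h(x_0)|\le Ce^{-c/(2h)}$ and $|H(x_n)-H(x_0)|\le Ch^2$. The constants $h_0,C,c$ depend only on $N$, $\alpha$ and $R$. -/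

import Mathlib

open Matrix Set
open scoped Matrix.Norms.L2Operator ContDiff

noncomputable section

namespace Hazeltine

/-- Complex `N × N` matrices, with the operator norm. The bracket `⁅A, B⁆` is the matrix
commutator `A * B - B * A`. -/
abbrev Mat (N : ℕ) := Matrix (Fin N) (Fin N) ℂ

/-! ### The quantized (Hoppe–Yau) Laplacian -/

/-- The raising operator of the spin `(N - 1) / 2` representation of `so(3)` in its standard
weight basis; the basis vector with index `k` has weight `(N - 1) / 2 - k`. -/
def spinRaise (N : ℕ) : Mat N :=
  Matrix.of fun i j =>
    if (i : ℕ) + 1 = (j : ℕ) then ((Real.sqrt (((i : ℝ) + 1) * ((N : ℝ) - ((i : ℝ) + 1))) : ℝ) : ℂ)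
    else 0

def spin1 (N : ℕ) : Mat N := (1 / 2 : ℂ) • (spinRaise N + (spinRaise N)ᴴ)

def spin2 (N : ℕ) : Mat N := (-Complex.I / 2 : ℂ) • (spinRaise N - (spinRaise N)ᴴ)

def spin3 (N : ℕ) : Mat N :=
  Matrix.diagonal fun k => (((N : ℝ) - 1) / 2 - ((k : ℕ) : ℝ) : ℝ)

/-- The linear map `A ↦ [S, A]`. -/
def adMat {N : ℕ} (S : Mat N) : Mat N →ₗ[ℂ] Mat N :=
  LinearMap.mulLeft ℂ S - LinearMap.mulRight ℂ S

/-- The Hoppe–Yau Laplacian `Δ_N A = - ∑ₐ [Sₐ, [Sₐ, A]]`. In terms of the rescaled generators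
`Xₐ = 2 / √(N² - 1) • Sₐ`, which satisfy `∑ₐ Xₐ² = 1`, it is
`- (N² - 1) / 4 * ∑ₐ [Xₐ, [Xₐ, A]]`. Its eigenvalues are `- l * (l + 1)`, `0 ≤ l ≤ N - 1`. -/
def lap (N : ℕ) : Mat N →ₗ[ℂ] Mat N :=
  -(adMat (spin1 N) ∘ₗ adMat (spin1 N) + adMat (spin2 N) ∘ₗ adMat (spin2 N)
    + adMat (spin3 N) ∘ₗ adMat (spin3 N))

/-- Traceless matrices, the complexification of `su(N)`. -/
abbrev traceless (N : ℕ) : Submodule ℂ (Mat N) := LinearMap.ker (Matrix.traceLinearMap (Fin N) ℂ ℂ)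

theorem trace_adMat {N : ℕ} (S A : Mat N) : (adMat S A).trace = 0 := by
  simp [adMat, Matrix.trace_sub, Matrix.trace_mul_comm S A]

theorem lap_mem (N : ℕ) (A : Mat N) : lap N A ∈ traceless N := by
  simp [lap, Matrix.trace_neg, Matrix.trace_add, trace_adMat]

theorem spin1_herm (N : ℕ) : (spin1 N)ᴴ = spin1 N := by
  simp [spin1, Matrix.conjTranspose_smul, add_comm]

theorem spin2_herm (N : ℕ) : (spin2 N)ᴴ = spin2 N := by
  simp only [spin2, Matrix.conjTranspose_smul, Matrix.conjTranspose_sub,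
    Matrix.conjTranspose_conjTranspose]
  have : star (-Complex.I / 2 : ℂ) = -(-Complex.I / 2) := by
    simp [neg_div]
  rw [this, neg_smul, ← smul_neg, neg_sub]

theorem spin3_herm (N : ℕ) : (spin3 N)ᴴ = spin3 N := by
  rw [spin3, Matrix.diagonal_conjTranspose]
  congr 1
  funext k
  simp [Pi.star_apply]

theorem trace_adMat_adMat {N : ℕ} {S : Mat N} (hS : Sᴴ = S) (A : Mat N) :
    (Aᴴ * adMat S (adMat S A)).trace = ((adMat S A)ᴴ * adMat S A).trace := by
  simp only [adMat, LinearMap.sub_apply, LinearMap.mulLeft_apply, LinearMap.mulRight_apply,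
    Matrix.conjTranspose_sub, Matrix.conjTranspose_mul, hS, mul_sub, sub_mul, Matrix.trace_sub]
  have e1 : (S * Aᴴ * (S * A)).trace = (Aᴴ * (S * A * S)).trace := by
    rw [mul_assoc, Matrix.trace_mul_comm, mul_assoc]
  have e2 : (S * Aᴴ * (A * S)).trace = (Aᴴ * (A * S * S)).trace := by
    rw [mul_assoc, Matrix.trace_mul_comm, mul_assoc]
  rw [e1, e2]
  simp only [mul_assoc]

theorem comm_of_lap_eq_zero {N : ℕ} {A : Mat N} (h : lap N A = 0) :
    adMat (spin1 N) A = 0 ∧ adMat (spin2 N) A = 0 ∧ adMat (spin3 N) A = 0 := by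
  have h0 : (Aᴴ * -lap N A).trace = 0 := by simp [h]
  simp only [lap, LinearMap.neg_apply, LinearMap.add_apply, LinearMap.comp_apply, neg_neg, mul_add,
    Matrix.trace_add, trace_adMat_adMat (spin1_herm N), trace_adMat_adMat (spin2_herm N),
    trace_adMat_adMat (spin3_herm N)] at h0
  have key : ∀ B : Mat N, 0 ≤ (Bᴴ * B).trace.re ∧ ((Bᴴ * B).trace.re = 0 → B = 0) := by
    intro B
    have e : (Bᴴ * B).trace.re = ∑ i, ∑ j, Complex.normSq (B j i) := by
      simp [Matrix.trace, Matrix.mul_apply, Complex.normSq_apply]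
    rw [e]
    refine ⟨Finset.sum_nonneg fun i _ => Finset.sum_nonneg fun j _ => Complex.normSq_nonneg _, ?_⟩
    intro hz
    ext j i
    have h1 := (Finset.sum_eq_zero_iff_of_nonneg
      (fun i _ => Finset.sum_nonneg fun j _ => Complex.normSq_nonneg (B j i))).1 hz i
      (Finset.mem_univ _)
    have h2 := (Finset.sum_eq_zero_iff_of_nonneg
      (fun j _ => Complex.normSq_nonneg (B j i))).1 h1 j (Finset.mem_univ _)
    simpa using h2
  have h1 := key (adMat (spin1 N) A)
  have h2 := key (adMat (spin2 N) A)
  have h3 := key (adMat (spin3 N) A)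
  have hr := congrArg Complex.re h0
  simp only [Complex.add_re, Complex.zero_re] at hr
  exact ⟨h1.2 (by linarith), h2.2 (by linarith), h3.2 (by linarith)⟩

theorem eq_zero_of_lap_eq_zero {N : ℕ} {A : Mat N} (h : lap N A = 0) (ht : A.trace = 0) :
    A = 0 := by
  obtain ⟨h1, h2, h3⟩ := comm_of_lap_eq_zero h
  have hoff : ∀ i j, i ≠ j → A i j = 0 := by
    intro i j hij
    have := congrFun (congrFun h3 i) j
    simp only [adMat, spin3, LinearMap.sub_apply, LinearMap.mulLeft_apply,
      LinearMap.mulRight_apply, Matrix.sub_apply, Matrix.diagonal_mul, Matrix.mul_diagonal,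
      Matrix.zero_apply] at this
    have h' : (((j : ℕ) : ℂ) - ((i : ℕ) : ℂ)) * A i j = 0 := by
      push_cast at this
      linear_combination this
    rcases mul_eq_zero.1 h' with h' | h'
    · exfalso
      apply hij
      have : ((j : ℕ) : ℂ) = ((i : ℕ) : ℂ) := sub_eq_zero.1 h'
      exact (Fin.ext (by exact_mod_cast this)).symm
    · exact h'
  have hp : spinRaise N = spin1 N + Complex.I • spin2 N := by
    have e : Complex.I * (-Complex.I / 2) = 1 / 2 := by
      rw [mul_div_assoc', mul_neg, Complex.I_mul_I, neg_neg]
    rw [spin1, spin2, smul_smul, e, ← smul_add, add_add_sub_cancel, ← two_smul ℂ, smul_smul]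
    norm_num
  have h4 : spinRaise N * A - A * spinRaise N = 0 := by
    simp only [adMat, LinearMap.sub_apply, LinearMap.mulLeft_apply,
      LinearMap.mulRight_apply] at h1 h2
    rw [hp, add_mul, mul_add, Matrix.smul_mul, Matrix.mul_smul, add_sub_add_comm, ← smul_sub,
      h1, h2]
    simp
  have hstep : ∀ (k : ℕ) (hk : k + 1 < N), A ⟨k + 1, hk⟩ ⟨k + 1, hk⟩
      = A ⟨k, by omega⟩ ⟨k, by omega⟩ := by
    intro k hk
    have := congrFun (congrFun h4 ⟨k, by omega⟩) ⟨k + 1, hk⟩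
    rw [Matrix.sub_apply, Matrix.mul_apply, Matrix.mul_apply, Matrix.zero_apply,
      Finset.sum_eq_single (⟨k + 1, hk⟩ : Fin N), Finset.sum_eq_single (⟨k, by omega⟩ : Fin N)]
      at this
    · simp only [spinRaise, Matrix.of_apply, if_true] at this
      have hne : ((Real.sqrt (((k : ℝ) + 1) * ((N : ℝ) - ((k : ℝ) + 1))) : ℝ) : ℂ) ≠ 0 := by
        have hk' : ((k : ℝ) + 1) < N := by exact_mod_cast hk
        have : 0 < Real.sqrt (((k : ℝ) + 1) * ((N : ℝ) - ((k : ℝ) + 1))) :=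
          Real.sqrt_pos.2 (mul_pos (by positivity) (by linarith))
        exact_mod_cast this.ne'
      apply mul_left_cancel₀ hne
      linear_combination this
    · intro b _ hb
      rw [hoff _ _ (Ne.symm hb), zero_mul]
    · simp
    · intro b _ hb
      rw [hoff _ _ hb, mul_zero]
    · simp
  rcases Nat.eq_zero_or_pos N with rfl | hN
  · ext i
    exact i.elim0
  have hconst : ∀ (k : ℕ) (hk : k < N), A ⟨k, hk⟩ ⟨k, hk⟩ = A ⟨0, hN⟩ ⟨0, hN⟩ := by
    intro k
    induction k with
    | zero => intro _; rfl
    | succ k ih => intro hk; rw [hstep k hk, ih]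
  have hsum : (N : ℂ) * A ⟨0, hN⟩ ⟨0, hN⟩ = 0 := by
    have e : A.trace = ∑ _i : Fin N, A ⟨0, hN⟩ ⟨0, hN⟩ :=
      Finset.sum_congr rfl fun i _ => hconst i.1 i.2
    rw [← ht, e]
    simp
  have hz : A ⟨0, hN⟩ ⟨0, hN⟩ = 0 := by
    rcases mul_eq_zero.1 hsum with h' | h'
    · have h'' : N = 0 := Nat.cast_eq_zero.1 h'
      omega
    · exact h'
  ext i j
  by_cases hij : i = j
  · subst hij
    rw [Matrix.zero_apply, ← hz]
    exact hconst i.1 i.2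
  · rw [hoff i j hij, Matrix.zero_apply]

/-- The Laplacian as a bijection of the traceless matrices. -/
def lapEquiv (N : ℕ) : traceless N ≃ₗ[ℂ] traceless N :=
  LinearEquiv.ofInjectiveEndo
    (((lap N).codRestrict (traceless N) (lap_mem N)) ∘ₗ (traceless N).subtype) (by
      rw [← LinearMap.ker_eq_bot, LinearMap.ker_eq_bot']
      rintro ⟨A, hA⟩ h
      have h' : lap N A = 0 := congrArg Subtype.val h
      exact Subtype.ext (eq_zero_of_lap_eq_zero h' (by simpa using hA)))

/-- The traceless part `A - (tr A / N) • 1`. -/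
def tracelessPart (N : ℕ) : Mat N →ₗ[ℂ] traceless N :=
  LinearMap.codRestrict (traceless N)
    (LinearMap.id - ((N : ℂ)⁻¹ • Matrix.traceLinearMap (Fin N) ℂ ℂ).smulRight (1 : Mat N)) (by
      intro A
      rcases Nat.eq_zero_or_pos N with rfl | hN
      · simp
      · have : (N : ℂ) ≠ 0 := by exact_mod_cast hN.ne'
        simp only [LinearMap.mem_ker, LinearMap.sub_apply, LinearMap.id_apply,
          LinearMap.smulRight_apply, LinearMap.smul_apply, Matrix.traceLinearMap_apply,
          Matrix.trace_sub, Matrix.trace_smul, Matrix.trace_one, Fintype.card_fin, smul_eq_mul]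
        field_simp
        simp)

/-- `Δ_N⁻¹`: the inverse of the Laplacian on traceless matrices, extended by `0` to multiples of
the identity. -/
def lapInv (N : ℕ) : Mat N →ₗ[ℂ] Mat N :=
  (traceless N).subtype ∘ₗ (lapEquiv N).symm.toLinearMap ∘ₗ tracelessPart N

/-! ### The phase space -/

/-- `su(N)`: skew-Hermitian traceless matrices. -/
def su (N : ℕ) : Submodule ℝ (Mat N) where
  carrier := {A | Aᴴ = -A ∧ A.trace = 0}
  zero_mem' := by simp
  add_mem' := by
    rintro A B ⟨hA, hA'⟩ ⟨hB, hB'⟩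
    exact ⟨by rw [Matrix.conjTranspose_add, hA, hB, neg_add], by
      rw [Matrix.trace_add, hA', hB', add_zero]⟩
  smul_mem' := by
    rintro c A ⟨hA, hA'⟩
    exact ⟨by rw [Matrix.conjTranspose_smul, hA, star_trivial, smul_neg], by
      rw [Matrix.trace_smul, hA', smul_zero]⟩

instance (N : ℕ) : FiniteDimensional ℝ (su N) :=
  FiniteDimensional.finiteDimensional_submodule (su N)

/-- Triples of matrices `(W, Θ, χ)`. -/
abbrev Tri (N : ℕ) := Mat N × Mat N × Mat N

/-- The phase space: triples `(W, Θ, χ)` in `su(N)`. -/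
abbrev State (N : ℕ) := su N × su N × su N

/-- The Lie algebra `su(N) ⊕ (su(N) ⋉ su(N)*)` as a vector space, with `su(N)*` identified with
`su(N)` through the Frobenius inner product; its elements are written `(ξ, v, a)`. -/
abbrev Alg (N : ℕ) := su N × su N × su N

def toTri {N : ℕ} (x : State N) : Tri N := (x.1.1, x.2.1.1, x.2.2.1)

/-- The commutator of `su(N)`. -/
def suBracket {N : ℕ} (A B : su N) : su N :=
  ⟨⁅(A : Mat N), (B : Mat N)⁆, by
    obtain ⟨A, hA, hA'⟩ := A
    obtain ⟨B, hB, hB'⟩ := B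
    refine ⟨?_, ?_⟩
    · simp only [Ring.lie_def, Matrix.conjTranspose_sub, Matrix.conjTranspose_mul, hA, hB]
      noncomm_ring
    · simp only [Ring.lie_def, Matrix.trace_sub, Matrix.trace_mul_comm A B, sub_self]⟩

/-- The Lie bracket of `su(N) ⊕ (su(N) ⋉ su(N)*)`:
`[(ξ, v, a), (η, w, b)] = ([ξ, η], [v, w], [v, b] + [a, w])`. -/
def algBracket {N : ℕ} (p q : Alg N) : Alg N :=
  (suBracket p.1 q.1, suBracket p.2.1 q.2.1, suBracket p.2.1 q.2.2 + suBracket p.2.2 q.2.1)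

/-- The Frobenius inner product `tr (Aᴴ B)` on `su(N)` (which is real there). -/
def frob (N : ℕ) : LinearMap.BilinForm ℝ (su N) :=
  LinearMap.mk₂ ℝ (fun A B => ((A : Mat N)ᴴ * (B : Mat N)).trace.re)
    (by intros; simp [add_mul, Matrix.conjTranspose_add])
    (by intros; simp [Matrix.conjTranspose_smul])
    (by intros; simp [mul_add])
    (by intros; simp)

/-- The pairing through which a state `(W, Θ, χ)` is an element of the dual of
`su(N) ⊕ (su(N) ⋉ su(N)*)`:
`⟨(W, Θ, χ), (ξ, v, a)⟩ = ⟨W - χ, ξ⟩ + ⟨χ, v⟩ + ⟨Θ, a⟩`. The algebra element is the first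
argument. -/
def pairing (N : ℕ) : LinearMap.BilinForm ℝ (su N × su N × su N) :=
  LinearMap.mk₂ ℝ
    (fun p x => frob N p.1 (x.1 - x.2.2) + frob N p.2.1 x.2.2 + frob N p.2.2 x.2.1)
    (by intros; simp; ring) (by intros; simp; ring) (by intros; simp; ring)
    (by intros; simp; ring)

theorem frob_self_eq_zero {N : ℕ} {A : su N} (h : frob N A A = 0) : A = 0 := by
  have e : frob N A A = ∑ i, ∑ j, Complex.normSq ((A : Mat N) j i) := by
    simp [frob, Matrix.trace, Matrix.mul_apply, Complex.normSq_apply]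
  rw [e] at h
  apply Subtype.ext
  ext j i
  have h1 := (Finset.sum_eq_zero_iff_of_nonneg
    (fun i _ => Finset.sum_nonneg fun j _ => Complex.normSq_nonneg ((A : Mat N) j i))).1 h i
    (Finset.mem_univ _)
  have h2 := (Finset.sum_eq_zero_iff_of_nonneg
    (fun j _ => Complex.normSq_nonneg ((A : Mat N) j i))).1 h1 j (Finset.mem_univ _)
  simpa using h2

theorem pairing_nondegenerate (N : ℕ) : (pairing N).Nondegenerate := by
  have hl : (pairing N).SeparatingLeft := by
    rintro ⟨ξ, v, a⟩ h
    have h1 := h (ξ, 0, 0)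
    have h2 := h (v, 0, v)
    have h3 := h (0, a, 0)
    simp only [pairing, LinearMap.mk₂_apply, sub_zero, sub_self, map_zero, add_zero, zero_add] at h1 h2 h3
    rw [frob_self_eq_zero h1, frob_self_eq_zero h2, frob_self_eq_zero h3]
    rfl
  exact LinearMap.BilinForm.Nondegenerate.ofSeparatingLeft hl

/-- The differential of a function on the phase space, as an element of the Lie algebra:
`⟨δ, grad F x⟩ = DF(x) δ` for all `δ`. -/
def grad {N : ℕ} (F : State N → ℝ) (x : State N) : Alg N :=
  ((pairing N).toDual (pairing_nondegenerate N)).symm (fderiv ℝ F x).toLinearMap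

/-- The Lie–Poisson bracket `{F, G}(x) = ⟨x, [dF(x), dG(x)]⟩`. -/
def lpBracket {N : ℕ} (F G : State N → ℝ) (x : State N) : ℝ :=
  pairing N (algBracket (grad F x) (grad G x)) x

/-! ### Coadjoint orbits and Lie–Poisson maps -/

/-- The infinitesimal coadjoint action `ad*_p x`, for `p = (ξ, v, a)` and `x = (W, Θ, χ)`, that is,
`⟨ad*_p x, q⟩ = ⟨x, [p, q]⟩` for all `q`. -/
def coad {N : ℕ} (p : Alg N) (x : State N) : State N :=
  (suBracket (x.1 - x.2.2) p.1 + (suBracket x.2.2 p.2.1 + suBracket x.2.1 p.2.2),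
    suBracket x.2.1 p.2.1,
    suBracket x.2.2 p.2.1 + suBracket x.2.1 p.2.2)

theorem frob_bracket {N : ℕ} (p q x : su N) :
    frob N q (suBracket x p) = frob N (suBracket p q) x := by
  obtain ⟨p, hp, -⟩ := p
  obtain ⟨q, hq, -⟩ := q
  obtain ⟨x, hx, -⟩ := x
  simp only [frob, suBracket, LinearMap.mk₂_apply, Ring.lie_def, Matrix.conjTranspose_sub,
    Matrix.conjTranspose_mul, hp, hq, mul_sub, sub_mul, Matrix.trace_sub, neg_mul, mul_neg, neg_neg,
    Matrix.trace_neg, mul_assoc]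
  rw [Matrix.trace_mul_comm p (q * x), mul_assoc]
  simp only [Complex.sub_re, Complex.neg_re]
  ring

/-- The formula in `coad` is the coadjoint action. -/
theorem pairing_coad {N : ℕ} (p q : Alg N) (x : State N) :
    pairing N q (coad p x) = pairing N (algBracket p q) x := by
  simp only [pairing, coad, algBracket, LinearMap.mk₂_apply, add_sub_cancel_right, map_add,
    LinearMap.add_apply, frob_bracket]
  ring

/-- `x = (W, Θ, χ)` and `y = (W', Θ', χ')` lie on the same coadjoint orbit of the group
`SU(N) × (SU(N) ⋉ su(N)*)`: for some `U, G ∈ SU(N)` and `u ∈ su(N)`,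
`W' - χ' = U (W - χ) Uᴴ`, `Θ' = G Θ Gᴴ` and `χ' = G χ Gᴴ + [u, G Θ Gᴴ]`. -/
def SameCoadjointOrbit {N : ℕ} (x y : State N) : Prop :=
  ∃ U ∈ Matrix.specialUnitaryGroup (Fin N) ℂ, ∃ G ∈ Matrix.specialUnitaryGroup (Fin N) ℂ,
    ∃ u : su N,
      ((y.1 - y.2.2 : su N) : Mat N) = U * ((x.1 - x.2.2 : su N) : Mat N) * Uᴴ ∧
      (y.2.1 : Mat N) = G * (x.2.1 : Mat N) * Gᴴ ∧
      (y.2.2 : Mat N) = G * (x.2.2 : Mat N) * Gᴴ + ⁅(u : Mat N), G * (x.2.1 : Mat N) * Gᴴ⁆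

/-- `φ` is a Lie–Poisson map on `D`: it preserves the coadjoint orbits, it is symplectic on them
for the Kirillov–Kostant–Souriau form `ω_x (ad*_p x, ad*_q x) = ⟨x, [p, q]⟩`, and it preserves the
Lie–Poisson bracket. -/
structure IsLiePoissonMapOn {N : ℕ} (φ : State N → State N) (D : Set (State N)) : Prop where
  orbit : ∀ x ∈ D, SameCoadjointOrbit x (φ x)
  symplectic : ∀ x ∈ D, ∀ p q : Alg N, ∃ p' q' : Alg N,
    fderiv ℝ φ x (coad p x) = coad p' (φ x) ∧ fderiv ℝ φ x (coad q x) = coad q' (φ x) ∧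
    pairing N (algBracket p' q') (φ x) = pairing N (algBracket p q) x
  poisson : ∀ F G : State N → ℝ, ContDiff ℝ ∞ F → ContDiff ℝ ∞ G → ∀ x ∈ D,
    lpBracket (F ∘ φ) (G ∘ φ) x = lpBracket F G (φ x)

/-- `γ` is a solution, on the time set `s`, of the Hamiltonian system with Hamiltonian `H` for the
Lie–Poisson bracket: `d/dt F(γ) = {F, H}(γ)` for every smooth `F`. -/
def IsHamiltonianSolutionOn {N : ℕ} (H : State N → ℝ) (γ : ℝ → State N) (s : Set ℝ) : Prop :=
  ∀ F : State N → ℝ, ContDiff ℝ ∞ F → ∀ t ∈ s,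
    HasDerivWithinAt (fun r => F (γ r)) (lpBracket F H (γ t)) s t

/-! ### The quantized Hazeltine equations -/

/-- The right-hand side of the quantized Hazeltine equations, with `M₁ = Δ_N⁻¹ W` and
`M₂ = Δ_N Θ`. -/
def hazField {N : ℕ} (α : ℝ) : Tri N → Tri N := fun (W, Θ, χ) =>
  let M₁ := lapInv N W
  let M₂ := lap N Θ
  (⁅W, M₁⁆ + ⁅Θ, M₂⁆, ⁅Θ, M₁⁆ - α • ⁅Θ, χ⁆, ⁅χ, M₁⁆ + ⁅Θ, M₂⁆)

/-- `γ` solves the quantized Hazeltine equations on the time set `s`. -/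
def IsSolutionOn {N : ℕ} (α : ℝ) (γ : ℝ → State N) (s : Set ℝ) : Prop :=
  ∀ t ∈ s, HasDerivWithinAt (fun r => toTri (γ r)) (hazField α (toTri (γ t))) s t

/-- The Hamiltonian `tr (W M₁ + Θ M₂ - α χ²) / 2` (the trace is real). -/
def ham {N : ℕ} (α : ℝ) (x : State N) : ℝ :=
  let W : Mat N := x.1
  let Θ : Mat N := x.2.1
  let χ : Mat N := x.2.2
  (1 / 2) * (W * lapInv N W + Θ * lap N Θ - α • χ ^ 2).trace.re

/-! ### The numerical scheme -/

def IsSkewTri {N : ℕ} (x : Tri N) : Prop := x.1ᴴ = -x.1 ∧ x.2.1ᴴ = -x.2.1 ∧ x.2.2ᴴ = -x.2.2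

/-- The implicit half of the scheme: the skew-Hermitian stage `(Wt, Θt, χt)` is obtained from
`(W, Θ, χ)`. -/
def IsStage {N : ℕ} (α h : ℝ) : Tri N → Tri N → Prop := fun (W, Θ, χ) (Wt, Θt, χt) =>
  let M₁ := lapInv N Wt
  let M₂ := lap N Θt
  let M₃ := M₁ - α • χt
  IsSkewTri (Wt, Θt, χt) ∧
  Θ = Θt - (h / 2) • ⁅Θt, M₃⁆ - (h ^ 2 / 4) • (M₃ * Θt * M₃) ∧
  W = Wt - (h / 2) • ⁅Wt, M₁⁆ - (h / 2) • ⁅Θt, M₂⁆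
    - (h ^ 2 / 4) • (M₁ * Wt * M₁ + M₂ * Θt * M₃ + M₃ * Θt * M₂
        - α • (M₁ * χt ^ 2) - α • (χt ^ 2 * M₁) + α ^ 2 • χt ^ 3) ∧
  χ = χt - (h / 2) • ⁅χt, M₃⁆ - (h / 2) • ⁅Θt, M₂⁆
    - (h ^ 2 / 4) • (M₃ * χt * M₃ + M₂ * Θt * M₃ + M₃ * Θt * M₂)

/-- The explicit half of the scheme: the new values from the old ones and the stage. -/
def update {N : ℕ} (α h : ℝ) : Tri N → Tri N → Tri N := fun (W, Θ, χ) (Wt, Θt, χt) =>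
  let M₁ := lapInv N Wt
  let M₂ := lap N Θt
  let M₃ := M₁ - α • χt
  (W + h • ⁅Wt, M₁⁆ + h • ⁅Θt, M₂⁆, Θ + h • ⁅Θt, M₃⁆, χ + h • ⁅χt, M₃⁆ + h • ⁅Θt, M₂⁆)

/-- One step of the scheme with step size `h`, from `x` to `y` through the stage `xt`. -/
def IsStep {N : ℕ} (α h : ℝ) (x xt y : Tri N) : Prop :=
  IsStage α h x xt ∧ y = update α h x xt

/-- The isospectral midpoint step for `Ψ' = [Ψ, M]`, from `Ψ` to `Ψ₁` through `Ψt`, where `M` is the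
value at the stage. -/
def IsIsospectralMidpointStep {N : ℕ} (h : ℝ) (M Ψ Ψt Ψ₁ : Mat N) : Prop :=
  Ψ = Ψt - (h / 2) • ⁅Ψt, M⁆ - (h ^ 2 / 4) • (M * Ψt * M) ∧ Ψ₁ = Ψ + h • ⁅Ψt, M⁆

/-- The magnetic midpoint step for `Θ' = [Θ, M]`, `χ' = [χ, M] + [Θ, M']`, from `(Θ, χ)` to
`(Θ₁, χ₁)` through `(Θt, χt)`, where `M` and `M'` are the values at the stage. -/
def IsMagneticMidpointStep {N : ℕ} (h : ℝ) (M M' Θ χ Θt χt Θ₁ χ₁ : Mat N) : Prop :=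
  Θ = Θt - (h / 2) • ⁅Θt, M⁆ - (h ^ 2 / 4) • (M * Θt * M) ∧
  Θ₁ = Θ + h • ⁅Θt, M⁆ ∧
  χ = χt - (h / 2) • ⁅χt, M⁆ - (h / 2) • ⁅Θt, M'⁆
    - (h ^ 2 / 4) • (M * χt * M + M' * Θt * M + M * Θt * M') ∧
  χ₁ = χ + h • ⁅χt, M⁆ + h • ⁅Θt, M'⁆

/-- Near preservation of the Hamiltonian, in the sense of backward error analysis, by the maps
`φ h` on the ball of radius `R`. There is a modified Hamiltonian `Hm h`, `O(h²)`-close to the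
Hamiltonian, such that `φ h` is the time-`h` map of the modified Hamiltonian system up to an
exponentially small error and nearly preserves `Hm h` up to such an error; and along numerical
trajectories in the ball, over exponentially long times, the modified Hamiltonian is preserved up
to an exponentially small error and the Hamiltonian up to `O(h²)`. -/
def NearlyPreservesHamiltonian {N : ℕ} (α h₀ R : ℝ) (φ : ℝ → State N → State N) : Prop :=
  ∃ C > 0, ∃ c > 0, ∃ Hm : ℝ → State N → ℝ, ∀ h, 0 < h → h < h₀ →
    ContDiff ℝ ∞ (Hm h) ∧
    (∀ x, ‖x‖ < R → |Hm h x - ham α x| ≤ C * h ^ 2) ∧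
    (∀ γ : ℝ → State N, ‖γ 0‖ < R → IsHamiltonianSolutionOn (Hm h) γ (Icc 0 h) →
      ‖φ h (γ 0) - γ h‖ ≤ C * h * Real.exp (-c / h)) ∧
    (∀ x, ‖x‖ < R → |Hm h (φ h x) - Hm h x| ≤ C * h * Real.exp (-c / h)) ∧
    (∀ (n : ℕ) (x : ℕ → State N), (∀ k ≤ n, ‖x k‖ < R) → (∀ k < n, x (k + 1) = φ h (x k)) →
      n * h ≤ Real.exp (c / (2 * h)) →
        |Hm h (x n) - Hm h (x 0)| ≤ C * Real.exp (-c / (2 * h)) ∧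
        |ham α (x n) - ham α (x 0)| ≤ C * h ^ 2)

end Hazeltine

/-! Write a triple as the element z = (W - χ, Θ + εχ) of the algebra `Amb N`, a matrix algebra times
the dual numbers over it. There the equations become one Lax equation z' = [z, Lz], where L =
`genMap` is linear and symmetric for the trace form `tau`, and the Hamiltonian is τ(Lz·z)/2. With u
= 1 + (h/2)Lz and v = 1 - (h/2)Lz, a step with stage z leads from uzv to vzu (`isStep_iff_mid`).
Hence the end point is the conjugate of the starting point by the Cayley transform v u⁻¹, which is
unitary because Lz is skew, and whose ε-part acts as the translation by su(N)*. This gives orbits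
and Casimirs for every step size (`exists_conj`, `step_orbit`).

For small steps the stage is a fixed point of a contraction (`exists_implicit_inverse`); uniqueness
and the symmetry z ↦ -zᴴ make it skew-Hermitian. The Poisson property is a trace identity that uses
only the symmetry of L and u + v = 2 (`trace_bracket_eq`).

The order and the near preservation of H rest on one observation. For a fixed starting point, the
end point y moves with the step size s by y' = [y, κ] (`deriv_endpoint`), and κ is the differential
of the energy of the stage, seen as a function of y (`trace_dmid_endpoint`). So the scheme is
exactly the flow, in the time s, of a time-dependent Hamiltonian. By homogeneity this Hamiltonian is
s⁻² k(-sy) with one function k analytic near 0, that is, a convergent series ∑ sᵈ κ_d with κ_d a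
polynomial of degree d + 2. Here κ₀ = H, and κ₁ = 0 because the cubic part is the trace of a
commutator. Gronwall's inequality then gives order two.

The modified Hamiltonian is the Magnus series G of this time-dependent system: formally, the
autonomous flow of G is the flow of the scheme (`IsMagnus`, `IsPoisson.eul_expS`). The Lie–Poisson
bivector is linear, so the coefficient of sᵈ in G is a polynomial of degree at most d + 1, and
differentiating it costs a factor d + 1 but no shrinking of the domain. Among the first n terms each
bracket costs O(n), so the Magnus recursion closes in a weighted norm of radius ρ = c₀/(n+1)
(`nu_eul_le_of_isMagnus`). G diverges, and is truncated at n of the order of 1/h.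

To compare the scheme with the flow of the truncation, take the polynomials exp(-{·, G})Xᵢ. Along
the curve of the scheme, and along the modified flow with G scaled by t/h, they are constant up to
errors θⁿ (`Adm.approx_const`, `Adm.flow_const`). At time h they form the same near-identity map
(`Adm.near_id`), so the two end points are exponentially close. The modified energy is conserved by
its own flow, hence almost by a step; summing over the steps gives the long-time bounds. -/

/-! ### Polynomial Poisson brackets and the Jacobi identity. -/

namespace PolyPoisson

open MvPolynomial Finset

variable {ι : Type*} [Fintype ι]

/-- The derivation `P ↦ {P, G}` of the polynomial ring for the bivector `π`. -/
def ham (π : ι → ι → MvPolynomial ι ℝ) (G : MvPolynomial ι ℝ) :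
    Derivation ℝ (MvPolynomial ι ℝ) (MvPolynomial ι ℝ) :=
  ∑ i, (∑ j, π i j * pderiv j G) • pderiv i

/-- The bracket `{P, G} = ∑ πᵢⱼ ∂ᵢP ∂ⱼG`. -/
def pb (π : ι → ι → MvPolynomial ι ℝ) (P G : MvPolynomial ι ℝ) : MvPolynomial ι ℝ :=
  ∑ i, ∑ j, π i j * pderiv i P * pderiv j G

theorem ham_apply (π : ι → ι → MvPolynomial ι ℝ) (P G : MvPolynomial ι ℝ) :
    ham π G P = pb π P G := by
  have h : ∀ s : Finset ι, (∑ i ∈ s, (∑ j, π i j * pderiv j G) • pderiv (R := ℝ) i) P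
      = ∑ i ∈ s, (∑ j, π i j * pderiv j G) * pderiv i P := by
    classical
    intro s
    induction s using Finset.induction_on with
    | empty => simp
    | insert a s ha ih => rw [Finset.sum_insert ha, Finset.sum_insert ha, Derivation.add_apply, ih,
        Derivation.smul_apply, smul_eq_mul]
  rw [ham, h, pb]
  refine Finset.sum_congr rfl fun i _ => ?_
  rw [Finset.sum_mul]
  exact Finset.sum_congr rfl fun j _ => by ring

/-- A Poisson structure with polynomial coefficients. -/
structure IsPoisson (π : ι → ι → MvPolynomial ι ℝ) : Prop where
  antisymm : ∀ i j, π i j = -π j i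
  jacobi : ∀ i j k, pb π (π i j) (X k) + pb π (π j k) (X i) + pb π (π k i) (X j) = 0

section
variable {π : ι → ι → MvPolynomial ι ℝ}

theorem pb_add_left (P Q G : MvPolynomial ι ℝ) : pb π (P + Q) G = pb π P G + pb π Q G := by
  simp only [← ham_apply, map_add]

theorem pb_smul_left (c : ℝ) (P G : MvPolynomial ι ℝ) : pb π (c • P) G = c • pb π P G := by
  rw [← ham_apply, ← ham_apply]; exact (ham π G).map_smul c P

theorem pb_zero_left (G : MvPolynomial ι ℝ) : pb π 0 G = 0 := by
  simp only [← ham_apply, map_zero]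

variable (hπ : IsPoisson π)
include hπ

theorem IsPoisson.pb_antisymm (P G : MvPolynomial ι ℝ) : pb π P G = -pb π G P := by
  rw [pb, pb, Finset.sum_comm, ← Finset.sum_neg_distrib]
  refine Finset.sum_congr rfl fun i _ => ?_
  rw [← Finset.sum_neg_distrib]
  refine Finset.sum_congr rfl fun j _ => ?_
  rw [hπ.antisymm]; ring

theorem IsPoisson.pb_self (P : MvPolynomial ι ℝ) : pb π P P = 0 := by
  have h := hπ.pb_antisymm P P
  have h2 : (2 : ℝ) • pb π P P = 0 := by
    rw [two_smul]; nth_rewrite 1 [h]; simp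
  exact (smul_eq_zero.1 h2).resolve_left two_ne_zero

end

theorem pb_X_X [DecidableEq ι] (π : ι → ι → MvPolynomial ι ℝ) (i j : ι) :
    pb π (X i) (X j) = π i j := by
  simp [pb, pderiv_X, Pi.single_apply]

/-- For fixed F and G both sides are derivations in P, namely a commutator of two Hamiltonian
derivations and a single one, so it suffices to compare them on the generators. Antisymmetry moves
another argument into the derivation slot; three rounds reduce the identity to the hypothesis on
triples of coordinates. -/
theorem IsPoisson.pb_jacobi {π : ι → ι → MvPolynomial ι ℝ} (hπ : IsPoisson π)
    (P F G : MvPolynomial ι ℝ) :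
    pb π (pb π P F) G - pb π (pb π P G) F = pb π P (pb π F G) := by
  classical
  have ext : ∀ {D E : Derivation ℝ (MvPolynomial ι ℝ) (MvPolynomial ι ℝ)},
      (∀ i, D (X i) = E (X i)) → ∀ P, D P = E P := fun h P => by rw [derivation_ext h]
  have a := hπ.pb_antisymm
  have nl : ∀ P G, pb π (-P) G = -pb π P G := fun P G => by simp only [← ham_apply, map_neg]
  have nr : ∀ P G, pb π P (-G) = -pb π P G := fun P G => by rw [a, nl, a G P, neg_neg]
  have h1 : ∀ i j G, pb π (pb π G (X i)) (X j) - pb π (pb π G (X j)) (X i)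
      = pb π G (pb π (X i) (X j)) := by
    intro i j
    refine fun G => ?_
    have := ext (D := ⁅ham π (X j), ham π (X i)⁆) (E := ham π (pb π (X i) (X j))) ?_ G
    · simpa only [Derivation.commutator_apply, ham_apply] using this
    · intro k
      simp only [Derivation.commutator_apply, ham_apply, pb_X_X]
      have := hπ.jacobi i j k
      rw [a (X k) (π i j)]
      have e : pb π (π k i) (X j) = -pb π (π i k) (X j) := by rw [hπ.antisymm k i, nl]
      rw [hπ.antisymm k i, hπ.antisymm k j, nl, nl]
      rw [e] at this
      linear_combination (exp := 1) this
  have h2 : ∀ i F G, pb π (pb π F G) (X i) - pb π (pb π F (X i)) G = pb π F (pb π G (X i)) := by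
    intro i F G
    have := ext (D := ⁅ham π (X i), ham π G⁆) (E := ham π (pb π G (X i))) ?_ F
    · simpa only [Derivation.commutator_apply, ham_apply] using this
    · intro k
      simp only [Derivation.commutator_apply, ham_apply]
      have := h1 i k G
      rw [a (X k) G, a (pb π (X k) (X i)) G, a (X k) (pb π G (X i)), nl, a (X k) (X i), nr]
      linear_combination (exp := 1) this
  have := ext (D := ⁅ham π G, ham π F⁆) (E := ham π (pb π F G)) ?_ P
  · simpa only [Derivation.commutator_apply, ham_apply] using this
  · intro k
    simp only [Derivation.commutator_apply, ham_apply]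
    have := h2 k F G
    rw [a (X k) F, a (X k) G, a (X k) (pb π F G), nl, nl, a (pb π G (X k)) F]
    linear_combination (exp := 1) this

end PolyPoisson

/-! ### Formal series of polynomials and the derivative of the exponential. -/

namespace PolyPoisson

open MvPolynomial Finset

variable {ι : Type*} [Fintype ι]

/-- The Poisson bracket as a bilinear map. -/
def pbL (π : ι → ι → MvPolynomial ι ℝ) :
    MvPolynomial ι ℝ →ₗ[ℝ] MvPolynomial ι ℝ →ₗ[ℝ] MvPolynomial ι ℝ :=
  LinearMap.mk₂ ℝ (pb π) pb_add_left pb_smul_left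
    (fun P Q G => by simp only [pb, map_add, mul_add, Finset.sum_add_distrib])
    (fun c P G => by
      have : ∀ j, pderiv j (c • G) = c • pderiv j G := fun j => (pderiv j).map_smul c G
      simp only [pb, this, Finset.smul_sum, mul_smul_comm])

@[simp] theorem pbL_apply (π : ι → ι → MvPolynomial ι ℝ) (P Q : MvPolynomial ι ℝ) :
    pbL π P Q = pb π P Q := rfl

/-- Formal power series in a parameter, with polynomial coefficients. -/
abbrev Ser (ι : Type*) := ℕ → MvPolynomial ι ℝ

/-- The Poisson bracket of formal series. -/
def br (π : ι → ι → MvPolynomial ι ℝ) : Ser ι →ₗ[ℝ] Ser ι →ₗ[ℝ] Ser ι :=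
  LinearMap.mk₂ ℝ (fun F G d => ∑ p ∈ antidiagonal d, pbL π (F p.1) (G p.2))
    (fun F F' G => by
      funext d; simp only [Pi.add_apply, map_add, LinearMap.add_apply, Finset.sum_add_distrib])
    (fun c F G => by
      funext d; simp only [Pi.smul_apply, map_smul, LinearMap.smul_apply, Finset.smul_sum])
    (fun F G G' => by
      funext d; simp only [Pi.add_apply, map_add, Finset.sum_add_distrib])
    (fun c F G => by
      funext d; simp only [Pi.smul_apply, map_smul, Finset.smul_sum])

theorem br_apply (π : ι → ι → MvPolynomial ι ℝ) (F G : Ser ι) (d : ℕ) :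
    br π F G d = ∑ p ∈ antidiagonal d, pb π (F p.1) (G p.2) := rfl

/-- The Euler derivation `s d/ds` of formal series. -/
def eul : Ser ι →ₗ[ℝ] Ser ι where
  toFun F d := (d : ℝ) • F d
  map_add' F G := by funext d; simp
  map_smul' c F := by funext d; simp [smul_comm c]

omit [Fintype ι] in
theorem eul_apply (F : Ser ι) (d : ℕ) : eul F d = (d : ℝ) • F d := rfl

theorem eul_br (π : ι → ι → MvPolynomial ι ℝ) (F G : Ser ι) :
    eul (br π F G) = br π (eul F) G + br π F (eul G) := by
  funext d
  simp only [eul_apply, Pi.add_apply, br_apply, Finset.smul_sum, ← Finset.sum_add_distrib]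
  refine Finset.sum_congr rfl fun p hp => ?_
  rw [← pbL_apply, ← pbL_apply, ← pbL_apply, map_smul, map_smul, LinearMap.smul_apply, ← add_smul]
  rw [← HasAntidiagonal.mem_antidiagonal.1 hp]; push_cast; rfl

theorem IsPoisson.br_jacobi {π : ι → ι → MvPolynomial ι ℝ} (hπ : IsPoisson π) (P F G : Ser ι) :
    br π (br π P F) G = br π (br π P G) F + br π P (br π F G) := by
  funext d
  simp only [Pi.add_apply, br_apply]
  simp only [← pbL_apply, map_sum, LinearMap.sum_apply]
  rw [Finset.sum_sigma', Finset.sum_sigma', Finset.sum_sigma']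
  have e1 : (∑ x ∈ (antidiagonal d).sigma fun x => antidiagonal x.1,
      pbL π (pbL π (P x.2.1) (G x.2.2)) (F x.1.2))
      = ∑ x ∈ (antidiagonal d).sigma fun x => antidiagonal x.1,
      pbL π (pbL π (P x.2.1) (G x.1.2)) (F x.2.2) := by
    apply Finset.sum_nbij' (fun ⟨⟨_, k⟩, ⟨i, j⟩⟩ => ⟨(i + k, j), (i, k)⟩)
      (fun ⟨⟨_, k⟩, ⟨i, j⟩⟩ => ⟨(i + k, j), (i, k)⟩)
    · rintro ⟨⟨a, k⟩, ⟨i, j⟩⟩ h; simp at h ⊢; omega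
    · rintro ⟨⟨a, k⟩, ⟨i, j⟩⟩ h; simp at h ⊢; omega
    · rintro ⟨⟨a, k⟩, ⟨i, j⟩⟩ h; simp at h ⊢; omega
    · rintro ⟨⟨a, k⟩, ⟨i, j⟩⟩ h; simp at h ⊢; omega
    · rintro ⟨⟨a, k⟩, ⟨i, j⟩⟩ h; simp
  have e2 : (∑ x ∈ (antidiagonal d).sigma fun x => antidiagonal x.2,
      pbL π (P x.1.1) (pbL π (F x.2.1) (G x.2.2)))
      = ∑ x ∈ (antidiagonal d).sigma fun x => antidiagonal x.1,
      pbL π (P x.2.1) (pbL π (F x.2.2) (G x.1.2)) := by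
    apply Finset.sum_nbij' (fun ⟨⟨i, _⟩, ⟨j, k⟩⟩ => ⟨(i + j, k), (i, j)⟩)
      (fun ⟨⟨_, k⟩, ⟨i, j⟩⟩ => ⟨(i, j + k), (j, k)⟩)
    · rintro ⟨⟨a, k⟩, ⟨i, j⟩⟩ h; simp at h ⊢; omega
    · rintro ⟨⟨a, k⟩, ⟨i, j⟩⟩ h; simp at h ⊢; omega
    · rintro ⟨⟨a, k⟩, ⟨i, j⟩⟩ h; simp at h ⊢; omega
    · rintro ⟨⟨a, k⟩, ⟨i, j⟩⟩ h; simp at h ⊢; omega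
    · rintro ⟨⟨a, k⟩, ⟨i, j⟩⟩ h; simp
  rw [e1, e2, ← Finset.sum_add_distrib]
  refine Finset.sum_congr rfl fun x _ => ?_
  have := hπ.pb_jacobi (P x.2.1) (F x.2.2) (G x.1.2)
  simp only [pbL_apply]
  rw [← this]; abel

/-- The operator `F ↦ {F, G}` on formal series. -/
def adS (π : ι → ι → MvPolynomial ι ℝ) (G : Ser ι) : Module.End ℝ (Ser ι) := (br π).flip G

@[simp] theorem adS_apply (π : ι → ι → MvPolynomial ι ℝ) (F G : Ser ι) :
    adS π G F = br π F G := rfl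

/-- The formal series `F` has order at least `m`. -/
def OrdGE (m : ℕ) (F : Ser ι) : Prop := ∀ d < m, F d = 0

theorem OrdGE.br {π : ι → ι → MvPolynomial ι ℝ} {a b : ℕ} {F G : Ser ι} (hF : OrdGE a F)
    (hG : OrdGE b G) : OrdGE (a + b) (br π F G) := by
  intro d hd
  rw [br_apply]
  refine Finset.sum_eq_zero fun p hp => ?_
  rw [HasAntidiagonal.mem_antidiagonal] at hp
  rw [← pbL_apply]
  rcases lt_or_ge p.1 a with h | h
  · rw [hF _ h, map_zero, LinearMap.zero_apply]
  · rw [hG p.2 (by omega), map_zero]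

omit [Fintype ι] in
theorem ordGE_one_eul (F : Ser ι) : OrdGE 1 (eul F) := fun d hd => by
  rw [eul_apply, Nat.lt_one_iff.1 hd]; simp

theorem OrdGE.adS_pow {π : ι → ι → MvPolynomial ι ℝ} {a : ℕ} {F G : Ser ι} (hG : OrdGE 1 G)
    (hF : OrdGE a F) (k : ℕ) : OrdGE (a + k) ((adS π G ^ k) F) := by
  induction k with
  | zero => simpa using hF
  | succ k ih => rw [pow_succ', Module.End.mul_apply, adS_apply, ← add_assoc]; exact ih.br hG

/-- The mixed brackets in the derivative of a power of `F ↦ {F, G}`. -/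
def mix (π : ι → ι → MvPolynomial ι ℝ) (F G : Ser ι) (a : ℕ) : ℕ → Ser ι
  | 0 => 0
  | b + 1 => br π ((adS π G ^ a) F) ((adS π G ^ b) (eul G))

theorem mix_ordGE {π : ι → ι → MvPolynomial ι ℝ} {F G : Ser ι} (hG : OrdGE 1 G) (a b : ℕ) :
    OrdGE (a + b) (mix π F G a b) := by
  cases b with
  | zero => intro d _; rfl
  | succ b =>
    have h1 : OrdGE (0 + a) ((adS π G ^ a) F) := hG.adS_pow (fun d hd => absurd hd (by omega)) a
    have h2 := hG.adS_pow (π := π) (ordGE_one_eul G) b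
    have := h1.br (π := π) h2
    rwa [zero_add, add_comm 1 b] at this

/-- The Euler derivation can fall on any of the k copies of G. By the Jacobi identity the outer
copies of {·, G} then distribute over the bracket in which eul G stands, and this produces the
binomial coefficients. -/
theorem IsPoisson.eul_adS_pow {π : ι → ι → MvPolynomial ι ℝ} (hπ : IsPoisson π) {F G : Ser ι}
    (hF : eul F = 0) (k : ℕ) :
    eul ((adS π G ^ k) F) = ∑ p ∈ antidiagonal k, k.choose p.1 • mix π F G p.1 p.2 := by
  induction k with
  | zero => simp [hF, mix]
  | succ k ih =>
    have hsym : ∀ p ∈ antidiagonal k, k.choose p.2 • mix π F G (p.1 + 1) p.2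
        = k.choose p.1 • mix π F G (p.1 + 1) p.2 := fun p hp => by
      rw [Nat.choose_symm_of_eq_add (HasAntidiagonal.mem_antidiagonal.1 hp).symm]
    rw [Finset.sum_antidiagonal_choose_succ_nsmul (fun a b => mix π F G a b),
      Finset.sum_congr rfl hsym]
    rw [pow_succ', Module.End.mul_apply, adS_apply, eul_br, ih, ← adS_apply, map_sum,
      ← Finset.sum_add_distrib]
    -- This is Leibniz' rule, except that `mix` is 0 for b = 0, where the term `mix a 1` has to be
    -- removed. It reappears in `hs`, when the Euler derivation falls on the outermost G.
    have hD : ∀ a b, adS π G (mix π F G a b) = mix π F G (a + 1) b + mix π F G a (b + 1)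
        - if b = 0 then mix π F G a 1 else 0 := by
      intro a b
      cases b with
      | zero => simp [mix]
      | succ b =>
        simp only [mix, adS_apply, Nat.add_eq_zero_iff, one_ne_zero, and_false, if_false, sub_zero]
        rw [hπ.br_jacobi, pow_succ', Module.End.mul_apply, pow_succ', Module.End.mul_apply]
        simp only [adS_apply]
    have hs : br π ((adS π G ^ k) F) (eul G)
        = ∑ p ∈ antidiagonal k, k.choose p.1 • (if p.2 = 0 then mix π F G p.1 1 else 0) := by
      rw [Finset.sum_eq_single (k, 0)]
      · simp [mix]
      · rintro ⟨a, b⟩ hp hne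
        have : b ≠ 0 := by
          rintro rfl
          rw [HasAntidiagonal.mem_antidiagonal] at hp
          exact hne (by simpa using hp)
        simp [this]
      · simp
    rw [hs, ← Finset.sum_add_distrib]
    refine Finset.sum_congr rfl fun p _ => ?_
    rw [map_nsmul, hD, ← smul_add, ← smul_add, sub_add_cancel, add_comm]

/-- The coefficients of `exp (-t)`. -/
def ec (t : ℝ) (k : ℕ) : ℝ := (-t) ^ k / k.factorial

/-- The series `exp (-t {·, G}) F`, correct in degrees up to `n`. -/
def expS (π : ι → ι → MvPolynomial ι ℝ) (G : Ser ι) (n : ℕ) (t : ℝ) (F : Ser ι) : Ser ι :=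
  ∑ k ∈ range (n + 1), ec t k • (adS π G ^ k) F

/-- `G` solves, in degrees up to `n`, the equation expressing that `exp {·, G}` is the flow of the
non-autonomous Hamiltonian `S`. -/
def IsMagnus (π : ι → ι → MvPolynomial ι ℝ) (S G : Ser ι) (n : ℕ) : Prop :=
  ∀ d ≤ n, (∑ b ∈ range (n + 1), (-ec 1 (b + 1)) • (adS π G ^ b) (eul G)) d = S d

/-- After division by k! the binomial sum factors into the exponential series applied to F and the
series dexp applied to eul G, and `IsMagnus` says that the latter is S. Consequently exp(-{·, G})F
is a formal first integral of the time-dependent system whose Hamiltonian is S/s. -/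
theorem IsPoisson.eul_expS {π : ι → ι → MvPolynomial ι ℝ} (hπ : IsPoisson π) {S G F : Ser ι}
    {n : ℕ} (hG : OrdGE 1 G) (hM : IsMagnus π S G n) (hF : eul F = 0) {d : ℕ} (hd : d ≤ n) :
    eul (expS π G n 1 F) d = -br π (expS π G n 1 F) S d := by
  have hS : br π (expS π G n 1 F) S d = br π (expS π G n 1 F)
      (∑ b ∈ range (n + 1), (-ec 1 (b + 1)) • (adS π G ^ b) (eul G)) d := by
    rw [br_apply, br_apply]
    refine Finset.sum_congr rfl fun p hp => ?_
    rw [hM p.2 (by rw [HasAntidiagonal.mem_antidiagonal] at hp; omega)]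
  have hR : br π (expS π G n 1 F) S d =
      -∑ a ∈ range (n + 1), ∑ b ∈ range (n + 2), (ec 1 a * ec 1 b) • mix π F G a b d := by
    rw [hS, expS]
    simp only [map_sum, LinearMap.sum_apply, Finset.sum_apply, map_smul, LinearMap.smul_apply,
      Pi.smul_apply, Finset.smul_sum]
    rw [← Finset.sum_neg_distrib, Finset.sum_comm]
    refine Finset.sum_congr rfl fun a _ => ?_
    rw [Finset.sum_range_succ' _ (n + 1)]
    simp only [mix, Pi.zero_apply, smul_zero, add_zero]
    rw [← Finset.sum_neg_distrib]
    refine Finset.sum_congr rfl fun b _ => ?_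
    rw [smul_smul, ← neg_smul]
    congr 1; ring
  have hL : eul (expS π G n 1 F) d
      = ∑ k ∈ range (n + 1), ∑ p ∈ antidiagonal k, (ec 1 p.1 * ec 1 p.2) • mix π F G p.1 p.2 d := by
    rw [expS, map_sum, Finset.sum_apply]
    refine Finset.sum_congr rfl fun k _ => ?_
    rw [map_smul, hπ.eul_adS_pow hF, Finset.smul_sum, Finset.sum_apply]
    refine Finset.sum_congr rfl fun p hp => ?_
    rw [← Nat.cast_smul_eq_nsmul ℝ, smul_smul, Pi.smul_apply]
    congr 1
    rw [HasAntidiagonal.mem_antidiagonal] at hp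
    subst hp
    have h := Nat.add_choose_mul_factorial_mul_factorial p.1 p.2
    have h' : ((p.1 + p.2).choose p.1 : ℝ) * p.1.factorial * p.2.factorial
        = (p.1 + p.2).factorial := by
      rw [Nat.choose_symm_add]; exact_mod_cast h
    have h1 : (p.1.factorial : ℝ) ≠ 0 := by positivity
    have h2 : (p.2.factorial : ℝ) ≠ 0 := by positivity
    have h3 : ((p.1 + p.2).factorial : ℝ) ≠ 0 := by positivity
    have h4 : ((p.1 + p.2).choose p.1 : ℝ) ≠ 0 := fun h0 => h3 (by rw [← h', h0]; ring)
    simp only [ec]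
    rw [← h']
    field_simp
    rw [pow_add]
  rw [hR, hL, neg_neg, Finset.sum_sigma', ← Finset.sum_product']
  symm
  -- The product of the two truncated sums contains extra pairs with a + b > n. Their mixed brackets
  -- have order at least a + b > d and vanish in degree d.
  rw [← Finset.sum_filter_of_ne (p := fun x => x.1 + x.2 ≤ n)]
  · apply Finset.sum_nbij' (fun x => ⟨x.1 + x.2, x⟩) (fun x => x.2)
    · rintro ⟨a, b⟩ h; simp at h ⊢; omega
    · rintro ⟨k, ⟨a, b⟩⟩ h; simp at h ⊢; omega
    · rintro ⟨a, b⟩ h; rfl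
    · rintro ⟨k, ⟨a, b⟩⟩ h; simp at h ⊢; omega
    · rintro ⟨a, b⟩ h; rfl
  · rintro ⟨a, b⟩ _ hne
    by_contra hcon
    exact hne (by rw [mix_ordGE hG a b d (by simp at hcon; omega), smul_zero])

end PolyPoisson

/-! ### Weighted norms of polynomials and of truncated series. -/

namespace PolyPoisson

open MvPolynomial Finset

section Norm
variable {ι : Type*}

/-- The weighted `ℓ¹` norm of the coefficients of a polynomial. -/
def pnorm (r : ℝ) (P : MvPolynomial ι ℝ) : ℝ := ∑ m ∈ P.support, |P.coeff m| * r ^ m.degree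

variable {r : ℝ}

theorem pnorm_eq_sum {P : MvPolynomial ι ℝ} {s : Finset (ι →₀ ℕ)} (h : P.support ⊆ s) :
    pnorm r P = ∑ m ∈ s, |P.coeff m| * r ^ m.degree :=
  Finset.sum_subset h fun m _ hm => by rw [notMem_support_iff.1 hm]; simp

theorem pnorm_nonneg (hr : 0 ≤ r) (P : MvPolynomial ι ℝ) : 0 ≤ pnorm r P :=
  Finset.sum_nonneg fun _ _ => by positivity

@[simp] theorem pnorm_zero : pnorm r (0 : MvPolynomial ι ℝ) = 0 := by simp [pnorm]

theorem pnorm_add_le (hr : 0 ≤ r) (P Q : MvPolynomial ι ℝ) :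
    pnorm r (P + Q) ≤ pnorm r P + pnorm r Q := by
  classical
  rw [pnorm_eq_sum (support_add (p := P) (q := Q)), pnorm_eq_sum (P := P) subset_union_left,
    pnorm_eq_sum (P := Q) subset_union_right, ← Finset.sum_add_distrib]
  refine Finset.sum_le_sum fun m _ => ?_
  rw [coeff_add, ← add_mul]
  exact mul_le_mul_of_nonneg_right (abs_add_le _ _) (by positivity)

theorem pnorm_smul (c : ℝ) (P : MvPolynomial ι ℝ) : pnorm r (c • P) = |c| * pnorm r P := by
  rw [pnorm_eq_sum (support_smul (a := c) (f := P)), pnorm, Finset.mul_sum]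
  exact Finset.sum_congr rfl fun m _ => by rw [coeff_smul, smul_eq_mul, abs_mul, mul_assoc]

theorem pnorm_sum_le (hr : 0 ≤ r) {κ : Type*} (s : Finset κ) (P : κ → MvPolynomial ι ℝ) :
    pnorm r (∑ k ∈ s, P k) ≤ ∑ k ∈ s, pnorm r (P k) := by
  classical
  induction s using Finset.induction_on with
  | empty => simp
  | insert a s ha ih =>
    rw [Finset.sum_insert ha, Finset.sum_insert ha]
    exact (pnorm_add_le hr _ _).trans (by gcongr)

theorem pnorm_monomial (m : ι →₀ ℕ) (a : ℝ) : pnorm r (monomial m a) = |a| * r ^ m.degree := by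
  classical
  rw [pnorm_eq_sum (s := {m}) (support_monomial_subset)]
  simp

theorem pnorm_X (i : ι) : pnorm r (X i : MvPolynomial ι ℝ) = r := by
  rw [X, pnorm_monomial]; simp

theorem pnorm_mul_le (hr : 0 ≤ r) (P Q : MvPolynomial ι ℝ) :
    pnorm r (P * Q) ≤ pnorm r P * pnorm r Q := by
  classical
  conv_lhs => rw [P.as_sum, Q.as_sum, Finset.sum_mul_sum]
  rw [pnorm.eq_1 r P, pnorm.eq_1 r Q, Finset.sum_mul_sum]
  refine (pnorm_sum_le hr _ _).trans (Finset.sum_le_sum fun m _ => ?_)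
  refine (pnorm_sum_le hr _ _).trans (Finset.sum_le_sum fun m' _ => ?_)
  rw [monomial_mul, pnorm_monomial, abs_mul, map_add, pow_add]
  apply le_of_eq; ring

/-- An exponent is at most the degree, and lowering it does not increase the weight because r ≥ 1.
The radius is the same on both sides: this takes the place of Cauchy estimates on shrinking domains.
-/
theorem pnorm_pderiv_le (hr : 1 ≤ r) (i : ι) (P : MvPolynomial ι ℝ) :
    pnorm r (pderiv i P) ≤ P.totalDegree * pnorm r P := by
  classical
  have hr0 : 0 ≤ r := by linarith
  conv_lhs => rw [P.as_sum, map_sum]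
  rw [pnorm.eq_1 r P, Finset.mul_sum]
  refine (pnorm_sum_le hr0 _ _).trans (Finset.sum_le_sum fun m hm => ?_)
  rw [pderiv_monomial, pnorm_monomial, abs_mul]
  have h1 : (m i : ℝ) ≤ P.totalDegree := by
    have : m i ≤ m.degree := Finsupp.le_degree i m
    have h2 : m.degree ≤ P.totalDegree := le_totalDegree hm
    exact_mod_cast this.trans h2
  have h3 : r ^ (m - Finsupp.single i 1).degree ≤ r ^ m.degree := by
    apply pow_le_pow_right₀ hr
    exact Finsupp.degree_mono tsub_le_self
  rw [Nat.abs_cast]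
  calc |coeff m P| * (m i : ℝ) * r ^ (m - Finsupp.single i 1).degree
      ≤ |coeff m P| * (P.totalDegree : ℝ) * r ^ m.degree := by gcongr
    _ = _ := by ring

theorem totalDegree_pderiv_le (i : ι) (P : MvPolynomial ι ℝ) :
    (pderiv i P).totalDegree ≤ P.totalDegree - 1 := by
  classical
  conv_lhs => rw [P.as_sum, map_sum]
  refine totalDegree_finsetSum_le fun m hm => ?_
  rw [pderiv_monomial]
  rcases Nat.eq_zero_or_pos (m i) with h | h
  · simp [h]
  · refine (totalDegree_monomial_le _ _).trans ?_
    have h2 : m.degree ≤ P.totalDegree := le_totalDegree hm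
    have h3 : (m - Finsupp.single i 1) + Finsupp.single i 1 = m :=
      tsub_add_cancel_of_le (Finsupp.single_le_iff.2 h)
    have h4 := congrArg Finsupp.degree h3
    rw [map_add, Finsupp.degree_single] at h4
    change (m - Finsupp.single i 1).degree ≤ _
    omega

theorem abs_eval_le {x : ι → ℝ} (hx : ∀ i, |x i| ≤ r) (P : MvPolynomial ι ℝ) :
    |eval x P| ≤ pnorm r P := by
  rw [eval_eq, pnorm]
  refine (Finset.abs_sum_le_sum_abs _ _).trans (Finset.sum_le_sum fun m _ => ?_)
  rw [abs_mul, Finset.abs_prod]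
  refine mul_le_mul_of_nonneg_left ?_ (abs_nonneg _)
  have hdeg : m.degree = ∑ i ∈ m.support, m i := rfl
  rw [hdeg, ← Finset.prod_pow_eq_pow_sum]
  exact Finset.prod_le_prod (fun _ _ => abs_nonneg _) fun i _ => by rw [abs_pow]; gcongr; exact hx i

end Norm

variable {ι : Type*} [Fintype ι] {r : ℝ}

/-- The norm of the bivector. -/
def pbConst (r : ℝ) (π : ι → ι → MvPolynomial ι ℝ) : ℝ := ∑ i, ∑ j, pnorm r (π i j)

theorem pbConst_nonneg (hr : 0 ≤ r) (π : ι → ι → MvPolynomial ι ℝ) : 0 ≤ pbConst r π :=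
  Finset.sum_nonneg fun _ _ => Finset.sum_nonneg fun _ _ => pnorm_nonneg hr _

theorem pnorm_pb_le (hr : 1 ≤ r) (π : ι → ι → MvPolynomial ι ℝ) {P Q : MvPolynomial ι ℝ} {p q : ℕ}
    (hp : P.totalDegree ≤ p) (hq : Q.totalDegree ≤ q) :
    pnorm r (pb π P Q) ≤ pbConst r π * (p * pnorm r P) * (q * pnorm r Q) := by
  have hr0 : 0 ≤ r := by linarith
  have hd : ∀ {P : MvPolynomial ι ℝ} {p : ℕ}, P.totalDegree ≤ p → ∀ i,
      pnorm r (pderiv i P) ≤ p * pnorm r P := fun {P p} h i => by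
    refine (pnorm_pderiv_le hr i P).trans ?_
    have := pnorm_nonneg hr0 P
    gcongr
  rw [pb, pbConst, Finset.sum_mul, Finset.sum_mul]
  refine (pnorm_sum_le hr0 _ _).trans (Finset.sum_le_sum fun i _ => ?_)
  rw [Finset.sum_mul, Finset.sum_mul]
  refine (pnorm_sum_le hr0 _ _).trans (Finset.sum_le_sum fun j _ => ?_)
  have h0 := pnorm_nonneg hr0 (π i j)
  have h1 := pnorm_nonneg hr0 P
  have h2 := pnorm_nonneg hr0 Q
  have h3 := pnorm_nonneg hr0 (pderiv j Q)
  calc _ ≤ pnorm r (π i j * pderiv i P) * pnorm r (pderiv j Q) := pnorm_mul_le hr0 _ _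
    _ ≤ (pnorm r (π i j) * pnorm r (pderiv i P)) * pnorm r (pderiv j Q) := by
        gcongr; exact pnorm_mul_le hr0 _ _
    _ ≤ _ := by gcongr; exacts [hd hp i, hd hq j]

/-- The coefficient of degree `d` of the series is a polynomial of degree at most `d + 1`. -/
def DegLE (F : Ser ι) : Prop := ∀ d, (F d).totalDegree ≤ d + 1

section Degree
variable {π : ι → ι → MvPolynomial ι ℝ}

/-- Two derivatives remove two degrees and the linear bivector gives one back. With the shift by
one, degrees add under the bracket just as orders in s do, so `DegLE` is stable. -/
theorem totalDegree_pb_le (hπ : ∀ i j, (π i j).totalDegree ≤ 1) {P Q : MvPolynomial ι ℝ} {p q : ℕ}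
    (hp : P.totalDegree ≤ p + 1) (hq : Q.totalDegree ≤ q + 1) :
    (pb π P Q).totalDegree ≤ p + q + 1 := by
  refine totalDegree_finsetSum_le fun i _ => totalDegree_finsetSum_le fun j _ => ?_
  have h1 := totalDegree_mul (π i j * pderiv i P) (pderiv j Q)
  have h2 := totalDegree_mul (π i j) (pderiv i P)
  have h3 := totalDegree_pderiv_le i P
  have h4 := totalDegree_pderiv_le j Q
  have h5 := hπ i j
  omega

theorem DegLE.br (hπ : ∀ i j, (π i j).totalDegree ≤ 1) {F G : Ser ι} (hF : DegLE F)
    (hG : DegLE G) : DegLE (br π F G) := fun d =>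
  totalDegree_finsetSum_le fun p hp => by
    rw [← HasAntidiagonal.mem_antidiagonal.1 hp]
    exact totalDegree_pb_le hπ (hF _) (hG _)

omit [Fintype ι] in
theorem DegLE.eul {F : Ser ι} (hF : DegLE F) : DegLE (eul F) := fun d =>
  (totalDegree_smul_le _ _).trans (hF d)

theorem DegLE.adS_pow (hπ : ∀ i j, (π i j).totalDegree ≤ 1) {F G : Ser ι} (hF : DegLE F)
    (hG : DegLE G) (k : ℕ) : DegLE ((adS π G ^ k) F) := by
  induction k with
  | zero => simpa using hF
  | succ k ih => rw [pow_succ', Module.End.mul_apply, adS_apply]; exact ih.br hπ hG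

omit [Fintype ι] in
theorem DegLE.sum {κ : Type*} {s : Finset κ} {c : κ → ℝ} {F : κ → Ser ι}
    (hF : ∀ k ∈ s, DegLE (F k)) : DegLE (∑ k ∈ s, c k • F k) := fun d => by
  rw [Finset.sum_apply]
  exact totalDegree_finsetSum_le fun k hk => (totalDegree_smul_le _ _).trans (hF k hk d)

theorem DegLE.expS (hπ : ∀ i j, (π i j).totalDegree ≤ 1) {F G : Ser ι} (hF : DegLE F)
    (hG : DegLE G) (n : ℕ) (t : ℝ) : DegLE (expS π G n t F) :=
  DegLE.sum fun k _ => hF.adS_pow hπ hG k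

end Degree

/-- The weighted norm of the coefficients of degree at most `n` of a series. -/
def nu (r ρ : ℝ) (n : ℕ) (F : Ser ι) : ℝ := ∑ d ∈ range (n + 1), ρ ^ d * pnorm r (F d)

section Nu
variable {ρ : ℝ} {n : ℕ}

omit [Fintype ι] in
theorem nu_nonneg (hr : 0 ≤ r) (hρ : 0 ≤ ρ) (F : Ser ι) : 0 ≤ nu r ρ n F :=
  Finset.sum_nonneg fun _ _ => mul_nonneg (by positivity) (pnorm_nonneg hr _)

omit [Fintype ι] in
theorem nu_sum_le (hr : 0 ≤ r) (hρ : 0 ≤ ρ) {κ : Type*} (s : Finset κ) (c : κ → ℝ)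
    (F : κ → Ser ι) : nu r ρ n (∑ k ∈ s, c k • F k) ≤ ∑ k ∈ s, |c k| * nu r ρ n (F k) := by
  simp only [nu, Finset.mul_sum, Finset.sum_apply]
  rw [Finset.sum_comm]
  refine Finset.sum_le_sum fun d _ => ?_
  refine (mul_le_mul_of_nonneg_left (pnorm_sum_le hr _ _) (by positivity)).trans ?_
  rw [Finset.mul_sum]
  refine Finset.sum_le_sum fun k _ => le_of_eq ?_
  rw [Pi.smul_apply, pnorm_smul]; ring

omit [Fintype ι] in
theorem nu_congr {F G : Ser ι} (h : ∀ d ≤ n, F d = G d) : nu r ρ n F = nu r ρ n G :=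
  Finset.sum_congr rfl fun d hd => by rw [h d (by simpa [Nat.lt_succ_iff] using hd)]

omit [Fintype ι] in
theorem nu_add_le (hr : 0 ≤ r) (hρ : 0 ≤ ρ) (F G : Ser ι) :
    nu r ρ n (F + G) ≤ nu r ρ n F + nu r ρ n G := by
  rw [nu, nu, nu, ← Finset.sum_add_distrib]
  refine Finset.sum_le_sum fun d _ => ?_
  rw [← mul_add]
  exact mul_le_mul_of_nonneg_left (pnorm_add_le hr _ _) (by positivity)

theorem sum_antidiagonal_le {a b : ℕ → ℝ} (ha : ∀ i, 0 ≤ a i) (hb : ∀ i, 0 ≤ b i) (n : ℕ) :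
    ∑ d ∈ range (n + 1), ∑ p ∈ antidiagonal d, a p.1 * b p.2
      ≤ (∑ i ∈ range (n + 1), a i) * ∑ j ∈ range (n + 1), b j := by
  rw [Finset.sum_mul_sum, Finset.sum_sigma', ← Finset.sum_product']
  have : ∑ x ∈ (range (n + 1)).sigma fun d => antidiagonal d, a x.2.1 * b x.2.2
      = ∑ x ∈ (range (n + 1) ×ˢ range (n + 1)).filter (fun x => x.1 + x.2 ≤ n), a x.1 * b x.2 := by
    apply Finset.sum_nbij' (fun x => x.2) (fun x => ⟨x.1 + x.2, x⟩)
    · rintro ⟨k, ⟨a, b⟩⟩ h; simp at h ⊢; omega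
    · rintro ⟨a, b⟩ h; simp at h ⊢; omega
    · rintro ⟨k, ⟨a, b⟩⟩ h; simp at h ⊢; omega
    · rintro ⟨a, b⟩ h; rfl
    · rintro ⟨k, ⟨a, b⟩⟩ h; rfl
  rw [this]
  exact Finset.sum_le_sum_of_subset_of_nonneg (Finset.filter_subset _ _)
    fun x _ _ => mul_nonneg (ha _) (hb _)

/-- Differentiating G j costs j + 1 ≤ 2j, since G starts in degree 1, and this factor is absorbed by
the Euler derivation. Only the derivative of F leaves a factor, at most n + 1. -/
theorem pnorm_pb_ser_le (hr : 1 ≤ r) (π : ι → ι → MvPolynomial ι ℝ) {F G : Ser ι}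
    (hF : DegLE F) (hG : DegLE G) (hG1 : OrdGE 1 G) {i : ℕ} (hi : i ≤ n) (j : ℕ) :
    pnorm r (pb π (F i) (G j))
      ≤ 2 * pbConst r π * (n + 1) * (pnorm r (F i) * pnorm r (eul G j)) := by
  have hr0 : 0 ≤ r := by linarith
  have hC := pbConst_nonneg hr0 π
  have h1 := pnorm_pb_le hr π (hF i) (hG j)
  have hFp := pnorm_nonneg hr0 (F i)
  have hGp := pnorm_nonneg hr0 (G j)
  have h2 : ((j + 1 : ℕ) : ℝ) * pnorm r (G j) ≤ 2 * pnorm r (eul G j) := by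
    rw [eul_apply, pnorm_smul, Nat.abs_cast]
    rcases Nat.eq_zero_or_pos j with h | h
    · rw [h, hG1 0 one_pos]; simp
    · rw [← mul_assoc]
      gcongr
      have : (1 : ℝ) ≤ j := by exact_mod_cast h
      push_cast; linarith
  have h3 : ((i + 1 : ℕ) : ℝ) ≤ n + 1 := by exact_mod_cast Nat.succ_le_succ hi
  calc pnorm r (pb π (F i) (G j))
      ≤ pbConst r π * ((n + 1) * pnorm r (F i)) * (2 * pnorm r (eul G j)) := by
        refine h1.trans ?_
        gcongr
    _ = _ := by ring

theorem nu_br_le (hr : 1 ≤ r) (hρ : 0 ≤ ρ) {π : ι → ι → MvPolynomial ι ℝ} {F G : Ser ι}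
    (hF : DegLE F) (hG : DegLE G) (hG1 : OrdGE 1 G) :
    nu r ρ n (br π F G) ≤ 2 * pbConst r π * (n + 1) * nu r ρ n (eul G) * nu r ρ n F := by
  have hr0 : 0 ≤ r := by linarith
  have hC := pbConst_nonneg hr0 π
  have key := sum_antidiagonal_le (a := fun i => ρ ^ i * pnorm r (F i))
    (b := fun j => ρ ^ j * pnorm r (eul G j))
    (fun i => mul_nonneg (by positivity) (pnorm_nonneg hr0 _))
    (fun i => mul_nonneg (by positivity) (pnorm_nonneg hr0 _)) n
  have : nu r ρ n (br π F G) ≤ 2 * pbConst r π * (n + 1) *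
      ∑ d ∈ range (n + 1), ∑ p ∈ antidiagonal d,
        (ρ ^ p.1 * pnorm r (F p.1)) * (ρ ^ p.2 * pnorm r (eul G p.2)) := by
    rw [nu, Finset.mul_sum]
    refine Finset.sum_le_sum fun d hd => ?_
    rw [br_apply, Finset.mul_sum]
    refine (mul_le_mul_of_nonneg_left (pnorm_sum_le hr0 _ _) (by positivity)).trans ?_
    rw [Finset.mul_sum]
    refine Finset.sum_le_sum fun p hp => ?_
    rw [HasAntidiagonal.mem_antidiagonal] at hp
    rw [Finset.mem_range] at hd
    refine (mul_le_mul_of_nonneg_left (pnorm_pb_ser_le hr π hF hG hG1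
      (show p.1 ≤ n by omega) p.2) (by positivity)).trans (le_of_eq ?_)
    rw [← hp, pow_add]; ring
  refine this.trans ?_
  rw [mul_assoc _ (nu r ρ n (eul G)), mul_comm (nu r ρ n (eul G))]
  gcongr
  exact key

theorem nu_adS_pow_le (hr : 1 ≤ r) (hρ : 0 ≤ ρ) {π : ι → ι → MvPolynomial ι ℝ}
    (hπ : ∀ i j, (π i j).totalDegree ≤ 1) {F G : Ser ι}
    (hF : DegLE F) (hG : DegLE G) (hG1 : OrdGE 1 G) {ε : ℝ}
    (hε : 2 * pbConst r π * (n + 1) * nu r ρ n (eul G) ≤ ε) (k : ℕ) :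
    nu r ρ n ((adS π G ^ k) F) ≤ ε ^ k * nu r ρ n F := by
  have hr0 : 0 ≤ r := by linarith
  have hC := pbConst_nonneg hr0 π
  have hε0 : 0 ≤ ε := le_trans (by have := nu_nonneg (n := n) hr0 hρ (eul G); positivity) hε
  induction k with
  | zero => simp
  | succ k ih =>
    rw [pow_succ', Module.End.mul_apply, adS_apply, pow_succ', mul_assoc]
    refine (nu_br_le hr hρ (hF.adS_pow hπ hG k) hG hG1).trans ?_
    gcongr
    exact nu_nonneg hr0 hρ _

theorem sum_half_pow_le (n : ℕ) : ∑ k ∈ range n, (1 / 2 : ℝ) ^ k ≤ 2 := by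
  have := geom_sum_eq (x := (1 / 2 : ℝ)) (by norm_num) n
  rw [this]
  have : (0 : ℝ) ≤ (1 / 2) ^ n := by positivity
  rw [div_le_iff_of_neg (by norm_num)]
  linarith

theorem abs_ec_le {t : ℝ} (ht : |t| ≤ 1) (k : ℕ) : |ec t k| ≤ 1 / k.factorial := by
  rw [ec, abs_div, abs_pow, abs_neg, Nat.abs_cast]
  gcongr
  exact pow_le_one₀ (abs_nonneg _) ht

theorem nu_expS_le (hr : 1 ≤ r) (hρ : 0 ≤ ρ) {π : ι → ι → MvPolynomial ι ℝ}
    (hπ : ∀ i j, (π i j).totalDegree ≤ 1) {F G : Ser ι}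
    (hF : DegLE F) (hG : DegLE G) (hG1 : OrdGE 1 G)
    (hε : 2 * pbConst r π * (n + 1) * nu r ρ n (eul G) ≤ 1 / 2) {t : ℝ} (ht : |t| ≤ 1) :
    nu r ρ n (expS π G n t F) ≤ 2 * nu r ρ n F := by
  have hr0 : 0 ≤ r := by linarith
  refine (nu_sum_le hr0 hρ _ _ _).trans ?_
  have hF0 := nu_nonneg (n := n) hr0 hρ F
  refine le_trans ?_ (mul_le_mul_of_nonneg_right (sum_half_pow_le (n + 1)) hF0)
  rw [Finset.sum_mul]
  refine Finset.sum_le_sum fun k _ => ?_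
  have h1 : |ec t k| ≤ 1 := (abs_ec_le ht k).trans (by
    rw [div_le_one (by positivity)]; exact_mod_cast Nat.one_le_iff_ne_zero.2 k.factorial_ne_zero)
  calc |ec t k| * nu r ρ n ((adS π G ^ k) F) ≤ 1 * ((1 / 2) ^ k * nu r ρ n F) := by
        gcongr
        · exact nu_nonneg hr0 hρ _
        · exact nu_adS_pow_le hr hρ hπ hF hG hG1 hε k
    _ = _ := one_mul _

end Nu

end PolyPoisson

/-! ### The Magnus series: recursion, majorants and first coefficients. -/

namespace PolyPoisson

open MvPolynomial Finset

variable {ι : Type*} [Fintype ι] {r ρ : ℝ} {n : ℕ}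

/-- Both G and eul G start in degree 1, so a bracket of degree d involves only their coefficients of
degree less than d. This makes the Magnus recursion well founded: only the term b = 0 sees G d. -/
theorem adS_pow_congr {π : ι → ι → MvPolynomial ι ℝ} {G G' : Ser ι} {d : ℕ}
    (h : ∀ e < d, G e = G' e) (hG : OrdGE 1 G) (hG' : OrdGE 1 G') (b : ℕ) :
    (∀ e < d, (adS π G ^ b) (eul G) e = (adS π G' ^ b) (eul G') e) ∧
    (1 ≤ b → (adS π G ^ b) (eul G) d = (adS π G' ^ b) (eul G') d) := by
  induction b with
  | zero => exact ⟨fun e he => by simp [eul_apply, h e he], by simp⟩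
  | succ b ih =>
    have key : ∀ e ≤ d, (adS π G ^ (b + 1)) (eul G) e = (adS π G' ^ (b + 1)) (eul G') e := by
      intro e he
      rw [pow_succ', Module.End.mul_apply, pow_succ', Module.End.mul_apply, adS_apply, adS_apply,
        br_apply, br_apply]
      refine Finset.sum_congr rfl fun p hp => ?_
      rw [HasAntidiagonal.mem_antidiagonal] at hp
      rcases Nat.eq_zero_or_pos p.1 with h1 | h1
      · have o1 := (hG.adS_pow (π := π) (ordGE_one_eul G) b) 0 (by omega)
        have o2 := (hG'.adS_pow (π := π) (ordGE_one_eul G') b) 0 (by omega)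
        rw [h1, o1, o2, pb_zero_left, pb_zero_left]
      · rcases Nat.eq_zero_or_pos p.2 with h2 | h2
        · rw [h2, hG 0 one_pos, hG' 0 one_pos, ← pbL_apply, ← pbL_apply, map_zero, map_zero]
        · rw [ih.1 p.1 (by omega), h p.2 (by omega)]
    exact ⟨fun e he => key e he.le, fun _ => key d le_rfl⟩

/-- The coefficients of degree less than `m` of a series. -/
def cut (m : ℕ) (G : Ser ι) : Ser ι := fun e => if e < m then G e else 0

omit [Fintype ι] in
theorem cut_ordGE {m k : ℕ} {G : Ser ι} (hG : OrdGE k G) : OrdGE k (cut m G) := fun d hd => by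
  simp [cut, hG d hd]

omit [Fintype ι] in
theorem cut_degLE {m : ℕ} {G : Ser ι} (hG : DegLE G) : DegLE (cut m G) := fun d => by
  by_cases h : d < m
  · simpa [cut, h] using hG d
  · simp [cut, h]

/-- One step of the recursion for the Magnus series. -/
def magnusStep (π : ι → ι → MvPolynomial ι ℝ) (S G : Ser ι) (d : ℕ) : MvPolynomial ι ℝ :=
  (d : ℝ)⁻¹ • (S d - ∑ b ∈ Ico 1 (d + 1), (-ec 1 (b + 1)) • (adS π G ^ b) (eul G) d)

/-- The Magnus series: the autonomous Hamiltonian whose flow is, formally, that of `S`. -/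
def magnus (π : ι → ι → MvPolynomial ι ℝ) (S : Ser ι) : Ser ι
  | d => magnusStep π S (fun e => if _h : e < d then magnus π S e else 0) d

theorem magnus_eq (π : ι → ι → MvPolynomial ι ℝ) (S : Ser ι) (d : ℕ) :
    magnus π S d = magnusStep π S (cut d (magnus π S)) d := by
  rw [magnus]; rfl

theorem magnus_ordGE (π : ι → ι → MvPolynomial ι ℝ) (S : Ser ι) : OrdGE 1 (magnus π S) := by
  intro d hd
  rw [Nat.lt_one_iff.1 hd, magnus_eq, magnusStep]; simp

theorem magnus_degLE {π : ι → ι → MvPolynomial ι ℝ} (hπ : ∀ i j, (π i j).totalDegree ≤ 1)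
    {S : Ser ι} (hS : DegLE S) : DegLE (magnus π S) := by
  intro d
  induction d using Nat.strong_induction_on with
  | _ d ih =>
    have hc : DegLE (cut d (magnus π S)) := fun e => by
      by_cases h : e < d
      · simpa [cut, h] using ih e h
      · simp [cut, h]
    rw [magnus_eq, magnusStep]
    refine (totalDegree_smul_le _ _).trans ((totalDegree_sub _ _).trans (max_le (hS d) ?_))
    exact totalDegree_finsetSum_le fun b _ =>
      (totalDegree_smul_le _ _).trans (hc.eul.adS_pow hπ hc b d)

theorem isMagnus_of_eq {π : ι → ι → MvPolynomial ι ℝ} {S G : Ser ι} (hS : OrdGE 1 S)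
    (hG : OrdGE 1 G) (h : ∀ d, G d = magnusStep π S (cut d G) d) (n : ℕ) :
    IsMagnus π S G n := by
  intro d hd
  rw [Finset.sum_apply]
  rcases Nat.eq_zero_or_pos d with h0 | h0
  · subst h0
    rw [hS 0 one_pos]
    exact Finset.sum_eq_zero fun b _ => by
      rw [Pi.smul_apply, hG.adS_pow (ordGE_one_eul _) b 0 (by omega), smul_zero]
  · have hsub : range (d + 1) ⊆ range (n + 1) := Finset.range_subset_range.2 (by omega)
    rw [← Finset.sum_subset hsub fun b _ hb => by
      rw [Pi.smul_apply, hG.adS_pow (ordGE_one_eul _) b d (by simp at hb; omega), smul_zero]]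
    have h1 : G d = _ := h d
    have hd' : (d : ℝ) ≠ 0 := by exact_mod_cast h0.ne'
    have h2 : eul G d = S d - ∑ b ∈ Ico 1 (d + 1),
        (-ec 1 (b + 1)) • (adS π G ^ b) (eul G) d := by
      rw [eul_apply, h1, magnusStep, smul_smul, mul_inv_cancel₀ hd', one_smul]
      refine congrArg (S d - ·) (Finset.sum_congr rfl fun b hb => ?_)
      refine congrArg (fun x : MvPolynomial ι ℝ => (-ec 1 (b + 1)) • x) ?_
      refine (adS_pow_congr (fun e he => ?_) (cut_ordGE hG) hG b).2 (Finset.mem_Ico.1 hb).1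
      simp [cut, he]
    rw [Finset.sum_range_succ']
    rw [Finset.sum_Ico_eq_sum_range, Nat.add_sub_cancel] at h2
    simp only [Pi.smul_apply]
    rw [pow_zero, Module.End.one_apply, h2]
    have e1 : -ec 1 (0 + 1) = 1 := by simp [ec]
    rw [e1, one_smul, add_comm, sub_add_eq_add_sub, sub_eq_iff_eq_add]
    congr 1
    exact Finset.sum_congr rfl fun b _ => by rw [add_comm 1 b]

theorem isMagnus_magnus (π : ι → ι → MvPolynomial ι ℝ) {S : Ser ι} (hS : OrdGE 1 S) (n : ℕ) :
    IsMagnus π S (magnus π S) n :=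
  isMagnus_of_eq hS (magnus_ordGE π S) (magnus_eq π S) n

/-- Induction on the truncation degree. Up to degree m + 1, eul G is S plus iterated brackets that
see only the coefficients of degree at most m; for these the bound 2μ is known, and it makes the
operator {·, G} have norm at most 1/2. The brackets then sum to at most μ, which reproduces the
bound. -/
theorem nu_eul_le_of_isMagnus (hr : 1 ≤ r) (hρ : 0 ≤ ρ) {π : ι → ι → MvPolynomial ι ℝ}
    (hπ : ∀ i j, (π i j).totalDegree ≤ 1) {S G : Ser ι} (hGd : DegLE G) (hG : OrdGE 1 G)
    (hM : ∀ m, IsMagnus π S G m) {μ : ℝ}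
    (hμ : nu r ρ n S ≤ μ) (hε : 2 * pbConst r π * (n + 1) * (2 * μ) ≤ 1 / 2) :
    nu r ρ n (eul G) ≤ 2 * μ := by
  have hr0 : 0 ≤ r := by linarith
  have hC := pbConst_nonneg hr0 π
  have hμ0 : 0 ≤ μ := (nu_nonneg hr0 hρ S).trans hμ
  have main : ∀ m ≤ n, nu r ρ m (eul G) ≤ 2 * μ := by
    intro m
    induction m with
    | zero =>
      intro _
      have : nu r ρ 0 (eul G) = 0 := by simp [nu, eul_apply]
      rw [this]; positivity
    | succ m ih =>
      intro hm
      have ih := ih (by omega)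
      set G' := cut (m + 1) G with hG'def
      have hG' : OrdGE 1 G' := cut_ordGE hG
      have hG'd : DegLE G' := cut_degLE hGd
      have hle : ∀ d ≤ m + 1, eul G d = (S + ∑ b ∈ range (n + 1),
          (ec 1 (b + 2)) • (adS π G' ^ (b + 1)) (eul G')) d := by
        intro d hd
        have h1 := hM (n + 1) d (by omega)
        rw [Finset.sum_range_succ', Pi.add_apply, Finset.sum_apply] at h1
        rw [Pi.add_apply, Finset.sum_apply, ← h1]
        have h2 : ∑ b ∈ range (n + 1), ((-ec 1 (b + 1 + 1)) • (adS π G ^ (b + 1)) (eul G)) d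
            = -∑ b ∈ range (n + 1), ((ec 1 (b + 2)) • (adS π G' ^ (b + 1)) (eul G')) d := by
          rw [← Finset.sum_neg_distrib]
          refine Finset.sum_congr rfl fun b _ => ?_
          rw [Pi.smul_apply, Pi.smul_apply, neg_smul]
          refine congrArg (fun x : MvPolynomial ι ℝ => -(ec 1 (b + 2) • x)) ?_
          have hcg := adS_pow_congr (π := π) (G := G) (G' := G') (d := m + 1)
            (fun e he => by simp [hG'def, cut, he]) hG hG' (b + 1)
          rcases Nat.lt_or_ge d (m + 1) with h | h
          · exact hcg.1 d h
          · rw [show d = m + 1 by omega]; exact hcg.2 (by omega)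
        have e1 : -ec 1 (0 + 1) = 1 := by simp [ec]
        rw [h2, e1, one_smul, pow_zero, Module.End.one_apply]
        abel
      have hnu' : nu r ρ (m + 1) (eul G') ≤ 2 * μ := by
        refine le_trans (le_of_eq ?_) ih
        rw [nu, Finset.sum_range_succ]
        have : eul G' (m + 1) = 0 := by simp [eul_apply, hG'def, cut]
        rw [this, pnorm_zero, mul_zero, add_zero]
        refine Finset.sum_congr rfl fun d hd => ?_
        rw [eul_apply, eul_apply, hG'def, cut, if_pos (Finset.mem_range.1 hd)]
      have hε' : 2 * pbConst r π * ((m + 1 : ℕ) + 1) * nu r ρ (m + 1) (eul G') ≤ 1 / 2 := by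
        refine le_trans ?_ hε
        have : ((m + 1 : ℕ) : ℝ) ≤ n := by exact_mod_cast hm
        have h0 := nu_nonneg (n := m + 1) hr0 hρ (eul G')
        gcongr
      have hSm : nu r ρ (m + 1) S ≤ μ := by
        refine le_trans ?_ hμ
        exact Finset.sum_le_sum_of_subset_of_nonneg (Finset.range_subset_range.2 (by omega))
          fun d _ _ => mul_nonneg (by positivity) (pnorm_nonneg hr0 _)
      rw [nu_congr hle]
      refine (nu_add_le hr0 hρ _ _).trans ?_
      -- The factorial contributes 1/2 and the b + 1 brackets contribute (1/2)^(b+1), applied to 2μ;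
      -- the geometric series adds up to at most μ.
      have hsum : nu r ρ (m + 1) (∑ b ∈ range (n + 1),
          (ec 1 (b + 2)) • (adS π G' ^ (b + 1)) (eul G')) ≤ μ := by
        refine (nu_sum_le hr0 hρ _ _ _).trans ?_
        have : ∀ b ∈ range (n + 1), |ec 1 (b + 2)| *
            nu r ρ (m + 1) ((adS π G' ^ (b + 1)) (eul G')) ≤ (1 / 2) ^ b * (μ / 2) := by
          intro b _
          have h1 : |ec 1 (b + 2)| ≤ 1 / 2 := (abs_ec_le (by simp) _).trans (by
            apply one_div_le_one_div_of_le (by norm_num)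
            have : Nat.factorial 2 ≤ (b + 2).factorial := Nat.factorial_le (by omega)
            exact_mod_cast this)
          have h2 := nu_adS_pow_le hr hρ hπ hG'd.eul hG'd hG' hε' (b + 1)
          calc _ ≤ 1 / 2 * ((1 / 2) ^ (b + 1) * (2 * μ)) := by
                gcongr
                · exact nu_nonneg hr0 hρ _
                · exact h2.trans (by gcongr)
            _ = _ := by ring
        refine (Finset.sum_le_sum this).trans ?_
        rw [← Finset.sum_mul]
        have := sum_half_pow_le (n + 1)
        nlinarith
      linarith
  exact main n le_rfl

theorem IsPoisson.magnus_one {π : ι → ι → MvPolynomial ι ℝ} {S : Ser ι} :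
    magnus π S 1 = S 1 := by
  have hG := magnus_ordGE π S
  rw [magnus_eq, magnusStep]
  simp only [Nat.cast_one, inv_one, one_smul]
  rw [Finset.sum_eq_zero, sub_zero]
  intro b hb
  have hb1 := (Finset.mem_Ico.1 hb).1
  rw [(cut_ordGE hG).adS_pow (ordGE_one_eul _) b 1 (by omega), smul_zero]

/-- The only bracket of degree two is that of the first coefficient with itself, which is zero. This
is why the modified Hamiltonian differs from H only in second order. -/
theorem IsPoisson.magnus_two {π : ι → ι → MvPolynomial ι ℝ} (hπ : IsPoisson π) {S : Ser ι}
    (hS : S 2 = 0) : magnus π S 2 = 0 := by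
  have hG := magnus_ordGE π S
  have hc : OrdGE 1 (cut 2 (magnus π S)) := cut_ordGE hG
  rw [magnus_eq, magnusStep, hS]
  have : ∑ b ∈ Ico 1 (2 + 1), (-ec 1 (b + 1)) •
      (adS π (cut 2 (magnus π S)) ^ b) (eul (cut 2 (magnus π S))) 2 = 0 := by
    refine Finset.sum_eq_zero fun b hb => ?_
    have hb1 := (Finset.mem_Ico.1 hb).1
    rcases Nat.lt_or_ge b 2 with h | h
    · have : b = 1 := by omega
      subst this
      rw [pow_one, adS_apply, br_apply]
      rw [Finset.sum_eq_zero, smul_zero]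
      rintro ⟨i, j⟩ hp
      rw [HasAntidiagonal.mem_antidiagonal] at hp
      simp only at hp ⊢
      rcases Nat.lt_or_ge i 1 with h1 | h1
      · rw [ordGE_one_eul _ i h1, pb_zero_left]
      · rcases Nat.lt_or_ge j 1 with h2 | h2
        · rw [hc j h2, ← pbL_apply, map_zero]
        · have hi : i = 1 := by omega
          have hj : j = 1 := by omega
          rw [hi, hj, eul_apply, pb_smul_left, hπ.pb_self, smul_zero]
    · rw [hc.adS_pow (ordGE_one_eul _) b 2 (by omega), smul_zero]
  rw [this]; simp

end PolyPoisson

/-! ### Truncation defects and approximate first integrals. -/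

namespace PolyPoisson

open MvPolynomial Finset

variable {ι : Type*} [Fintype ι] {r ρ : ℝ} {n : ℕ}

/-- The value at `s` of the polynomial in the parameter formed by the coefficients of degree at
most `n`. -/
def ev (s : ℝ) (n : ℕ) : Ser ι →ₗ[ℝ] MvPolynomial ι ℝ where
  toFun F := ∑ d ∈ range (n + 1), s ^ d • F d
  map_add' F G := by simp [Finset.sum_add_distrib]
  map_smul' c F := by simp [Finset.smul_sum, smul_comm c]

omit [Fintype ι] in
theorem ev_apply (s : ℝ) (n : ℕ) (F : Ser ι) : ev s n F = ∑ d ∈ range (n + 1), s ^ d • F d := rfl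

omit [Fintype ι] in
theorem ev_congr {s : ℝ} {F G : Ser ι} (h : ∀ d ≤ n, F d = G d) : ev s n F = ev s n G := by
  rw [ev_apply, ev_apply]
  exact Finset.sum_congr rfl fun d hd => by rw [h d (by simpa [Nat.lt_succ_iff] using hd)]

theorem pb_ev_ev (π : ι → ι → MvPolynomial ι ℝ) (s : ℝ) (n : ℕ) (F G : Ser ι) :
    pb π (ev s n F) (ev s n G) = ev s n (br π F G) +
      ∑ x ∈ (range (n + 1) ×ˢ range (n + 1)).filter (fun x => n < x.1 + x.2),
        s ^ (x.1 + x.2) • pb π (F x.1) (G x.2) := by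
  have h1 : pb π (ev s n F) (ev s n G) = ∑ x ∈ range (n + 1) ×ˢ range (n + 1),
      s ^ (x.1 + x.2) • pb π (F x.1) (G x.2) := by
    rw [← pbL_apply, ev_apply, ev_apply]
    simp only [map_sum, LinearMap.sum_apply, map_smul, LinearMap.smul_apply, Finset.smul_sum]
    rw [Finset.sum_comm, ← Finset.sum_product']
    exact Finset.sum_congr rfl fun x _ => by rw [smul_smul, ← pow_add, add_comm, pbL_apply]
  have h2 : ev s n (br π F G) = ∑ x ∈ (range (n + 1) ×ˢ range (n + 1)).filter
      (fun x => ¬ n < x.1 + x.2), s ^ (x.1 + x.2) • pb π (F x.1) (G x.2) := by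
    rw [ev_apply]
    simp only [br_apply, Finset.smul_sum]
    rw [Finset.sum_sigma']
    apply Finset.sum_nbij' (fun x => x.2) (fun x => ⟨x.1 + x.2, x⟩)
    · rintro ⟨k, ⟨a, b⟩⟩ h; simp at h ⊢; omega
    · rintro ⟨a, b⟩ h; simp at h ⊢; omega
    · rintro ⟨k, ⟨a, b⟩⟩ h; simp at h ⊢; omega
    · rintro ⟨a, b⟩ h; rfl
    · rintro ⟨k, ⟨a, b⟩⟩ h; simp at h ⊢; rw [h.2]
  rw [h1, h2, add_comm (Finset.sum _ _), Finset.sum_filter_add_sum_filter_not]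

/-- The defect consists of the products of total degree between n + 1 and 2n. Passing from the
radius ρ to s ≤ ρ gains a factor s/ρ per degree, hence at least (s/ρ)^(n+1). -/
theorem pnorm_pb_ev_sub_le (hr : 1 ≤ r) (hρ : 0 < ρ) {π : ι → ι → MvPolynomial ι ℝ} {F G : Ser ι}
    (hF : DegLE F) (hG : DegLE G) (hG1 : OrdGE 1 G) {s : ℝ} (hs : 0 ≤ s) (hsρ : s ≤ ρ) :
    pnorm r (pb π (ev s n F) (ev s n G) - ev s n (br π F G))
      ≤ (s / ρ) ^ (n + 1) * (2 * pbConst r π * (n + 1) * nu r ρ n (eul G) * nu r ρ n F) := by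
  have hr0 : 0 ≤ r := by linarith
  have hC := pbConst_nonneg hr0 π
  rw [pb_ev_ev, add_sub_cancel_left]
  refine (pnorm_sum_le hr0 _ _).trans ?_
  have hterm : ∀ x ∈ (range (n + 1) ×ˢ range (n + 1)).filter (fun x => n < x.1 + x.2),
      pnorm r (s ^ (x.1 + x.2) • pb π (F x.1) (G x.2)) ≤ (s / ρ) ^ (n + 1) * (2 * pbConst r π *
        (n + 1)) * ((ρ ^ x.1 * pnorm r (F x.1)) * (ρ ^ x.2 * pnorm r (eul G x.2))) := by
    rintro ⟨i, j⟩ hx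
    simp only [Finset.mem_filter, Finset.mem_product, Finset.mem_range] at hx ⊢
    rw [pnorm_smul, abs_of_nonneg (by positivity)]
    have h1 := pnorm_pb_ser_le hr π hF hG hG1 (show i ≤ n by omega) j
    have h2 : s ^ (i + j) ≤ (s / ρ) ^ (n + 1) * ρ ^ (i + j) := by
      have : s ^ (i + j) = (s / ρ) ^ (i + j) * ρ ^ (i + j) := by
        rw [← mul_pow, div_mul_cancel₀ _ hρ.ne']
      rw [this]
      gcongr ?_ * _
      exact pow_le_pow_of_le_one (by positivity) ((div_le_one hρ).2 hsρ) (by omega)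
    have h3 := pnorm_nonneg hr0 (F i)
    have h4 := pnorm_nonneg hr0 (eul G j)
    calc _ ≤ ((s / ρ) ^ (n + 1) * ρ ^ (i + j)) *
          (2 * pbConst r π * (n + 1) * (pnorm r (F i) * pnorm r (eul G j))) := by
          gcongr
          exact pnorm_nonneg hr0 _
      _ = _ := by rw [pow_add ρ]; ring
  refine (Finset.sum_le_sum hterm).trans ?_
  have hsub : ∑ x ∈ (range (n + 1) ×ˢ range (n + 1)).filter (fun x => n < x.1 + x.2),
      ((ρ ^ x.1 * pnorm r (F x.1)) * (ρ ^ x.2 * pnorm r (eul G x.2)))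
      ≤ nu r ρ n F * nu r ρ n (eul G) := by
    rw [nu, nu, Finset.sum_mul_sum, ← Finset.sum_product']
    exact Finset.sum_le_sum_of_subset_of_nonneg (Finset.filter_subset _ _) fun x _ _ =>
      mul_nonneg (mul_nonneg (by positivity) (pnorm_nonneg hr0 _))
        (mul_nonneg (by positivity) (pnorm_nonneg hr0 _))
  rw [← Finset.mul_sum]
  calc _ ≤ (s / ρ) ^ (n + 1) * (2 * pbConst r π * (n + 1)) * (nu r ρ n F * nu r ρ n (eul G)) := by
        gcongr
    _ = _ := by ring

theorem hasDerivWithinAt_eval {y : ℝ → ι → ℝ} {y' : ι → ℝ} {S : Set ℝ} {t : ℝ}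
    (h : ∀ i, HasDerivWithinAt (fun τ => y τ i) (y' i) S t) (P : MvPolynomial ι ℝ) :
    HasDerivWithinAt (fun τ => eval (y τ) P) (∑ i, eval (y t) (pderiv i P) * y' i) S t := by
  classical
  induction P using MvPolynomial.induction_on with
  | C a => simpa using hasDerivWithinAt_const t S a
  | add p q hp hq =>
    simp only [map_add, add_mul, Finset.sum_add_distrib]
    exact hp.add hq
  | mul_X p i hp =>
    have := hp.mul (h i)
    simp only [Derivation.leibniz, pderiv_X, smul_eq_mul, map_add, map_mul, eval_X, add_mul,
      Finset.sum_add_distrib]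
    refine this.congr_deriv ?_
    symm
    rw [add_comm, Finset.sum_mul]
    congr 1
    · exact Finset.sum_congr rfl fun j _ => by ring
    · rw [Finset.sum_eq_single i] <;> simp +contextual [eq_comm]

theorem pb_eq_sum (π : ι → ι → MvPolynomial ι ℝ) (P G : MvPolynomial ι ℝ) :
    pb π P G = ∑ i, pderiv i P * pb π (X i) G := by
  classical
  rw [pb]
  refine Finset.sum_congr rfl fun i _ => ?_
  have : pb π (X i) G = ∑ j, π i j * pderiv j G := by
    simp [pb, pderiv_X, Pi.single_apply]
  rw [this, Finset.mul_sum]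
  exact Finset.sum_congr rfl fun j _ => by ring

omit [Fintype ι] in
theorem totalDegree_ev_le {F : Ser ι} (hF : DegLE F) (s : ℝ) : (ev s n F).totalDegree ≤ n + 1 :=
  totalDegree_finsetSum_le fun d hd => (totalDegree_smul_le _ _).trans ((hF d).trans (by
    have := Finset.mem_range.1 hd; omega))

omit [Fintype ι] in
theorem pnorm_ev_le (hr : 0 ≤ r) {s : ℝ} (hs : 0 ≤ s) (hsρ : s ≤ ρ) (F : Ser ι) :
    pnorm r (ev s n F) ≤ nu r ρ n F := by
  refine (pnorm_sum_le hr _ _).trans (Finset.sum_le_sum fun d _ => ?_)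
  rw [pnorm_smul, abs_of_nonneg (by positivity)]
  have := pnorm_nonneg hr (F d)
  gcongr

/-- The derivative of an approximate first integral along a solution of the approximate
non-autonomous system. -/
theorem IsPoisson.hasDerivAt_ev_expS (hr : 1 ≤ r) (hρ : 0 < ρ) {π : ι → ι → MvPolynomial ι ℝ}
    (hP : IsPoisson π) (hπ : ∀ i j, (π i j).totalDegree ≤ 1) {S G F : Ser ι}
    (hS : DegLE S) (hS1 : OrdGE 1 S) (hG : DegLE G) (hG1 : OrdGE 1 G) (hM : IsMagnus π S G n)
    (hF : DegLE F) (hF0 : eul F = 0) {y : ℝ → ι → ℝ} {y' : ι → ℝ} {s e : ℝ} (hs : 0 < s)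
    (hsρ : s ≤ ρ) (hy : ∀ i, HasDerivAt (fun τ => y τ i) (y' i) s) (hyr : ∀ i, |y s i| ≤ r)
    (hye : ∀ i, |y' i - s⁻¹ * eval (y s) (pb π (X i) (ev s n S))| ≤ e) :
    ∃ u', HasDerivAt (fun τ => eval (y τ) (ev τ n (expS π G n 1 F))) u' s ∧
      |u'| ≤ s⁻¹ * ((s / ρ) ^ (n + 1) * (2 * pbConst r π * (n + 1) * nu r ρ n (eul S) *
        nu r ρ n (expS π G n 1 F))) +
        Fintype.card ι * ((n + 1) * nu r ρ n (expS π G n 1 F) * e) := by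
  have hr0 : 0 ≤ r := by linarith
  set Q := expS π G n 1 F with hQ
  have hQd : DegLE Q := hF.expS hπ hG n 1
  refine ⟨s⁻¹ * eval (y s) (ev s n (eul Q)) + ∑ i, eval (y s) (pderiv i (ev s n Q)) * y' i, ?_, ?_⟩
  · have h1 : ∀ d ∈ range (n + 1), HasDerivAt (fun τ => τ ^ d * eval (y τ) (Q d))
        ((d * s ^ (d - 1)) * eval (y s) (Q d) +
          s ^ d * ∑ i, eval (y s) (pderiv i (Q d)) * y' i) s := fun d _ => by
      have := hasDerivWithinAt_eval (S := univ) (fun i => (hy i).hasDerivWithinAt) (Q d)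
      exact (hasDerivAt_pow d s).mul (hasDerivWithinAt_univ.1 this)
    have h2 := HasDerivAt.fun_sum h1
    have e1 : (fun τ => eval (y τ) (ev τ n Q)) = fun τ => ∑ d ∈ range (n + 1),
        τ ^ d * eval (y τ) (Q d) := by
      funext τ; simp [ev_apply, smul_eval]
    rw [e1]
    refine h2.congr_deriv ?_
    symm
    rw [Finset.sum_add_distrib]
    congr 1
    · rw [ev_apply, map_sum, Finset.mul_sum]
      refine Finset.sum_congr rfl fun d _ => ?_
      rw [smul_eval, eul_apply, smul_eval]
      cases d with
      | zero => simp
      | succ d => rw [Nat.add_sub_cancel, pow_succ]; field_simp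
    · rw [ev_apply]
      simp only [map_sum, Finset.sum_mul, Finset.mul_sum]
      rw [Finset.sum_comm]
      refine Finset.sum_congr rfl fun d _ => Finset.sum_congr rfl fun i _ => ?_
      rw [(pderiv i).map_smul, smul_eval]; ring
  · have e1 : ev s n (eul Q) = -ev s n (br π Q S) := by
      rw [← map_neg]
      exact ev_congr fun d hd => hP.eul_expS hG1 hM hF0 hd
    -- By `e1` the explicit time derivative is minus the truncated bracket, while an exact solution
    -- would contribute the bracket of the truncations. What remains is the truncation defect and
    -- the defect of y in the differential equation.
    have e2 : s⁻¹ * eval (y s) (ev s n (eul Q)) + ∑ i, eval (y s) (pderiv i (ev s n Q)) * y' i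
        = s⁻¹ * eval (y s) (pb π (ev s n Q) (ev s n S) - ev s n (br π Q S)) +
          ∑ i, eval (y s) (pderiv i (ev s n Q)) *
            (y' i - s⁻¹ * eval (y s) (pb π (X i) (ev s n S))) := by
      simp only [mul_sub, Finset.sum_sub_distrib, map_sub]
      rw [pb_eq_sum π (ev s n Q), e1, map_sum, map_neg, Finset.mul_sum]
      simp only [map_mul]
      have : ∀ i, s⁻¹ * (eval (y s) (pderiv i (ev s n Q)) * eval (y s) (pb π (X i) (ev s n S)))
        = eval (y s) (pderiv i (ev s n Q)) * (s⁻¹ * eval (y s) (pb π (X i) (ev s n S))) :=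
        fun i => by ring
      simp only [this]
      ring
    rw [e2]
    refine (abs_add_le _ _).trans (add_le_add ?_ ?_)
    · rw [abs_mul, abs_of_pos (inv_pos.2 hs)]
      gcongr
      exact (abs_eval_le hyr _).trans (pnorm_pb_ev_sub_le hr hρ hQd hS hS1 hs.le hsρ)
    · refine (Finset.abs_sum_le_sum_abs _ _).trans ?_
      rw [← nsmul_eq_mul, Fintype.card, ← Finset.sum_const]
      refine Finset.sum_le_sum fun i _ => ?_
      rw [abs_mul]
      have h0 := nu_nonneg (n := n) hr0 hρ.le Q
      have h1 : |eval (y s) (pderiv i (ev s n Q))| ≤ (n + 1) * nu r ρ n Q := by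
        refine (abs_eval_le hyr _).trans ((pnorm_pderiv_le hr i _).trans ?_)
        have h2 : ((ev s n Q).totalDegree : ℝ) ≤ n + 1 := by exact_mod_cast totalDegree_ev_le hQd s
        have h3 := pnorm_ev_le (n := n) hr0 hs.le hsρ Q
        have h4 := pnorm_nonneg hr0 (ev s n Q)
        gcongr
      gcongr
      exact hye i

/-- The derivative of an approximate first integral along a solution of the modified system. -/
theorem hasDerivWithinAt_ev_expS (hr : 1 ≤ r) (hρ : 0 < ρ) {π : ι → ι → MvPolynomial ι ℝ}
    (hπ : ∀ i j, (π i j).totalDegree ≤ 1) {G F : Ser ι}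
    (hG : DegLE G) (hG1 : OrdGE 1 G) (hF : DegLE F) {y : ℝ → ι → ℝ} {U : Set ℝ} {h t : ℝ}
    (hh : 0 < h) (hhρ : h ≤ ρ) (hyr : ∀ i, |y t i| ≤ r)
    (hy : ∀ i, HasDerivWithinAt (fun τ => y τ i)
      (eval (y t) (pb π (X i) (h⁻¹ • ev h n G))) U t) :
    ∃ u', HasDerivWithinAt (fun τ => eval (y τ) (ev h n (expS π G n (τ / h) F))) u' U t ∧
      |u'| ≤ h⁻¹ * ((h / ρ) ^ (n + 1) * (2 * pbConst r π * (n + 1) * nu r ρ n (eul G) *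
        nu r ρ n (expS π G n (t / h) F))) := by
  set Q := expS π G n (t / h) F with hQ
  have hQd : DegLE Q := hF.expS hπ hG n _
  refine ⟨h⁻¹ * eval (y t) (pb π (ev h n Q) (ev h n G) - ev h n (br π Q G)), ?_, ?_⟩
  · have hec : ∀ k, HasDerivWithinAt (fun τ => ec (τ / h) k)
        (-h⁻¹ * (if k = 0 then 0 else ec (t / h) (k - 1))) U t := by
      intro k
      have h1 : HasDerivWithinAt (fun τ : ℝ => -(τ / h)) (-(1 / h)) U t :=
        ((hasDerivWithinAt_id t U).div_const h).neg
      have h2 := (h1.pow k).div_const (k.factorial : ℝ)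
      refine h2.congr_deriv ?_
      cases k with
      | zero => simp
      | succ k =>
        simp only [ec, Nat.add_sub_cancel, Nat.factorial_succ, Nat.succ_ne_zero, if_false]
        have : (k.factorial : ℝ) ≠ 0 := by positivity
        push_cast
        field_simp
    have h1 : ∀ k ∈ range (n + 1), HasDerivWithinAt
        (fun τ => ec (τ / h) k * eval (y τ) (ev h n ((adS π G ^ k) F)))
        ((-h⁻¹ * (if k = 0 then 0 else ec (t / h) (k - 1))) * eval (y t) (ev h n ((adS π G ^ k) F))
          + ec (t / h) k * ∑ i, eval (y t) (pderiv i (ev h n ((adS π G ^ k) F))) *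
            eval (y t) (pb π (X i) (h⁻¹ • ev h n G))) U t := fun k _ =>
      (hec k).mul (hasDerivWithinAt_eval hy _)
    have h2 := HasDerivWithinAt.fun_sum h1
    have e1 : (fun τ => eval (y τ) (ev h n (expS π G n (τ / h) F))) = fun τ =>
        ∑ k ∈ range (n + 1), ec (τ / h) k * eval (y τ) (ev h n ((adS π G ^ k) F)) := by
      funext τ; simp [expS, smul_eval]
    rw [e1]
    refine h2.congr_deriv ?_
    rw [Finset.sum_add_distrib, map_sub, mul_sub, sub_eq_neg_add]
    congr 1
    · have e2 : br π Q G = ∑ k ∈ range (n + 1), ec (t / h) k • (adS π G ^ (k + 1)) F := by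
        rw [← adS_apply, hQ, expS, map_sum]
        refine Finset.sum_congr rfl fun k _ => ?_
        rw [map_smul, pow_succ', Module.End.mul_apply]
      -- The exponential is cut off after the power n, but nothing is lost: the next power has order
      -- n + 1 and is invisible to `ev h n`.
      have e3 : ev h n ((adS π G ^ (n + 1)) F) = 0 := by
        rw [ev_apply]
        refine Finset.sum_eq_zero fun d hd => ?_
        have := hG1.adS_pow (π := π) (a := 0) (F := F) (fun d hd => absurd hd (by omega)) (n + 1)
        rw [this d (by simpa using hd), smul_zero]
      rw [Finset.sum_range_succ', e2, map_sum, Finset.sum_range_succ, map_smul, e3]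
      simp only [if_true, mul_zero, zero_mul, add_zero, smul_zero, map_sum, Finset.mul_sum,
        ← Finset.sum_neg_distrib]
      refine Finset.sum_congr rfl fun k _ => ?_
      simp [smul_eval]; ring
    · rw [hQ, expS, map_sum, ← pbL_apply, map_sum, LinearMap.sum_apply, map_sum, Finset.mul_sum]
      refine Finset.sum_congr rfl fun k _ => ?_
      rw [map_smul, map_smul, LinearMap.smul_apply, smul_eval, pbL_apply, pb_eq_sum, map_sum,
        Finset.mul_sum, Finset.mul_sum, Finset.mul_sum]
      refine Finset.sum_congr rfl fun i _ => ?_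
      rw [map_mul, ← pbL_apply π (X i) (h⁻¹ • _), map_smul, smul_eval, pbL_apply]
      ring
  · rw [abs_mul, abs_of_pos (inv_pos.2 hh)]
    gcongr
    exact (abs_eval_le hyr _).trans (pnorm_pb_ev_sub_le hr hρ hQd hG hG1 hh.le hhρ)

end PolyPoisson

/-! ### Bounds for the truncated modified Hamiltonian. -/

namespace PolyPoisson

open MvPolynomial Finset

variable {ι : Type*} [Fintype ι] {r ρ : ℝ} {n : ℕ}

omit [Fintype ι] in
theorem pnorm_pderiv_ev_le (hr : 1 ≤ r) {F : Ser ι} (hF : DegLE F) {h : ℝ} (hh : 0 ≤ h) (j : ι) :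
    pnorm r (pderiv j (ev h n F)) ≤ ∑ d ∈ range (n + 1), h ^ d * ((d + 1) * pnorm r (F d)) := by
  have hr0 : 0 ≤ r := by linarith
  rw [ev_apply, map_sum]
  refine (pnorm_sum_le hr0 _ _).trans (Finset.sum_le_sum fun d _ => ?_)
  rw [(pderiv j).map_smul, pnorm_smul, abs_of_nonneg (by positivity)]
  have h1 := pnorm_pderiv_le hr j (F d)
  have h2 : ((F d).totalDegree : ℝ) ≤ d + 1 := by exact_mod_cast hF d
  have h3 := pnorm_nonneg hr0 (F d)
  gcongr
  exact h1.trans (by gcongr)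

theorem abs_eval_sub_le {P : MvPolynomial ι ℝ} {D : ℝ}
    (hP : ∀ j, pnorm r (pderiv j P) ≤ D) {y z : ι → ℝ} (hy : ‖y‖ ≤ r) (hz : ‖z‖ ≤ r) :
    |eval y P - eval z P| ≤ Fintype.card ι * (D * ‖y - z‖) := by
  have hd : ∀ t ∈ Icc (0 : ℝ) 1, HasDerivWithinAt (fun t : ℝ => eval (z + t • (y - z)) P)
      (∑ i, eval (z + t • (y - z)) (pderiv i P) * (y i - z i)) (Icc 0 1) t := by
    intro t _
    refine hasDerivWithinAt_eval (fun i => ?_) P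
    simpa using ((hasDerivWithinAt_id t (Icc (0 : ℝ) 1)).mul_const (y i - z i)).const_add (z i)
  have hb : ∀ t ∈ Icc (0 : ℝ) 1, ‖∑ i, eval (z + t • (y - z)) (pderiv i P) * (y i - z i)‖
      ≤ Fintype.card ι * (D * ‖y - z‖) := by
    intro t ht
    refine (norm_sum_le _ _).trans ?_
    rw [← nsmul_eq_mul, Fintype.card, ← Finset.sum_const]
    refine Finset.sum_le_sum fun i _ => ?_
    rw [norm_mul]
    have h1 : ‖z + t • (y - z)‖ ≤ r := by
      have := (convex_closedBall (0 : ι → ℝ) r).add_smul_sub_mem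
        (mem_closedBall_zero_iff.2 hz) (mem_closedBall_zero_iff.2 hy) ht
      exact mem_closedBall_zero_iff.1 this
    have h2 : |eval (z + t • (y - z)) (pderiv i P)| ≤ D :=
      (abs_eval_le (fun i => (norm_le_pi_norm _ i).trans h1) _).trans (hP i)
    have h3 : ‖y i - z i‖ ≤ ‖y - z‖ := norm_le_pi_norm (y - z) i
    rw [Real.norm_eq_abs]
    have : 0 ≤ D := (abs_nonneg _).trans h2
    gcongr
  have := (convex_Icc (0 : ℝ) 1).norm_image_sub_le_of_norm_hasDerivWithin_le hd hb
    (left_mem_Icc.2 zero_le_one) (right_mem_Icc.2 zero_le_one)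
  simpa using this

/-- The series `s κ`. -/
def shift (κ : Ser ι) : Ser ι
  | 0 => 0
  | d + 1 => κ d

omit [Fintype ι] in
theorem shift_ordGE (κ : Ser ι) : OrdGE 1 (shift κ) := fun d hd => by
  rw [Nat.lt_one_iff.1 hd]; rfl

omit [Fintype ι] in
theorem shift_degLE {κ : Ser ι} (hκ : ∀ d, (κ d).totalDegree ≤ d + 2) : DegLE (shift κ) := by
  rintro (_ | d)
  · simp [shift]
  · exact hκ d

theorem natCast_le_two_pow (d : ℕ) : ((d : ℝ) + 1) ≤ 2 ^ d := by
  exact_mod_cast Nat.lt_two_pow_self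

-- The factor d + 1 ≤ 2ᵈ of the Euler derivation against (ρB)ᵈ ≤ 4⁻ᵈ leaves a geometric series of
-- ratio 1/2.
omit [Fintype ι] in
theorem nu_eul_shift_le (hr : 0 ≤ r) {κ : Ser ι} {M B : ℝ} (hM : 0 ≤ M) (hB : 0 ≤ B)
    (hκ : ∀ d, pnorm r (κ d) ≤ M * B ^ d) (hρ : 0 ≤ ρ) (hρB : ρ * B ≤ 1 / 4) :
    nu r ρ n (eul (shift κ)) ≤ 2 * M * ρ := by
  rw [nu, Finset.sum_range_succ', eul_apply]
  simp only [Nat.cast_zero, zero_smul, pnorm_zero, mul_zero, add_zero]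
  have : ∀ d ∈ range n, ρ ^ (d + 1) * pnorm r (eul (shift κ) (d + 1)) ≤ (M * ρ) * (1 / 2) ^ d := by
    intro d _
    rw [eul_apply, pnorm_smul, Nat.abs_cast]
    have h1 := hκ d
    have h2 := natCast_le_two_pow d
    have h3 : (ρ * B) ^ d ≤ (1 / 4) ^ d := by gcongr
    calc ρ ^ (d + 1) * (((d + 1 : ℕ) : ℝ) * pnorm r (κ d))
        ≤ ρ ^ (d + 1) * (2 ^ d * (M * B ^ d)) := by
          gcongr
          · exact pnorm_nonneg hr _
          · push_cast; exact h2
      _ = M * ρ * (2 ^ d * (ρ * B) ^ d) := by rw [mul_pow]; ring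
      _ ≤ M * ρ * (2 ^ d * (1 / 4) ^ d) := by gcongr
      _ = _ := by rw [← mul_pow]; norm_num
  refine (Finset.sum_le_sum this).trans ?_
  rw [← Finset.mul_sum]
  have h2 := sum_half_pow_le n
  have : 0 ≤ M * ρ := by positivity
  nlinarith

omit [Fintype ι] in
theorem nu_le_nu_eul (hr : 0 ≤ r) (hρ : 0 ≤ ρ) {F : Ser ι} (hF : OrdGE 1 F) :
    nu r ρ n F ≤ nu r ρ n (eul F) := by
  refine Finset.sum_le_sum fun d _ => ?_
  have h0 := pnorm_nonneg hr (F d)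
  rw [eul_apply, pnorm_smul, Nat.abs_cast]
  rcases Nat.eq_zero_or_pos d with h | h
  · rw [h, hF 0 one_pos]; simp
  · have : (1 : ℝ) ≤ d := by exact_mod_cast h
    gcongr
    nlinarith

/-- Assumptions on the coefficients of a non-autonomous Hamiltonian and on the scale `c₀`. -/
structure Adm (r : ℝ) (π : ι → ι → MvPolynomial ι ℝ) (κ : Ser ι) (M B c₀ : ℝ) : Prop where
  hr : 1 ≤ r
  poisson : IsPoisson π
  deg : ∀ i j, (π i j).totalDegree ≤ 1
  kdeg : ∀ d, (κ d).totalDegree ≤ d + 2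
  hM : 0 ≤ M
  hB : 0 ≤ B
  bound : ∀ d, pnorm r (κ d) ≤ M * B ^ d
  one : κ 1 = 0
  hc : 0 < c₀
  hcB : c₀ * B ≤ 1 / 4
  hcC : 8 * pbConst r π * M * c₀ ≤ 1 / 2

section Bounds

variable {π : ι → ι → MvPolynomial ι ℝ} {κ : Ser ι} {M B c₀ : ℝ} (A : Adm r π κ M B c₀)
include A

theorem Adm.hr0 : 0 ≤ r := by linarith [A.hr]

theorem Adm.rho_pos (n : ℕ) : 0 < c₀ / (n + 1) := div_pos A.hc (by positivity)

theorem Adm.nu_eul_shift (n : ℕ) :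
    nu r (c₀ / (n + 1)) n (eul (shift κ)) ≤ 2 * M * (c₀ / (n + 1)) := by
  refine nu_eul_shift_le A.hr0 A.hM A.hB A.bound (A.rho_pos n).le (le_trans ?_ A.hcB)
  have hB := A.hB
  have hc := A.hc
  gcongr
  exact div_le_self hc.le (by have : (0 : ℝ) ≤ n := by positivity
                              linarith)

/-- The factor n + 1, the price of a derivative, cancels against the radius ρ = c₀/(n+1). This is
what forces the radius to shrink with n. -/
theorem Adm.eps_le (n : ℕ) :
    2 * pbConst r π * (n + 1) * (2 * (2 * M * (c₀ / (n + 1)))) ≤ 1 / 2 := by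
  refine le_trans (le_of_eq ?_) A.hcC
  field_simp
  ring

theorem Adm.nu_eul_magnus (n : ℕ) :
    nu r (c₀ / (n + 1)) n (eul (magnus π (shift κ))) ≤ 2 * (2 * M * (c₀ / (n + 1))) :=
  nu_eul_le_of_isMagnus A.hr (A.rho_pos n).le A.deg (magnus_degLE A.deg (shift_degLE A.kdeg))
    (magnus_ordGE _ _) (isMagnus_magnus π (shift_ordGE κ))
    ((nu_le_nu_eul A.hr0 (A.rho_pos n).le (shift_ordGE κ)).trans (A.nu_eul_shift n)) (A.eps_le n)

theorem Adm.eps_magnus (n : ℕ) :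
    2 * pbConst r π * (n + 1) * nu r (c₀ / (n + 1)) n (eul (magnus π (shift κ))) ≤ 1 / 2 := by
  refine le_trans ?_ (A.eps_le n)
  have := pbConst_nonneg A.hr0 π
  have h := A.nu_eul_magnus n
  gcongr

theorem Adm.eps_shift (n : ℕ) :
    2 * pbConst r π * (n + 1) * nu r (c₀ / (n + 1)) n (eul (shift κ)) ≤ 1 / 2 := by
  refine le_trans ?_ (A.eps_le n)
  have := pbConst_nonneg A.hr0 π
  have h := A.nu_eul_shift n
  have h1 := mul_nonneg A.hM (A.rho_pos n).le
  gcongr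
  linarith

/-- Read off from the single truncation n = d + 1, whose radius is c₀/(d+2). The bound on the
coefficients grows like dᵈ: it does not give convergence, but it makes truncation at d of the order
of 1/h effective. -/
theorem Adm.pnorm_magnus_le (d : ℕ) :
    pnorm r (magnus π (shift κ) (d + 1)) ≤ 4 * M * ((d + 2) / c₀) ^ d := by
  have hρ := A.rho_pos (d + 1)
  set ρ := c₀ / (((d + 1 : ℕ) : ℝ) + 1) with hρdef
  have h1 := A.nu_eul_magnus (d + 1)
  have h2 : ρ ^ (d + 1) * pnorm r (eul (magnus π (shift κ)) (d + 1))
      ≤ nu r ρ (d + 1) (eul (magnus π (shift κ))) :=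
    Finset.single_le_sum (f := fun d => ρ ^ d * pnorm r (eul (magnus π (shift κ)) d))
      (fun d _ => mul_nonneg (by positivity) (pnorm_nonneg A.hr0 _)) (by simp)
  have h3 := pnorm_nonneg A.hr0 (magnus π (shift κ) (d + 1))
  have h4 : pnorm r (magnus π (shift κ) (d + 1))
      ≤ pnorm r (eul (magnus π (shift κ)) (d + 1)) := by
    rw [eul_apply, pnorm_smul, Nat.abs_cast]
    have : (1 : ℝ) ≤ ((d + 1 : ℕ) : ℝ) := by push_cast; linarith [(Nat.cast_nonneg d : (0:ℝ) ≤ d)]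
    nlinarith
  have h5 : ρ ^ d * pnorm r (magnus π (shift κ) (d + 1)) ≤ 4 * M := by
    have : ρ * (ρ ^ d * pnorm r (magnus π (shift κ) (d + 1))) ≤ ρ * (4 * M) := by
      calc _ = ρ ^ (d + 1) * pnorm r (magnus π (shift κ) (d + 1)) := by ring
        _ ≤ ρ ^ (d + 1) * pnorm r (eul (magnus π (shift κ)) (d + 1)) := by gcongr
        _ ≤ _ := h2.trans h1
        _ = _ := by ring
    exact le_of_mul_le_mul_left this hρ
  have h6 : ((d : ℝ) + 2) / c₀ = ρ⁻¹ := by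
    rw [hρdef, inv_div]; push_cast; ring
  rw [h6, inv_pow, ← div_eq_mul_inv, le_div_iff₀ (by positivity), mul_comm]
  exact h5

/-- The modified Hamiltonian truncated after `n` terms. -/
def modHam (π : ι → ι → MvPolynomial ι ℝ) (κ : Ser ι) (h : ℝ) (n : ℕ) : MvPolynomial ι ℝ :=
  h⁻¹ • ev h n (magnus π (shift κ))

/-- After division by h the constant term is κ 0 and the term of first order vanishes by
`magnus_two`. In the rest (d+4)² ≤ 16·4ᵈ is beaten by (h(d+4)/c₀)ᵈ ≤ 8⁻ᵈ, so it is h² times a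
geometric series. -/
theorem Adm.pnorm_modHam_sub_le {h : ℝ} (hh : 0 < h) (hn : 2 ≤ n) (hhn : h * (n + 1) ≤ c₀ / 8) :
    pnorm r (modHam π κ h n - κ 0) ≤ 128 * M / c₀ ^ 2 * h ^ 2 := by
  have hc := A.hc
  have hM := A.hM
  obtain ⟨m, rfl⟩ := Nat.exists_eq_add_of_le' hn
  have e0 : magnus π (shift κ) 0 = 0 := magnus_ordGE _ _ 0 one_pos
  have e1 : magnus π (shift κ) 1 = κ 0 := IsPoisson.magnus_one
  have e2 : magnus π (shift κ) 2 = 0 := A.poisson.magnus_two A.one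
  have e3 : modHam π κ h (m + 2) - κ 0
      = ∑ d ∈ range m, (h ^ (d + 2)) • magnus π (shift κ) (d + 3) := by
    rw [modHam, ev_apply, Finset.sum_range_succ', Finset.sum_range_succ', Finset.sum_range_succ']
    simp only [zero_add, e0, e1, smul_zero, add_zero, pow_one, smul_add, Nat.reduceAdd]
    rw [e2, smul_zero, smul_zero, add_zero, smul_smul, inv_mul_cancel₀ hh.ne', one_smul,
      add_sub_cancel_right, Finset.smul_sum]
    refine Finset.sum_congr rfl fun d _ => ?_
    rw [smul_smul]
    congr 1
    rw [pow_succ]; field_simp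
  rw [e3]
  refine (pnorm_sum_le A.hr0 _ _).trans ?_
  have hterm : ∀ d ∈ range m, pnorm r ((h ^ (d + 2)) • magnus π (shift κ) (d + 3))
      ≤ (64 * M / c₀ ^ 2 * h ^ 2) * (1 / 2) ^ d := by
    intro d hd
    have hd := Finset.mem_range.1 hd
    rw [pnorm_smul, abs_of_nonneg (by positivity)]
    have h1 := A.pnorm_magnus_le (d + 2)
    have h2 : h * ((d : ℝ) + 4) / c₀ ≤ 1 / 8 := by
      rw [div_le_iff₀ hc]
      have : (d : ℝ) + 4 ≤ ((m + 2 : ℕ) : ℝ) + 1 := by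
        have : d + 4 ≤ m + 2 + 1 := by omega
        exact_mod_cast this
      nlinarith
    have h3 : ((d : ℝ) + 4) ^ 2 ≤ 16 * 4 ^ d := by
      have := natCast_le_two_pow d
      have h4 : (0 : ℝ) ≤ d := by positivity
      calc ((d : ℝ) + 4) ^ 2 ≤ (4 * 2 ^ d) ^ 2 := by gcongr; linarith
        _ = 16 * (2 ^ 2) ^ d := by rw [mul_pow, ← pow_mul, ← pow_mul, mul_comm d 2]; norm_num
        _ = _ := by norm_num
    calc h ^ (d + 2) * pnorm r (magnus π (shift κ) (d + 2 + 1))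
        ≤ h ^ (d + 2) * (4 * M * ((((d + 2 : ℕ) : ℝ) + 2) / c₀) ^ (d + 2)) := by gcongr
      _ = 4 * M / c₀ ^ 2 * h ^ 2 * (((d : ℝ) + 4) ^ 2 * (h * ((d : ℝ) + 4) / c₀) ^ d) := by
          push_cast
          rw [show ((d : ℝ) + 2 + 2) = d + 4 by ring, mul_div_assoc h, mul_pow h,
            pow_add h, pow_add (_ / c₀), div_pow _ _ 2]
          ring
      _ ≤ 4 * M / c₀ ^ 2 * h ^ 2 * ((16 * 4 ^ d) * (1 / 8) ^ d) := by gcongr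
      _ = (64 * M / c₀ ^ 2 * h ^ 2) * ((4 * (1 / 8)) ^ d) := by rw [mul_pow]; ring
      _ = _ := by norm_num
  refine (Finset.sum_le_sum hterm).trans ?_
  rw [← Finset.mul_sum]
  calc _ ≤ (64 * M / c₀ ^ 2 * h ^ 2) * 2 := by gcongr; exact sum_half_pow_le m
    _ = _ := by ring

/-- The series starts in degree one, so a factor h/ρ splits off; it cancels both the prefactor h⁻¹
and the factor ρ in the bound of eul G. The result is uniform in h and n, and controls the speed of
the modified flow as well as the variation of the modified energy. -/
theorem Adm.pnorm_pderiv_modHam_le {h : ℝ} (hh : 0 < h) (hhρ : h ≤ c₀ / (n + 1)) (j : ι) :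
    pnorm r (pderiv j (modHam π κ h n)) ≤ 8 * M := by
  have hρ := A.rho_pos n
  have hG := magnus_degLE A.deg (shift_degLE A.kdeg)
  have h1 := A.nu_eul_magnus n
  set ρ := c₀ / ((n : ℝ) + 1)
  rw [modHam, (pderiv j).map_smul, pnorm_smul, abs_of_pos (inv_pos.2 hh), inv_mul_le_iff₀ hh]
  refine (pnorm_pderiv_ev_le A.hr hG hh.le j).trans ?_
  have : ∑ d ∈ range (n + 1), h ^ d * ((d + 1) * pnorm r (magnus π (shift κ) d))
      ≤ 2 * (h / ρ) * nu r ρ n (eul (magnus π (shift κ))) := by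
    rw [nu, Finset.mul_sum]
    refine Finset.sum_le_sum fun d _ => ?_
    have h3 := pnorm_nonneg A.hr0 (magnus π (shift κ) d)
    rw [eul_apply, pnorm_smul, Nat.abs_cast]
    rcases Nat.eq_zero_or_pos d with hd | hd
    · rw [hd, magnus_ordGE π (shift κ) 0 one_pos]; simp
    · obtain ⟨d, rfl⟩ := Nat.exists_eq_add_of_le' hd
      have h4 : h ^ (d + 1) ≤ (h / ρ) * ρ ^ (d + 1) := by
        calc h ^ (d + 1) = h * h ^ d := by ring
          _ ≤ h * ρ ^ d := by gcongr
          _ = _ := by field_simp; ring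
      have h5 : ((d + 1 : ℕ) : ℝ) + 1 ≤ 2 * ((d + 1 : ℕ) : ℝ) := by
        push_cast; linarith [(Nat.cast_nonneg d : (0:ℝ) ≤ d)]
      calc _ ≤ ((h / ρ) * ρ ^ (d + 1)) * (2 * ((d + 1 : ℕ) : ℝ) *
            pnorm r (magnus π (shift κ) (d + 1))) := by gcongr
        _ = _ := by ring
  refine this.trans ?_
  calc _ ≤ 2 * (h / ρ) * (2 * (2 * M * ρ)) := by gcongr
    _ = _ := by field_simp; ring

theorem Adm.pnorm_pb_modHam_le {h : ℝ} (hh : 0 < h) (hhρ : h ≤ c₀ / (n + 1)) (i : ι) :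
    pnorm r (pb π (X i) (modHam π κ h n)) ≤ 8 * pbConst r π * M := by
  classical
  have hr0 := A.hr0
  have hM := A.hM
  have e : pb π (X i) (modHam π κ h n) = ∑ j, π i j * pderiv j (modHam π κ h n) := by
    simp [pb, pderiv_X, Pi.single_apply]
  rw [e]
  refine (pnorm_sum_le hr0 _ _).trans ?_
  calc _ ≤ ∑ j, pnorm r (π i j) * (8 * M) := Finset.sum_le_sum fun j _ => by
        refine (pnorm_mul_le hr0 _ _).trans ?_
        have := pnorm_nonneg hr0 (π i j)
        gcongr
        exact A.pnorm_pderiv_modHam_le hh hhρ j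
    _ = (∑ j, pnorm r (π i j)) * (8 * M) := by rw [Finset.sum_mul]
    _ ≤ pbConst r π * (8 * M) := by
        gcongr
        exact Finset.single_le_sum (f := fun i => ∑ j, pnorm r (π i j))
          (fun i _ => Finset.sum_nonneg fun j _ => pnorm_nonneg hr0 _) (Finset.mem_univ i)
    _ = _ := by ring

end Bounds

end PolyPoisson

/-! ### Comparison of the scheme with the modified flow through approximate first integrals. -/

namespace PolyPoisson

open MvPolynomial Finset

variable {ι : Type*} [Fintype ι] {r ρ : ℝ} {n : ℕ}

/-- The coordinate `Xᵢ` as a constant series. -/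
def gen (i : ι) : Ser ι := fun d => if d = 0 then X i else 0

omit [Fintype ι] in
theorem gen_degLE (i : ι) : DegLE (gen i) := fun d => by
  by_cases h : d = 0 <;> simp [gen, h]

omit [Fintype ι] in
theorem eul_gen (i : ι) : eul (gen i) = 0 := by
  funext d
  by_cases h : d = 0 <;> simp [gen, h, eul_apply]

omit [Fintype ι] in
theorem nu_gen (i : ι) : nu r ρ n (gen i) = r := by
  rw [nu, Finset.sum_eq_single 0] <;> simp +contextual [gen, pnorm_X]

omit [Fintype ι] in
theorem ev_gen (s : ℝ) (i : ι) : ev s n (gen i) = X i := by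
  rw [ev_apply, Finset.sum_eq_single 0] <;> simp +contextual [gen]

theorem expS_zero (π : ι → ι → MvPolynomial ι ℝ) (G : Ser ι) (n : ℕ) (F : Ser ι) :
    expS π G n 0 F = F := by
  rw [expS, Finset.sum_eq_single 0] <;> simp +contextual [ec]

theorem expS_apply_zero {π : ι → ι → MvPolynomial ι ℝ} {G : Ser ι} (hG : OrdGE 1 G) (n : ℕ) (t : ℝ)
    (F : Ser ι) : expS π G n t F 0 = F 0 := by
  rw [expS, Finset.sum_apply, Finset.sum_eq_single 0]
  · simp [ec]
  · intro k _ hk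
    rw [Pi.smul_apply, hG.adS_pow (a := 0) (fun d hd => absurd hd (by omega)) k 0 (by omega),
      smul_zero]
  · simp

omit [Fintype ι] in
theorem ev_zero (F : Ser ι) : ev 0 n F = F 0 := by
  rw [ev_apply, Finset.sum_eq_single 0] <;> simp +contextual

/-- A curve that solves the non-autonomous system of `∑ sᵈ κ_d` up to the expected error of every
truncation. -/
structure ApproxTraj (r : ℝ) (π : ι → ι → MvPolynomial ι ℝ) (κ : Ser ι) (M' B' h : ℝ)
    (y : ℝ → ι → ℝ) : Prop where
  cont : ContinuousOn y (Icc 0 h)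
  bound : ∀ s ∈ Icc 0 h, ‖y s‖ ≤ r
  deriv : ∀ s ∈ Ioo 0 h, ∃ y' : ι → ℝ, ∀ i, HasDerivAt (fun τ => y τ i) (y' i) s ∧
    ∀ n, |y' i - eval (y s) (pb π (X i) (∑ d ∈ range n, s ^ d • κ d))| ≤ M' * (B' * s) ^ n

omit [Fintype ι] in
theorem inv_smul_ev_shift {s : ℝ} (hs : s ≠ 0) (κ : Ser ι) (n : ℕ) :
    s⁻¹ • ev s n (shift κ) = ∑ d ∈ range n, s ^ d • κ d := by
  rw [ev_apply, Finset.sum_range_succ']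
  simp only [shift, smul_zero, add_zero, Finset.smul_sum, smul_smul]
  refine Finset.sum_congr rfl fun d _ => ?_
  congr 1
  rw [pow_succ]; field_simp

section

variable {π : ι → ι → MvPolynomial ι ℝ} {κ : Ser ι} {M B c₀ : ℝ} (A : Adm r π κ M B c₀)
include A

/-- The function s ↦ (exp(-{·, G})Xᵢ)(y s), truncated, is the i-th coordinate of y 0 at s = 0. Its
derivative is bounded by the truncation defect, of size θⁿ since h ≤ θρ, and by the defect of the
curve, of size (B'h)ⁿ ≤ θⁿ. -/
theorem Adm.approx_const {M' B' h θ : ℝ} (hM' : 0 ≤ M') (hB' : 0 ≤ B') (hh : 0 < h)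
    (hhρ : h ≤ θ * (c₀ / (n + 1))) (hθ1 : θ ≤ 1) (hB'h : B' * h ≤ θ)
    {y : ℝ → ι → ℝ} (hy : ApproxTraj r π κ M' B' h y) (i : ι) :
    |eval (y h) (ev h n (expS π (magnus π (shift κ)) n 1 (gen i))) - y 0 i|
      ≤ h * ((n + 1) * θ ^ n * (r / c₀ + 2 * r * M' * Fintype.card ι)) := by
  have hr0 := A.hr0
  have hρ := A.rho_pos n
  have hc := A.hc
  have hG := magnus_degLE A.deg (shift_degLE A.kdeg)
  have hG1 := magnus_ordGE π (shift κ)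
  have hS := shift_degLE A.kdeg
  have hS1 := shift_ordGE κ
  have hMag := isMagnus_magnus π hS1 n
  have heS := A.eps_shift n
  have hQ := nu_expS_le A.hr hρ.le A.deg (gen_degLE i) hG hG1 (A.eps_magnus n) (t := 1) (by simp)
  rw [nu_gen] at hQ
  have hρeq : (c₀ / ((n : ℝ) + 1))⁻¹ = (n + 1) / c₀ := inv_div _ _
  set ρ := c₀ / ((n : ℝ) + 1)
  have hθ : h / ρ ≤ θ := by rwa [div_le_iff₀ hρ]
  have hhρ1 : h ≤ ρ := hhρ.trans (by nlinarith)
  set G := magnus π (shift κ)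
  set u := fun s => eval (y s) (ev s n (expS π G n 1 (gen i))) with hu
  have hucont : ContinuousOn u (Icc 0 h) := by
    have e1 : u = fun s => ∑ d ∈ range (n + 1), s ^ d * eval (y s) (expS π G n 1 (gen i) d) := by
      funext s; simp [hu, ev_apply, smul_eval]
    rw [e1]
    refine continuousOn_finsetSum _ fun d _ => (continuousOn_id.pow d).mul ?_
    exact (MvPolynomial.continuous_eval _).comp_continuousOn hy.cont
  have hud : ∀ s ∈ Ioo 0 h, ∃ u', HasDerivAt u u' s ∧
      |u'| ≤ (n + 1) * θ ^ n * (r / c₀ + 2 * r * M' * Fintype.card ι) := by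
    intro s hs
    obtain ⟨y', hy'⟩ := hy.deriv s hs
    have hsb := hy.bound s ⟨hs.1.le, hs.2.le⟩
    obtain ⟨u', hu', hle⟩ := A.poisson.hasDerivAt_ev_expS A.hr hρ A.deg hS hS1 hG hG1 hMag
      (gen_degLE i) (eul_gen i) hs.1 (hs.2.le.trans hhρ1) (fun j => (hy' j).1)
      (fun j => (norm_le_pi_norm (y s) j).trans hsb) (e := M' * (B' * s) ^ n) (fun j => by
        have := (hy' j).2 n
        rw [← inv_smul_ev_shift hs.1.ne', ← pbL_apply, map_smul, smul_eval] at this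
        exact this)
    refine ⟨u', hu', hle.trans ?_⟩
    have hs0 := hs.1
    have hQ0 := nu_nonneg (n := n) hr0 hρ.le (expS π G n 1 (gen i))
    have h1 : s⁻¹ * ((s / ρ) ^ (n + 1) * (2 * pbConst r π * (n + 1) * nu r ρ n (eul (shift κ)) *
        nu r ρ n (expS π G n 1 (gen i)))) ≤ (n + 1) * θ ^ n * (r / c₀) := by
      have h2 : s⁻¹ * (s / ρ) ^ (n + 1) ≤ (n + 1) / c₀ * θ ^ n := by
        rw [← hρeq, pow_succ]
        have : s⁻¹ * ((s / ρ) ^ n * (s / ρ)) = ρ⁻¹ * (s / ρ) ^ n := by field_simp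
        rw [this]
        gcongr
        exact (div_le_div_of_nonneg_right hs.2.le hρ.le).trans hθ
      have h3 : 2 * pbConst r π * (n + 1) * nu r ρ n (eul (shift κ)) *
        nu r ρ n (expS π G n 1 (gen i)) ≤ 1 / 2 * (2 * r) := by gcongr
      rw [← mul_assoc]
      have h4 : 0 ≤ s⁻¹ * (s / ρ) ^ (n + 1) := by positivity
      have h5 : (0 : ℝ) ≤ 1 / 2 * (2 * r) := by positivity
      calc _ ≤ (n + 1) / c₀ * θ ^ n * (1 / 2 * (2 * r)) := by
            refine (mul_le_mul_of_nonneg_left h3 h4).trans (mul_le_mul_of_nonneg_right h2 h5)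
        _ = _ := by ring
    have h2 : (Fintype.card ι : ℝ) * ((n + 1) * nu r ρ n (expS π G n 1 (gen i)) *
        (M' * (B' * s) ^ n)) ≤ Fintype.card ι * ((n + 1) * (2 * r) * (M' * θ ^ n)) := by
      have : B' * s ≤ θ := (mul_le_mul_of_nonneg_left hs.2.le hB').trans hB'h
      gcongr
    calc _ ≤ (n + 1) * θ ^ n * (r / c₀)
          + Fintype.card ι * ((n + 1) * (2 * r) * (M' * θ ^ n)) := add_le_add h1 h2
      _ = _ := by ring
  have hud' : ∀ s ∈ Ioo 0 h, HasDerivAt u (deriv u s) s := fun s hs => by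
    obtain ⟨u', h1, _⟩ := hud s hs
    rwa [h1.deriv]
  -- The derivative is controlled only for s > 0, where division by s makes sense. The mean value
  -- theorem needs no more, given continuity on the closed interval.
  obtain ⟨s, hs, hslope⟩ := exists_hasDerivAt_eq_slope u (deriv u) hh hucont hud'
  obtain ⟨u', h1, h2⟩ := hud s hs
  have h0 : u 0 = y 0 i := by
    simp only [hu]
    rw [ev_zero, expS_apply_zero hG1]; simp [gen]
  rw [h1.deriv, sub_zero, h0] at hslope
  have h3 : u h - y 0 i = h * u' := by rw [hslope]; field_simp
  rw [h3, abs_mul, abs_of_pos hh]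
  gcongr

/-- Along the autonomous flow of G/h the observable to follow is exp(-(t/h){·, G})Xᵢ at the fixed
parameter h: it starts as Xᵢ and at t = h is the polynomial of `approx_const`. Transport by the flow
compensates the change of the exponent up to the truncation defect. -/
theorem Adm.flow_const {h θ : ℝ} (hh : 0 < h) (hhρ : h ≤ θ * (c₀ / (n + 1))) (hθ1 : θ ≤ 1)
    {y : ℝ → ι → ℝ} (hyr : ∀ t ∈ Icc 0 h, ‖y t‖ ≤ r)
    (hy : ∀ t ∈ Icc 0 h, ∀ i, HasDerivWithinAt (fun τ => y τ i)
      (eval (y t) (pb π (X i) (modHam π κ h n))) (Icc 0 h) t) (i : ι) :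
    |eval (y h) (ev h n (expS π (magnus π (shift κ)) n 1 (gen i))) - y 0 i| ≤ θ ^ (n + 1) * r := by
  have hr0 := A.hr0
  have hρ := A.rho_pos n
  have hG := magnus_degLE A.deg (shift_degLE A.kdeg)
  have hG1 := magnus_ordGE π (shift κ)
  have heG := A.eps_magnus n
  have hQ := fun t ht => nu_expS_le A.hr hρ.le A.deg (gen_degLE i) hG hG1 heG (t := t) ht
  simp only [nu_gen] at hQ
  set ρ := c₀ / ((n : ℝ) + 1)
  have hθ : h / ρ ≤ θ := by rwa [div_le_iff₀ hρ]
  have hhρ1 : h ≤ ρ := hhρ.trans (by nlinarith)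
  have hd : ∀ t ∈ Icc 0 h, ∃ u', HasDerivWithinAt
      (fun τ => eval (y τ) (ev h n (expS π (magnus π (shift κ)) n (τ / h) (gen i)))) u' (Icc 0 h) t
      ∧ ‖u'‖ ≤ h⁻¹ * (θ ^ (n + 1) * r) := by
    intro t ht
    obtain ⟨u', h1, h2⟩ := hasDerivWithinAt_ev_expS A.hr hρ A.deg hG hG1 (gen_degLE i) hh hhρ1
      (fun j => (norm_le_pi_norm (y t) j).trans (hyr t ht)) (hy t ht)
    refine ⟨u', h1, h2.trans ?_⟩
    have ht1 : |t / h| ≤ 1 := by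
      rw [abs_of_nonneg (div_nonneg ht.1 hh.le), div_le_one hh]; exact ht.2
    have h3 := hQ (t / h) ht1
    have hQ0 := nu_nonneg (n := n) hr0 hρ.le (expS π (magnus π (shift κ)) n (t / h) (gen i))
    have hG0 := nu_nonneg (n := n) hr0 hρ.le (eul (magnus π (shift κ)))
    have hC := pbConst_nonneg hr0 π
    have h4 : 2 * pbConst r π * (n + 1) * nu r ρ n (eul (magnus π (shift κ))) *
        nu r ρ n (expS π (magnus π (shift κ)) n (t / h) (gen i)) ≤ 1 / 2 * (2 * r) := by gcongr
    have hθ0 : 0 ≤ θ := (div_nonneg hh.le hρ.le).trans hθ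
    gcongr
    exact h4.trans (le_of_eq (by ring))
  choose! u' hu' using hd
  have := (convex_Icc (0 : ℝ) h).norm_image_sub_le_of_norm_hasDerivWithin_le
    (fun t ht => (hu' t ht).1) (fun t ht => (hu' t ht).2)
    (left_mem_Icc.2 hh.le) (right_mem_Icc.2 hh.le)
  rw [div_self hh.ne', zero_div, expS_zero, ev_gen, eval_X, Real.norm_eq_abs, sub_zero,
    Real.norm_eq_abs, abs_of_pos hh] at this
  refine this.trans (le_of_eq ?_)
  field_simp

/-- Apart from the constant term Xᵢ every coefficient carries a power of h ≤ θρ, so the difference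
from the identity has a derivative of order θ. Thus the values of the first integrals determine the
point in a Lipschitz way. -/
theorem Adm.near_id {h θ : ℝ} (hh : 0 < h) (hhρ : h ≤ θ * (c₀ / (n + 1))) (hθ1 : θ ≤ 1 / 8)
    {y z : ι → ℝ} (hy : ‖y‖ ≤ r) (hz : ‖z‖ ≤ r) (i : ι) :
    |(eval y (ev h n (expS π (magnus π (shift κ)) n 1 (gen i))) - y i) -
      (eval z (ev h n (expS π (magnus π (shift κ)) n 1 (gen i))) - z i)|
      ≤ Fintype.card ι * (4 * θ * r * ‖y - z‖) := by
  have hr0 := A.hr0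
  have hρ := A.rho_pos n
  have hG := magnus_degLE A.deg (shift_degLE A.kdeg)
  have hG1 := magnus_ordGE π (shift κ)
  have hQ := nu_expS_le A.hr hρ.le A.deg (gen_degLE i) hG hG1 (A.eps_magnus n) (t := 1) (by simp)
  rw [nu_gen] at hQ
  set ρ := c₀ / ((n : ℝ) + 1)
  have hθ : h / ρ ≤ θ := by rwa [div_le_iff₀ hρ]
  have hθ0 : 0 < θ := lt_of_lt_of_le (by positivity) hθ
  set Q := expS π (magnus π (shift κ)) n 1 (gen i) with hQdef
  have hQd : DegLE Q := (gen_degLE i).expS A.deg hG n 1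
  have hQ0 : Q 0 = X i := by rw [hQdef, expS_apply_zero hG1]; simp [gen]
  set R : Ser ι := Q - gen i with hR
  have hR0 : R 0 = 0 := by simp [hR, hQ0, gen]
  have hRd : ∀ d, d ≠ 0 → R d = Q d := fun d hd => by simp [hR, gen, hd]
  have hRdeg : DegLE R := fun d => by
    by_cases hd : d = 0
    · simp [hd, hR0]
    · rw [hRd d hd]; exact hQd d
  have e : ∀ y : ι → ℝ, eval y (ev h n Q) - y i = eval y (ev h n R) := fun y => by
    rw [hR, map_sub, map_sub, ev_gen, eval_X]
  rw [e, e]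
  refine abs_eval_sub_le (r := r) (D := 4 * θ * r) (fun j => ?_) hy hz
  refine (pnorm_pderiv_ev_le A.hr hRdeg hh.le j).trans ?_
  have : ∑ d ∈ range (n + 1), h ^ d * ((d + 1) * pnorm r (R d)) ≤ 2 * θ * nu r ρ n Q := by
    rw [nu, Finset.mul_sum]
    refine Finset.sum_le_sum fun d _ => ?_
    have h3 := pnorm_nonneg hr0 (Q d)
    rcases Nat.eq_zero_or_pos d with hd | hd
    · rw [hd, hR0, pnorm_zero, mul_zero, mul_zero]
      exact mul_nonneg (by positivity) (mul_nonneg (by positivity) (pnorm_nonneg hr0 _))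
    · rw [hRd d hd.ne']
      obtain ⟨d, rfl⟩ := Nat.exists_eq_add_of_le' hd
      have h4 := natCast_le_two_pow d
      have h5 : h ^ (d + 1) ≤ θ ^ (d + 1) * ρ ^ (d + 1) := by
        rw [← mul_pow]; gcongr
      have h6 : θ ^ (d + 1) * (((d + 1 : ℕ) : ℝ) + 1) ≤ 2 * θ := by
        have h7 : ((d + 1 : ℕ) : ℝ) + 1 ≤ 2 * 2 ^ d := by
          push_cast; linarith [(Nat.cast_nonneg d : (0:ℝ) ≤ d)]
        calc θ ^ (d + 1) * (((d + 1 : ℕ) : ℝ) + 1) ≤ θ ^ (d + 1) * (2 * 2 ^ d) := by gcongr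
          _ = 2 * θ * (2 * θ) ^ d := by rw [mul_pow]; ring
          _ ≤ 2 * θ * 1 := by gcongr; exact pow_le_one₀ (by positivity) (by linarith)
          _ = _ := mul_one _
      calc _ ≤ (θ ^ (d + 1) * ρ ^ (d + 1)) * ((((d + 1 : ℕ) : ℝ) + 1) * pnorm r (Q (d + 1))) := by
            gcongr
        _ = (θ ^ (d + 1) * (((d + 1 : ℕ) : ℝ) + 1)) * (ρ ^ (d + 1) * pnorm r (Q (d + 1))) := by ring
        _ ≤ _ := by gcongr
  refine this.trans ?_
  calc _ ≤ 2 * θ * (2 * r) := by gcongr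
    _ = _ := by ring

end

end PolyPoisson

/-! ### Modified flow lines and the exponentially small error. -/

namespace PolyPoisson

open MvPolynomial Finset

variable {ι : Type*} [Fintype ι] {r ρ : ℝ} {n : ℕ}

section

variable {π : ι → ι → MvPolynomial ι ℝ} {κ : Ser ι} {M B c₀ : ℝ}

/-- `y` is an integral curve on `[0, h]` of the Hamiltonian vector field of `P`. -/
def IsFlowLine (π : ι → ι → MvPolynomial ι ℝ) (P : MvPolynomial ι ℝ) (h : ℝ)
    (y : ℝ → ι → ℝ) : Prop :=
  ∀ t ∈ Icc 0 h, ∀ i, HasDerivWithinAt (fun τ => y τ i) (eval (y t) (pb π (X i) P)) (Icc 0 h) t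

theorem norm_flowField_le {P : MvPolynomial ι ℝ} {V : ℝ} (hV0 : 0 ≤ V)
    (hV : ∀ i, pnorm r (pb π (X i) P) ≤ V) {y : ι → ℝ} (hy : ‖y‖ ≤ r) :
    ‖fun i => eval y (pb π (X i) P)‖ ≤ V :=
  (pi_norm_le_iff_of_nonneg hV0).2 fun i =>
    (abs_eval_le (fun j => (norm_le_pi_norm y j).trans hy) _).trans (hV i)

theorem IsFlowLine.norm_le {P : MvPolynomial ι ℝ} {V h r₀ : ℝ} {y : ℝ → ι → ℝ}
    (hy : IsFlowLine π P h y) (hV0 : 0 ≤ V) (hV : ∀ i, pnorm r (pb π (X i) P) ≤ V)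
    (h0 : ‖y 0‖ ≤ r₀) (hh : r₀ + (V + 1) * h ≤ r) : ∀ t ∈ Icc 0 h, ‖y t‖ ≤ r := by
  have hd : ∀ t ∈ Icc 0 h, HasDerivWithinAt y (fun i => eval (y t) (pb π (X i) P)) (Icc 0 h) t :=
    fun t ht => hasDerivWithinAt_pi.2 (hy t ht)
  intro t ht
  -- The barrier grows at speed V + 1 rather than V because the speed of the curve must be strictly
  -- smaller at a point of contact. There the curve is still in the ball of radius r, where the
  -- field is at most V.
  have key := image_norm_le_of_norm_deriv_right_lt_deriv_boundary (f := y) (a := 0) (b := h)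
    (B := fun t => r₀ + (V + 1) * t) (B' := fun _ => V + 1)
    (f' := fun t i => eval (y t) (pb π (X i) P))
    (fun t ht => (hd t ht).continuousWithinAt)
    (fun t ht => (hd t ⟨ht.1, ht.2.le⟩).mono_of_mem_nhdsWithin (Icc_mem_nhdsGE_of_mem ht))
    (by simpa using h0)
    (fun x => by simpa using ((hasDerivAt_id x).const_mul (V + 1)).const_add r₀)
    (fun x hx e => by
      have : ‖y x‖ ≤ r := by
        rw [e]
        nlinarith [hx.2]
      have := norm_flowField_le hV0 hV this
      linarith)
  refine (key ht).trans (le_trans ?_ hh)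
  have := ht.2
  gcongr

theorem exists_isFlowLine {P : MvPolynomial ι ℝ} {V h r₀ : ℝ} (hh0 : 0 < h) (hV0 : 0 ≤ V)
    (hV : ∀ i, pnorm r (pb π (X i) P) ≤ V) (hh : r₀ + (V + 1) * h ≤ r) (hr : 0 ≤ r)
    {x : ι → ℝ} (hx : ‖x‖ ≤ r₀) : ∃ y : ℝ → ι → ℝ, y 0 = x ∧ IsFlowLine π P h y := by
  have hrr : 0 ≤ r - r₀ := by nlinarith
  have hball : ∀ z ∈ Metric.closedBall x (r - r₀), ‖z‖ ≤ r := by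
    intro z hz
    rw [mem_closedBall_iff_norm] at hz
    have := norm_add_le (z - x) x
    rw [sub_add_cancel] at this
    linarith
  let f : (ι → ℝ) → (ι → ℝ) := fun z i => eval z (pb π (X i) P)
  set D := ∑ i, ∑ j, pnorm r (pderiv j (pb π (X i) P)) with hD
  have hD' : ∀ i j, pnorm r (pderiv j (pb π (X i) P)) ≤ D := fun i j =>
    (Finset.single_le_sum (f := fun j => pnorm r (pderiv j (pb π (X i) P)))
      (fun j _ => pnorm_nonneg hr _) (mem_univ j)).trans
    (Finset.single_le_sum (f := fun i => ∑ j, pnorm r (pderiv j (pb π (X i) P)))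
      (fun i _ => Finset.sum_nonneg fun j _ => pnorm_nonneg hr _) (mem_univ i))
  have hD0 : 0 ≤ D := Finset.sum_nonneg fun i _ => Finset.sum_nonneg fun j _ => pnorm_nonneg hr _
  have hPL : IsPicardLindelof (fun _ => f) (⟨0, left_mem_Icc.2 hh0.le⟩ : Icc (0:ℝ) h) x
      ⟨r - r₀, hrr⟩ 0 ⟨V, hV0⟩ ⟨Fintype.card ι * D, mul_nonneg (Nat.cast_nonneg _) hD0⟩ := by
    refine IsPicardLindelof.of_time_independent (fun z hz => norm_flowField_le hV0 hV (hball z hz))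
      ?_ ?_
    · refine LipschitzOnWith.of_dist_le_mul fun y hy z hz => ?_
      rw [dist_eq_norm, dist_eq_norm]
      refine (pi_norm_le_iff_of_nonneg (mul_nonneg (NNReal.coe_nonneg _) (norm_nonneg _))).2
        fun i => ?_
      have := abs_eval_sub_le (hD' i) (hball y hy) (hball z hz)
      rw [← mul_assoc] at this
      exact this
    · simp only [sub_zero, sub_self, NNReal.coe_zero]
      rw [max_eq_left hh0.le]
      change V * h ≤ r - r₀
      linarith
  obtain ⟨y, h0, hy⟩ := hPL.exists_eq_forall_mem_Icc_hasDerivWithinAt₀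
  exact ⟨y, h0, fun t ht i => hasDerivWithinAt_pi.1 (hy t ht) i⟩

theorem IsFlowLine.eval_eq {P : MvPolynomial ι ℝ} {h : ℝ} {y : ℝ → ι → ℝ}
    (hπ : IsPoisson π) (hh : 0 ≤ h) (hy : IsFlowLine π P h y) :
    eval (y h) P = eval (y 0) P := by
  have hd : ∀ t ∈ Icc 0 h, HasDerivWithinAt (fun τ => eval (y τ) P) 0 (Icc 0 h) t := by
    intro t ht
    refine (hasDerivWithinAt_eval (hy t ht) P).congr_deriv ?_
    rw [← map_zero (eval (y t)), ← hπ.pb_self P, pb_eq_sum, map_sum]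
    simp
  have := (convex_Icc (0 : ℝ) h).norm_image_sub_le_of_norm_hasDerivWithin_le (C := 0)
    hd (fun t ht => by simp) (left_mem_Icc.2 hh) (right_mem_Icc.2 hh)
  rw [zero_mul] at this
  exact sub_eq_zero.1 (norm_le_zero_iff.1 this)

variable (A : Adm r π κ M B c₀)
include A

/-- The near-identity map of the first integrals sends both end points close to the common starting
point, by `approx_const` and `flow_const`. By `near_id` it differs from the identity by a
contraction of factor 1/2, and inverting it costs a factor 2. -/
theorem Adm.norm_sub_le {M' B' h θ : ℝ} (hM' : 0 ≤ M') (hB' : 0 ≤ B') (hh : 0 < h)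
    (hhρ : h ≤ θ * (c₀ / (n + 1))) (hθ0 : 0 ≤ θ) (hθ1 : θ ≤ 1 / 8)
    (hθ : Fintype.card ι * (4 * θ * r) ≤ 1 / 2)
    (hB'h : B' * h ≤ θ) {y γ : ℝ → ι → ℝ} (hy : ApproxTraj r π κ M' B' h y)
    (hγ : IsFlowLine π (modHam π κ h n) h γ) (hγr : ∀ t ∈ Icc 0 h, ‖γ t‖ ≤ r) (h0 : γ 0 = y 0) :
    ‖y h - γ h‖ ≤ 2 * (h * ((n + 1) * θ ^ n * (r / c₀ + 2 * r * M' * Fintype.card ι))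
      + θ ^ (n + 1) * r) := by
  have hr0 := A.hr0
  have hc := A.hc
  have hmem : h ∈ Icc 0 h := right_mem_Icc.2 hh.le
  have key : ‖y h - γ h‖ ≤ (h * ((n + 1) * θ ^ n * (r / c₀ + 2 * r * M' * Fintype.card ι))
      + θ ^ (n + 1) * r) + 1 / 2 * ‖y h - γ h‖ := by
    refine (pi_norm_le_iff_of_nonneg (by positivity)).2 fun i => ?_
    have h1 := A.approx_const hM' hB' hh hhρ (by linarith) hB'h hy i
    have h2 := A.flow_const hh hhρ (by linarith) hγr hγ i
    have h3 := A.near_id hh hhρ hθ1 (hy.bound h hmem) (hγr h hmem) i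
    have h4 : Fintype.card ι * (4 * θ * r * ‖y h - γ h‖) ≤ 1 / 2 * ‖y h - γ h‖ := by
      rw [← mul_assoc]
      gcongr
    rw [h0] at h2
    rw [Pi.sub_apply, Real.norm_eq_abs]
    rw [abs_le] at h1 h2 h3 ⊢
    constructor <;> linarith [h1.1, h1.2, h2.1, h2.2, h3.1, h3.2]
  linarith

end

theorem two_mul_pow_le_exp {θ : ℝ} (hθ0 : 0 ≤ θ) (hθ : θ ≤ 1 / 8) (n : ℕ) :
    (n + 1) * θ ^ n ≤ Real.exp (-n) := by
  have h1 := natCast_le_two_pow n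
  have h2 : Real.exp (-n) = (Real.exp (-1)) ^ n := by rw [← Real.exp_nat_mul]; simp
  have h3 : 1 / 4 ≤ Real.exp (-1) := by
    rw [Real.exp_neg, one_div]
    exact inv_anti₀ (Real.exp_pos 1) (by linarith [Real.exp_one_lt_d9])
  rw [h2]
  calc (n + 1) * θ ^ n ≤ 2 ^ n * θ ^ n := by gcongr
    _ = (2 * θ) ^ n := by rw [mul_pow]
    _ ≤ _ := by gcongr; linarith

set_option maxHeartbeats 1000000 in
/-- The modified Hamiltonian of a family of curves that solve, up to the error of truncation, a
non-autonomous Hamiltonian system with a convergent polynomial expansion in time. -/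
theorem exists_modified_hamiltonian {π : ι → ι → MvPolynomial ι ℝ} {κ : Ser ι}
    {M B M' B' r₀ : ℝ} (hr : 1 ≤ r) (poisson : IsPoisson π)
    (deg : ∀ i j, (π i j).totalDegree ≤ 1) (kdeg : ∀ d, (κ d).totalDegree ≤ d + 2)
    (hM : 0 ≤ M) (hB : 0 ≤ B) (bound : ∀ d, pnorm r (κ d) ≤ M * B ^ d) (one : κ 1 = 0)
    (hM' : 0 ≤ M') (hB' : 0 ≤ B') (hr₀ : r₀ < r) :
    ∃ h₁ > 0, ∃ C > 0, ∃ c > 0, ∃ Hm : ℝ → MvPolynomial ι ℝ, ∀ h, 0 < h → h < h₁ →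
      (∀ y : ι → ℝ, ‖y‖ ≤ r → |eval y (Hm h) - eval y (κ 0)| ≤ C * h ^ 2) ∧
      (∀ y γ : ℝ → ι → ℝ, ‖y 0‖ ≤ r₀ → ApproxTraj r π κ M' B' h y → γ 0 = y 0 →
        IsFlowLine π (Hm h) h γ → ‖y h - γ h‖ ≤ C * h * Real.exp (-c / h)) ∧
      (∀ y : ℝ → ι → ℝ, ‖y 0‖ ≤ r₀ → ApproxTraj r π κ M' B' h y →
        |eval (y h) (Hm h) - eval (y 0) (Hm h)| ≤ C * h * Real.exp (-c / h)) := by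
  have hr0 : 0 ≤ r := by linarith
  have hCB := pbConst_nonneg hr0 π
  have hCBM := mul_nonneg hCB hM
  -- The summands provide c₀B ≤ 1/4 and 8·pbConst·M·c₀ ≤ 1/2, as `Adm` requires, and c₀B' ≤ 1.
  set c₀ : ℝ := 1 / (4 * B + 16 * (pbConst r π * M) + B' + 1) with hc₀
  have hden : 0 < 4 * B + 16 * (pbConst r π * M) + B' + 1 := by positivity
  have hc : 0 < c₀ := by positivity
  have hmul : (4 * B + 16 * (pbConst r π * M) + B' + 1) * c₀ = 1 := by
    rw [hc₀]; field_simp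
  have p1 := mul_nonneg hB hc.le
  have p2 := mul_nonneg hCBM hc.le
  have p3 := mul_nonneg hB' hc.le
  have A : Adm r π κ M B c₀ :=
    ⟨hr, poisson, deg, kdeg, hM, hB, bound, one, hc, by linarith, by linarith⟩
  -- Chosen so that θ ≤ 1/8 and the contraction factor of `near_id`, the number of coordinates times
  -- 4θr, is at most 1/2.
  set θ : ℝ := 1 / (8 * (Fintype.card ι + 1) * r) with hθdef
  have hθ0 : 0 < θ := by positivity
  have hθmul : 8 * (Fintype.card ι + 1) * r * θ = 1 := by
    rw [hθdef]; field_simp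
  have hι : (0 : ℝ) ≤ Fintype.card ι := Nat.cast_nonneg _
  have hθ1 : θ ≤ 1 / 8 := by
    have : 0 ≤ (Fintype.card ι * r + (r - 1)) * θ := mul_nonneg (by nlinarith) hθ0.le
    linarith
  have hθ2 : Fintype.card ι * (4 * θ * r) ≤ 1 / 2 := by
    have : 0 ≤ r * θ := by positivity
    linarith
  set V : ℝ := 8 * pbConst r π * M with hV
  have hV0 : 0 ≤ V := by positivity
  set K : ℝ := 2 * (r / c₀ + 2 * r * M' * Fintype.card ι + 2 * r / c₀) * Real.exp 2 with hK
  have hK0 : 0 ≤ K := by positivity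
  set C : ℝ := 128 * M / c₀ ^ 2 + (1 + Fintype.card ι * (8 * M)) * K + 1 with hC
  have hL0 : 0 ≤ Fintype.card ι * (8 * M) := by positivity
  have q1 : 0 ≤ 128 * M / c₀ ^ 2 := by positivity
  have q2 : 0 ≤ Fintype.card ι * (8 * M) * K := by positivity
  have hCpos : 0 < C := by positivity
  -- The truncation index n satisfies n + 1 = ⌊θc₀/h⌋, the largest value with h ≤ θρ; then n > θc₀/h
  -- - 2, so e⁻ⁿ ≤ e²·exp(-θc₀/h). The first bound on h makes n ≥ 3, and the second keeps modified
  -- flow lines in the ball of radius r.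
  refine ⟨min (θ * c₀ / 4) ((r - r₀) / (V + 1)), lt_min (by positivity)
    (div_pos (by linarith) (by linarith)), C, hCpos, θ * c₀, by positivity,
    fun h => modHam π κ h (⌊θ * c₀ / h⌋₊ - 1), ?_⟩
  intro h hh hh1
  obtain ⟨hh2, hh3⟩ := lt_min_iff.1 hh1
  have hfl : 4 ≤ ⌊θ * c₀ / h⌋₊ := by
    rw [Nat.le_floor_iff (by positivity), le_div_iff₀ hh]
    push_cast; linarith
  obtain ⟨n, hn⟩ : ∃ n, ⌊θ * c₀ / h⌋₊ = n + 1 := ⟨⌊θ * c₀ / h⌋₊ - 1, by omega⟩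
  have hn1 : ((n : ℝ) + 1) * h ≤ θ * c₀ := by
    have := Nat.floor_le (show 0 ≤ θ * c₀ / h by positivity)
    rw [hn, le_div_iff₀ hh] at this
    exact_mod_cast this
  have hn2 : θ * c₀ / h < n + 2 := by
    have := Nat.lt_floor_add_one (θ * c₀ / h)
    rw [hn] at this
    push_cast at this
    linarith
  have hhρ : h ≤ θ * (c₀ / (n + 1)) := by
    rw [← mul_div_assoc, le_div_iff₀ (by positivity)]
    linarith
  have hhρ1 : h ≤ c₀ / (n + 1) :=
    hhρ.trans (mul_le_of_le_one_left (by positivity) (by linarith))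
  simp only [hn, Nat.add_sub_cancel]
  have hVh : r₀ + (V + 1) * h ≤ r := by
    rw [lt_div_iff₀ (by linarith)] at hh3
    linarith
  have hVb := A.pnorm_pb_modHam_le hh hhρ1
  have hclose : ∀ y γ : ℝ → ι → ℝ, ‖y 0‖ ≤ r₀ → ApproxTraj r π κ M' B' h y → γ 0 = y 0 →
      IsFlowLine π (modHam π κ h n) h γ → ‖y h - γ h‖ ≤ K * h * Real.exp (-(θ * c₀) / h) := by
    intro y γ hy0 hy h0 hγ
    have hγr := hγ.norm_le hV0 hVb (by rw [h0]; exact hy0) hVh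
    refine (A.norm_sub_le hM' hB' hh hhρ hθ0.le hθ1 hθ2 ?_ hy hγ hγr h0).trans ?_
    · have : B' * h ≤ B' * (θ * c₀ / 4) := by gcongr
      nlinarith
    · have e1 := two_mul_pow_le_exp hθ0.le hθ1 n
      have e2 : Real.exp (-n) ≤ Real.exp 2 * Real.exp (-(θ * c₀) / h) := by
        rw [← Real.exp_add]
        gcongr
        rw [neg_div]; linarith
      have e3 : θ ^ (n + 1) * r ≤ h * ((n + 1) * θ ^ n * (2 * r / c₀)) := by
        have : θ * c₀ ≤ h * (2 * (n + 1)) := by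
          rw [div_lt_iff₀ hh] at hn2
          nlinarith [mul_nonneg hh.le (Nat.cast_nonneg n : (0 : ℝ) ≤ n)]
        have e4 : θ ≤ h * (2 * (n + 1)) / c₀ := by rwa [le_div_iff₀ hc]
        calc θ ^ (n + 1) * r = θ * (θ ^ n * r) := by ring
          _ ≤ h * (2 * (n + 1)) / c₀ * (θ ^ n * r) := by gcongr
          _ = _ := by ring
      calc _ ≤ 2 * (h * ((n + 1) * θ ^ n * (r / c₀ + 2 * r * M' * Fintype.card ι))
              + h * ((n + 1) * θ ^ n * (2 * r / c₀))) := by gcongr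
        _ = 2 * (r / c₀ + 2 * r * M' * Fintype.card ι + 2 * r / c₀) * h * ((n + 1) * θ ^ n) := by
            ring
        _ ≤ 2 * (r / c₀ + 2 * r * M' * Fintype.card ι + 2 * r / c₀) * h *
            (Real.exp 2 * Real.exp (-(θ * c₀) / h)) :=
            mul_le_mul_of_nonneg_left (e1.trans e2) (by positivity)
        _ = _ := by rw [hK]; ring
  have hexp : 0 ≤ h * Real.exp (-(θ * c₀) / h) := by positivity
  refine ⟨fun y hy => ?_, fun y γ hy0 hy h0 hγ => (hclose y γ hy0 hy h0 hγ).trans ?_,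
    fun y hy0 hy => ?_⟩
  · rw [← map_sub]
    refine (abs_eval_le (fun j => (norm_le_pi_norm y j).trans hy) _).trans
      ((A.pnorm_modHam_sub_le hh (by omega) ?_).trans ?_)
    · nlinarith
    · refine mul_le_mul_of_nonneg_right ?_ (by positivity)
      rw [hC]; linarith
  · rw [mul_assoc K, mul_assoc C]
    refine mul_le_mul_of_nonneg_right ?_ hexp
    rw [hC]; linarith
  -- The modified Hamiltonian is constant along its own flow line from the same point, so its change
  -- over a step is at most its Lipschitz constant times the distance of the end points.
  · obtain ⟨γ, h0, hγ⟩ := exists_isFlowLine hh hV0 hVb hVh hr0 hy0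
    have hγr := hγ.norm_le hV0 hVb (by rw [h0]; exact hy0) hVh
    have hmem : h ∈ Icc 0 h := right_mem_Icc.2 hh.le
    have e1 := abs_eval_sub_le (A.pnorm_pderiv_modHam_le hh hhρ1) (hy.bound h hmem) (hγr h hmem)
    rw [hγ.eval_eq poisson hh.le, h0] at e1
    refine e1.trans ?_
    have e2 := hclose y γ hy0 hy h0 hγ
    calc _ ≤ Fintype.card ι * (8 * M * (K * h * Real.exp (-(θ * c₀) / h))) := by gcongr
      _ = Fintype.card ι * (8 * M) * K * (h * Real.exp (-(θ * c₀) / h)) := by ring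
      _ ≤ C * (h * Real.exp (-(θ * c₀) / h)) := by
          refine mul_le_mul_of_nonneg_right ?_ hexp
          rw [hC]; linarith
      _ = _ := by ring

end PolyPoisson

/-! ### Algebra of the midpoint map for a linear map that is symmetric for a trace form. -/

namespace Midpoint

variable {A : Type*} [Ring A] [Algebra ℝ A]

/-- The map `z ↦ (1 + (h / 2) L z) z (1 - (h / 2) L z)`; an isospectral midpoint step leads from
`mid L h z` to `mid L (-h) z`. -/
def mid (L : A →ₗ[ℝ] A) (h : ℝ) (z : A) : A :=
  (1 + (h / 2) • L z) * z * (1 - (h / 2) • L z)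

/-- The derivative of `mid L h` at `z` in the direction `ζ`. -/
def dmid (L : A →ₗ[ℝ] A) (h : ℝ) (z ζ : A) : A :=
  ((h / 2) • L ζ) * z * (1 - (h / 2) • L z) + (1 + (h / 2) • L z) * ζ * (1 - (h / 2) • L z)
    - (1 + (h / 2) • L z) * z * ((h / 2) • L ζ)

/-- A small step at a bounded point is a step of size 1 near 0. This converts Taylor expansion in z
at the origin into expansion in the step size. -/
theorem mid_smul (L : A →ₗ[ℝ] A) (h c : ℝ) (z : A) : mid L h (c • z) = c • mid L (h * c) z := by
  simp only [mid, map_smul, smul_smul, mul_smul_comm, smul_mul_assoc]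
  rw [show h / 2 * c = h * c / 2 by ring]

theorem dmid_smul (L : A →ₗ[ℝ] A) (h c : ℝ) (z ζ : A) :
    dmid L h (c • z) (c • ζ) = c • dmid L (h * c) z ζ := by
  simp only [dmid, map_smul, smul_smul, mul_smul_comm, smul_mul_assoc, smul_add, smul_sub]
  rw [show h / 2 * c = h * c / 2 by ring, show h * c / 2 * c = c * (h * c / 2) by ring]

theorem mid_neg (L : A →ₗ[ℝ] A) (h : ℝ) (z : A) :
    mid L (-h) z = (1 - (h / 2) • L z) * z * (1 + (h / 2) • L z) := by
  simp only [mid, neg_div, neg_smul, sub_neg_eq_add, ← sub_eq_add_neg]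

theorem dmid_neg (L : A →ₗ[ℝ] A) (h : ℝ) (z ζ : A) :
    dmid L (-h) z ζ = -(((h / 2) • L ζ) * z * (1 + (h / 2) • L z))
      + (1 - (h / 2) • L z) * ζ * (1 + (h / 2) • L z)
      + (1 - (h / 2) • L z) * z * ((h / 2) • L ζ) := by
  simp only [dmid, neg_div, neg_smul, sub_neg_eq_add, ← sub_eq_add_neg, neg_mul, mul_neg]

theorem mid_neg_eq (L : A →ₗ[ℝ] A) (h : ℝ) (z : A) :
    mid L (-h) z = mid L h z + h • ⁅z, L z⁆ := by
  have : h • ⁅z, L z⁆ = (h / 2) • ⁅z, L z⁆ + (h / 2) • ⁅z, L z⁆ := by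
    rw [← add_smul, add_halves]
  rw [mid_neg, mid, this]
  simp only [Ring.lie_def, smul_sub, smul_add, mul_add, mul_sub, add_mul, sub_mul, one_mul, mul_one,
    smul_mul_assoc, mul_smul_comm]
  abel

omit [Algebra ℝ A] in
/-- The velocity of the end point of the step, for a fixed starting point, as the step size
grows. -/
theorem deriv_endpoint {u v ui vi z z' m : A} (hu : ui * u = 1) (hu' : u * ui = 1)
    (hv : vi * v = 1) (hv' : v * vi = 1) (huv : u * v = v * u) (h2 : u + v = 2)
    (hx : m * z * v + u * z' * v - u * z * m = 0) :
    -(m * z * u) + v * z' * u + v * z * m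
      = v * z * u * (2 * (ui * m * vi)) - 2 * (ui * m * vi) * (v * z * u) := by
  -- The starting point uzv is fixed, so its derivative vanishes; this determines z'. Substituted
  -- into the derivative of vzu, and with v u⁻¹ + 1 = 2u⁻¹ from u + v = 2, the terms combine into a
  -- commutator with 2u⁻¹mv⁻¹.
  have hz' : z' = z * m * vi - ui * m * z := by
    have : ui * (m * z * v + u * z' * v - u * z * m) * vi = 0 := by rw [hx]; simp
    simp only [mul_add, mul_sub, add_mul, sub_mul, ← mul_assoc, hu, one_mul] at this
    simp only [mul_assoc, hv', mul_one] at this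
    simp only [mul_assoc]
    rw [← sub_eq_zero, ← this]; abel
  have huiv : ui * v = v * ui := by
    calc ui * v = ui * (v * u) * ui := by rw [mul_assoc, mul_assoc, hu', mul_one]
      _ = v * ui := by rw [← huv, ← mul_assoc, hu, one_mul]
  have e1 : v * ui + 1 = 2 * ui := by rw [← h2, add_mul, hu', add_comm]
  have hviu : vi * u = u * vi := by
    calc vi * u = vi * (u * v) * vi := by rw [mul_assoc, mul_assoc, hv', mul_one]
      _ = u * vi := by rw [huv, ← mul_assoc, hv, one_mul]
  have e2 : vi * u + 1 = 2 * vi := by rw [hviu, ← h2, add_mul, hv']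
  have e3 : (2 : A) * (ui * m * vi) = 2 * ui * m * vi := by simp only [mul_assoc]
  have c2 : ∀ a : A, a * 2 = 2 * a := fun a => by rw [two_mul, mul_two]
  have e4 : v * z * u * (2 * (ui * m * vi)) = v * z * m * (2 * vi) := by
    calc v * z * u * (2 * (ui * m * vi)) = v * z * (u * (2 * ui)) * m * vi := by
          simp only [mul_assoc]
      _ = v * z * m * (2 * vi) := by
          rw [← c2 ui, ← mul_assoc u, hu', one_mul, ← c2 vi]
          simp only [mul_assoc]
          rw [← mul_assoc 2 m, ← c2 m, mul_assoc, c2 vi]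
  have e5 : 2 * (ui * m * vi) * (v * z * u) = 2 * ui * m * z * u := by
    calc 2 * (ui * m * vi) * (v * z * u) = 2 * ui * m * (vi * v) * z * u := by
          simp only [mul_assoc]
      _ = _ := by rw [hv, mul_one]
  rw [e4, e5, ← e1, ← e2, hz']
  simp only [mul_add, mul_sub, add_mul, sub_mul, ← mul_assoc, mul_one, one_mul]
  abel

section

variable (τ : A →ₗ[ℝ] ℝ) (hτ : ∀ a b, τ (a * b) = τ (b * a)) (L : A →ₗ[ℝ] A)
  (hL : ∀ a b, τ (L a * b) = τ (a * L b))
include hτ hL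

/-- The differential of the Hamiltonian at the stage, as a function of the end point. -/
theorem trace_dmid_endpoint {ui vi z z' ζ : A} {s : ℝ}
    (hu : ui * (1 + (s / 2) • L z) = 1) (hu' : (1 + (s / 2) • L z) * ui = 1)
    (hv : vi * (1 - (s / 2) • L z) = 1)
    (hv' : (1 - (s / 2) • L z) * vi = 1)
    (hx : ((1 / 2 : ℝ) • L z + (s / 2) • L z') * z * (1 - (s / 2) • L z)
      + (1 + (s / 2) • L z) * z' * (1 - (s / 2) • L z)
      - (1 + (s / 2) • L z) * z * ((1 / 2 : ℝ) • L z + (s / 2) • L z') = 0) :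
    τ (2 * (ui * ((1 / 2 : ℝ) • L z + (s / 2) • L z') * vi) * dmid L (-s) z ζ) = τ (L z * ζ) := by
  set m := (1 / 2 : ℝ) • L z + (s / 2) • L z' with hm
  rw [dmid_neg]
  set u := 1 + (s / 2) • L z with hudef
  set v := 1 - (s / 2) • L z with hvdef
  have hz' : z' = z * m * vi - ui * m * z := by
    have : ui * (m * z * v + u * z' * v - u * z * m) * vi = 0 := by rw [hx]; simp
    simp only [mul_add, mul_sub, add_mul, sub_mul, ← mul_assoc, hu, one_mul] at this
    simp only [mul_assoc, hv', mul_one] at this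
    simp only [mul_assoc]
    rw [← sub_eq_zero, ← this]; abel
  have two : ∀ a : A, 2 * a = (2 : ℝ) • a := fun a => by rw [two_mul, two_smul]
  have t1 : τ (ui * m * vi * (v * ζ * u)) = τ (m * ζ) := by
    calc _ = τ (ui * (m * (vi * v) * ζ * u)) := by simp only [mul_assoc]
      _ = τ (m * ζ) := by rw [hτ, hv, mul_one, mul_assoc (m * ζ), hu', mul_one]
  have t2 : τ (ui * m * vi * (L ζ * z * u)) = τ (L (z * m * vi) * ζ) := by
    calc _ = τ (ui * (m * vi * L ζ * z * u)) := by simp only [mul_assoc]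
      _ = τ (m * vi * L ζ * z) := by rw [hτ, mul_assoc (m * vi * L ζ * z), hu', mul_one]
      _ = τ (z * m * vi * L ζ) := by rw [hτ]; simp only [mul_assoc]
      _ = _ := (hL _ _).symm
  have t3 : τ (ui * m * vi * (v * z * L ζ)) = τ (L (ui * m * z) * ζ) := by
    calc _ = τ (ui * m * (vi * v) * z * L ζ) := by simp only [mul_assoc]
      _ = _ := by rw [hv, mul_one, hL]
  have t4 : τ (L z' * ζ) = τ (L (z * m * vi) * ζ) - τ (L (ui * m * z) * ζ) := by
    conv_lhs => rw [hz']
    rw [map_sub, sub_mul, map_sub]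
  have t5 : τ (m * ζ) = 1 / 2 * τ (L z * ζ) + s / 2 * τ (L z' * ζ) := by
    rw [hm, add_mul, map_add]; simp
  rw [two, smul_mul_assoc, map_smul, mul_add, mul_add, map_add, map_add, mul_neg, map_neg]
  simp only [smul_mul_assoc, mul_smul_comm, map_smul, smul_eq_mul]
  rw [t1, t2, t3, t5, t4]
  ring

/-- The midpoint step is a Poisson map: covectors that correspond to each other at the starting
point and at the end point have the same bracket. -/
theorem trace_bracket_eq {S : Set A} {h : ℝ} {z p q P Q : A}
    (hp : ∀ ζ ∈ S, τ (p * dmid L h z ζ) = τ (P * dmid L (-h) z ζ))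
    (hq : ∀ ζ ∈ S, τ (q * dmid L h z ζ) = τ (Q * dmid L (-h) z ζ))
    (hS : ∀ p ∈ S, ∀ P ∈ S, P * (1 - (h / 2) • L z) * z - z * (1 + (h / 2) • L z) * P
      - z * (1 - (h / 2) • L z) * p + p * (1 + (h / 2) • L z) * z ∈ S)
    (hpS : p ∈ S) (hqS : q ∈ S) (hPS : P ∈ S) (hQS : Q ∈ S) :
    τ (mid L h z * (p * q - q * p)) = τ (mid L (-h) z * (P * Q - Q * P)) := by
  -- The hypothesis in adjoint form: by cyclicity of τ the terms are sorted into those paired with ζ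
  -- and those paired with L ζ.
  have key : ∀ {p P : A}, (∀ ζ ∈ S, τ (p * dmid L h z ζ) = τ (P * dmid L (-h) z ζ)) →
      ∀ ζ ∈ S, τ (((1 - (h / 2) • L z) * p * (1 + (h / 2) • L z)
        - (1 + (h / 2) • L z) * P * (1 - (h / 2) • L z)) * ζ)
        = h / 2 * τ ((P * (1 - (h / 2) • L z) * z - z * (1 + (h / 2) • L z) * P
      - z * (1 - (h / 2) • L z) * p + p * (1 + (h / 2) • L z) * z) * L ζ) := by
    intro p P hp ζ hζ
    have := hp ζ hζ
    rw [dmid_neg, dmid] at this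
    set u := 1 + (h / 2) • L z
    set v := 1 - (h / 2) • L z
    simp only [mul_add, mul_sub, mul_neg, map_add, map_sub, map_neg, smul_mul_assoc,
      mul_smul_comm, map_smul, smul_eq_mul] at this
    simp only [sub_mul, add_mul, map_add, map_sub]
    have a1 : τ (p * (L ζ * z * v)) = τ (z * v * p * L ζ) := by
      calc _ = τ ((p * L ζ) * (z * v)) := by simp only [mul_assoc]
        _ = _ := by rw [hτ]; simp only [mul_assoc]
    have a2 : τ (p * (u * ζ * v)) = τ (v * p * u * ζ) := by
      calc _ = τ ((p * u * ζ) * v) := by simp only [mul_assoc]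
        _ = _ := by rw [hτ]; simp only [mul_assoc]
    have a3 : τ (P * (L ζ * z * u)) = τ (z * u * P * L ζ) := by
      calc _ = τ ((P * L ζ) * (z * u)) := by simp only [mul_assoc]
        _ = _ := by rw [hτ]; simp only [mul_assoc]
    have a4 : τ (P * (v * ζ * u)) = τ (u * P * v * ζ) := by
      calc _ = τ ((P * v * ζ) * u) := by simp only [mul_assoc]
        _ = _ := by rw [hτ]; simp only [mul_assoc]
    have a5 : τ (p * (u * z * L ζ)) = τ (p * u * z * L ζ) := by simp only [mul_assoc]
    have a6 : τ (P * (v * z * L ζ)) = τ (P * v * z * L ζ) := by simp only [mul_assoc]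
    rw [a1, a2, a3, a4, a5, a6] at this
    linarith
  -- The relation for (p, P) is tested with the element that the relation for (q, Q) attaches to L
  -- ζ, and conversely. By the symmetry of L the two right-hand sides agree, and the resulting
  -- equation of left-hand sides is the claim in disguise.
  have k1 := key hp _ (hS q hqS Q hQS)
  have k2 := key hq _ (hS p hpS P hPS)
  rw [← hL, hτ (L _)] at k1
  have hk := k1.trans k2.symm
  rw [mid_neg, mid]
  have h2 : (1 + (h / 2) • L z) + (1 - (h / 2) • L z) = 2 := by
    rw [add_add_sub_cancel, one_add_one_eq_two]
  set u := 1 + (h / 2) • L z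
  set v := 1 - (h / 2) • L z
  simp only [mul_add, mul_sub, sub_mul, map_add, map_sub] at hk
  -- The bracket terms pq and PQ carry nothing between the factors, whereas `hk` has u or v there.
  -- Inserting 2 = u + v makes them comparable; the rest is cyclic permutation.
  have two : ∀ a b c : A, τ (c * (a * 2 * b)) = 2 * τ (c * (a * b)) := fun a b c => by
    rw [mul_two, add_mul, mul_add, map_add, two_mul]
  have b1 := two p q (u * z * v)
  have b2 := two q p (u * z * v)
  have b3 := two P Q (v * z * u)
  have b4 := two Q P (v * z * u)
  rw [← h2] at b1 b2 b3 b4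
  simp only [mul_add, add_mul, map_add] at b1 b2 b3 b4
  have cyc : ∀ {a b c d : A}, a * b = c → b * a = d → τ c = τ d := by
    rintro a b c d rfl rfl; exact hτ _ _
  have c1 : τ (v * p * u * (z * v * q)) = τ (u * z * v * (q * v * p)) :=
    cyc (a := v * p) (b := u * z * v * q) (by simp only [mul_assoc]) (by simp only [mul_assoc])
  have c2 : τ (v * p * u * (q * u * z)) = τ (u * z * v * (p * u * q)) :=
    cyc (a := v * p * u * q) (b := u * z) (by simp only [mul_assoc]) (by simp only [mul_assoc])
  have c3 : τ (v * q * u * (z * v * p)) = τ (u * z * v * (p * v * q)) :=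
    cyc (a := v * q) (b := u * z * v * p) (by simp only [mul_assoc]) (by simp only [mul_assoc])
  have c4 : τ (v * q * u * (p * u * z)) = τ (u * z * v * (q * u * p)) :=
    cyc (a := v * q * u * p) (b := u * z) (by simp only [mul_assoc]) (by simp only [mul_assoc])
  have c5 : τ (u * P * v * (Q * v * z)) = τ (v * z * u * (P * v * Q)) :=
    cyc (a := u * P * v * Q) (b := v * z) (by simp only [mul_assoc]) (by simp only [mul_assoc])
  have c6 : τ (u * P * v * (z * u * Q)) = τ (v * z * u * (Q * u * P)) :=
    cyc (a := u * P) (b := v * z * u * Q) (by simp only [mul_assoc]) (by simp only [mul_assoc])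
  have c7 : τ (u * Q * v * (P * v * z)) = τ (v * z * u * (Q * v * P)) :=
    cyc (a := u * Q * v * P) (b := v * z) (by simp only [mul_assoc]) (by simp only [mul_assoc])
  have c8 : τ (u * Q * v * (z * u * P)) = τ (v * z * u * (P * u * Q)) :=
    cyc (a := u * Q) (b := v * z * u * P) (by simp only [mul_assoc]) (by simp only [mul_assoc])
  have d1 : τ (v * p * u * (Q * v * z)) = τ (u * Q * v * (z * v * p)) :=
    cyc (a := v * p) (b := u * Q * v * z) (by simp only [mul_assoc]) (by simp only [mul_assoc])
  have d2 : τ (v * p * u * (z * u * Q)) = τ (u * Q * v * (p * u * z)) :=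
    cyc (a := v * p * u * z) (b := u * Q) (by simp only [mul_assoc]) (by simp only [mul_assoc])
  have d3 : τ (u * P * v * (z * v * q)) = τ (v * q * u * (P * v * z)) :=
    cyc (a := u * P * v * z) (b := v * q) (by simp only [mul_assoc]) (by simp only [mul_assoc])
  have d4 : τ (u * P * v * (q * u * z)) = τ (v * q * u * (z * u * P)) :=
    cyc (a := u * P) (b := v * q * u * z) (by simp only [mul_assoc]) (by simp only [mul_assoc])
  rw [c1, c2, c3, c4, c5, c6, c7, c8, d1, d2, d3, d4] at hk
  simp only [mul_sub, map_sub]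
  linarith

end

end Midpoint

namespace Hazeltine

variable {N : ℕ}

/-! ### The Laplacian and its inverse -/

theorem conjTranspose_adMat_adMat {S : Mat N} (hS : Sᴴ = S) (A : Mat N) :
    (adMat S (adMat S A))ᴴ = adMat S (adMat S Aᴴ) := by
  simp only [adMat, LinearMap.sub_apply, LinearMap.mulLeft_apply, LinearMap.mulRight_apply,
    Matrix.conjTranspose_sub, Matrix.conjTranspose_mul, hS]
  noncomm_ring

theorem conjTranspose_lap (A : Mat N) : (lap N A)ᴴ = lap N Aᴴ := by
  simp only [lap, LinearMap.neg_apply, LinearMap.add_apply, LinearMap.comp_apply,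
    Matrix.conjTranspose_neg, Matrix.conjTranspose_add, conjTranspose_adMat_adMat (spin1_herm N),
    conjTranspose_adMat_adMat (spin2_herm N), conjTranspose_adMat_adMat (spin3_herm N)]

theorem trace_adMat_mul (S A B : Mat N) : (adMat S A * B).trace = -(A * adMat S B).trace := by
  simp only [adMat, LinearMap.sub_apply, LinearMap.mulLeft_apply, LinearMap.mulRight_apply,
    sub_mul, mul_sub, Matrix.trace_sub]
  rw [mul_assoc, Matrix.trace_mul_comm, mul_assoc, mul_assoc]
  ring

theorem trace_lap_mul (A B : Mat N) : (lap N A * B).trace = (A * lap N B).trace := by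
  simp only [lap, LinearMap.neg_apply, LinearMap.add_apply, LinearMap.comp_apply, neg_mul, mul_neg,
    add_mul, mul_add, Matrix.trace_neg, Matrix.trace_add, trace_adMat_mul, neg_neg]

theorem tracelessPart_apply (A : Mat N) :
    (tracelessPart N A : Mat N) = A - ((N : ℂ)⁻¹ * A.trace) • (1 : Mat N) := rfl

theorem trace_lapInv (A : Mat N) : (lapInv N A).trace = 0 :=
  LinearMap.mem_ker.1 ((lapEquiv N).symm (tracelessPart N A)).2

theorem lap_lapInv (A : Mat N) : lap N (lapInv N A) = tracelessPart N A :=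
  congrArg Subtype.val ((lapEquiv N).apply_symm_apply (tracelessPart N A))

theorem conjTranspose_lapInv (A : Mat N) : (lapInv N A)ᴴ = lapInv N Aᴴ := by
  rw [← sub_eq_zero]
  refine eq_zero_of_lap_eq_zero ?_ ?_
  · rw [map_sub, ← conjTranspose_lap, lap_lapInv, lap_lapInv, tracelessPart_apply,
      tracelessPart_apply, Matrix.conjTranspose_sub, Matrix.conjTranspose_smul,
      Matrix.conjTranspose_one, Matrix.trace_conjTranspose, star_mul']
    simp
  · rw [Matrix.trace_sub, Matrix.trace_conjTranspose, trace_lapInv, trace_lapInv, star_zero,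
      sub_zero]

theorem trace_lapInv_mul (A B : Mat N) : (lapInv N A * B).trace = (A * lapInv N B).trace := by
  have h1 : ∀ C D : Mat N, C.trace = 0 → (C * D).trace = (C * (tracelessPart N D : Mat N)).trace := by
    intro C D hC
    rw [tracelessPart_apply, mul_sub, Matrix.trace_sub, mul_smul_comm, mul_one, Matrix.trace_smul,
      hC, smul_zero, sub_zero]
  rw [h1 _ _ (trace_lapInv A), ← lap_lapInv, ← trace_lap_mul, lap_lapInv, Matrix.trace_mul_comm,
    Matrix.trace_mul_comm A, h1 _ A (trace_lapInv B)]

/-- `A` is skew-Hermitian. -/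
abbrev IsSkew (A : Mat N) : Prop := Aᴴ = -A

theorem IsSkew.lap {A : Mat N} (hA : IsSkew A) : IsSkew (lap N A) := by
  rw [IsSkew, conjTranspose_lap, hA, map_neg]

theorem IsSkew.lapInv {A : Mat N} (hA : IsSkew A) : IsSkew (lapInv N A) := by
  rw [IsSkew, conjTranspose_lapInv, hA, map_neg]

theorem IsSkew.add {A B : Mat N} (hA : IsSkew A) (hB : IsSkew B) : IsSkew (A + B) := by
  rw [IsSkew, Matrix.conjTranspose_add, hA, hB, neg_add]

theorem IsSkew.sub {A B : Mat N} (hA : IsSkew A) (hB : IsSkew B) : IsSkew (A - B) := by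
  rw [IsSkew, Matrix.conjTranspose_sub, hA, hB, neg_sub_neg, neg_sub]

theorem IsSkew.smul {A : Mat N} (hA : IsSkew A) (c : ℝ) : IsSkew (c • A) := by
  rw [IsSkew, Matrix.conjTranspose_smul, hA, star_trivial, smul_neg]

theorem IsSkew.lie {A B : Mat N} (hA : IsSkew A) (hB : IsSkew B) : IsSkew ⁅A, B⁆ := by
  rw [IsSkew, Ring.lie_def, Matrix.conjTranspose_sub, Matrix.conjTranspose_mul,
    Matrix.conjTranspose_mul, hA, hB]
  noncomm_ring

-- If Ax = -x, then x*Ax equals -x*x, and moving A to the other side it also equals x*x; so x = 0.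
-- Hence the Cayley transforms exist for every step size.
open scoped ComplexOrder in
theorem IsSkew.isUnit_one_add {A : Mat N} (hA : IsSkew A) : IsUnit (1 + A) := by
  rw [← Matrix.mulVec_injective_iff_isUnit]
  refine (injective_iff_map_eq_zero (Matrix.mulVecLin (1 + A))).2 fun x hx => ?_
  have h1 : A *ᵥ x = -x := by
    rw [Matrix.mulVecLin_apply, Matrix.add_mulVec, Matrix.one_mulVec] at hx
    rw [← sub_eq_zero, sub_neg_eq_add, add_comm]; exact hx
  have h2 : star x ⬝ᵥ (A *ᵥ x) = -(star x ⬝ᵥ x) := by rw [h1, dotProduct_neg]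
  have h3 : star x ⬝ᵥ (A *ᵥ x) = star x ⬝ᵥ x := by
    have : Aᴴ *ᵥ x = x := by rw [hA, Matrix.neg_mulVec, h1, neg_neg]
    rw [Matrix.dotProduct_mulVec]
    conv_lhs => rw [← Matrix.conjTranspose_conjTranspose A, ← Matrix.star_mulVec, this]
  have h4 : star x ⬝ᵥ x = 0 := by
    rw [h3] at h2
    exact self_eq_neg.1 h2
  exact dotProduct_star_self_eq_zero.1 h4


theorem IsSkew.isStarNormal {A : Mat N} (hA : IsSkew A) : IsStarNormal A :=
  ⟨by rw [Matrix.star_eq_conjTranspose, hA]; exact (Commute.refl A).neg_left⟩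

/-- Every function is continuous on a finite set, so the functional calculus applies to arbitrary K,
and the Casimirs need no regularity. -/
theorem continuousOn_spectrum (K : ℂ → ℂ) (A : Mat N) : ContinuousOn K (spectrum ℂ A) :=
  (Matrix.finite_spectrum A).continuousOn K

theorem cfc_conj {U : Mat N} (hU : U ∈ Matrix.unitaryGroup (Fin N) ℂ) {A : Mat N} (hA : IsSkew A)
    (K : ℂ → ℂ) : cfc K (U * A * Uᴴ) = U * cfc K A * Uᴴ := by
  have hA' : IsSkew (U * A * Uᴴ) := by
    rw [IsSkew, Matrix.conjTranspose_mul, Matrix.conjTranspose_mul, hA,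
      Matrix.conjTranspose_conjTranspose]
    noncomm_ring
  let φ := Unitary.conjStarAlgAut ℂ (Mat N) ⟨U, hU⟩
  have hφ : ∀ B, φ B = U * B * Uᴴ := fun B => rfl
  have hcont : Continuous φ := by
    have : (φ : Mat N → Mat N) = fun B => U * B * Uᴴ := funext hφ
    rw [this]; fun_prop
  have := StarAlgHomClass.map_cfc φ K A (continuousOn_spectrum K A) hcont hA.isStarNormal
    (by rw [hφ]; exact hA'.isStarNormal)
  rw [hφ, hφ] at this
  exact this.symm

theorem commute_cfc {A : Mat N} (hA : IsSkew A) (K : ℂ → ℂ) : Commute A (cfc K A) := by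
  exact (Commute.cfc (Commute.refl A) hA.isStarNormal.star_comm_self K).symm

/-! ### The scheme as an isospectral and a magnetic midpoint step -/

/-- Subtract the equations for χ from those for W. Since χt commutes with itself, M₃ may be replaced
by M₁ in the commutator, and the expansion of M₃ χt M₃ yields exactly the α-terms in the formula for
W. -/
theorem isStep_iff (α h : ℝ) (W Θ χ Wt Θt χt W₁ Θ₁ χ₁ : Mat N) :
    IsStep α h (W, Θ, χ) (Wt, Θt, χt) (W₁, Θ₁, χ₁) ↔ IsSkewTri (Wt, Θt, χt) ∧
      IsIsospectralMidpointStep h (lapInv N Wt) (W - χ) (Wt - χt) (W₁ - χ₁) ∧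
      IsMagneticMidpointStep h (lapInv N Wt - α • χt) (lap N Θt) Θ χ Θt χt Θ₁ χ₁ := by
  simp only [IsStep, IsStage, update, IsIsospectralMidpointStep, IsMagneticMidpointStep,
    Prod.mk.injEq]
  set M := lapInv N Wt
  set M₂ := lap N Θt
  have e1 : ⁅χt, M - α • χt⁆ = ⁅χt, M⁆ := by
    simp [Ring.lie_def, mul_sub, sub_mul]
  have e2 : (M - α • χt) * χt * (M - α • χt)
      = M * χt * M - α • (M * χt ^ 2) - α • (χt ^ 2 * M) + α ^ 2 • χt ^ 3 := by
    simp only [sub_mul, mul_sub, smul_mul_assoc, mul_smul_comm, smul_sub, smul_smul, pow_succ,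
      pow_zero, one_mul, mul_assoc]
    abel
  have e3 : ⁅Wt - χt, M⁆ = ⁅Wt, M⁆ - ⁅χt, M⁆ := by
    simp only [Ring.lie_def, sub_mul, mul_sub]; abel
  rw [e1, e2, e3]
  have e4 : M * (Wt - χt) * M = M * Wt * M - M * χt * M := by rw [mul_sub, sub_mul]
  rw [e4]
  generalize M * χt * M = B1
  generalize M * Wt * M = B2
  generalize α • (M * χt ^ 2) = B3
  generalize α • (χt ^ 2 * M) = B4
  generalize α ^ 2 • χt ^ 3 = B5
  generalize ⁅Wt, M⁆ = B6
  generalize ⁅χt, M⁆ = B7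
  generalize ⁅Θt, M₂⁆ = B8
  generalize M₂ * Θt * (M - α • χt) = B9
  generalize (M - α • χt) * Θt * M₂ = B10
  simp only [smul_add, smul_sub]
  constructor
  · rintro ⟨⟨hs, h1, h2, h3⟩, h4, h5, h6⟩
    refine ⟨hs, ⟨?_, ?_⟩, h1, h5, h3, h6⟩
    · rw [h2, h3]; abel
    · rw [h4, h6]; abel
  · rintro ⟨hs, ⟨h2, h4⟩, h1, h5, h3, h6⟩
    refine ⟨⟨hs, h1, ?_, h3⟩, ?_, h5, h6⟩
    · rw [← sub_add_cancel W χ, h2, h3]; abel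
    · rw [← sub_add_cancel W₁ χ₁, h4, h6]; abel

/-! ### The scheme preserves coadjoint orbits and Casimir functions -/

theorem isospectral_eq {h : ℝ} {M Ψ Ψt Ψ₁ : Mat N} (H : IsIsospectralMidpointStep h M Ψ Ψt Ψ₁) :
    Ψ = (1 + (h / 2) • M) * Ψt * (1 - (h / 2) • M) ∧
      Ψ₁ = (1 - (h / 2) • M) * Ψt * (1 + (h / 2) • M) := by
  obtain ⟨h1, h2⟩ := H
  have e1 : h • ⁅Ψt, M⁆ = (h / 2) • ⁅Ψt, M⁆ + (h / 2) • ⁅Ψt, M⁆ := by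
    rw [← add_smul, add_halves]
  have e2 : h ^ 2 / 4 = h / 2 * (h / 2) := by ring
  rw [h2, h1, e1, e2]
  simp only [Ring.lie_def, smul_sub, smul_add, mul_add, mul_sub, add_mul, sub_mul, one_mul, mul_one,
    smul_mul_assoc, mul_smul_comm, smul_smul]
  constructor <;> abel

/-- The formulas for χ are the ε-coefficients of the isospectral formulas with M + εM' and Θ + εχ in
place of M and Θ. -/
theorem magnetic_eq {h : ℝ} {M M' Θ χ Θt χt Θ₁ χ₁ : Mat N}
    (H : IsMagneticMidpointStep h M M' Θ χ Θt χt Θ₁ χ₁) :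
    Θ = (1 + (h / 2) • M) * Θt * (1 - (h / 2) • M) ∧
    Θ₁ = (1 - (h / 2) • M) * Θt * (1 + (h / 2) • M) ∧
    χ = (1 + (h / 2) • M) * χt * (1 - (h / 2) • M) + (h / 2) • M' * Θt * (1 - (h / 2) • M)
      - (1 + (h / 2) • M) * Θt * ((h / 2) • M') ∧
    χ₁ = (1 - (h / 2) • M) * χt * (1 + (h / 2) • M) - (h / 2) • M' * Θt * (1 + (h / 2) • M)
      + (1 - (h / 2) • M) * Θt * ((h / 2) • M') := by
  obtain ⟨h1, h2, h3, h4⟩ := H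
  obtain ⟨h5, h6⟩ := isospectral_eq ⟨h1, h2⟩
  refine ⟨h5, h6, ?_⟩
  have e1 : ∀ A : Mat N, h • A = (h / 2) • A + (h / 2) • A := fun A => by
    rw [← add_smul, add_halves]
  have e2 : h ^ 2 / 4 = h / 2 * (h / 2) := by ring
  rw [h4, h3, e1, e1, e2]
  simp only [Ring.lie_def, smul_sub, smul_add, mul_add, mul_sub, add_mul, sub_mul, one_mul, mul_one,
    smul_mul_assoc, mul_smul_comm, smul_smul]
  constructor <;> abel

theorem IsSkew.neg {A : Mat N} (hA : IsSkew A) : IsSkew (-A) := by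
  rw [IsSkew, Matrix.conjTranspose_neg, hA]

/-- The Cayley transform of a skew-Hermitian matrix conjugates the starting point of a step to its
end point. -/
theorem exists_conj {m m' : Mat N} (hm : IsSkew m) (hm' : IsSkew m') :
    ∃ U ∈ Matrix.unitaryGroup (Fin N) ℂ, ∃ k : Mat N, IsSkew k ∧ ∀ Θ χ : Mat N,
      (1 - m) * Θ * (1 + m) = U * ((1 + m) * Θ * (1 - m)) * Uᴴ ∧
      (1 - m) * χ * (1 + m) - m' * Θ * (1 + m) + (1 - m) * Θ * m'
        = U * ((1 + m) * χ * (1 - m) + m' * Θ * (1 - m) - (1 + m) * Θ * m') * Uᴴ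
          + ⁅k, (1 - m) * Θ * (1 + m)⁆ := by
  obtain ⟨⟨u, ui, hu, hu'⟩, hu0⟩ := hm.isUnit_one_add
  obtain ⟨⟨v, vi, hv, hv'⟩, hv0⟩ := hm.neg.isUnit_one_add
  simp only at hu0 hv0
  have hus : uᴴ = v := by
    rw [hu0, hv0, Matrix.conjTranspose_add, Matrix.conjTranspose_one, hm]
  have hvs : vᴴ = u := by rw [← hus, Matrix.conjTranspose_conjTranspose]
  have huis : uiᴴ = vi := by
    have : uiᴴ * v = 1 := by rw [← hus, ← Matrix.conjTranspose_mul, hu, Matrix.conjTranspose_one]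
    calc uiᴴ = uiᴴ * (v * vi) := by rw [hv, mul_one]
      _ = vi := by rw [← mul_assoc, this, one_mul]
  have hvis : viᴴ = ui := by rw [← huis, Matrix.conjTranspose_conjTranspose]
  have h2 : u + v = 2 := by rw [hu0, hv0, add_add_add_comm, add_neg_cancel, add_zero,
    one_add_one_eq_two]
  have huv : u * v = v * u := by rw [hu0, hv0]; noncomm_ring
  have huiv : ui * v = v * ui := by
    calc ui * v = ui * (v * u) * ui := by rw [mul_assoc, mul_assoc, hu, mul_one]
      _ = v * ui := by rw [← huv, ← mul_assoc, hu', one_mul]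
  have e1 : v * ui + 1 = 2 * ui := by rw [← h2, add_mul, hu, add_comm]
  have hviu : vi * u = u * vi := by
    calc vi * u = vi * (u * v) * vi := by rw [mul_assoc, mul_assoc, hv, mul_one]
      _ = u * vi := by rw [huv, ← mul_assoc, hv', one_mul]
  have e2 : vi * u + 1 = 2 * vi := by rw [hviu, ← h2, add_mul, hv]
  have hU : (v * ui)ᴴ = vi * u := by rw [Matrix.conjTranspose_mul, huis, hvs]
  rw [sub_eq_add_neg, ← hu0, ← hv0]
  -- With u = 1 + m and v = 1 - m, the second matrix is the logarithmic derivative of the Cayley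
  -- transform v u⁻¹ in the direction m', that is, its ε-part at m + εm'. It simplifies because v
  -- u⁻¹ + 1 = 2u⁻¹.
  refine ⟨v * ui, ?_, -(2 * (ui * m' * vi)), ?_, fun Θ χ => ⟨?_, ?_⟩⟩
  · rw [Matrix.mem_unitaryGroup_iff, Matrix.star_eq_conjTranspose, hU]
    calc v * ui * (vi * u) = v * ui * (u * vi) := by rw [hviu]
      _ = v * (ui * u) * vi := by simp only [mul_assoc]
      _ = 1 := by rw [hu', mul_one, hv]
  · refine IsSkew.neg ?_
    rw [two_mul]
    have : IsSkew (ui * m' * vi) := by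
      rw [IsSkew, Matrix.conjTranspose_mul, Matrix.conjTranspose_mul, hm', huis, hvis]
      noncomm_ring
    exact this.add this
  · rw [hU]
    calc v * Θ * u = v * (ui * u) * Θ * (v * vi) * u := by rw [hu', hv, mul_one, mul_one]
      _ = _ := by simp only [mul_assoc]
  · rw [hU, Ring.lie_def]
    have c2 : ∀ a : Mat N, a * 2 = 2 * a := fun a => by rw [two_mul, mul_two]
    have t1 : 2 * (ui * m' * vi) * (v * Θ * u) = (v * ui + 1) * m' * Θ * u := by
      calc 2 * (ui * m' * vi) * (v * Θ * u) = 2 * ui * m' * (vi * v) * Θ * u := by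
            simp only [mul_assoc]
        _ = _ := by rw [hv', mul_one, e1]
    have t2 : v * Θ * u * (2 * (ui * m' * vi)) = v * Θ * m' * (vi * u + 1) := by
      calc v * Θ * u * (2 * (ui * m' * vi)) = (v * Θ * u) * 2 * (ui * m' * vi) := by
            simp only [mul_assoc]
        _ = 2 * (v * Θ * (u * ui) * m' * vi) := by
            rw [c2]; simp only [mul_assoc]
        _ = v * Θ * m' * (2 * vi) := by
            rw [hu, mul_one, ← c2 vi, ← c2]; simp only [mul_assoc]
        _ = _ := by rw [e2]
    have t3 : v * ui * (u * χ * v + m' * Θ * v - u * Θ * m') * (vi * u)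
        = v * χ * u + v * ui * m' * Θ * u - v * Θ * m' * vi * u := by
      calc _ = v * (ui * u) * χ * (v * vi) * u + v * ui * m' * Θ * (v * vi) * u
            - v * (ui * u) * Θ * m' * vi * u := by noncomm_ring
        _ = _ := by rw [hu', hv]; simp only [mul_one]
    rw [t3, neg_mul, mul_neg, t1, t2]
    noncomm_ring

/-- A phase does not change conjugation, and the phase can be taken to be an N-th root of 1/det U.
-/
theorem exists_specialUnitary {U : Mat N} (hU : U ∈ Matrix.unitaryGroup (Fin N) ℂ) :
    ∃ V ∈ Matrix.specialUnitaryGroup (Fin N) ℂ, ∀ A : Mat N, V * A * Vᴴ = U * A * Uᴴ := by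
  rcases Nat.eq_zero_or_pos N with rfl | hN
  · exact ⟨U, Matrix.mem_specialUnitaryGroup_iff.2 ⟨hU, by simp⟩, fun _ => rfl⟩
  obtain ⟨c, hc⟩ := IsAlgClosed.exists_pow_nat_eq (U.det)⁻¹ hN
  have hdet : ‖U.det‖ = 1 := by
    have := Matrix.det_of_mem_unitary hU
    exact CStarRing.norm_of_mem_unitary this
  have hcn : ‖c‖ = 1 := by
    have : ‖c‖ ^ N = 1 := by rw [← norm_pow, hc, norm_inv, hdet, inv_one]
    exact (pow_eq_one_iff_of_nonneg (norm_nonneg c) hN.ne').1 this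
  have hcc : c * star c = 1 := by
    have := Complex.mul_conj c
    rw [Complex.normSq_eq_norm_sq, hcn] at this
    simpa using this
  have hconj : ∀ A : Mat N, c • U * A * (c • U)ᴴ = U * A * Uᴴ := fun A => by
    rw [Matrix.conjTranspose_smul, smul_mul_assoc, smul_mul_assoc, mul_smul_comm, smul_smul, hcc,
      one_smul]
  refine ⟨c • U, Matrix.mem_specialUnitaryGroup_iff.2 ⟨?_, ?_⟩, hconj⟩
  · rw [Matrix.mem_unitaryGroup_iff, Matrix.star_eq_conjTranspose]
    have := hconj 1
    rw [mul_one, mul_one] at this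
    rw [this]
    exact Matrix.mem_unitaryGroup_iff.1 hU
  · rw [Matrix.det_smul, Fintype.card_fin, hc, inv_mul_cancel₀]
    intro h0
    rw [h0, norm_zero] at hdet
    exact zero_ne_one hdet

theorem toTri_injective : Function.Injective (toTri (N := N)) := by
  rintro ⟨W, Θ, χ⟩ ⟨W', Θ', χ'⟩ h
  simp only [toTri, Prod.mk.injEq] at h
  exact Prod.ext (Subtype.ext h.1) (Prod.ext (Subtype.ext h.2.1) (Subtype.ext h.2.2))

theorem exists_su {k : Mat N} (hk : IsSkew k) : ∃ k' : su N, ∀ A : Mat N, ⁅(k' : Mat N), A⁆ = ⁅k, A⁆ := by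
  refine ⟨⟨tracelessPart N k, ?_, LinearMap.mem_ker.1 (tracelessPart N k).2⟩, fun A => ?_⟩
  · rw [tracelessPart_apply, Matrix.conjTranspose_sub, Matrix.conjTranspose_smul, hk,
      Matrix.conjTranspose_one, star_mul', ← Matrix.trace_conjTranspose, hk, Matrix.trace_neg]
    simp only [star_inv₀, star_natCast, mul_neg, neg_smul, sub_neg_eq_add, neg_sub]
    abel
  · rw [tracelessPart_apply]
    simp [Ring.lie_def, sub_mul, mul_sub]

theorem trace_lie (A B : Mat N) : ⁅A, B⁆.trace = 0 := by
  rw [Ring.lie_def, Matrix.trace_sub, Matrix.trace_mul_comm, sub_self]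

/-- A step adds commutators of skew-Hermitian matrices, which are skew-Hermitian and traceless even
if the stage is not traceless. The Cayley transforms of (h/2)M₁ and (h/2)M₃ carry out the coadjoint
action, and functional calculus commutes with conjugation. -/
theorem step_orbit {α h : ℝ} {x : State N} {xt y : Tri N} (H : IsStep α h (toTri x) xt y) :
    (∃ y' : State N, toTri y' = y ∧ SameCoadjointOrbit x y') ∧
      ∀ K F G : ℂ → ℂ,
        (cfc K (y.1 - y.2.2)).trace = (cfc K ((toTri x).1 - (toTri x).2.2)).trace ∧
        (cfc F y.2.1).trace = (cfc F (toTri x).2.1).trace ∧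
        (y.2.2 * cfc G y.2.1).trace = ((toTri x).2.2 * cfc G (toTri x).2.1).trace := by
  obtain ⟨W, Θ, χ⟩ := x
  obtain ⟨Wt, Θt, χt⟩ := xt
  obtain ⟨W₁, Θ₁, χ₁⟩ := y
  have Hu := H.2
  obtain ⟨⟨hW, hΘ, hχ⟩, h1, h2⟩ := (isStep_iff _ _ _ _ _ _ _ _ _ _ _).1 H
  simp only at hW hΘ hχ
  have hM : IsSkew (lapInv N Wt) := IsSkew.lapInv hW
  have hM2 : IsSkew (lap N Θt) := IsSkew.lap hΘ
  have hM3 : IsSkew (lapInv N Wt - α • χt) := hM.sub (IsSkew.smul hχ α)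
  simp only [update, toTri, Prod.mk.injEq] at Hu
  obtain ⟨y1, y2, y3⟩ := Hu
  have hy : ∃ y' : State N, toTri y' = (W₁, Θ₁, χ₁) := by
    refine ⟨(⟨W₁, ?_, ?_⟩, ⟨Θ₁, ?_, ?_⟩, ⟨χ₁, ?_, ?_⟩), rfl⟩
    · rw [y1]
      exact (IsSkew.add W.2.1 (IsSkew.smul (IsSkew.lie hW hM) h)).add
        (IsSkew.smul (IsSkew.lie hΘ hM2) h)
    · rw [y1, Matrix.trace_add, Matrix.trace_add, Matrix.trace_smul, Matrix.trace_smul, trace_lie,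
        trace_lie, W.2.2]
      simp
    · rw [y2]
      exact IsSkew.add Θ.2.1 (IsSkew.smul (IsSkew.lie hΘ hM3) h)
    · rw [y2, Matrix.trace_add, Matrix.trace_smul, trace_lie, Θ.2.2]
      simp
    · rw [y3]
      exact (IsSkew.add χ.2.1 (IsSkew.smul (IsSkew.lie hχ hM3) h)).add
        (IsSkew.smul (IsSkew.lie hΘ hM2) h)
    · rw [y3, Matrix.trace_add, Matrix.trace_add, Matrix.trace_smul, Matrix.trace_smul, trace_lie,
        trace_lie, χ.2.2]
      simp
  obtain ⟨y', hy'⟩ := hy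
  obtain ⟨e1, e2⟩ := isospectral_eq h1
  obtain ⟨e3, e4, e5, e6⟩ := magnetic_eq h2
  obtain ⟨U, hU, _, _, hU'⟩ := exists_conj (hM.smul (h / 2)) (hM2.smul (h / 2))
  obtain ⟨G, hG, k, hk, hG'⟩ := exists_conj (hM3.smul (h / 2)) (hM2.smul (h / 2))
  have f1 : W₁ - χ₁ = U * ((W : Mat N) - χ) * Uᴴ := by
    rw [e2, (hU' (Wt - χt) 0).1]; exact congrArg (fun a => U * a * Uᴴ) e1.symm
  have f2 : Θ₁ = G * (Θ : Mat N) * Gᴴ := by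
    rw [e4, (hG' Θt χt).1]; exact congrArg (fun a => G * a * Gᴴ) e3.symm
  have f3 : χ₁ = G * (χ : Mat N) * Gᴴ + ⁅k, Θ₁⁆ := by
    rw [e6, e4, (hG' Θt χt).2]
    exact congrArg (fun a => G * a * Gᴴ + _) e5.symm
  have hGG : Gᴴ * G = 1 := Matrix.mem_unitaryGroup_iff'.1 hG
  have hUU : Uᴴ * U = 1 := Matrix.mem_unitaryGroup_iff'.1 hU
  refine ⟨⟨y', hy', ?_⟩, fun K F P => ⟨?_, ?_, ?_⟩⟩
  · obtain ⟨U', hU1, hU2⟩ := exists_specialUnitary hU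
    obtain ⟨G', hG1, hG2⟩ := exists_specialUnitary hG
    obtain ⟨k', hk'⟩ := exists_su hk
    have hy'' := hy'
    simp only [toTri, Prod.mk.injEq] at hy''
    obtain ⟨z1, z2, z3⟩ := hy''
    refine ⟨U', hU1, G', hG1, k', ?_, ?_, ?_⟩
    · rw [hU2, Submodule.coe_sub, z1, z3, f1]; rfl
    · rw [hG2, z2, f2]
    · rw [hG2, hG2, z3, hk', f3, f2]
  · simp only [toTri]
    rw [f1, cfc_conj hU (IsSkew.sub W.2.1 χ.2.1), Matrix.trace_mul_comm, ← mul_assoc, hUU, one_mul]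
  · simp only [toTri]
    rw [f2, cfc_conj hG Θ.2.1, Matrix.trace_mul_comm, ← mul_assoc, hGG, one_mul]
  · simp only [toTri]
    have hΘ1 : IsSkew Θ₁ := by
      rw [toTri] at hy'
      have := y'.2.1.2.1
      simp only [Prod.mk.injEq] at hy'
      rwa [hy'.2.1] at this
    -- The translation part of the action does not affect the magnetic Casimir, because Θ₁ commutes
    -- with its functions.
    have g1 : (⁅k, Θ₁⁆ * cfc P Θ₁).trace = 0 := by
      have := commute_cfc hΘ1 P
      rw [Ring.lie_def, sub_mul, Matrix.trace_sub, mul_assoc, mul_assoc, this.eq,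
        Matrix.trace_mul_comm Θ₁, mul_assoc, sub_self]
    rw [f3, add_mul, Matrix.trace_add, g1, add_zero, f2, cfc_conj hG Θ.2.1]
    calc (G * (χ : Mat N) * Gᴴ * (G * cfc P (Θ : Mat N) * Gᴴ)).trace
        = (G * ((χ : Mat N) * (Gᴴ * G) * cfc P (Θ : Mat N) * Gᴴ)).trace := by
          simp only [mul_assoc]
      _ = _ := by
          rw [Matrix.trace_mul_comm, mul_assoc _ Gᴴ, hGG, mul_one, mul_one]

end Hazeltine

/-! ### The ambient algebra in which the scheme is one midpoint step. -/

namespace Hazeltine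

open Midpoint

variable {N : ℕ}

/-- The algebra `M_N(ℂ) × M_N(ℂ)[ε] / ε²`, in which the scheme is a single midpoint step. -/
def Amb (N : ℕ) : Type := Mat N × TrivSqZeroExt (Mat N) (Mat N)

instance : NormedRing (Amb N) := inferInstanceAs (NormedRing (Mat N × TrivSqZeroExt (Mat N) (Mat N)))

instance : NormedAlgebra ℝ (Amb N) :=
  inferInstanceAs (NormedAlgebra ℝ (Mat N × TrivSqZeroExt (Mat N) (Mat N)))

namespace Amb

/-- The component in the first factor. -/
def fst (a : Amb N) : Mat N := Prod.fst a

/-- The component without `ε` in the second factor. -/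
def re (a : Amb N) : Mat N := TrivSqZeroExt.fst (Prod.snd a)

/-- The coefficient of `ε` in the second factor. -/
def eps (a : Amb N) : Mat N := TrivSqZeroExt.snd (Prod.snd a)

/-- The element `(A, B + ε C)`. -/
def mk (A B C : Mat N) : Amb N := (A, (B, C))

@[simp] theorem fst_mk (A B C : Mat N) : (mk A B C).fst = A := rfl
@[simp] theorem re_mk (A B C : Mat N) : (mk A B C).re = B := rfl
@[simp] theorem eps_mk (A B C : Mat N) : (mk A B C).eps = C := rfl
@[simp] theorem fst_zero : (0 : Amb N).fst = 0 := rfl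
@[simp] theorem re_zero : (0 : Amb N).re = 0 := rfl
@[simp] theorem eps_zero : (0 : Amb N).eps = 0 := rfl
@[simp] theorem fst_one : (1 : Amb N).fst = 1 := rfl
@[simp] theorem re_one : (1 : Amb N).re = 1 := rfl
@[simp] theorem eps_one : (1 : Amb N).eps = 0 := rfl
@[simp] theorem fst_add (a b : Amb N) : (a + b).fst = a.fst + b.fst := rfl
@[simp] theorem re_add (a b : Amb N) : (a + b).re = a.re + b.re := rfl
@[simp] theorem eps_add (a b : Amb N) : (a + b).eps = a.eps + b.eps := rfl
@[simp] theorem fst_neg (a : Amb N) : (-a).fst = -a.fst := rfl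
@[simp] theorem re_neg (a : Amb N) : (-a).re = -a.re := rfl
@[simp] theorem eps_neg (a : Amb N) : (-a).eps = -a.eps := rfl
@[simp] theorem fst_sub (a b : Amb N) : (a - b).fst = a.fst - b.fst := rfl
@[simp] theorem re_sub (a b : Amb N) : (a - b).re = a.re - b.re := rfl
@[simp] theorem eps_sub (a b : Amb N) : (a - b).eps = a.eps - b.eps := rfl
@[simp] theorem fst_smul (c : ℝ) (a : Amb N) : (c • a).fst = c • a.fst := rfl
@[simp] theorem re_smul (c : ℝ) (a : Amb N) : (c • a).re = c • a.re := rfl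
@[simp] theorem eps_smul (c : ℝ) (a : Amb N) : (c • a).eps = c • a.eps := rfl
@[simp] theorem fst_mul (a b : Amb N) : (a * b).fst = a.fst * b.fst := rfl
@[simp] theorem re_mul (a b : Amb N) : (a * b).re = a.re * b.re := rfl
@[simp] theorem eps_mul (a b : Amb N) : (a * b).eps = a.re * b.eps + a.eps * b.re := rfl

theorem ext {a b : Amb N} (h1 : a.fst = b.fst) (h2 : a.re = b.re) (h3 : a.eps = b.eps) :
    a = b := Prod.ext h1 (TrivSqZeroExt.ext h2 h3)

end Amb

/-- The linear coordinates `(W - χ, Θ + ε χ)` of a triple `(W, Θ, χ)`. -/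
def toAmb (N : ℕ) : Tri N ≃ₗ[ℝ] Amb N where
  toFun x := Amb.mk (x.1 - x.2.2) x.2.1 x.2.2
  invFun a := (a.fst + a.eps, a.re, a.eps)
  map_add' x y := by
    refine Amb.ext ?_ ?_ ?_ <;> simp
    abel
  map_smul' c x := by
    refine Amb.ext ?_ ?_ ?_ <;> simp [smul_sub]
  left_inv x := by simp
  right_inv a := by
    refine Amb.ext ?_ ?_ ?_ <;> simp

@[simp] theorem toAmb_fst (x : Tri N) : (toAmb N x).fst = x.1 - x.2.2 := rfl
@[simp] theorem toAmb_re (x : Tri N) : (toAmb N x).re = x.2.1 := rfl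
@[simp] theorem toAmb_eps (x : Tri N) : (toAmb N x).eps = x.2.2 := rfl

instance : FiniteDimensional ℝ (Amb N) := (toAmb N).finiteDimensional

/-- The matrices `(M₁, M₃ + ε M₂)` as a function of the stage. -/
def genMap (N : ℕ) (α : ℝ) : Amb N →ₗ[ℝ] Amb N where
  toFun a := Amb.mk (lapInv N (a.fst + a.eps)) (lapInv N (a.fst + a.eps) - α • a.eps) (lap N a.re)
  map_add' a b := by
    refine Amb.ext ?_ ?_ ?_ <;> simp <;> abel
  map_smul' c a := by
    have h1 : ∀ A : Mat N, lapInv N (c • A) = c • lapInv N A := fun A =>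
      LinearMap.map_smul_of_tower _ c A
    have h2 : ∀ A : Mat N, lap N (c • A) = c • lap N A := fun A =>
      LinearMap.map_smul_of_tower _ c A
    refine Amb.ext ?_ ?_ ?_
    · simp only [Amb.fst_mk, Amb.fst_smul, Amb.eps_smul, ← smul_add, h1, RingHom.id_apply]
    · simp only [Amb.re_mk, Amb.re_smul, Amb.fst_smul, Amb.eps_smul, ← smul_add, h1,
        RingHom.id_apply, smul_sub, smul_comm α c]
    · simp [h2]

@[simp] theorem genMap_fst (α : ℝ) (a : Amb N) :
    (genMap N α a).fst = lapInv N (a.fst + a.eps) := rfl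
@[simp] theorem genMap_re (α : ℝ) (a : Amb N) :
    (genMap N α a).re = lapInv N (a.fst + a.eps) - α • a.eps := rfl
@[simp] theorem genMap_eps (α : ℝ) (a : Amb N) : (genMap N α a).eps = lap N a.re := rfl

/-- The trace form of `Amb N`. -/
def tau (N : ℕ) : Amb N →ₗ[ℝ] ℝ where
  toFun a := a.fst.trace.re + a.eps.trace.re
  map_add' a b := by simp [Matrix.trace_add]; ring
  map_smul' c a := by simp [Matrix.trace_smul]; ring

theorem tau_apply (a : Amb N) : tau N a = a.fst.trace.re + a.eps.trace.re := rfl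

theorem tau_mul_comm (a b : Amb N) : tau N (a * b) = tau N (b * a) := by
  rw [tau_apply, tau_apply, Amb.eps_mul, Amb.eps_mul, Amb.fst_mul, Amb.fst_mul,
    Matrix.trace_mul_comm, Matrix.trace_add, Matrix.trace_add, Matrix.trace_mul_comm a.re,
    Matrix.trace_mul_comm a.eps, add_comm (b.eps * a.re).trace]

/-- The form is tr Δ⁻¹(W)W' + tr Δ(Θ)Θ' - α tr χχ' in terms of triples, symmetric because Δ and Δ⁻¹
are. It is twice the polarized Hamiltonian. -/
theorem tau_genMap_mul (α : ℝ) (a b : Amb N) :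
    tau N (genMap N α a * b) = tau N (a * genMap N α b) := by
  rw [tau_apply, tau_apply, Amb.eps_mul, Amb.eps_mul, Amb.fst_mul, Amb.fst_mul,
    genMap_fst, genMap_fst, genMap_re, genMap_re, genMap_eps, genMap_eps]
  have h1 := trace_lapInv_mul (a.fst + a.eps) (b.fst + b.eps)
  have h2 := trace_lap_mul a.re b.re
  simp only [add_mul, mul_add, sub_mul, mul_sub, Matrix.trace_add, Matrix.trace_sub, map_add,
    smul_mul_assoc, mul_smul_comm] at h1 ⊢
  rw [h2]
  have h3 := congrArg Complex.re h1
  simp only [Complex.add_re, Complex.sub_re] at h3 ⊢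
  linarith

/-- The anti-automorphism of `Amb N` given by the conjugate transpose of the components. -/
def conj (a : Amb N) : Amb N := Amb.mk a.fstᴴ a.reᴴ a.epsᴴ

theorem conj_mul (a b : Amb N) : conj (a * b) = conj b * conj a := by
  refine Amb.ext ?_ ?_ ?_
  · simp [conj]
  · simp [conj]
  · simp [conj, add_comm]

theorem conj_add (a b : Amb N) : conj (a + b) = conj a + conj b := by
  refine Amb.ext ?_ ?_ ?_ <;> simp [conj]

theorem conj_neg (a : Amb N) : conj (-a) = -conj a := by
  refine Amb.ext ?_ ?_ ?_ <;> simp [conj]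

theorem conj_sub (a b : Amb N) : conj (a - b) = conj a - conj b := by
  rw [sub_eq_add_neg, conj_add, conj_neg, ← sub_eq_add_neg]

theorem conj_smul (c : ℝ) (a : Amb N) : conj (c • a) = c • conj a := by
  refine Amb.ext ?_ ?_ ?_ <;> simp [conj, Matrix.conjTranspose_smul]

theorem conj_one : conj (1 : Amb N) = 1 := by
  refine Amb.ext ?_ ?_ ?_ <;> simp [conj]

theorem conj_conj (a : Amb N) : conj (conj a) = a := by
  refine Amb.ext ?_ ?_ ?_ <;> simp [conj]

/-- The elements with skew-Hermitian components. -/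
def skew (N : ℕ) : Submodule ℝ (Amb N) where
  carrier := {a | conj a = -a}
  zero_mem' := by
    have := conj_smul (0 : ℝ) (0 : Amb N)
    simpa using this
  add_mem' {a b} ha hb := by
    change conj a = -a at ha
    change conj b = -b at hb
    change conj (a + b) = -(a + b)
    rw [conj_add, ha, hb, neg_add]
  smul_mem' c a ha := by
    change conj a = -a at ha
    change conj (c • a) = -(c • a)
    rw [conj_smul, ha, smul_neg]

theorem mem_skew {a : Amb N} : a ∈ skew N ↔ conj a = -a := Iff.rfl

theorem mem_skew_iff {a : Amb N} :
    a ∈ skew N ↔ IsSkew a.fst ∧ IsSkew a.re ∧ IsSkew a.eps := by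
  rw [mem_skew]
  constructor
  · intro h
    exact ⟨congrArg Amb.fst h, congrArg Amb.re h, congrArg Amb.eps h⟩
  · rintro ⟨h1, h2, h3⟩
    exact Amb.ext h1 h2 h3

theorem toAmb_mem_skew {x : Tri N} : toAmb N x ∈ skew N ↔ IsSkewTri x := by
  rw [mem_skew_iff, toAmb_fst, toAmb_re, toAmb_eps]
  constructor
  · rintro ⟨h1, h2, h3⟩
    refine ⟨?_, h2, h3⟩
    have := h1.add h3
    rwa [sub_add_cancel] at this
  · rintro ⟨h1, h2, h3⟩
    exact ⟨IsSkew.sub h1 h3, h2, h3⟩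

theorem genMap_mem_skew (α : ℝ) {a : Amb N} (ha : a ∈ skew N) : genMap N α a ∈ skew N := by
  rw [mem_skew_iff] at ha ⊢
  obtain ⟨h1, h2, h3⟩ := ha
  have h4 := (h1.add h3).lapInv
  exact ⟨h4, h4.sub (h3.smul α), h2.lap⟩

theorem isUnit_one_add {a : Amb N} (ha : a ∈ skew N) : IsUnit (1 + a) := by
  obtain ⟨h1, h2, -⟩ := mem_skew_iff.1 ha
  obtain ⟨⟨u, ui, hu, hu'⟩, hu0⟩ := h1.isUnit_one_add
  obtain ⟨⟨v, vi, hv, hv'⟩, hv0⟩ := h2.isUnit_one_add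
  simp only at hu0 hv0
  -- Since ε² = 0, the inverse of v + εa is v⁻¹ - ε v⁻¹av⁻¹.
  refine ⟨⟨1 + a, Amb.mk ui vi (-(vi * a.eps * vi)), ?_, ?_⟩, rfl⟩
  · refine Amb.ext ?_ ?_ ?_
    · simp [← hu0, hu]
    · simp [← hv0, hv]
    · simp only [Amb.eps_mul, Amb.re_add, Amb.re_one, Amb.eps_add, Amb.eps_one, Amb.eps_mk,
        Amb.re_mk, ← hv0, zero_add]
      rw [mul_neg, ← mul_assoc, ← mul_assoc, hv, one_mul, neg_add_cancel]
  · refine Amb.ext ?_ ?_ ?_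
    · simp [← hu0, hu']
    · simp [← hv0, hv']
    · simp only [Amb.eps_mul, Amb.re_add, Amb.re_one, Amb.eps_add, Amb.eps_one, Amb.eps_mk,
        Amb.re_mk, ← hv0, zero_add]
      rw [neg_mul, mul_assoc, hv', mul_one, add_neg_cancel]

theorem mid_fst (α h : ℝ) (z : Tri N) : (mid (genMap N α) h (toAmb N z)).fst
    = (1 + (h / 2) • lapInv N z.1) * (z.1 - z.2.2) * (1 - (h / 2) • lapInv N z.1) := by
  simp [mid]

theorem mid_re (α h : ℝ) (z : Tri N) : (mid (genMap N α) h (toAmb N z)).re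
    = (1 + (h / 2) • (lapInv N z.1 - α • z.2.2)) * z.2.1
      * (1 - (h / 2) • (lapInv N z.1 - α • z.2.2)) := by
  simp only [mid, Amb.re_mul, Amb.re_add, Amb.re_sub, Amb.re_smul, Amb.re_one, genMap_re, toAmb_re,
    toAmb_fst, toAmb_eps, sub_add_cancel]

theorem mid_eps (α h : ℝ) (z : Tri N) : (mid (genMap N α) h (toAmb N z)).eps
    = (1 + (h / 2) • (lapInv N z.1 - α • z.2.2)) * z.2.2
        * (1 - (h / 2) • (lapInv N z.1 - α • z.2.2))
      + (h / 2) • lap N z.2.1 * z.2.1 * (1 - (h / 2) • (lapInv N z.1 - α • z.2.2))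
      - (1 + (h / 2) • (lapInv N z.1 - α • z.2.2)) * z.2.1 * ((h / 2) • lap N z.2.1) := by
  simp only [mid, Amb.re_mul, Amb.eps_mul, Amb.re_sub, Amb.re_smul, Amb.re_one,
    Amb.eps_add, Amb.eps_sub, Amb.eps_smul, Amb.eps_one, genMap_re, genMap_eps, toAmb_re,
    toAmb_fst, toAmb_eps, sub_add_cancel, zero_sub, mul_neg, add_mul, zero_mul]
  abel

theorem isStage_iff {α h : ℝ} {x xt : Tri N} :
    IsStage α h x xt ↔ IsSkewTri xt ∧ toAmb N x = mid (genMap N α) h (toAmb N xt) := by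
  obtain ⟨W, Θ, χ⟩ := x
  obtain ⟨Wt, Θt, χt⟩ := xt
  have h0 := isStep_iff α h W Θ χ Wt Θt χt (update α h (W, Θ, χ) (Wt, Θt, χt)).1
    (update α h (W, Θ, χ) (Wt, Θt, χt)).2.1 (update α h (W, Θ, χ) (Wt, Θt, χt)).2.2
  constructor
  · intro H
    obtain ⟨hs, h1, h2⟩ := h0.1 ⟨H, rfl⟩
    refine ⟨hs, Amb.ext ?_ ?_ ?_⟩
    · rw [mid_fst]; exact (isospectral_eq h1).1
    · rw [mid_re, toAmb_re]; exact (magnetic_eq h2).1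
    · rw [mid_eps, toAmb_eps]; exact (magnetic_eq h2).2.2.1
  · rintro ⟨hs, H⟩
    have k1 := congrArg Amb.fst H
    have k2 := congrArg Amb.re H
    have k3 := congrArg Amb.eps H
    simp only [mid_fst, mid_re, mid_eps, toAmb_eps, toAmb_re, toAmb_fst]
      at k1 k2 k3
    have e2 : h ^ 2 / 4 = h / 2 * (h / 2) := by ring
    refine (h0.2 ⟨hs, ⟨?_, ?_⟩, ?_, rfl, ?_, rfl⟩).1
    · rw [k1, e2]
      simp only [Ring.lie_def, smul_sub, smul_add, mul_sub, add_mul, sub_mul, one_mul, mul_one,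
        smul_mul_assoc, mul_smul_comm, smul_smul]
      abel
    · simp only [update, Ring.lie_def, smul_sub, mul_sub, sub_mul, smul_mul_assoc,
        mul_smul_comm]
      abel
    · rw [k2, e2]
      generalize lapInv N Wt - α • χt = M₃
      simp only [Ring.lie_def, smul_sub, smul_add, mul_sub, add_mul, one_mul, mul_one,
        smul_mul_assoc, mul_smul_comm, smul_smul]
      abel
    · rw [k3, e2]
      generalize lapInv N Wt - α • χt = M₃
      simp only [Ring.lie_def, smul_sub, smul_add, mul_sub, add_mul, one_mul,
        mul_one, smul_mul_assoc, mul_smul_comm, smul_smul]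
      abel

/-- The Lax form of the equations: the ε-part of the commutator of Θ + εχ and M₃ + εM₂ is [χ, M₃] +
[Θ, M₂], and [χ, M₃] = [χ, M₁]. -/
theorem toAmb_hazField (α : ℝ) (z : Tri N) :
    toAmb N (hazField α z) = ⁅toAmb N z, genMap N α (toAmb N z)⁆ := by
  obtain ⟨W, Θ, χ⟩ := z
  rw [Ring.lie_def]
  refine Amb.ext ?_ ?_ ?_
  · rw [Amb.fst_sub, Amb.fst_mul, Amb.fst_mul, genMap_fst, toAmb_fst, toAmb_fst, toAmb_eps,
      sub_add_cancel]
    simp only [hazField, Ring.lie_def, sub_mul, mul_sub]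
    abel
  · rw [Amb.re_sub, Amb.re_mul, Amb.re_mul, genMap_re,
      toAmb_re, toAmb_re, toAmb_fst, toAmb_eps, sub_add_cancel]
    simp only [hazField, Ring.lie_def, sub_mul, mul_sub, smul_mul_assoc, mul_smul_comm, smul_sub]
    abel
  · rw [Amb.eps_sub, Amb.eps_mul, Amb.eps_mul, genMap_re,
      genMap_eps,
      toAmb_re, toAmb_fst, toAmb_eps, toAmb_eps, sub_add_cancel]
    simp only [hazField, Ring.lie_def, sub_mul, mul_sub, smul_mul_assoc, mul_smul_comm]
    abel

theorem toAmb_update (α h : ℝ) (x z : Tri N) :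
    toAmb N (update α h x z) = toAmb N x + h • ⁅toAmb N z, genMap N α (toAmb N z)⁆ := by
  rw [← toAmb_hazField, ← map_smul, ← map_add]
  congr 1
  obtain ⟨W, Θ, χ⟩ := z
  obtain ⟨W', Θ', χ'⟩ := x
  simp only [update, hazField, Prod.smul_mk, Prod.mk_add_mk, smul_add, Ring.lie_def, smul_sub,
    mul_sub, sub_mul, smul_mul_assoc, mul_smul_comm, Prod.mk.injEq]
  refine ⟨?_, ?_, ?_⟩ <;> abel

theorem isStep_iff_mid {α h : ℝ} {x xt y : Tri N} :
    IsStep α h x xt y ↔ IsSkewTri xt ∧ toAmb N x = mid (genMap N α) h (toAmb N xt) ∧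
      toAmb N y = mid (genMap N α) (-h) (toAmb N xt) := by
  rw [IsStep, isStage_iff, and_assoc]
  refine and_congr_right fun _ => and_congr_right fun h1 => ?_
  rw [mid_neg_eq, ← h1, ← toAmb_update, (toAmb N).injective.eq_iff]

/-- `toAmb` as a continuous linear equivalence. -/
def toAmbL (N : ℕ) : Tri N ≃L[ℝ] Amb N := (toAmb N).toContinuousLinearEquiv

theorem toAmbL_apply (x : Tri N) : toAmbL N x = toAmb N x := rfl

theorem toAmbL_symm_apply (a : Amb N) : (toAmbL N).symm a = (toAmb N).symm a := rfl

attribute [irreducible] genMap toAmb toAmbL tau conj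

end Hazeltine

namespace Hazeltine

open Midpoint

variable {N : ℕ}

/-! ### The Lie–Poisson structure in the ambient algebra -/

/-- The element of the ambient algebra given by an element of the Lie algebra. -/
def hat (p : Alg N) : Amb N := Amb.mk p.1 p.2.1 p.2.2

@[simp] theorem hat_fst (p : Alg N) : (hat p).fst = p.1 := rfl
@[simp] theorem hat_re (p : Alg N) : (hat p).re = p.2.1 := rfl
@[simp] theorem hat_eps (p : Alg N) : (hat p).eps = p.2.2 := rfl

attribute [irreducible] hat

/-- `toTri` as a linear map. -/
def toTriL (N : ℕ) : State N →ₗ[ℝ] Tri N where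
  toFun := toTri
  map_add' _ _ := rfl
  map_smul' _ _ := rfl

theorem norm_toTri (x : State N) : ‖toTri x‖ = ‖x‖ := rfl

/-- A state as an element of the ambient algebra. -/
def emb (N : ℕ) : State N →L[ℝ] Amb N :=
  LinearMap.toContinuousLinearMap ((toAmb N).toLinearMap ∘ₗ toTriL N)

theorem emb_apply (x : State N) : emb N x = toAmb N (toTri x) := rfl

@[simp] theorem emb_fst (x : State N) : (emb N x).fst = (x.1 : Mat N) - x.2.2 := toAmb_fst _
@[simp] theorem emb_re (x : State N) : (emb N x).re = x.2.1 := toAmb_re _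
@[simp] theorem emb_eps (x : State N) : (emb N x).eps = x.2.2 := toAmb_eps _

attribute [irreducible] emb

theorem emb_injective : Function.Injective (emb N) := fun _ _ h =>
  toTri_injective ((toAmb N).injective (by rwa [← emb_apply, ← emb_apply]))

theorem emb_mem_skew (x : State N) : emb N x ∈ skew N := by
  rw [emb_apply]
  exact toAmb_mem_skew.2 ⟨x.1.2.1, x.2.1.2.1, x.2.2.2.1⟩

theorem hat_mem_skew (p : Alg N) : hat p ∈ skew N :=
  mem_skew_iff.2 (by simpa using ⟨p.1.2.1, p.2.1.2.1, p.2.2.2.1⟩)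

theorem frob_eq (A B : su N) : frob N A B = -((A : Mat N) * (B : Mat N)).trace.re := by
  have : frob N A B = ((A : Mat N)ᴴ * (B : Mat N)).trace.re := rfl
  rw [this, A.2.1]
  simp

theorem pairing_eq (p : Alg N) (x : State N) : pairing N p x = -tau N (hat p * emb N x) := by
  have : pairing N p x = frob N p.1 (x.1 - x.2.2) + frob N p.2.1 x.2.2 + frob N p.2.2 x.2.1 := rfl
  rw [this, frob_eq, frob_eq, frob_eq, tau_apply]
  simp only [Amb.fst_mul, Amb.eps_mul, hat_fst, hat_re, hat_eps, emb_fst, emb_re, emb_eps,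
    Submodule.coe_sub, Matrix.trace_add, Complex.add_re]
  ring

theorem hat_algBracket (p q : Alg N) : hat (algBracket p q) = ⁅hat p, hat q⁆ := by
  refine Amb.ext ?_ ?_ ?_
  · simp [algBracket, suBracket, Ring.lie_def]
  · simp [algBracket, suBracket, Ring.lie_def]
  · simp [algBracket, suBracket, Ring.lie_def]
    abel

theorem emb_coad (p : Alg N) (x : State N) : emb N (coad p x) = ⁅emb N x, hat p⁆ := by
  refine Amb.ext ?_ ?_ ?_
  · simp [coad, suBracket, Ring.lie_def]
  · simp [coad, suBracket, Ring.lie_def]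
  · simp [coad, suBracket, Ring.lie_def]
    abel

theorem algBracket_swap (p q : Alg N) : algBracket p q = -algBracket q p := by
  refine Prod.ext (Subtype.ext ?_) (Prod.ext (Subtype.ext ?_) (Subtype.ext ?_))
  · simp [algBracket, suBracket, Ring.lie_def]
  · simp [algBracket, suBracket, Ring.lie_def]
  · simp [algBracket, suBracket, Ring.lie_def]

theorem trace_tracelessPart_mul (A : Mat N) {B : Mat N} (hB : B.trace = 0) :
    ((tracelessPart N A : Mat N) * B).trace = (A * B).trace := by
  rw [tracelessPart_apply, sub_mul, Matrix.trace_sub, smul_mul_assoc, one_mul, Matrix.trace_smul,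
    hB, smul_zero, sub_zero]

theorem IsSkew.tracelessPart_mem {A : Mat N} (hA : IsSkew A) : (tracelessPart N A : Mat N) ∈ su N := by
  refine ⟨?_, LinearMap.mem_ker.1 (tracelessPart N A).2⟩
  rw [tracelessPart_apply, Matrix.conjTranspose_sub, Matrix.conjTranspose_smul, hA,
    Matrix.conjTranspose_one, star_mul', ← Matrix.trace_conjTranspose, hA, Matrix.trace_neg]
  simp only [star_inv₀, star_natCast, mul_neg, neg_smul, sub_neg_eq_add, neg_sub]
  abel

theorem tracelessPart_mul_sub (A B : Mat N) :
    (tracelessPart N A : Mat N) * B - B * (tracelessPart N A : Mat N) = A * B - B * A := by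
  rw [tracelessPart_apply]
  simp [sub_mul, mul_sub]

/-- The Lie algebra element that a skew-Hermitian element represents. -/
theorem exists_hat {a : Amb N} (ha : a ∈ skew N) :
    ∃ p : Alg N, (∀ b : Amb N, ⁅hat p, b⁆ = ⁅a, b⁆) ∧ ∀ x, pairing N p x = -tau N (a * emb N x) := by
  obtain ⟨h1, h2, h3⟩ := mem_skew_iff.1 ha
  refine ⟨(⟨_, h1.tracelessPart_mem⟩, ⟨_, h2.tracelessPart_mem⟩, ⟨_, h3.tracelessPart_mem⟩),
    fun b => ?_, fun x => ?_⟩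
  · refine Amb.ext ?_ ?_ ?_
    · simp only [Ring.lie_def, Amb.fst_sub, Amb.fst_mul, hat_fst, tracelessPart_mul_sub]
    · simp only [Ring.lie_def, Amb.re_sub, Amb.re_mul, hat_re, tracelessPart_mul_sub]
    · simp only [Ring.lie_def, Amb.eps_sub, Amb.eps_mul, hat_re, hat_eps]
      have e1 := tracelessPart_mul_sub a.re b.eps
      have e2 := tracelessPart_mul_sub a.eps b.re
      rw [sub_eq_iff_eq_add] at e1 e2
      rw [e1, e2]; abel
  · rw [pairing_eq, tau_apply, tau_apply]
    simp only [Amb.fst_mul, Amb.eps_mul, hat_fst, hat_re, hat_eps, Matrix.trace_add]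
    rw [trace_tracelessPart_mul, trace_tracelessPart_mul, trace_tracelessPart_mul]
    · rw [emb_re, x.2.1.2.2]
    · rw [emb_eps, x.2.2.2.2]
    · rw [emb_fst, Matrix.trace_sub, x.1.2.2, x.2.2.2.2, sub_zero]

theorem pairing_left_injective {p q : Alg N} (h : ∀ x, pairing N p x = pairing N q x) : p = q := by
  have := (pairing_nondegenerate N).1 (p - q) (fun x => by
    rw [map_sub, LinearMap.sub_apply, h, sub_self])
  exact sub_eq_zero.1 this

theorem pairing_grad (F : State N → ℝ) (x δ : State N) :
    pairing N (grad F x) δ = fderiv ℝ F x δ := by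
  rw [grad]
  exact LinearMap.BilinForm.apply_toDual_symm_apply (hB := pairing_nondegenerate N) _ _

theorem grad_eq {F : State N → ℝ} {x : State N} {p : Alg N}
    (h : ∀ δ, fderiv ℝ F x δ = pairing N p δ) : grad F x = p :=
  pairing_left_injective fun δ => by rw [pairing_grad, h]

theorem lie_hat_grad {F : State N → ℝ} {x : State N} {a : Amb N} (ha : a ∈ skew N)
    (h : ∀ δ, fderiv ℝ F x δ = -tau N (a * emb N δ)) (b : Amb N) :
    ⁅hat (grad F x), b⁆ = ⁅a, b⁆ := by
  obtain ⟨p, h1, h2⟩ := exists_hat ha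
  rw [grad_eq (p := p) fun δ => by rw [h, h2], h1]

/-- The Hamiltonian vector field of a function. -/
def hamVec (F : State N → ℝ) (x : State N) : State N := -coad (grad F x) x

theorem lpBracket_eq (F G : State N → ℝ) (x : State N) :
    lpBracket F G x = fderiv ℝ F x (hamVec G x) := by
  rw [← pairing_grad, hamVec, map_neg, pairing_coad, lpBracket, algBracket_swap, map_neg]
  rfl

theorem lie_swap {A : Type*} [Ring A] (a b : A) : -⁅a, b⁆ = ⁅b, a⁆ := by
  rw [Ring.lie_def, Ring.lie_def, neg_sub]

theorem emb_hamVec {F : State N → ℝ} {x : State N} {a : Amb N} (ha : a ∈ skew N)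
    (h : ∀ δ, fderiv ℝ F x δ = tau N (a * emb N δ)) :
    emb N (hamVec F x) = ⁅emb N x, a⁆ := by
  have h' : ∀ δ, fderiv ℝ F x δ = -tau N (-a * emb N δ) := fun δ => by
    rw [h, neg_mul, map_neg, neg_neg]
  rw [hamVec, map_neg, emb_coad, lie_swap, lie_hat_grad (Submodule.neg_mem _ ha) h']
  simp only [Ring.lie_def, neg_mul, mul_neg, sub_neg_eq_add]
  abel

/-- Linear coordinates of the phase space. -/
def coords (N : ℕ) : State N ≃L[ℝ] (Fin (Module.finrank ℝ (State N)) → ℝ) :=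
  (Module.finBasis ℝ (State N)).equivFunL

/-- Testing with linear coordinates recovers the differential equation for the Hamiltonian vector
field; the chain rule gives all other observables. -/
theorem isHamiltonianSolutionOn_iff {H : State N → ℝ} {γ : ℝ → State N} {s : Set ℝ} :
    IsHamiltonianSolutionOn H γ s ↔
      ∀ t ∈ s, HasDerivWithinAt γ (hamVec H (γ t)) s t := by
  constructor
  · intro h t ht
    have h1 : HasDerivWithinAt (fun r => coords N (γ r)) (coords N (hamVec H (γ t))) s t := by
      refine hasDerivWithinAt_pi.2 fun i => ?_
      let ℓ : State N →L[ℝ] ℝ :=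
        (ContinuousLinearMap.proj i).comp (coords N).toContinuousLinearMap
      refine (h ℓ ℓ.contDiff t ht).congr_deriv ?_
      rw [lpBracket_eq, ℓ.fderiv]
      rfl
    have h2 := (coords N).symm.toContinuousLinearMap.hasFDerivAt.comp_hasDerivWithinAt t h1
    simpa [Function.comp_def] using h2
  · intro h F hF t ht
    rw [lpBracket_eq]
    exact ((hF.differentiable (by simp)).differentiableAt.hasFDerivAt).comp_hasDerivWithinAt t (h t ht)

/-! ### The quantized Hazeltine equations as a Hamiltonian system -/

theorem ham_eq (α : ℝ) (x : State N) :
    ham α x = 1 / 2 * tau N (genMap N α (emb N x) * emb N x) := by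
  rw [ham, tau_apply]
  congr 1
  simp only [Amb.fst_mul, Amb.eps_mul, genMap_fst, genMap_re, genMap_eps, emb_fst, emb_re, emb_eps,
    sub_add_cancel, Matrix.trace_add, Matrix.trace_sub, mul_sub, sub_mul, smul_mul_assoc, pow_two]
  rw [Matrix.trace_mul_comm (x.1 : Mat N), Matrix.trace_mul_comm (x.2.1 : Mat N)]
  simp only [Complex.add_re, Complex.sub_re]
  ring

theorem hasFDerivAt_quadratic {A : Type*} [NormedRing A] [NormedAlgebra ℝ A]
    [FiniteDimensional ℝ A] (τ : A →ₗ[ℝ] ℝ) (hτ : ∀ a b, τ (a * b) = τ (b * a)) (L : A →ₗ[ℝ] A)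
    (hL : ∀ a b, τ (L a * b) = τ (a * L b)) (z : A) :
    HasFDerivAt (fun z => 1 / 2 * τ (L z * z))
      (LinearMap.toContinuousLinearMap (τ ∘ₗ LinearMap.mulLeft ℝ (L z))) z := by
  let τc := LinearMap.toContinuousLinearMap τ
  let Lc := LinearMap.toContinuousLinearMap L
  have h1 : HasFDerivAt (fun z => Lc z * z) _ z := Lc.hasFDerivAt.mul' (hasFDerivAt_id z)
  have h2 := (τc.hasFDerivAt.comp z h1).const_mul (1 / 2)
  refine h2.congr_fderiv ?_
  ext ζ
  simp only [_root_.smul_apply, ContinuousLinearMap.comp_apply,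
    _root_.add_apply, smul_eq_mul, map_add, ContinuousLinearMap.id_apply,
    LinearMap.coe_toContinuousLinearMap', LinearMap.comp_apply, LinearMap.mulLeft_apply,
    MulOpposite.smul_eq_mul_unop, MulOpposite.unop_op, τc, Lc]
  rw [hL ζ z, hτ ζ]
  ring

theorem fderiv_ham (α : ℝ) (x δ : State N) :
    fderiv ℝ (ham α) x δ = tau N (genMap N α (emb N x) * emb N δ) := by
  have h := (hasFDerivAt_quadratic (tau N) tau_mul_comm (genMap N α) (tau_genMap_mul α)
    (emb N x)).comp x (emb N).hasFDerivAt
  have e : ham α = (fun z => 1 / 2 * tau N (genMap N α z * z)) ∘ emb N := funext (ham_eq α)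
  rw [e, h.fderiv]
  simp

theorem emb_hamVec_ham (α : ℝ) (x : State N) :
    emb N (hamVec (ham α) x) = ⁅emb N x, genMap N α (emb N x)⁆ :=
  emb_hamVec (genMap_mem_skew α (emb_mem_skew x)) (fderiv_ham α x)

theorem toTri_hamVec_ham (α : ℝ) (x : State N) :
    toTri (hamVec (ham α) x) = hazField α (toTri x) := by
  apply (toAmb N).injective
  rw [toAmb_hazField, ← emb_apply, ← emb_apply, emb_hamVec_ham]

theorem hasDerivWithinAt_emb_iff {γ : ℝ → State N} {δ : State N} {s : Set ℝ} {t : ℝ} :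
    HasDerivWithinAt (fun r => emb N (γ r)) (emb N δ) s t ↔ HasDerivWithinAt γ δ s t := by
  constructor
  · intro h
    obtain ⟨g, hg⟩ := (emb N).toLinearMap.exists_leftInverse_of_injective
      (LinearMap.ker_eq_bot.2 emb_injective)
    have h2 := (LinearMap.toContinuousLinearMap g).hasFDerivAt.comp_hasDerivWithinAt t h
    have e : ∀ x, g (emb N x) = x := fun x => LinearMap.congr_fun hg x
    simpa [Function.comp_def, e] using h2
  · intro h
    exact (emb N).hasFDerivAt.comp_hasDerivWithinAt t h

theorem isSolutionOn_iff {α : ℝ} {γ : ℝ → State N} {s : Set ℝ} :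
    IsSolutionOn α γ s ↔ IsHamiltonianSolutionOn (ham α) γ s := by
  rw [isHamiltonianSolutionOn_iff]
  refine forall₂_congr fun t _ => ?_
  rw [← hasDerivWithinAt_emb_iff, emb_apply, toTri_hamVec_ham]
  have e : ∀ x : State N, emb N x = toAmbL N (toTri x) := fun x => by rw [emb_apply, toAmbL_apply]
  simp only [← toAmbL_apply, e]
  constructor
  · intro h
    exact (toAmbL N).toContinuousLinearMap.hasFDerivAt.comp_hasDerivWithinAt t h
  · intro h
    have h2 := (toAmbL N).symm.toContinuousLinearMap.hasFDerivAt.comp_hasDerivWithinAt t h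
    simpa [Function.comp_def] using h2

end Hazeltine

/-! ### Solving the stage equation, uniquely and smoothly. -/

namespace Midpoint

open Filter Topology

section

variable {E : Type*} [NormedAddCommGroup E] [NormedSpace ℝ E] [FiniteDimensional ℝ E]

/-- A smooth family of maps that starts at the identity is small and contracting, after
subtraction of the identity, on a fixed ball for small parameters. -/
theorem exists_contraction {Ψ : ℝ × E → E} (hΨ : ContDiff ℝ ∞ Ψ) (h0 : ∀ z, Ψ (0, z) = z) {r ε : ℝ}
    (hε : 0 < ε) :
    ∃ h₀ > 0, ∀ h z, |h| < h₀ → ‖z‖ ≤ r → ‖Ψ (h, z) - z‖ < ε ∧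
      ‖fderiv ℝ (fun z => Ψ (h, z) - z) z‖ < 1 / 2 := by
  have hG : ContDiff ℝ ∞ (fun p : ℝ × E => Ψ p - p.2) := hΨ.sub contDiff_snd
  have hD : ∀ h z, HasFDerivAt (fun z => Ψ (h, z) - z)
      ((fderiv ℝ (fun p : ℝ × E => Ψ p - p.2) (h, z)).comp (ContinuousLinearMap.inr ℝ ℝ E)) z := by
    intro h z
    have h1 := ((hG.differentiable (by simp)) (h, z)).hasFDerivAt
    have h2 : HasFDerivAt (fun z : E => (h, z)) (ContinuousLinearMap.inr ℝ ℝ E) z :=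
      hasFDerivAt_prodMk_right h z
    exact h1.comp z h2
  have hcont : Continuous fun p : ℝ × E =>
      (fderiv ℝ (fun p : ℝ × E => Ψ p - p.2) p).comp (ContinuousLinearMap.inr ℝ ℝ E) :=
    (hG.continuous_fderiv (by simp)).clm_comp continuous_const
  have hzero : ∀ z, (fderiv ℝ (fun p : ℝ × E => Ψ p - p.2) (0, z)).comp
      (ContinuousLinearMap.inr ℝ ℝ E) = 0 := by
    intro z
    have h1 := hD 0 z
    have h2 : (fun z => Ψ (0, z) - z) = fun _ => (0 : E) := funext fun z => by rw [h0, sub_self]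
    rw [h2] at h1
    exact h1.unique (hasFDerivAt_const 0 z)
  have key : ∀ᶠ h in 𝓝 (0 : ℝ), ∀ z ∈ Metric.closedBall (0 : E) r, ‖Ψ (h, z) - z‖ < ε ∧
      ‖(fderiv ℝ (fun p : ℝ × E => Ψ p - p.2) (h, z)).comp (ContinuousLinearMap.inr ℝ ℝ E)‖
        < 1 / 2 := by
    refine (isCompact_closedBall (0 : E) r).eventually_forall_of_forall_eventually fun z _ => ?_
    refine Filter.Eventually.and ?_ ?_
    · refine (hG.continuous.norm.tendsto (0, z)).eventually (gt_mem_nhds ?_)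
      simpa [h0] using hε
    · refine (hcont.norm.tendsto (0, z)).eventually (gt_mem_nhds ?_)
      rw [hzero, norm_zero]; norm_num
  obtain ⟨h₀, hh₀, hh⟩ := Metric.eventually_nhds_iff.1 key
  refine ⟨h₀, hh₀, fun h z hh1 hz => ?_⟩
  have := hh (y := h) (by simpa using hh1) z (by simpa using hz)
  rw [(hD h z).fderiv]
  exact this

/-- A solution is a fixed point of z ↦ x - (Ψ(h, z) - z). For small h this map is a 1/2-contraction
and moves the ball of radius 2R into itself, the perturbation being smaller than R. The last
conclusion keeps the size and the invertibility of the derivative for later use with -h as well as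
with h. -/
theorem exists_implicit_inverse {Ψ : ℝ × E → E} (hΨ : ContDiff ℝ ∞ Ψ) (h0 : ∀ z, Ψ (0, z) = z)
    {R : ℝ} (hR : 0 < R) :
    ∃ h₀ > 0, ∃ Z : ℝ → E → E,
      (∀ h x, |h| < h₀ → ‖x‖ < R → ‖Z h x‖ < 2 * R ∧ Ψ (h, Z h x) = x ∧
        ∀ z, ‖z‖ < 2 * R → Ψ (h, z) = x → z = Z h x) ∧
      ContDiffOn ℝ ∞ (fun p : ℝ × E => Z p.1 p.2) (Ioo (-h₀) h₀ ×ˢ Metric.ball 0 R) ∧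
      (∀ h z, |h| < h₀ → ‖z‖ ≤ 2 * R → ‖Ψ (h, z) - z‖ < R ∧
        Function.Bijective (fderiv ℝ (fun z => Ψ (h, z)) z)) := by
  obtain ⟨h₀, hh₀, hc⟩ := exists_contraction hΨ h0 (r := 2 * R) hR
  have hslice : ∀ h, ContDiff ℝ ∞ fun z => Ψ (h, z) := fun h =>
    hΨ.comp (contDiff_const.prodMk contDiff_id)
  have hdiff : ∀ h z, DifferentiableAt ℝ (fun z => Ψ (h, z)) z := fun h z =>
    (hslice h).differentiable (by simp) z
  have hLip : ∀ h, |h| < h₀ → ∀ z w, ‖z‖ ≤ 2 * R → ‖w‖ ≤ 2 * R →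
      ‖(Ψ (h, z) - z) - (Ψ (h, w) - w)‖ ≤ 1 / 2 * ‖z - w‖ := by
    intro h hh z w hz hw
    refine (convex_closedBall (0 : E) (2 * R)).norm_image_sub_le_of_norm_fderiv_le (𝕜 := ℝ)
      (f := fun z => Ψ (h, z) - z) (fun x _ => (hdiff h x).sub differentiableAt_id)
      (fun x hx => (hc h x hh (by simpa using hx)).2.le) (by simpa using hw) (by simpa using hz)
  have hbij : ∀ h z, |h| < h₀ → ‖z‖ ≤ 2 * R →
      Function.Bijective (fderiv ℝ (fun z => Ψ (h, z)) z) := by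
    intro h z hh hz
    have h1 := (hc h z hh hz).2
    have h2 : fderiv ℝ (fun z => Ψ (h, z) - z) z
        = fderiv ℝ (fun z => Ψ (h, z)) z - ContinuousLinearMap.id ℝ E := by
      rw [fderiv_fun_sub (hdiff h z) differentiableAt_fun_id, fderiv_fun_id]
    have hinj : Function.Injective (fderiv ℝ (fun z => Ψ (h, z)) z).toLinearMap := by
      refine (injective_iff_map_eq_zero _).2 fun ζ hζ => ?_
      have h3 : (fderiv ℝ (fun z => Ψ (h, z) - z) z) ζ = -ζ := by
        rw [h2]
        change (fderiv ℝ (fun z => Ψ (h, z)) z).toLinearMap ζ - ζ = -ζ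
        rw [hζ, zero_sub]
      have h4 := (fderiv ℝ (fun z => Ψ (h, z) - z) z).le_opNorm ζ
      rw [h3, norm_neg] at h4
      have h5 : ‖ζ‖ ≤ 1 / 2 * ‖ζ‖ := h4.trans (by gcongr)
      exact norm_le_zero_iff.1 (by linarith)
    exact ⟨hinj, LinearMap.injective_iff_surjective.1 hinj⟩
  have hex : ∀ h x, |h| < h₀ → ‖x‖ < R → ∃ z, ‖z‖ < 2 * R ∧ Ψ (h, z) = x := by
    intro h x hh hx
    have hmaps : MapsTo (fun z => x - (Ψ (h, z) - z)) (Metric.closedBall 0 (2 * R))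
        (Metric.closedBall (0 : E) (2 * R)) := by
      intro z hz
      have h1 := (hc h z hh (by simpa using hz)).1
      have h2 := norm_sub_le x (Ψ (h, z) - z)
      rw [mem_closedBall_zero_iff]
      linarith
    have hcontr : ContractingWith (1 / 2) (hmaps.restrict _ _ _) := by
      refine ⟨by norm_num [← NNReal.coe_lt_coe], LipschitzWith.of_dist_le_mul fun z w => ?_⟩
      have h1 := hLip h hh w z (mem_closedBall_zero_iff.1 w.2)
        (mem_closedBall_zero_iff.1 z.2)
      rw [Subtype.dist_eq, Subtype.dist_eq, dist_comm z.1, dist_eq_norm, dist_eq_norm]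
      have e : (hmaps.restrict _ _ _ z : E) - (hmaps.restrict _ _ _ w : E)
          = (Ψ (h, w) - w) - (Ψ (h, z) - z) := by
        simp only [MapsTo.val_restrict_apply]; abel
      rw [e]
      simpa using h1
    obtain ⟨z, hz, hfix, -⟩ := ContractingWith.exists_fixedPoint'
      Metric.isClosed_closedBall.isComplete hmaps hcontr
      (Metric.mem_closedBall_self (by linarith)) (edist_ne_top _ _)
    have h1 : x - (Ψ (h, z) - z) = z := hfix
    have h2 : Ψ (h, z) = x := by
      rw [sub_sub_eq_add_sub, sub_eq_iff_eq_add, add_comm z] at h1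
      exact (add_right_cancel h1).symm
    refine ⟨z, ?_, h2⟩
    have h3 := (hc h z hh (by simpa using hz)).1
    have h4 := norm_sub_le x (Ψ (h, z) - z)
    rw [h1] at h4
    linarith
  have huniq : ∀ h, |h| < h₀ → ∀ z w, ‖z‖ < 2 * R → ‖w‖ < 2 * R → Ψ (h, z) = Ψ (h, w) → z = w := by
    intro h hh z w hz hw he
    have h1 := hLip h hh z w hz.le hw.le
    rw [he, show Ψ (h, w) - z - (Ψ (h, w) - w) = -(z - w) by abel, norm_neg] at h1
    exact sub_eq_zero.1 (norm_le_zero_iff.1 (by linarith))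
  choose! Z hZ1 hZ2 using hex
  refine ⟨h₀, hh₀, Z, fun h x hh hx => ⟨hZ1 h x hh hx, hZ2 h x hh hx, fun z hz he =>
    huniq h hh z _ hz (hZ1 h x hh hx) (he.trans (hZ2 h x hh hx).symm)⟩, ?_,
    fun h z hh hz => ⟨(hc h z hh hz).1, hbij h z hh hz⟩⟩
  rintro ⟨h₁, x₁⟩ ⟨hh₁, hx₁⟩
  simp only [mem_ball_zero_iff] at hh₁ hx₁
  refine ContDiffAt.contDiffWithinAt ?_
  have hh₁' : |h₁| < h₀ := abs_lt.2 hh₁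
  have hz₁ := hZ1 h₁ x₁ hh₁' hx₁
  have he₁ := hZ2 h₁ x₁ hh₁' hx₁
  set z₁ := Z h₁ x₁
  -- Adding the parameter as a component turns joint smoothness into the inverse function theorem.
  -- Uniqueness in the ball of radius 2R identifies the local inverse with Z.
  let Φ : ℝ × E → ℝ × E := fun p => (p.1, Ψ p)
  have hΦ : ContDiff ℝ ∞ Φ := contDiff_fst.prodMk hΨ
  have hΦd := ((hΦ.differentiable (by simp)) (h₁, z₁)).hasFDerivAt
  have hinj : Function.Injective (fderiv ℝ Φ (h₁, z₁)).toLinearMap := by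
    refine (injective_iff_map_eq_zero _).2 ?_
    rintro ⟨a, ζ⟩ hζ
    have e1 : fderiv ℝ Φ (h₁, z₁) = (ContinuousLinearMap.fst ℝ ℝ E).prod (fderiv ℝ Ψ (h₁, z₁)) :=
      (hasFDerivAt_fst.prodMk ((hΨ.differentiable (by simp)) (h₁, z₁)).hasFDerivAt).fderiv
    have e2 : (a, fderiv ℝ Ψ (h₁, z₁) (a, ζ)) = (0 : ℝ × E) := by
      rw [← hζ, e1]; rfl
    simp only [Prod.mk_eq_zero] at e2
    obtain ⟨rfl, e3⟩ := e2
    have e4 : fderiv ℝ (fun z => Ψ (h₁, z)) z₁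
        = (fderiv ℝ Ψ (h₁, z₁)).comp (ContinuousLinearMap.inr ℝ ℝ E) :=
      (((hΨ.differentiable (by simp)) (h₁, z₁)).hasFDerivAt.comp z₁
        (hasFDerivAt_prodMk_right h₁ z₁)).fderiv
    have e5 : fderiv ℝ (fun z => Ψ (h₁, z)) z₁ ζ = 0 := by rw [e4]; exact e3
    rw [(hbij h₁ z₁ hh₁' hz₁.le).1 (e5.trans (map_zero _).symm)]
    rfl
  let e : (ℝ × E) ≃L[ℝ] (ℝ × E) := (LinearEquiv.ofInjectiveEndo _ hinj).toContinuousLinearEquiv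
  have he : HasFDerivAt Φ (e : (ℝ × E) →L[ℝ] (ℝ × E)) (h₁, z₁) := by
    refine hΦd.congr_fderiv ?_
    ext v <;> rfl
  have hn : (∞ : WithTop ℕ∞) ≠ 0 := by simp
  have hca : ContDiffAt ℝ ∞ Φ (h₁, z₁) := hΦ.contDiffAt
  have hloc := hca.to_localInverse he hn
  have hst := hca.hasStrictFDerivAt' he hn
  have hright := hst.eventually_right_inverse
  have htend := hst.localInverse_tendsto
  have hp : Φ (h₁, z₁) = (h₁, x₁) := by simp only [Φ, he₁]
  rw [hp] at hloc hright htend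
  have hsmall : ∀ᶠ p : ℝ × E in 𝓝 (h₁, z₁), ‖p.2‖ < 2 * R :=
    (continuous_snd.norm.tendsto (h₁, z₁)).eventually (gt_mem_nhds hz₁)
  have hdom : ∀ᶠ p : ℝ × E in 𝓝 (h₁, x₁), |p.1| < h₀ ∧ ‖p.2‖ < R :=
    ((continuous_fst.abs.tendsto (h₁, x₁)).eventually (gt_mem_nhds hh₁')).and
      ((continuous_snd.norm.tendsto (h₁, x₁)).eventually (gt_mem_nhds hx₁))
  refine (contDiff_snd.contDiffAt.comp (h₁, x₁) hloc).congr_of_eventuallyEq ?_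
  filter_upwards [hright, htend.eventually hsmall, hdom] with p hp1 hp2 hp3
  have e1 : (hca.localInverse he hn p).1 = p.1 := by
    have := congrArg Prod.fst hp1
    exact this
  have e2 : Ψ (p.1, (hca.localInverse he hn p).2) = p.2 := by
    rw [← e1]
    have := congrArg Prod.snd hp1
    exact this
  exact (huniq p.1 hp3.1 _ _ hp2 (hZ1 p.1 p.2 hp3.1 hp3.2)
    (e2.trans (hZ2 p.1 p.2 hp3.1 hp3.2).symm)).symm

end

end Midpoint

/-! ### Smoothness of the midpoint map, and the scheme for small steps. -/

namespace Midpoint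

section

variable {A : Type*} [NormedRing A] [NormedAlgebra ℝ A]

/-- `dmid` as a linear map. -/
def dmidL (L : A →ₗ[ℝ] A) (h : ℝ) (z : A) : A →ₗ[ℝ] A where
  toFun := dmid L h z
  map_add' ζ ξ := by
    simp only [dmid, map_add, smul_add, add_mul, mul_add]; abel
  map_smul' c ζ := by
    simp only [dmid, map_smul, smul_mul_assoc, mul_smul_comm, smul_add, smul_sub, RingHom.id_apply,
      smul_comm c (h / 2)]

@[simp] theorem dmidL_apply (L : A →ₗ[ℝ] A) (h : ℝ) (z ζ : A) : dmidL L h z ζ = dmid L h z ζ := rfl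

variable [FiniteDimensional ℝ A]

theorem contDiff_mid {n : WithTop ℕ∞} (L : A →ₗ[ℝ] A) :
    ContDiff ℝ n fun p : ℝ × A => mid L p.1 p.2 := by
  have hL : ContDiff ℝ n fun p : ℝ × A => (p.1 / 2) • L p.2 :=
    (contDiff_fst.div_const 2).smul
      ((LinearMap.toContinuousLinearMap L).contDiff.comp contDiff_snd)
  exact ((contDiff_const.add hL).mul contDiff_snd).mul (contDiff_const.sub hL)

theorem _root_.ContDiff.mid {E : Type*} [NormedAddCommGroup E] [NormedSpace ℝ E] {n : WithTop ℕ∞}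
    (L : A →ₗ[ℝ] A) {f : E → ℝ} {g : E → A} (hf : ContDiff ℝ n f) (hg : ContDiff ℝ n g) :
    ContDiff ℝ n fun p => mid L (f p) (g p) :=
  (contDiff_mid L).comp (hf.prodMk hg)

theorem hasFDerivAt_mid (L : A →ₗ[ℝ] A) (h : ℝ) (z : A) :
    HasFDerivAt (fun z => mid L h z) (LinearMap.toContinuousLinearMap (dmidL L h z)) z := by
  have hL : HasFDerivAt (fun z : A => (h / 2) • L z)
      ((h / 2) • LinearMap.toContinuousLinearMap L) z :=
    (LinearMap.toContinuousLinearMap L).hasFDerivAt.const_smul (h / 2)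
  have h1 := ((hL.const_add 1).mul' (hasFDerivAt_id z)).mul' (hL.const_sub 1)
  refine h1.congr_fderiv ?_
  ext ζ
  simp [dmid]
  noncomm_ring

end

end Midpoint

namespace Hazeltine

open Midpoint

variable {N : ℕ}

/-- The stage equation as a map of triples: a stage `z` belongs to the triple
`stageMap α (h, z)`. -/
def stageMap (α : ℝ) (p : ℝ × Tri N) : Tri N :=
  (toAmb N).symm (mid (genMap N α) p.1 (toAmb N p.2))

theorem toAmb_stageMap (α h : ℝ) (z : Tri N) :
    toAmb N (stageMap α (h, z)) = mid (genMap N α) h (toAmb N z) :=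
  (toAmb N).apply_symm_apply _

theorem stageMap_zero (α : ℝ) (z : Tri N) : stageMap α (0, z) = z := by
  apply (toAmb N).injective
  rw [toAmb_stageMap]
  simp [mid]

theorem stageMap_eq (α : ℝ) : stageMap (N := N) α =
    fun p => (toAmbL N).symm (mid (genMap N α) p.1 (toAmbL N p.2)) := by
  funext p
  rw [stageMap, toAmbL_symm_apply, toAmbL_apply]

theorem contDiff_stageMap (α : ℝ) : ContDiff ℝ ∞ (stageMap (N := N) α) := by
  have h1 : ContDiff ℝ ∞ fun p : ℝ × Tri N => p.1 := contDiff_fst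
  have h3 : ContDiff ℝ ∞ fun p : ℝ × Tri N => toAmbL N p.2 :=
    (toAmbL N).contDiff.comp contDiff_snd
  rw [stageMap_eq]
  exact (toAmbL N).symm.contDiff.comp (ContDiff.mid (genMap N α) h1 h3)

theorem fderiv_stageMap (α h : ℝ) (z ζ : Tri N) :
    toAmb N (fderiv ℝ (fun z => stageMap α (h, z)) z ζ)
      = dmid (genMap N α) h (toAmb N z) (toAmb N ζ) := by
  have h1 : HasFDerivAt (fun z => (toAmbL N).symm (mid (genMap N α) h (toAmbL N z))) _ z :=
    (toAmbL N).symm.toContinuousLinearMap.hasFDerivAt.comp z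
      ((hasFDerivAt_mid (genMap N α) h (toAmbL N z)).comp z
        (toAmbL N).toContinuousLinearMap.hasFDerivAt)
  rw [stageMap_eq, h1.fderiv]
  have e : ∀ a, toAmb N ((toAmbL N).symm a) = a := fun a => by
    rw [← toAmbL_apply, ContinuousLinearEquiv.apply_symm_apply]
  simp [e, toAmbL_apply]

theorem genMap_conj (α : ℝ) (a : Amb N) : genMap N α (conj a) = conj (genMap N α a) := by
  refine Amb.ext ?_ ?_ ?_
  · simp [conj, conjTranspose_lapInv]
  · simp [conj, conjTranspose_lapInv, Matrix.conjTranspose_smul]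
  · simp [conj, conjTranspose_lap]

/-- The stage equation is invariant under z ↦ -zᴴ, whose fixed points are the skew-Hermitian
elements. Uniqueness of the stage then makes it skew-Hermitian. -/
theorem mid_neg_conj (α h : ℝ) (a : Amb N) :
    mid (genMap N α) h (-conj a) = -conj (mid (genMap N α) h a) := by
  simp only [mid, map_neg, genMap_conj, conj_mul, conj_add, conj_sub, conj_smul, conj_one, smul_neg,
    sub_neg_eq_add, ← sub_eq_add_neg, mul_neg, neg_mul, mul_assoc]

attribute [irreducible] stageMap

theorem norm_conjTri (z : Tri N) : ‖((-z.1ᴴ, -z.2.1ᴴ, -z.2.2ᴴ) : Tri N)‖ = ‖z‖ := by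
  simp only [Prod.norm_def, norm_neg, ← Matrix.star_eq_conjTranspose, norm_star]

/-- The scheme for small steps: on the ball of radius `R` and for step sizes below `h₀`, the
stage `Z h x` and the result `φ h x` of a step. -/
structure IsScheme (α R h₀ : ℝ) (Z : ℝ → State N → Tri N) (φ : ℝ → State N → State N) : Prop where
  pos : 0 < h₀
  norm_stage : ∀ {h x}, |h| < h₀ → ‖x‖ < R → ‖Z h x‖ < 2 * R
  skew_stage : ∀ {h x}, |h| < h₀ → ‖x‖ < R → IsSkewTri (Z h x)
  start : ∀ {h x}, |h| < h₀ → ‖x‖ < R → emb N x = mid (genMap N α) h (toAmb N (Z h x))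
  target : ∀ {h x}, |h| < h₀ → ‖x‖ < R → emb N (φ h x) = mid (genMap N α) (-h) (toAmb N (Z h x))
  unique : ∀ {h x z}, |h| < h₀ → ‖x‖ < R → ‖z‖ < 2 * R →
    emb N x = mid (genMap N α) h (toAmb N z) → z = Z h x
  smooth_stage : ContDiffOn ℝ ∞ (fun p : ℝ × State N => Z p.1 p.2)
    (Ioo (-h₀) h₀ ×ˢ Metric.ball 0 R)
  smooth : ContDiffOn ℝ ∞ (fun p : ℝ × State N => φ p.1 p.2) (Ioo (-h₀) h₀ ×ˢ Metric.ball 0 R)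
  norm_target : ∀ {h x}, |h| < h₀ → ‖x‖ < R → ‖φ h x‖ < 3 * R
  bijective : ∀ {h z}, |h| < h₀ → ‖z‖ ≤ 2 * R →
    Function.Bijective (dmidL (genMap N α) h (toAmb N z))

/-- The stage comes from `exists_implicit_inverse` on all triples, and the result of the step is
`stageMap` at -h, since mid(-h) is the other half of the step. It lies in the phase space by
`step_orbit`, so a linear left inverse P of the inclusion may be applied smoothly. A stage is
smaller than 2R and `stageMap` moves it by less than R, whence the bound 3R. -/
theorem exists_isScheme (N : ℕ) (α : ℝ) {R : ℝ} (hR : 0 < R) :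
    ∃ h₀ : ℝ, ∃ (Z : ℝ → State N → Tri N) (φ : ℝ → State N → State N), IsScheme α R h₀ Z φ := by
  obtain ⟨h₀, hh₀, Z, hZ, hZs, hb⟩ :=
    exists_implicit_inverse (contDiff_stageMap (N := N) α) (stageMap_zero α) hR
  obtain ⟨g, hg⟩ := (toTriL N).exists_leftInverse_of_injective
    (LinearMap.ker_eq_bot.2 toTri_injective)
  obtain ⟨P, hP⟩ : ∃ P : Tri N →L[ℝ] State N, ∀ x, P (toTri x) = x :=
    ⟨LinearMap.toContinuousLinearMap g, fun x => LinearMap.congr_fun hg x⟩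
  obtain ⟨J, hJ⟩ : ∃ J : State N →L[ℝ] Tri N, ∀ x, J x = toTri x :=
    ⟨LinearMap.toContinuousLinearMap (toTriL N), fun x => rfl⟩
  have hskew : ∀ {h x}, |h| < h₀ → ‖x‖ < R → IsSkewTri (Z h (toTri x)) := by
    intro h x hh hx
    obtain ⟨h1, h2, h3⟩ := hZ h (toTri x) hh hx
    have e1 := congrArg (toAmb N) h2
    rw [toAmb_stageMap] at e1
    set z := Z h (toTri x)
    have e2 : toAmb N (-z.1ᴴ, -z.2.1ᴴ, -z.2.2ᴴ) = -conj (toAmb N z) := by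
      refine Amb.ext ?_ ?_ ?_ <;> simp [conj]
      abel
    have e3 := h3 (-z.1ᴴ, -z.2.1ᴴ, -z.2.2ᴴ) (by rw [norm_conjTri]; exact h1) (by
      apply (toAmb N).injective
      have := mem_skew.1 (emb_mem_skew x)
      rw [emb_apply] at this
      rw [toAmb_stageMap, e2, mid_neg_conj, e1, this, neg_neg])
    refine ⟨?_, ?_, ?_⟩
    · nth_rewrite 2 [← e3]; simp
    · nth_rewrite 2 [← e3]; simp
    · nth_rewrite 2 [← e3]; simp
  have hstart : ∀ {h x}, |h| < h₀ → ‖x‖ < R →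
      emb N x = mid (genMap N α) h (toAmb N (Z h (toTri x))) := by
    intro h x hh hx
    rw [← toAmb_stageMap, (hZ h (toTri x) hh hx).2.1, emb_apply]
  have htarget : ∀ {h x}, |h| < h₀ → ‖x‖ < R →
      toTri (P (stageMap α (-h, Z h (toTri x)))) = stageMap α (-h, Z h (toTri x)) := by
    intro h x hh hx
    have : IsStep α h (toTri x) (Z h (toTri x)) (stageMap α (-h, Z h (toTri x))) :=
      isStep_iff_mid.2 ⟨hskew hh hx, by rw [← emb_apply]; exact hstart hh hx, toAmb_stageMap _ _ _⟩
    obtain ⟨⟨y, hy, -⟩, -⟩ := step_orbit this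
    rw [← hy]
    exact congrArg toTri (hP y)
  have hmaps : MapsTo (fun p : ℝ × State N => (p.1, J p.2)) (Ioo (-h₀) h₀ ×ˢ Metric.ball 0 R)
      (Ioo (-h₀) h₀ ×ˢ Metric.ball (0 : Tri N) R) := by
    rintro ⟨h, x⟩ ⟨h1, h2⟩
    refine ⟨h1, ?_⟩
    rw [mem_ball_zero_iff] at h2 ⊢
    simp only [hJ]
    exact h2
  have hsm : ContDiffOn ℝ ∞ (fun p : ℝ × State N => Z p.1 (toTri p.2))
      (Ioo (-h₀) h₀ ×ˢ Metric.ball 0 R) := by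
    have h1 : ContDiff ℝ ∞ fun p : ℝ × State N => (p.1, J p.2) :=
      contDiff_fst.prodMk (J.contDiff.comp contDiff_snd)
    have h2 := hZs.comp h1.contDiffOn hmaps
    simp only [Function.comp_def, hJ] at h2
    exact h2
  have hsm' : ContDiffOn ℝ ∞ (fun p : ℝ × State N => P (stageMap α (-p.1, Z p.1 (toTri p.2))))
      (Ioo (-h₀) h₀ ×ˢ Metric.ball 0 R) := by
    have h0 : ContDiff ℝ ∞ fun p : ℝ × State N => -p.1 := contDiff_fst.neg
    have h1 : ContDiffOn ℝ ∞ (fun p : ℝ × State N => (-p.1, Z p.1 (toTri p.2)))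
        (Ioo (-h₀) h₀ ×ˢ Metric.ball 0 R) := h0.contDiffOn.prodMk hsm
    have h2 : ContDiff ℝ ∞ fun q : ℝ × Tri N => P (stageMap α q) :=
      P.contDiff.comp (contDiff_stageMap α)
    exact h2.comp_contDiffOn h1
  have htarget' : ∀ {h x}, |h| < h₀ → ‖x‖ < R → emb N (P (stageMap α (-h, Z h (toTri x))))
      = mid (genMap N α) (-h) (toAmb N (Z h (toTri x))) := by
    intro h x hh hx
    rw [emb_apply, htarget hh hx, toAmb_stageMap]
  have hunique : ∀ {h x z}, |h| < h₀ → ‖x‖ < R → ‖z‖ < 2 * R →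
      emb N x = mid (genMap N α) h (toAmb N z) → z = Z h (toTri x) := by
    intro h x z hh hx hz he
    refine (hZ h (toTri x) hh hx).2.2 z hz ?_
    apply (toAmb N).injective
    rw [toAmb_stageMap, ← he, emb_apply]
  have hnorm : ∀ {h x}, |h| < h₀ → ‖x‖ < R → ‖P (stageMap α (-h, Z h (toTri x)))‖ < 3 * R := by
    intro h x hh hx
    rw [← norm_toTri, htarget hh hx]
    have h1 := (hZ h (toTri x) hh hx).1
    have h2 := (hb (-h) (Z h (toTri x)) (by rwa [abs_neg]) h1.le).1
    have h3 := norm_sub_norm_le (stageMap α (-h, Z h (toTri x))) (Z h (toTri x))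
    linarith
  have hbij : ∀ {h z}, |h| < h₀ → ‖z‖ ≤ 2 * R →
      Function.Bijective (dmidL (genMap N α) h (toAmb N z)) := by
    intro h z hh hz
    have h1 := (hb h z hh hz).2
    have h2 : ⇑(dmidL (genMap N α) h (toAmb N z))
        = toAmb N ∘ (fderiv ℝ (fun z => stageMap α (h, z)) z) ∘ (toAmb N).symm := by
      funext ζ
      rw [Function.comp_apply, Function.comp_apply, fderiv_stageMap, LinearEquiv.apply_symm_apply,
        dmidL_apply]
    rw [h2]
    exact (toAmb N).bijective.comp (h1.comp (toAmb N).symm.bijective)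
  exact ⟨h₀, fun h x => Z h (toTri x), fun h x => P (stageMap α (-h, Z h (toTri x))),
    { pos := hh₀
      norm_stage := fun {h x} hh hx => (hZ h (toTri x) hh hx).1
      skew_stage := hskew
      start := hstart
      target := htarget'
      unique := hunique
      smooth_stage := hsm
      smooth := hsm'
      norm_target := hnorm
      bijective := hbij }⟩

end Hazeltine

namespace Hazeltine

open Midpoint

variable {N : ℕ}

/-! ### Poisson maps -/

theorem IsSkew.trace_mul_self {A : Mat N} (hA : IsSkew A) :
    (A * A).trace.re ≤ 0 ∧ ((A * A).trace.re = 0 → A = 0) := by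
  have e : (A * A).trace.re = -∑ i, ∑ j, Complex.normSq (A j i) := by
    have : A * A = -(Aᴴ * A) := by rw [show Aᴴ = -A from hA]; simp
    rw [this]
    simp [Matrix.trace, Matrix.mul_apply, Complex.normSq_apply]
  have h0 : ∀ i, 0 ≤ ∑ j, Complex.normSq (A j i) := fun i =>
    Finset.sum_nonneg fun j _ => Complex.normSq_nonneg _
  rw [e]
  refine ⟨neg_nonpos.2 (Finset.sum_nonneg fun i _ => h0 i), fun hz => ?_⟩
  ext j i
  have h1 := (Finset.sum_eq_zero_iff_of_nonneg fun i _ => h0 i).1 (neg_eq_zero.1 hz) i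
    (Finset.mem_univ _)
  have h2 := (Finset.sum_eq_zero_iff_of_nonneg
    (fun j _ => Complex.normSq_nonneg (A j i))).1 h1 j (Finset.mem_univ _)
  simpa using h2

theorem eq_zero_of_tau_mul {a : Amb N} (ha : a ∈ skew N)
    (h : ∀ ζ ∈ skew N, tau N (a * ζ) = 0) : a = 0 := by
  obtain ⟨h1, h2, h3⟩ := mem_skew_iff.1 ha
  -- The form pairs the two dual-number components crosswise. Exchanging them in the test element
  -- gives a sum of three traces of squares of skew-Hermitian matrices, all of one sign.
  have hs : Amb.mk a.fst a.eps a.re ∈ skew N := mem_skew_iff.2 (by simpa using ⟨h1, h3, h2⟩)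
  have h0 := h _ hs
  rw [tau_apply] at h0
  simp only [Amb.fst_mul, Amb.eps_mul, Amb.fst_mk, Amb.re_mk, Amb.eps_mk, Matrix.trace_add,
    Complex.add_re] at h0
  obtain ⟨a1, b1⟩ := h1.trace_mul_self
  obtain ⟨a2, b2⟩ := h2.trace_mul_self
  obtain ⟨a3, b3⟩ := h3.trace_mul_self
  refine Amb.ext ?_ ?_ ?_
  · exact b1 (by linarith)
  · exact b2 (by linarith)
  · exact b3 (by linarith)

theorem exists_tau_mul_eq (f : skew N →ₗ[ℝ] ℝ) :
    ∃ a ∈ skew N, ∀ ζ : skew N, tau N (a * ζ) = f ζ := by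
  let B : skew N →ₗ[ℝ] Module.Dual ℝ (skew N) :=
    ((LinearMap.mul ℝ (Amb N)).compr₂ (tau N)).domRestrict₁₂ (skew N) (skew N)
  have hB : ∀ a ζ : skew N, B a ζ = tau N (a * ζ) := fun _ _ => rfl
  have hinj : Function.Injective B := by
    rw [← LinearMap.ker_eq_bot, LinearMap.ker_eq_bot']
    intro a ha
    refine Subtype.ext (eq_zero_of_tau_mul a.2 fun ζ hζ => ?_)
    rw [← hB a ⟨ζ, hζ⟩, ha, LinearMap.zero_apply]
  obtain ⟨a, ha⟩ := (LinearMap.injective_iff_surjective_of_finrank_eq_finrank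
    (Subspace.dual_finrank_eq (K := ℝ) (V := skew N)).symm).1 hinj f
  exact ⟨a, a.2, fun ζ => by rw [← hB, ha]⟩

theorem conj_smul_genMap (α c : ℝ) {z : Amb N} (hz : z ∈ skew N) :
    conj (c • genMap N α z) = -(c • genMap N α z) :=
  mem_skew.1 (Submodule.smul_mem _ _ (genMap_mem_skew α hz))

theorem dmid_mem_skew (α h : ℝ) {z ζ : Amb N} (hz : z ∈ skew N) (hζ : ζ ∈ skew N) :
    dmid (genMap N α) h z ζ ∈ skew N := by
  have e1 := conj_smul_genMap α (h / 2) hz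
  have e2 := conj_smul_genMap α (h / 2) hζ
  rw [mem_skew] at hz hζ ⊢
  rw [dmid]
  generalize (h / 2) • genMap N α z = m at *
  generalize (h / 2) • genMap N α ζ = n at *
  simp only [conj_sub, conj_add, conj_mul, conj_one, e1, e2, hz, hζ]
  noncomm_ring

theorem symm_mem_skew (α h : ℝ) {z p P : Amb N} (hz : z ∈ skew N) (hp : p ∈ skew N)
    (hP : P ∈ skew N) :
    P * (1 - (h / 2) • genMap N α z) * z - z * (1 + (h / 2) • genMap N α z) * P
      - z * (1 - (h / 2) • genMap N α z) * p + p * (1 + (h / 2) • genMap N α z) * z ∈ skew N := by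
  have e1 := conj_smul_genMap α (h / 2) hz
  rw [mem_skew] at hz hp hP ⊢
  generalize (h / 2) • genMap N α z = m at *
  simp only [conj_sub, conj_add, conj_mul, conj_one, e1, hz, hp, hP]
  noncomm_ring

/-- A covector at the end point of a step has a pull-back to the starting point. -/
theorem exists_pullback (α : ℝ) {h : ℝ} {z : Amb N} (hz : z ∈ skew N)
    (hb : Function.Injective (dmidL (genMap N α) h z)) (P : Amb N) :
    ∃ p ∈ skew N, ∀ ζ ∈ skew N,
      tau N (p * dmid (genMap N α) h z ζ) = tau N (P * dmid (genMap N α) (-h) z ζ) := by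
  let T : skew N →ₗ[ℝ] skew N :=
    (dmidL (genMap N α) h z).restrict fun ζ hζ => dmid_mem_skew α h hz hζ
  have hT : ∀ ζ : skew N, (T ζ : Amb N) = dmid (genMap N α) h z ζ := fun _ => rfl
  have hTi : Function.Injective T := fun a b hab =>
    Subtype.ext (hb (congrArg Subtype.val hab))
  let e := LinearEquiv.ofInjectiveEndo T hTi
  have he : ∀ ζ, e.symm (T ζ) = ζ := fun ζ => e.symm_apply_apply ζ
  obtain ⟨p, hp, h1⟩ := exists_tau_mul_eq (tau N ∘ₗ LinearMap.mulLeft ℝ P ∘ₗ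
    dmidL (genMap N α) (-h) z ∘ₗ (skew N).subtype ∘ₗ e.symm.toLinearMap)
  refine ⟨p, hp, fun ζ hζ => ?_⟩
  rw [← hT ⟨ζ, hζ⟩, h1]
  simp [he]

theorem mem_skew_of_hasDerivAt {f : ℝ → Amb N} {f' : Amb N} {t : ℝ} (hf : HasDerivAt f f' t)
    (hs : ∀ᶠ r in nhds t, f r ∈ skew N) : f' ∈ skew N := by
  refine (skew N).closed_of_finiteDimensional.mem_of_tendsto hf.tendsto_slope ?_
  filter_upwards [hs.filter_mono nhdsWithin_le_nhds] with r hr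
  rw [slope_def_module]
  exact Submodule.smul_mem _ _ (Submodule.sub_mem _ hr hs.self_of_nhds)

namespace IsScheme

variable {α R h₀ : ℝ} {Z : ℝ → State N → Tri N} {φ : ℝ → State N → State N}

theorem mem_nhds (_ : IsScheme α R h₀ Z φ) {h : ℝ} {x : State N} (hh : |h| < h₀) (hx : ‖x‖ < R) :
    Ioo (-h₀) h₀ ×ˢ Metric.ball (0 : State N) R ∈ nhds (h, x) :=
  (isOpen_Ioo.prod Metric.isOpen_ball).mem_nhds ⟨abs_lt.1 hh, by simpa using hx⟩

theorem differentiableAt_fst {E F : Type*} [NormedAddCommGroup E] [NormedSpace ℝ E]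
    [NormedAddCommGroup F] [NormedSpace ℝ F] {f : ℝ → E → F} {h : ℝ} {x : E} {s : Set (ℝ × E)}
    (hf : ContDiffOn ℝ ∞ (fun p : ℝ × E => f p.1 p.2) s) (hs : s ∈ nhds (h, x)) :
    DifferentiableAt ℝ (fun s => f s x) h := by
  have h1 := (hf.contDiffAt hs).differentiableAt (by simp)
  exact h1.comp (f := fun s : ℝ => (s, x)) h (by fun_prop)

theorem differentiableAt_snd {E F : Type*} [NormedAddCommGroup E] [NormedSpace ℝ E]
    [NormedAddCommGroup F] [NormedSpace ℝ F] {f : ℝ → E → F} {h : ℝ} {x : E} {s : Set (ℝ × E)}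
    (hf : ContDiffOn ℝ ∞ (fun p : ℝ × E => f p.1 p.2) s) (hs : s ∈ nhds (h, x)) :
    DifferentiableAt ℝ (f h) x := by
  have h1 := (hf.contDiffAt hs).differentiableAt (by simp)
  exact h1.comp (f := fun y : E => (h, y)) x (by fun_prop)

theorem stage_mem_skew (H : IsScheme α R h₀ Z φ) {h : ℝ} {x : State N} (hh : |h| < h₀)
    (hx : ‖x‖ < R) : toAmb N (Z h x) ∈ skew N :=
  toAmb_mem_skew.2 (H.skew_stage hh hx)

/-- The derivatives of a step at the starting point and at the end point, in terms of the derivative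
of the stage. -/
theorem exists_dmid (H : IsScheme α R h₀ Z φ) {h : ℝ} {x : State N} (hh : |h| < h₀) (hx : ‖x‖ < R)
    (δ : State N) : ∃ ζ ∈ skew N,
      emb N δ = dmid (genMap N α) h (toAmb N (Z h x)) ζ ∧
      emb N (fderiv ℝ (φ h) x δ) = dmid (genMap N α) (-h) (toAmb N (Z h x)) ζ := by
  have hn := H.mem_nhds hh hx
  have dZ := (differentiableAt_snd H.smooth_stage hn).hasFDerivAt
  have dφ := (differentiableAt_snd H.smooth hn).hasFDerivAt
  have hball : ∀ᶠ y in nhds x, ‖y‖ < R := by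
    have := Metric.isOpen_ball.mem_nhds (show x ∈ Metric.ball (0 : State N) R by simpa using hx)
    filter_upwards [this] with y hy
    simpa using hy
  have dT : HasFDerivAt (fun y => toAmb N (Z h y))
      ((toAmbL N).toContinuousLinearMap.comp (fderiv ℝ (Z h) x)) x := by
    have := (toAmbL N).toContinuousLinearMap.hasFDerivAt.comp x dZ
    refine this.congr_of_eventuallyEq (Filter.Eventually.of_forall fun y => ?_)
    exact (toAmbL_apply _).symm
  have d1 := (hasFDerivAt_mid (genMap N α) h _).comp x dT
  have d2 := (hasFDerivAt_mid (genMap N α) (-h) _).comp x dT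
  have e1 : HasFDerivAt (fun y => emb N y) (emb N) x := (emb N).hasFDerivAt
  have e2 := (emb N).hasFDerivAt.comp x dφ
  have u1 := e1.unique (d1.congr_of_eventuallyEq
    (by filter_upwards [hball] with y hy using H.start hh hy))
  have u2 := e2.unique (d2.congr_of_eventuallyEq
    (by filter_upwards [hball] with y hy using H.target hh hy))
  refine ⟨toAmb N (fderiv ℝ (Z h) x δ), ?_, ?_, ?_⟩
  · have hline : HasDerivAt (fun t : ℝ => x + t • δ) δ 0 := by
      simpa using ((hasDerivAt_id (0 : ℝ)).smul_const δ).const_add x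
    have hl : HasDerivAt (fun t : ℝ => toAmb N (Z h (x + t • δ)))
        (toAmb N (fderiv ℝ (Z h) x δ)) 0 := by
      refine (HasFDerivAt.comp_hasDerivAt_of_eq (0 : ℝ) dT hline (by simp)).congr_deriv ?_
      exact toAmbL_apply _
    have hball' : ∀ᶠ t in nhds (0 : ℝ), ‖x + t • δ‖ < R := by
      have : Filter.Tendsto (fun t : ℝ => x + t • δ) (nhds 0) (nhds x) := by
        simpa using hline.continuousAt.tendsto
      exact this.eventually hball
    exact mem_skew_of_hasDerivAt hl
      (by filter_upwards [hball'] with t ht using H.stage_mem_skew hh ht)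
  · have := congrArg (fun f => f δ) u1
    simpa [toAmbL_apply] using this
  · have := congrArg (fun f => f δ) u2
    simpa [toAmbL_apply] using this

/-- Covectors that correspond to each other at the starting point and at the end point of a step
have the same bracket. -/
theorem pairing_bracket_eq (H : IsScheme α R h₀ Z φ) {h : ℝ} {x : State N} (hh : |h| < h₀)
    (hx : ‖x‖ < R) {p q P Q : Alg N}
    (hp : ∀ δ, pairing N p δ = pairing N P (fderiv ℝ (φ h) x δ))
    (hq : ∀ δ, pairing N q δ = pairing N Q (fderiv ℝ (φ h) x δ)) :
    pairing N (algBracket p q) x = pairing N (algBracket P Q) (φ h x) := by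
  have hz := H.stage_mem_skew hh hx
  have hb := (H.bijective hh (H.norm_stage hh hx).le).1
  have key : ∀ {p P : Alg N}, (∀ δ, pairing N p δ = pairing N P (fderiv ℝ (φ h) x δ)) →
      ∃ a ∈ skew N, (∀ b : Amb N, ⁅hat p, b⁆ = ⁅a, b⁆) ∧ ∀ ζ ∈ skew N,
        tau N (a * dmid (genMap N α) h (toAmb N (Z h x)) ζ)
          = tau N (hat P * dmid (genMap N α) (-h) (toAmb N (Z h x)) ζ) := by
    intro p P hp
    obtain ⟨a, ha, h1⟩ := exists_pullback α hz hb (hat P)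
    obtain ⟨p', h2, h3⟩ := exists_hat ha
    have : p' = p := pairing_left_injective fun δ => by
      obtain ⟨ζ, hζ, h4, h5⟩ := H.exists_dmid hh hx δ
      rw [h3, hp, pairing_eq, h4, h5, h1 ζ hζ]
    rw [← this]
    exact ⟨a, ha, h2, h1⟩
  obtain ⟨a, ha, h1, h2⟩ := key hp
  obtain ⟨b, hb', h3, h4⟩ := key hq
  have e := trace_bracket_eq (tau N) tau_mul_comm (genMap N α) (tau_genMap_mul α) h2 h4
    (fun p hp P hP => symm_mem_skew α h hz hp hP) ha hb' (hat_mem_skew P) (hat_mem_skew Q)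
  rw [← H.start hh hx, ← H.target hh hx] at e
  rw [pairing_eq, pairing_eq, hat_algBracket, hat_algBracket, h1, ← lie_swap, h3, lie_swap,
    tau_mul_comm, tau_mul_comm (⁅hat P, hat Q⁆), Ring.lie_def, Ring.lie_def, e]

theorem isStep (H : IsScheme α R h₀ Z φ) {h : ℝ} {x : State N} (hh : |h| < h₀) (hx : ‖x‖ < R) :
    IsStep α h (toTri x) (Z h x) (toTri (φ h x)) :=
  isStep_iff_mid.2 ⟨H.skew_stage hh hx, by rw [← emb_apply]; exact H.start hh hx,
    by rw [← emb_apply]; exact H.target hh hx⟩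

/-- The step size -h is also small, so the derivative from the stage to the end point is as
invertible as that from the stage to the starting point. -/
theorem fderiv_injective (H : IsScheme α R h₀ Z φ) {h : ℝ} {x : State N} (hh : |h| < h₀)
    (hx : ‖x‖ < R) : Function.Injective (fderiv ℝ (φ h) x) := by
  rw [injective_iff_map_eq_zero]
  intro δ hδ
  obtain ⟨ζ, -, h1, h2⟩ := H.exists_dmid hh hx δ
  have hb := (H.bijective (h := -h) (by rwa [abs_neg]) (H.norm_stage hh hx).le).1
  have : ζ = 0 := by
    apply hb
    rw [dmidL_apply, ← h2, hδ, map_zero, map_zero]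
  apply emb_injective
  rw [h1, this, map_zero, ← dmidL_apply, map_zero]

/-- Small steps of the scheme are Lie–Poisson maps. -/
theorem isLiePoissonMapOn (H : IsScheme α R h₀ Z φ) {h : ℝ} (hh : |h| < h₀) :
    IsLiePoissonMapOn (φ h) (Metric.ball 0 R) where
  orbit x hx := by
    obtain ⟨⟨y, hy, h1⟩, -⟩ := step_orbit (H.isStep hh (mem_ball_zero_iff.1 hx))
    rwa [toTri_injective hy] at h1
  symplectic x hx p q := by
    have hx := mem_ball_zero_iff.1 hx
    let e := LinearEquiv.ofInjectiveEndo (fderiv ℝ (φ h) x).toLinearMap (H.fderiv_injective hh hx)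
    have he : ∀ δ, e δ = fderiv ℝ (φ h) x δ := fun _ => rfl
    have key : ∀ p : Alg N, ∃ P : Alg N, ∀ δ, pairing N p δ = pairing N P (fderiv ℝ (φ h) x δ) := by
      intro p
      refine ⟨((pairing N).toDual (pairing_nondegenerate N)).symm
        (pairing N p ∘ₗ e.symm.toLinearMap), fun δ => ?_⟩
      rw [LinearMap.BilinForm.apply_toDual_symm_apply (hB := pairing_nondegenerate N), ← he]
      simp
    -- If p is the pull-back of P, the derivative intertwines the two coadjoint vectors. Paired with
    -- Q this is the equality of brackets for the pull-back q of Q, and the pairing is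
    -- nondegenerate.
    have key2 : ∀ {p P : Alg N}, (∀ δ, pairing N p δ = pairing N P (fderiv ℝ (φ h) x δ)) →
        fderiv ℝ (φ h) x (coad p x) = coad P (φ h x) := by
      intro p P hp
      have h1 : ∀ Q, pairing N Q (fderiv ℝ (φ h) x (coad p x) - coad P (φ h x)) = 0 := by
        intro Q
        let q := ((pairing N).toDual (pairing_nondegenerate N)).symm
          (pairing N Q ∘ₗ (fderiv ℝ (φ h) x).toLinearMap)
        have hq : ∀ δ, pairing N q δ = pairing N Q (fderiv ℝ (φ h) x δ) := fun δ =>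
          LinearMap.BilinForm.apply_toDual_symm_apply (hB := pairing_nondegenerate N) _ _
        rw [map_sub, ← hq, pairing_coad, pairing_coad, H.pairing_bracket_eq hh hx hp hq, sub_self]
      exact sub_eq_zero.1 ((pairing_nondegenerate N).2 _ h1)
    obtain ⟨P, hP⟩ := key p
    obtain ⟨Q, hQ⟩ := key q
    exact ⟨P, Q, key2 hP, key2 hQ, (H.pairing_bracket_eq hh hx hP hQ).symm⟩
  poisson F G hF hG x hx := by
    have hx := mem_ball_zero_iff.1 hx
    have dφ := differentiableAt_snd H.smooth (H.mem_nhds hh hx)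
    have key : ∀ F : State N → ℝ, ContDiff ℝ ∞ F → ∀ δ, pairing N (grad (F ∘ φ h) x) δ
        = pairing N (grad F (φ h x)) (fderiv ℝ (φ h) x δ) := by
      intro F hF δ
      rw [pairing_grad, pairing_grad,
        fderiv_comp x (hF.differentiable (by simp)).differentiableAt dφ]
      rfl
    exact H.pairing_bracket_eq hh hx (key F hF) (key G hG)

end IsScheme

end Hazeltine

/-! ### The generating function of the scheme and its power series. -/

namespace FormalMultilinearSeries

variable {E F : Type*} [NormedAddCommGroup E] [NormedSpace ℝ E] [NormedAddCommGroup F]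
  [NormedSpace ℝ F] [CompleteSpace F]

/-- The truncated series converges everywhere, so it may be differentiated term by term; the k-th
coefficient of the derivative involves only the coefficient k + 1 of the series. -/
theorem fderiv_partialSum (p : FormalMultilinearSeries ℝ E F) (n : ℕ) (w : E) :
    fderiv ℝ (p.partialSum (n + 1)) w = p.derivSeries.partialSum n w := by
  let q : FormalMultilinearSeries ℝ E F := fun k => if k < n + 1 then p k else 0
  have hq0 : ∀ k, n + 1 ≤ k → q k = 0 := fun k hk => if_neg (by omega)
  have hq1 : ∀ k, k < n + 1 → q k = p k := fun k hk => if_pos hk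
  have hrad : q.radius = ⊤ :=
    q.radius_eq_top_of_forall_image_add_eq_zero (n + 1) fun m => hq0 _ (by omega)
  have hf : HasFPowerSeriesOnBall (p.partialSum (n + 1)) q 0 ⊤ := by
    refine ⟨hrad.ge, by simp, fun {y} _ => ?_⟩
    have h1 : HasSum (fun k => q k fun _ => y) (∑ k ∈ Finset.range (n + 1), q k fun _ => y) :=
      hasSum_sum_of_ne_finset_zero fun k hk => by
        rw [hq0 k (by simpa using hk), _root_.zero_apply]
    rw [zero_add, partialSum]
    have e : ∑ k ∈ Finset.range (n + 1), (p k fun _ => y)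
        = ∑ k ∈ Finset.range (n + 1), q k fun _ => y :=
      Finset.sum_congr rfl fun k hk => by rw [hq1 k (Finset.mem_range.1 hk)]
    rw [e]
    exact h1
  have h2 := hf.fderiv.hasSum (y := w) (by simp)
  rw [zero_add] at h2
  have h3 : HasSum (fun k => q.derivSeries k fun _ => w)
      (∑ k ∈ Finset.range n, q.derivSeries k fun _ => w) :=
    hasSum_sum_of_ne_finset_zero fun k hk => by
      rw [q.derivSeries_eq_zero (hq0 _ (by simpa using hk)), _root_.zero_apply]
  rw [h2.unique h3, partialSum]
  refine Finset.sum_congr rfl fun k hk => ?_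
  have h4 : q (1 + k) = p (1 + k) := hq1 _ (by have := Finset.mem_range.1 hk; omega)
  simp only [derivSeries, changeOriginSeries, changeOriginSeriesTerm, h4,
    ContinuousLinearMap.compFormalMultilinearSeries_apply]

end FormalMultilinearSeries

namespace Midpoint

open Filter Asymptotics

variable {A : Type*} [NormedRing A] [NormedAlgebra ℝ A] [FiniteDimensional ℝ A]
  (τ : A →ₗ[ℝ] ℝ) (L : A →ₗ[ℝ] A)

omit [FiniteDimensional ℝ A] in
theorem dmidL_zero (h : ℝ) : dmidL L h (0 : A) = LinearMap.id := by
  ext ζ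
  simp [dmid]

/-- The quadratic form `τ (L z * z) / 2`. -/
def quad (z : A) : ℝ := 1 / 2 * τ (L z * z)

theorem contDiff_quad {n : WithTop ℕ∞} : ContDiff ℝ n (quad τ L) := by
  have hL : ContDiff ℝ n fun z : A => L z := (LinearMap.toContinuousLinearMap L).contDiff
  have h1 : ContDiff ℝ n fun z : A => L z * z := hL.mul contDiff_id
  have h2 : ContDiff ℝ n fun z : A => τ (L z * z) :=
    (LinearMap.toContinuousLinearMap τ).contDiff.comp h1
  exact contDiff_const.mul h2

/-- The quadratic form `quad` as a continuous multilinear map. -/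
def quadMul : A [×2]→L[ℝ] ℝ :=
  (1 / 2 : ℝ) • (LinearMap.toContinuousLinearMap τ).compContinuousMultilinearMap
    ((ContinuousMultilinearMap.mkPiAlgebraFin ℝ 2 A).compContinuousLinearMap
      ![LinearMap.toContinuousLinearMap L, ContinuousLinearMap.id ℝ A])

theorem quadMul_apply (z : A) : quadMul τ L (fun _ => z) = quad τ L z := by
  simp [quadMul, quad, ContinuousMultilinearMap.mkPiAlgebraFin_apply, List.ofFn_succ]

theorem isBigO_linear {E F : Type*} [NormedAddCommGroup E] [NormedSpace ℝ E]
    [FiniteDimensional ℝ E] [NormedAddCommGroup F] [NormedSpace ℝ F] (T : E →ₗ[ℝ] F) {X : Type*}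
    (l : Filter X) (f : X → E) : (fun x => T (f x)) =O[l] f :=
  (LinearMap.toContinuousLinearMap T).isBigO_comp f l

theorem isBigO_quad : (quad τ L) =O[nhds 0] fun z => ‖z‖ ^ 2 := by
  have hz : (fun z : A => z) =O[nhds 0] fun z => ‖z‖ := (isBigO_refl _ _).norm_right
  have hL : (fun z : A => L z) =O[nhds 0] fun z => ‖z‖ := (isBigO_linear L _ _).trans hz
  refine ((((isBigO_linear τ _ _).trans (hL.mul hz)).const_mul_left (1 / 2))).congr_right fun z => ?_
  ring

/-- The cubic part of the difference is, up to a constant, τ(Lz·[Lz, z]), the trace of a commutator,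
and vanishes. This is the source of κ 1 = 0, hence of the order two. -/
theorem isBigO_quad_mid (hτ : ∀ a b, τ (a * b) = τ (b * a)) (hL : ∀ a b, τ (L a * b) = τ (a * L b)) :
    (fun z => quad τ L z - quad τ L (mid L 1 z)) =O[nhds 0] fun z => ‖z‖ ^ 4 := by
  have e : ∀ z, quad τ L z - quad τ L (mid L 1 z)
      = 2 * τ ((1 / 2 : ℝ) • L z * ((1 / 2 : ℝ) • L z * z * (1 / 2 : ℝ) • L z))
        - 1 / 2 * τ (L ((1 / 2 : ℝ) • L z * z - z * (1 / 2 : ℝ) • L z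
            - (1 / 2 : ℝ) • L z * z * (1 / 2 : ℝ) • L z) * ((1 / 2 : ℝ) • L z * z
            - z * (1 / 2 : ℝ) • L z - (1 / 2 : ℝ) • L z * z * (1 / 2 : ℝ) • L z)) := by
    intro z
    have h1 : mid L 1 z = z + ((1 / 2 : ℝ) • L z * z - z * (1 / 2 : ℝ) • L z
            - (1 / 2 : ℝ) • L z * z * (1 / 2 : ℝ) • L z) := by
      rw [mid]
      simp only [add_mul, mul_sub, one_mul, mul_one]
      abel
    have h2 : τ (L z * ((1 / 2 : ℝ) • L z * z - z * (1 / 2 : ℝ) • L z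
            - (1 / 2 : ℝ) • L z * z * (1 / 2 : ℝ) • L z))
        = -(2 * τ ((1 / 2 : ℝ) • L z * ((1 / 2 : ℝ) • L z * z * (1 / 2 : ℝ) • L z))) := by
      simp only [mul_sub, map_sub, mul_smul_comm, smul_mul_assoc, map_smul, smul_eq_mul]
      have : τ (L z * (z * L z)) = τ (L z * (L z * z)) := by
        rw [hτ (L z) (z * L z), mul_assoc, hτ z, mul_assoc]
      rw [this]; ring
    generalize (1 / 2 : ℝ) • L z * z - z * (1 / 2 : ℝ) • L z
            - (1 / 2 : ℝ) • L z * z * (1 / 2 : ℝ) • L z = a at *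
    have h3 : τ (L a * z) = τ (L z * a) := by rw [hL, hτ]
    rw [h1, quad, quad]
    simp only [map_add, add_mul, mul_add, h3, h2]
    ring
  have hz : (fun z : A => z) =O[nhds 0] fun z => ‖z‖ := (isBigO_refl _ _).norm_right
  have h1z : (fun z : A => ‖z‖) =O[nhds 0] fun _ => (1 : ℝ) :=
    continuous_norm.continuousAt.isBigO_one ℝ
  have hm : (fun z : A => (1 / 2 : ℝ) • L z) =O[nhds 0] fun z => ‖z‖ :=
    ((isBigO_linear L _ _).trans hz).const_smul_left (1 / 2 : ℝ)
  have hmz := hm.mul hz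
  have hmzm := hmz.mul hm
  have ha := (hmz.sub (hz.mul hm)).sub (hmzm.trans
    (((isBigO_refl (fun z : A => ‖z‖ * ‖z‖) _).mul h1z).congr_right fun z => mul_one _))
  have hLa := (isBigO_linear L (nhds 0) _).trans ha
  have t1 := ((isBigO_linear τ (nhds 0) _).trans (hm.mul hmzm)).const_mul_left 2
  have t2 := ((isBigO_linear τ (nhds 0) _).trans (hLa.mul ha)).const_mul_left (1 / 2)
  refine (((t1.congr_right fun z => ?_).sub (t2.congr_right fun z => ?_)).congr_left
    fun z => (e z).symm)
  · ring
  · ring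

/-- Near `0`, the value of the Hamiltonian at the stage is an analytic function of the end point of a
step, and its derivative is the derivative of the Hamiltonian at the stage. -/
theorem exists_generating_function (hτ : ∀ a b, τ (a * b) = τ (b * a))
    (hL : ∀ a b, τ (L a * b) = τ (a * L b)) :
    ∃ k : A → ℝ, AnalyticAt ℝ k 0 ∧ (fun w => k w - quad τ L w) =O[nhds 0] (fun w => ‖w‖ ^ 4) ∧
      ∀ᶠ z in nhds (0 : A), DifferentiableAt ℝ k (mid L 1 z) ∧
        ∀ ζ, fderiv ℝ k (mid L 1 z) (dmid L 1 z ζ) = τ (L z * ζ) := by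
  have hm0 : mid L 1 (0 : A) = 0 := by simp [mid]
  have hc : ContDiff ℝ ω fun z : A => mid L 1 z := ContDiff.mid L contDiff_const contDiff_id
  have hd : HasFDerivAt (fun z : A => mid L 1 z)
      ((ContinuousLinearEquiv.refl ℝ A : A ≃L[ℝ] A) : A →L[ℝ] A) 0 := by
    refine (hasFDerivAt_mid L 1 0).congr_fderiv ?_
    rw [dmidL_zero]
    rfl
  have hca : ContDiffAt ℝ ω (fun z : A => mid L 1 z) 0 := hc.contDiffAt
  have hs := hca.hasStrictFDerivAt' hd (by simp)
  have hinv := hca.to_localInverse hd (by simp)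
  -- Y recovers the stage from the end point, so quad ∘ Y is the energy of the stage as a function
  -- of the end point. It is analytic by the analytic inverse function theorem, which is available
  -- because `mid` is polynomial.
  let Y : A → A := hca.localInverse hd (by simp)
  have hY : ContDiffAt ℝ ω Y 0 := by
    have : ContDiffAt ℝ ω Y (mid L 1 0) := hinv
    rwa [hm0] at this
  have hleft : ∀ᶠ z in nhds (0 : A), Y (mid L 1 z) = z := hs.eventually_left_inverse
  have hright : ∀ᶠ w in nhds (0 : A), mid L 1 (Y w) = w := by
    have : ∀ᶠ w in nhds (mid L 1 (0 : A)), mid L 1 (Y w) = w := hs.eventually_right_inverse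
    rwa [hm0] at this
  have hY0 : Y 0 = 0 := by
    have := hleft.self_of_nhds
    rwa [hm0] at this
  have hk : ContDiffAt ℝ ω (fun w => quad τ L (Y w)) 0 := (contDiff_quad τ L).contDiffAt.comp 0 hY
  refine ⟨fun w => quad τ L (Y w), hk.analyticAt, ?_, ?_⟩
  · have h1 : Tendsto Y (nhds 0) (nhds 0) := by
      have := hY.continuousAt.tendsto
      rwa [hY0] at this
    have h2 := (isBigO_quad_mid τ L hτ hL).comp_tendsto h1
    have h3 : Y =O[nhds 0] fun w => ‖w‖ := by
      have := (hY.differentiableAt (by simp)).isBigO_sub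
      simp only [hY0, sub_zero] at this
      exact this.norm_right
    refine (h2.trans ?_).congr' ?_ Filter.EventuallyEq.rfl
    · exact h3.norm_left.pow 4
    · filter_upwards [hright] with w hw
      simp only [Function.comp_apply, hw]
  · have h1 : Tendsto (fun z : A => mid L 1 z) (nhds 0) (nhds 0) := by
      have := hc.continuous.tendsto 0
      rwa [hm0] at this
    have h2 : ∀ᶠ w in nhds (0 : A), DifferentiableAt ℝ (fun w => quad τ L (Y w)) w := by
      filter_upwards [hk.analyticAt.eventually_analyticAt] with w hw using hw.differentiableAt
    filter_upwards [h1.eventually h2, hleft.eventually_nhds] with z hz hz'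
    refine ⟨hz, fun ζ => ?_⟩
    have h3 := hz.hasFDerivAt.comp z (hasFDerivAt_mid L 1 z)
    have h4 := (Hazeltine.hasFDerivAt_quadratic τ hτ L hL z)
    have h5 := h3.unique (h4.congr_of_eventuallyEq (by
      filter_upwards [hz'] with z hz
      simp only [Function.comp_apply, hz, quad]))
    exact congrArg (fun f => f ζ) h5

theorem isBigO_pow_norm {A : Type*} [NormedRing A] {m n : ℕ} (h : m ≤ n) :
    (fun w : A => ‖w‖ ^ n) =O[nhds 0] fun w => ‖w‖ ^ m := by
  have h1z : (fun z : A => ‖z‖ ^ (n - m)) =O[nhds 0] fun _ => (1 : ℝ) :=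
    (continuous_norm.pow _).continuousAt.isBigO_one ℝ
  refine ((isBigO_refl (fun w : A => ‖w‖ ^ m) _).mul h1z).congr (fun w => ?_) fun w => mul_one _
  rw [← pow_add, Nat.add_sub_cancel' h]

/-- The expansion of the generating function of the midpoint scheme. -/
theorem exists_generating_series (hτ : ∀ a b, τ (a * b) = τ (b * a))
    (hL : ∀ a b, τ (L a * b) = τ (a * L b)) :
    ∃ p : FormalMultilinearSeries ℝ A ℝ,
      (∀ w, (p 0 fun _ => w) = 0 ∧ (p 1 fun _ => w) = 0 ∧ (p 2 fun _ => w) = quad τ L w ∧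
        (p 3 fun _ => w) = 0) ∧
      (∃ M ≥ 0, ∃ B ≥ 0, ∀ n, ‖p n‖ ≤ M * B ^ n) ∧
      ∃ M ≥ 0, ∃ B ≥ 0, ∃ ε > 0, ∀ z : A, ‖z‖ < ε → ∃ D : A →L[ℝ] ℝ,
        (∀ ζ, D (dmid L 1 z ζ) = τ (L z * ζ)) ∧
        ∀ n, ‖D - fderiv ℝ (p.partialSum (n + 1)) (mid L 1 z)‖ ≤ M * (B * ‖mid L 1 z‖) ^ n := by
  obtain ⟨k, ⟨p, r, hp⟩, hk, hD⟩ := exists_generating_function τ L hτ hL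
  have hO : ∀ n, (fun w => k w - p.partialSum n w) =O[nhds 0] fun w => ‖w‖ ^ n := by
    intro n
    simpa using hp.hasFPowerSeriesAt.isBigO_sub_partialSum_pow n
  have hk2 : k =O[nhds 0] fun w => ‖w‖ ^ 2 :=
    ((hk.trans (isBigO_pow_norm (by norm_num))).add (isBigO_quad τ L)).congr_left fun w => by ring
  have h0 : ∀ w, (p 0 fun _ => w) = 0 := by
    refine fun w => IsBigO.continuousMultilinearMap_apply_eq_zero ?_ w
    refine ((hk2.trans (isBigO_pow_norm (by norm_num))).sub (hO 1)).congr_left fun w => ?_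
    simp [FormalMultilinearSeries.partialSum]
  have h1 : ∀ w, (p 1 fun _ => w) = 0 := by
    refine fun w => IsBigO.continuousMultilinearMap_apply_eq_zero ?_ w
    refine (hk2.sub (hO 2)).congr_left fun w => ?_
    simp [FormalMultilinearSeries.partialSum, Finset.sum_range_succ, h0]
  have h2 : ∀ w, (p 2 fun _ => w) = quad τ L w := by
    have : ∀ w, ((p 2 - quadMul τ L) fun _ => w) = 0 := by
      refine fun w => IsBigO.continuousMultilinearMap_apply_eq_zero ?_ w
      refine ((hk.trans (isBigO_pow_norm (by norm_num))).sub (hO 3)).congr_left fun w => ?_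
      simp [FormalMultilinearSeries.partialSum, Finset.sum_range_succ, h0, h1, quadMul_apply]
    intro w
    have := this w
    rwa [_root_.sub_apply, quadMul_apply, sub_eq_zero] at this
  have h3 : ∀ w, (p 3 fun _ => w) = 0 := by
    refine fun w => IsBigO.continuousMultilinearMap_apply_eq_zero ?_ w
    refine (hk.sub (hO 4)).congr_left fun w => ?_
    simp [FormalMultilinearSeries.partialSum, Finset.sum_range_succ, h0, h1, h2]
  refine ⟨p, fun w => ⟨h0 w, h1 w, h2 w, h3 w⟩, ?_, ?_⟩
  · obtain ⟨C, B, hC, hB, h⟩ := p.le_mul_pow_of_radius_pos (hp.r_pos.trans_le hp.r_le)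
    exact ⟨C, hC.le, B, hB.le, h⟩
  · obtain ⟨r', hr'0, hr'⟩ := ENNReal.lt_iff_exists_nnreal_btwn.1 hp.r_pos
    -- The estimate is needed for the derivative of the generating function; it comes from the power
    -- series of the derivative, whose partial sums are the derivatives of partial sums.
    obtain ⟨a, ha, C, hC, happ⟩ := hp.fderiv.uniform_geometric_approx' hr'
    have hr'p : (0 : ℝ) < r' := by exact_mod_cast hr'0
    have hc : ContDiff ℝ ω fun z : A => mid L 1 z := ContDiff.mid L contDiff_const contDiff_id
    have hm0 : mid L 1 (0 : A) = 0 := by simp [mid]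
    have h4 : ∀ᶠ z in nhds (0 : A), mid L 1 z ∈ Metric.ball (0 : A) r' := by
      have := hc.continuous.tendsto 0
      rw [hm0] at this
      exact this.eventually (Metric.ball_mem_nhds _ hr'p)
    obtain ⟨ε, hε, hball⟩ := Metric.eventually_nhds_iff.1 (h4.and hD)
    refine ⟨C, hC.le, a / r', div_nonneg ha.1.le hr'p.le, ε, hε, fun z hz => ?_⟩
    obtain ⟨h5, -, h6⟩ := hball (y := z) (by simpa using hz)
    refine ⟨fderiv ℝ k (mid L 1 z), h6, fun n => ?_⟩
    have h7 := happ _ h5 n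
    rw [zero_add] at h7
    rw [FormalMultilinearSeries.fderiv_partialSum]
    refine h7.trans (le_of_eq ?_)
    congr 2
    ring

/-- The scheme is the flow of a time-dependent Hamiltonian: its derivative at a point `mid L (-s) z`
and the expansion of this derivative in powers of `s`. -/
theorem exists_expansion (hτ : ∀ a b, τ (a * b) = τ (b * a))
    (hL : ∀ a b, τ (L a * b) = τ (a * L b)) :
    ∃ q : ∀ d : ℕ, A [×(d + 2)]→L[ℝ] ℝ,
      (∀ w, (q 0 fun _ => w) = quad τ L w) ∧ (∀ w, (q 1 fun _ => w) = 0) ∧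
      (∃ M ≥ 0, ∃ B ≥ 0, ∀ d, ‖q d‖ ≤ M * B ^ d) ∧
      ∀ ρ > 0, ∃ M ≥ 0, ∃ B ≥ 0, ∃ h₁ > 0, ∀ (s : ℝ) (z : A), s ≠ 0 → |s| < h₁ → ‖z‖ ≤ ρ →
        ‖mid L (-s) z‖ ≤ ρ → ∃ D : A →L[ℝ] ℝ, (∀ ζ, D (dmid L (-s) z ζ) = τ (L z * ζ)) ∧
          ∀ n, ‖D - fderiv ℝ (fun w => ∑ d ∈ Finset.range n, s ^ d * q d fun _ => w)
            (mid L (-s) z)‖ ≤ M * (B * |s|) ^ n := by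
  obtain ⟨p, hp, ⟨M, hM, B, hB, hMB⟩, M', hM', B', hB', ε, hε, hD⟩ :=
    exists_generating_series τ L hτ hL
  -- Since mid L 1 (-sz) = -s mid L (-s) z, the energy of the stage z is s⁻² k(-sy) at the end point
  -- y. The terms of degree 0 and 1 of k vanish, and the term of degree d + 2 becomes (-s)ᵈ
  -- p_{d+2}(y).
  refine ⟨fun d => (-1 : ℝ) ^ d • p (d + 2), fun w => ?_, fun w => ?_,
    ⟨M * B ^ 2, by positivity, B, hB, fun d => ?_⟩, fun ρ hρ => ?_⟩
  · simpa using (hp w).2.2.1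
  · simpa using (hp w).2.2.2
  · rw [norm_smul]
    refine le_trans (le_of_eq ?_) ((hMB (d + 2)).trans (le_of_eq (by ring)))
    simp
  · refine ⟨M' * (B' * ρ), by positivity, B' * ρ, by positivity, ε / ρ, by positivity,
      fun s z hs hs1 hz hy => ?_⟩
    have hz1 : ‖(-s) • z‖ < ε := by
      rw [norm_smul, norm_neg, Real.norm_eq_abs]
      calc |s| * ‖z‖ ≤ |s| * ρ := by gcongr
        _ < ε := (lt_div_iff₀ hρ).1 hs1
    obtain ⟨D, h1, h2⟩ := hD _ hz1
    have e1 : mid L 1 ((-s) • z) = (-s) • mid L (-s) z := by rw [mid_smul, one_mul]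
    refine ⟨(-s⁻¹) • D, fun ζ => ?_, fun n => ?_⟩
    · have h3 := h1 ((-s) • ζ)
      rw [dmid_smul, one_mul, map_smul, map_smul, smul_mul_smul_comm, map_smul, smul_eq_mul,
        smul_eq_mul] at h3
      have h4 : D (dmid L (-s) z ζ) = -s * τ (L z * ζ) := by
        have : -s ≠ 0 := neg_ne_zero.2 hs
        apply mul_left_cancel₀ this
        rw [h3]; ring
      rw [_root_.smul_apply, h4, smul_eq_mul]
      field_simp
    · set y := mid L (-s) z
      have e2 : (fun w => ∑ d ∈ Finset.range n, s ^ d * ((-1 : ℝ) ^ d • p (d + 2)) fun _ => w)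
          = fun w => (s ^ 2)⁻¹ * p.partialSum (n + 2) ((-s) • w) := by
        funext w
        rw [FormalMultilinearSeries.partialSum, Finset.sum_range_succ', Finset.sum_range_succ',
          zero_add, (hp _).1, (hp _).2.1, add_zero, add_zero, Finset.mul_sum]
        refine Finset.sum_congr rfl fun d _ => ?_
        rw [_root_.smul_apply, add_assoc,
          show (fun _ : Fin (d + (1 + 1)) => (-s) • w) = fun i => (fun _ => -s) i • (fun _ => w) i
            from rfl, ContinuousMultilinearMap.map_smul_univ]
        simp only [Finset.prod_const, Finset.card_univ, Fintype.card_fin, smul_eq_mul]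
        rw [neg_pow s, pow_add, pow_add s]
        norm_num
        field_simp
      have hpd : DifferentiableAt ℝ (p.partialSum (n + 2)) ((-s) • y) := by
        refine DifferentiableAt.fun_sum fun k _ => ?_
        have : ContDiff ℝ ω fun w => p k fun _ => w :=
          (p k).contDiff.comp (contDiff_pi.2 fun _ => contDiff_id)
        exact (this.differentiable (by simp)).differentiableAt
      have e3 : HasFDerivAt (fun w => (s ^ 2)⁻¹ * p.partialSum (n + 2) ((-s) • w))
          ((-s⁻¹) • fderiv ℝ (p.partialSum (n + 2)) ((-s) • y)) y := by
        have := (hpd.hasFDerivAt.comp y ((hasFDerivAt_id y).const_smul (-s))).const_mul (s ^ 2)⁻¹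
        refine this.congr_fderiv ?_
        ext ζ
        simp only [_root_.smul_apply, ContinuousLinearMap.comp_apply,
          ContinuousLinearMap.id_apply, map_smul, smul_eq_mul]
        field_simp
      have h3 := h2 (n + 1)
      rw [e1] at h3
      have e4 : (-s⁻¹) • D - (-s⁻¹) • fderiv ℝ (p.partialSum (n + 2)) ((-s) • y)
          = (-s⁻¹) • (D - fderiv ℝ (p.partialSum (n + 2)) ((-s) • y)) := by
        ext ζ
        simp only [_root_.smul_apply, _root_.sub_apply, smul_eq_mul]
        ring
      rw [e2, e3.fderiv, e4, norm_smul, norm_neg, norm_inv, Real.norm_eq_abs]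
      have hs0 : 0 < |s| := abs_pos.2 hs
      calc _ ≤ |s|⁻¹ * (M' * (B' * ‖(-s) • y‖) ^ (n + 1)) := by gcongr
        _ ≤ |s|⁻¹ * (M' * (B' * (|s| * ρ)) ^ (n + 1)) := by
          rw [norm_smul, norm_neg, Real.norm_eq_abs]; gcongr
        _ = _ := by rw [pow_succ]; field_simp

end Midpoint

namespace Hazeltine

open Midpoint

variable {N : ℕ}

/-! ### The scheme as the flow of a time-dependent Hamiltonian -/

theorem hasDerivAt_one_add {A : Type*} [NormedRing A] [NormedAlgebra ℝ A] [FiniteDimensional ℝ A]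
    (L : A →ₗ[ℝ] A) {z : ℝ → A} {z' : A} {s : ℝ} (hz : HasDerivAt z z' s) :
    HasDerivAt (fun t => (t / 2) • L (z t)) ((1 / 2 : ℝ) • L (z s) + (s / 2) • L z') s := by
  have h1 : HasDerivAt (fun t => L (z t)) (L z') s :=
    (LinearMap.toContinuousLinearMap L).hasFDerivAt.comp_hasDerivAt s hz
  have h2 : HasDerivAt (fun t : ℝ => t / 2) (1 / 2) s := (hasDerivAt_id s).div_const 2
  refine (h2.smul h1).congr_deriv ?_
  rw [add_comm]

theorem exists_inverse (α c : ℝ) {z : Amb N} (hz : z ∈ skew N) :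
    ∃ ui vi : Amb N, ui * (1 + c • genMap N α z) = 1 ∧ (1 + c • genMap N α z) * ui = 1 ∧
      vi * (1 - c • genMap N α z) = 1 ∧ (1 - c • genMap N α z) * vi = 1 ∧ conj ui = vi ∧
      conj vi = ui := by
  have hm : c • genMap N α z ∈ skew N := Submodule.smul_mem _ _ (genMap_mem_skew α hz)
  obtain ⟨⟨u, ui, hu, hu'⟩, rfl⟩ := isUnit_one_add hm
  have hc := mem_skew.1 hm
  have e1 := congrArg conj hu
  have e2 := congrArg conj hu'
  simp only [conj_mul, conj_add, conj_one, hc, ← sub_eq_add_neg] at e1 e2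
  exact ⟨ui, conj ui, hu', hu, e1, e2, rfl, conj_conj ui⟩

namespace IsScheme

variable {α R h₀ : ℝ} {Z : ℝ → State N → Tri N} {φ : ℝ → State N → State N}

/-- The velocity of the scheme as a function of the step size is a Hamiltonian vector field. -/
theorem exists_hasDerivAt (H : IsScheme α R h₀ Z φ) {s : ℝ} {x : State N} (hs : |s| < h₀)
    (hx : ‖x‖ < R) {D : Amb N →L[ℝ] ℝ} (hD : ∀ ζ, D (dmid (genMap N α) (-s) (toAmb N (Z s x)) ζ)
      = tau N (genMap N α (toAmb N (Z s x)) * ζ)) :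
    ∃ v, HasDerivAt (fun t => φ t x) v s ∧
      ∀ e : Alg N, pairing N e v = D (emb N (coad e (φ s x))) := by
  have hn := H.mem_nhds hs hx
  have dZ := (differentiableAt_fst H.smooth_stage hn).hasDerivAt
  have dφ := (differentiableAt_fst H.smooth hn).hasDerivAt
  set Z' := deriv (fun t => Z t x) s
  set v := deriv (fun t => φ t x) s
  have hnear : ∀ᶠ t in nhds s, |t| < h₀ := by
    filter_upwards [isOpen_Ioo.mem_nhds (abs_lt.1 hs)] with t ht using abs_lt.2 ht
  have dz : HasDerivAt (fun t => toAmb N (Z t x)) (toAmb N Z') s := by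
    refine (((toAmbL N).toContinuousLinearMap.hasFDerivAt.comp_hasDerivAt s
      dZ).congr_of_eventuallyEq (Filter.Eventually.of_forall fun t => ?_)).congr_deriv ?_
    · exact (toAmbL_apply _).symm
    · exact toAmbL_apply _
  have hz := H.stage_mem_skew hs hx
  have hz' : toAmb N Z' ∈ skew N := mem_skew_of_hasDerivAt dz
    (by filter_upwards [hnear] with t ht using H.stage_mem_skew ht hx)
  obtain ⟨ui, vi, hu, hu', hv, hv', hcu, hcv⟩ := exists_inverse α (s / 2) hz
  have dm := hasDerivAt_one_add (genMap N α) dz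
  have dstart := ((dm.const_add 1).mul dz).mul (dm.const_sub 1)
  have dend := ((dm.const_sub 1).mul dz).mul (dm.const_add 1)
  have hstart : HasDerivAt (fun _ : ℝ => emb N x) 0 s := hasDerivAt_const _ _
  have hend : HasDerivAt (fun t => emb N (φ t x)) (emb N v) s :=
    (emb N).hasFDerivAt.comp_hasDerivAt s dφ
  have e1 := hstart.unique (dstart.congr_of_eventuallyEq
    (by filter_upwards [hnear] with t ht using H.start ht hx))
  have e2 := hend.unique (dend.congr_of_eventuallyEq
    (by filter_upwards [hnear] with t ht using (H.target ht hx).trans (mid_neg _ _ _)))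
  have ey := (H.target hs hx).trans (mid_neg _ _ _)
  set z := toAmb N (Z s x)
  set m := (1 / 2 : ℝ) • genMap N α z + (s / 2) • genMap N α (toAmb N Z') with hm
  have hmc : conj m = -m := mem_skew.1 (Submodule.add_mem _
    (Submodule.smul_mem _ _ (genMap_mem_skew α hz)) (Submodule.smul_mem _ _ (genMap_mem_skew α hz')))
  have hxz : m * z * (1 - (s / 2) • genMap N α z)
      + (1 + (s / 2) • genMap N α z) * toAmb N Z' * (1 - (s / 2) • genMap N α z)
      - (1 + (s / 2) • genMap N α z) * z * m = 0 := by
    have e5 : (0 : Amb N) = (m * z + (1 + (s / 2) • genMap N α z) * toAmb N Z')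
        * (1 - (s / 2) • genMap N α z) + (1 + (s / 2) • genMap N α z) * z * -m := e1
    rw [e5, add_mul (m * z), mul_neg, sub_eq_add_neg]
  have h2 : (1 + (s / 2) • genMap N α z) + (1 - (s / 2) • genMap N α z) = 2 := by
    rw [add_add_sub_cancel, one_add_one_eq_two]
  have huv : (1 + (s / 2) • genMap N α z) * (1 - (s / 2) • genMap N α z)
      = (1 - (s / 2) • genMap N α z) * (1 + (s / 2) • genMap N α z) := by
    generalize (s / 2) • genMap N α z = l
    noncomm_ring
  have e3 := deriv_endpoint hu hu' hv hv' huv h2 hxz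
  set κ := 2 * (ui * m * vi) with hκ
  have hκs : κ ∈ skew N := by
    rw [mem_skew, hκ, ← one_add_one_eq_two]
    simp only [conj_mul, conj_add, conj_one, hcu, hcv, hmc]
    noncomm_ring
  -- The derivative of the end point with respect to the stage is onto, because -s is also a small
  -- step size. So D and κ need to be compared only on its values, where `trace_dmid_endpoint`
  -- applies.
  have hκD : ∀ w, D w = tau N (κ * w) := by
    intro w
    obtain ⟨ζ, rfl⟩ := (H.bijective (h := -s) (by rwa [abs_neg]) (H.norm_stage hs hx).le).2 w
    rw [dmidL_apply, hD, trace_dmid_endpoint (tau N) tau_mul_comm (genMap N α) (tau_genMap_mul α)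
      hu hu' hv hv' hxz]
  obtain ⟨p, hp1, hp2⟩ := exists_hat hκs
  have e4 : v = coad p (φ s x) := by
    apply emb_injective
    rw [emb_coad, ← lie_swap, hp1, lie_swap, ey, Ring.lie_def, ← e3]
    have e5 : emb N v = (-m * z + (1 - (s / 2) • genMap N α z) * toAmb N Z')
        * (1 + (s / 2) • genMap N α z) + (1 - (s / 2) • genMap N α z) * z * m := e2
    rw [e5, add_mul (-m * z), neg_mul, neg_mul]
  refine ⟨v, dφ, fun e => ?_⟩
  rw [e4, pairing_coad, algBracket_swap, map_neg, LinearMap.neg_apply, ← pairing_coad, hp2, hκD,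
    neg_neg]

end IsScheme

end Hazeltine

/-! ### Multilinear forms as polynomials in coordinates. -/

namespace PolyPoisson

open MvPolynomial

variable {ι : Type*} [Fintype ι]

omit [Fintype ι] in
theorem pnorm_C (r a : ℝ) : pnorm r (C a : MvPolynomial ι ℝ) = |a| := by
  rw [← monomial_zero', pnorm_monomial]
  simp

omit [Fintype ι] in
theorem pnorm_prod_X_le {r : ℝ} (hr : 0 ≤ r) {n : ℕ} (f : Fin n → ι) :
    pnorm r (∏ k, X (f k) : MvPolynomial ι ℝ) ≤ r ^ n := by
  induction n with
  | zero =>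
    have := pnorm_C (ι := ι) r 1
    rw [C_1, abs_one] at this
    simp [this]
  | succ n ih =>
    rw [Fin.prod_univ_succ, pow_succ']
    refine (pnorm_mul_le hr _ _).trans ?_
    rw [pnorm_X]
    exact mul_le_mul_of_nonneg_left (ih fun k => f k.succ) hr

theorem contDiff_eval {n : WithTop ℕ∞} (P : MvPolynomial ι ℝ) :
    ContDiff ℝ n fun y : ι → ℝ => eval y P := by
  induction P using MvPolynomial.induction_on with
  | C a => simpa using contDiff_const
  | add p q hp hq => simpa using hp.add hq
  | mul_X p i hp => simpa using hp.mul (contDiff_apply ℝ ℝ i)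

variable {A : Type*} [NormedAddCommGroup A] [NormedSpace ℝ A]

/-- The homogeneous polynomial given by a multilinear form in the coordinates with respect to a
family of vectors. -/
def ofMul {n : ℕ} (q : A [×n]→L[ℝ] ℝ) (b : ι → A) : MvPolynomial ι ℝ :=
  ∑ f : Fin n → ι, C (q fun k => b (f k)) * ∏ k, X (f k)

theorem eval_ofMul {n : ℕ} (q : A [×n]→L[ℝ] ℝ) (b : ι → A) (y : ι → ℝ) :
    eval y (ofMul q b) = q fun _ => ∑ i, y i • b i := by
  classical
  rw [ofMul, ContinuousMultilinearMap.map_sum, map_sum]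
  refine Finset.sum_congr rfl fun f _ => ?_
  rw [ContinuousMultilinearMap.map_smul_univ, map_mul, eval_C, map_prod, smul_eq_mul, mul_comm]
  simp

theorem totalDegree_ofMul_le {n : ℕ} (q : A [×n]→L[ℝ] ℝ) (b : ι → A) :
    (ofMul q b).totalDegree ≤ n := by
  refine totalDegree_finsetSum_le fun f _ => (totalDegree_mul _ _).trans ?_
  rw [totalDegree_C, zero_add]
  refine (totalDegree_finsetProd _ _).trans ?_
  simp

theorem pnorm_ofMul_le {r : ℝ} (hr : 0 ≤ r) {n : ℕ} (q : A [×n]→L[ℝ] ℝ) (b : ι → A) :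
    pnorm r (ofMul q b) ≤ ‖q‖ * (∑ i, ‖b i‖ * r) ^ n := by
  rw [Fintype.sum_pow, Finset.mul_sum]
  refine (pnorm_sum_le hr _ _).trans (Finset.sum_le_sum fun f _ => ?_)
  refine (pnorm_mul_le hr _ _).trans ?_
  rw [pnorm_C, Finset.prod_mul_distrib, ← mul_assoc]
  refine mul_le_mul (q.le_opNorm _) ?_ (pnorm_nonneg hr _) (by positivity)
  simpa using pnorm_prod_X_le hr f

end PolyPoisson

namespace Hazeltine

open PolyPoisson MvPolynomial

variable {N : ℕ}

/-! ### Polynomial coordinates -/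

/-- The indices of the coordinates of the phase space. -/
abbrev Idx (N : ℕ) := Fin (Module.finrank ℝ (State N))

/-- The basis of the phase space that belongs to the coordinates. -/
def base (i : Idx N) : State N := (coords N).symm (Pi.single i 1)

theorem sum_coords_smul {E : Type*} [AddCommGroup E] [Module ℝ E] (T : State N →ₗ[ℝ] E)
    (x : State N) : ∑ i, coords N x i • T (base i) = T x := by
  have h : ∑ i, coords N x i • base i = x := by
    apply (coords N).injective
    rw [map_sum]
    ext j
    simp [base, Pi.single_apply]
  conv_rhs => rw [← h, map_sum]
  simp

/-- The coordinates as elements of the Lie algebra. -/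
def covec (i : Idx N) : Alg N :=
  ((pairing N).toDual (pairing_nondegenerate N)).symm
    (LinearMap.proj i ∘ₗ (coords N).toLinearEquiv.toLinearMap)

theorem pairing_covec (i : Idx N) (x : State N) : pairing N (covec i) x = coords N x i :=
  LinearMap.BilinForm.apply_toDual_symm_apply (hB := pairing_nondegenerate N) _ _

/-- The linear polynomial of an element of the Lie algebra. -/
def linPoly (p : Alg N) : MvPolynomial (Idx N) ℝ := ∑ k, C (pairing N p (base k)) * X k

theorem eval_linPoly (p : Alg N) (x : State N) : eval (coords N x) (linPoly p) = pairing N p x := by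
  rw [← sum_coords_smul (pairing N p) x, linPoly, map_sum]
  refine Finset.sum_congr rfl fun k _ => ?_
  rw [map_mul, eval_C, eval_X, smul_eq_mul, mul_comm]

theorem totalDegree_linPoly_le (p : Alg N) : (linPoly p).totalDegree ≤ 1 := by
  refine totalDegree_finsetSum_le fun k _ => (totalDegree_mul _ _).trans ?_
  rw [totalDegree_C, zero_add]
  exact (totalDegree_X k).le

/-- The Lie–Poisson bivector in coordinates. -/
def bivector (N : ℕ) (i j : Idx N) : MvPolynomial (Idx N) ℝ :=
  linPoly (algBracket (covec i) (covec j))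

/-- The function on the phase space given by a polynomial in the coordinates. -/
def polyFun (P : MvPolynomial (Idx N) ℝ) (x : State N) : ℝ := eval (coords N x) P

theorem contDiff_polyFun {n : WithTop ℕ∞} (P : MvPolynomial (Idx N) ℝ) :
    ContDiff ℝ n (polyFun P) :=
  (contDiff_eval P).comp (coords N).contDiff

theorem fderiv_polyFun (P : MvPolynomial (Idx N) ℝ) (x δ : State N) :
    fderiv ℝ (polyFun P) x δ = ∑ i, eval (coords N x) (pderiv i P) * coords N δ i := by
  have hline : HasDerivAt (fun t : ℝ => x + t • δ) δ 0 := by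
    simpa using ((hasDerivAt_id (0 : ℝ)).smul_const δ).const_add x
  have h1 : HasDerivAt (fun t : ℝ => polyFun P (x + t • δ)) (fderiv ℝ (polyFun P) x δ) 0 :=
    HasFDerivAt.comp_hasDerivAt_of_eq (0 : ℝ)
      (((contDiff_polyFun (n := 1) P).differentiable (by simp)).differentiableAt.hasFDerivAt) hline
      (by simp)
  have h2 : ∀ i, HasDerivWithinAt (fun t : ℝ => coords N (x + t • δ) i) (coords N δ i) univ 0 := by
    intro i
    have := (coords N).toContinuousLinearMap.hasFDerivAt.comp_hasDerivAt (0 : ℝ) hline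
    exact (hasDerivAt_pi.1 this i).hasDerivWithinAt
  have h3 := hasDerivWithinAt_eval h2 P
  rw [hasDerivWithinAt_univ] at h3
  refine (h1.unique h3).trans ?_
  simp

theorem eval_pb_X (i : Idx N) (P : MvPolynomial (Idx N) ℝ) (x : State N) :
    eval (coords N x) (pb (bivector N) (X i) P) = fderiv ℝ (polyFun P) x (coad (covec i) x) := by
  rw [fderiv_polyFun]
  have : pb (bivector N) (X i) P = ∑ j, bivector N i j * pderiv j P := by
    simp [pb, pderiv_X, Pi.single_apply]
  rw [this, map_sum]
  refine Finset.sum_congr rfl fun j _ => ?_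
  rw [map_mul, bivector, eval_linPoly, ← pairing_coad, pairing_covec, mul_comm]

theorem lpBracket_polyFun_X (i : Idx N) (P : MvPolynomial (Idx N) ℝ) (x : State N) :
    lpBracket (fun x => coords N x i) (polyFun P) x
      = eval (coords N x) (pb (bivector N) (X i) P) := by
  have h : grad (fun x => coords N x i) x = covec i := by
    refine grad_eq fun δ => ?_
    let ℓ : State N →L[ℝ] ℝ :=
      (ContinuousLinearMap.proj i).comp (coords N).toContinuousLinearMap
    rw [show (fun x => coords N x i) = ℓ from rfl, ℓ.fderiv, pairing_covec]
    rfl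
  rw [eval_pb_X, ← pairing_grad, pairing_coad, lpBracket, h]

theorem eval_funext {P Q : MvPolynomial (Idx N) ℝ}
    (h : ∀ x, eval (coords N x) P = eval (coords N x) Q) : P = Q :=
  MvPolynomial.funext fun y => by
    have := h ((coords N).symm y)
    rwa [ContinuousLinearEquiv.apply_symm_apply] at this

/-- The brackets of coordinates are linear functions, so a second bracket with a coordinate is the
pairing with a double commutator. The Jacobi identity is then that of the associative algebra `Amb
N`. -/
theorem isPoisson_bivector (N : ℕ) : IsPoisson (bivector N) where
  antisymm i j := eval_funext fun x => by
    rw [map_neg, bivector, bivector, eval_linPoly, eval_linPoly, algBracket_swap, map_neg,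
      LinearMap.neg_apply]
  jacobi i j k := eval_funext fun x => by
    have key : ∀ i j k : Idx N, eval (coords N x) (pb (bivector N) (bivector N i j) (X k))
        = tau N (⁅hat (covec k), ⁅hat (covec i), hat (covec j)⁆⁆ * emb N x) := by
      intro i j k
      have h1 : pb (bivector N) (bivector N i j) (X k)
          = ∑ l, bivector N l k * pderiv l (bivector N i j) := by
        simp [pb, pderiv_X, Pi.single_apply]
      have h2 : polyFun (bivector N i j)
          = LinearMap.toContinuousLinearMap (pairing N (algBracket (covec i) (covec j))) := by
        funext x
        exact eval_linPoly _ _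
      have h3 := fderiv_polyFun (bivector N i j) x (coad (covec k) x)
      rw [h2, ContinuousLinearMap.fderiv] at h3
      have h4 : eval (coords N x) (pb (bivector N) (bivector N i j) (X k))
          = -pairing N (algBracket (covec i) (covec j)) (coad (covec k) x) := by
        rw [← LinearMap.coe_toContinuousLinearMap', h3, h1, map_sum, ← Finset.sum_neg_distrib]
        refine Finset.sum_congr rfl fun l _ => ?_
        rw [map_mul, bivector, eval_linPoly, algBracket_swap, map_neg, LinearMap.neg_apply,
          ← pairing_coad, pairing_covec]
        ring
      rw [h4, pairing_coad, pairing_eq, hat_algBracket, hat_algBracket, neg_neg]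
    rw [map_add, map_add, key, key, key, map_zero, ← map_add, ← map_add, ← add_mul, ← add_mul]
    have e : ⁅hat (covec k), ⁅hat (covec i), hat (covec j)⁆⁆
        + ⁅hat (covec i), ⁅hat (covec j), hat (covec k)⁆⁆
        + ⁅hat (covec j), ⁅hat (covec k), hat (covec i)⁆⁆ = 0 := by
      simp only [Ring.lie_def]
      noncomm_ring
    rw [e, zero_mul, map_zero]

theorem isFlowLine_coords {P : MvPolynomial (Idx N) ℝ} {γ : ℝ → State N} {h : ℝ}
    (hγ : IsHamiltonianSolutionOn (polyFun P) γ (Icc 0 h)) :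
    IsFlowLine (bivector N) P h fun t => coords N (γ t) := by
  intro t ht i
  let ℓ : State N →L[ℝ] ℝ := (ContinuousLinearMap.proj i).comp (coords N).toContinuousLinearMap
  have h1 := hγ ℓ ℓ.contDiff t ht
  rw [show (ℓ : State N → ℝ) = fun x => coords N x i from rfl, lpBracket_polyFun_X] at h1
  exact h1

end Hazeltine

/-! ### Gronwall estimate for approximate integral curves. -/

namespace PolyPoisson

open MvPolynomial
open scoped NNReal

variable {ι : Type*} [Fintype ι] {π : ι → ι → MvPolynomial ι ℝ} {P : MvPolynomial ι ℝ} {r : ℝ}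

theorem exists_lipschitzOnWith_flowField (hr : 0 ≤ r) :
    ∃ K : ℝ≥0, LipschitzOnWith K (fun z i => eval z (pb π (X i) P))
      (Metric.closedBall (0 : ι → ℝ) r) := by
  set D := ∑ i, ∑ j, pnorm r (pderiv j (pb π (X i) P)) with hD
  have hD' : ∀ i j, pnorm r (pderiv j (pb π (X i) P)) ≤ D := fun i j =>
    (Finset.single_le_sum (f := fun j => pnorm r (pderiv j (pb π (X i) P)))
      (fun j _ => pnorm_nonneg hr _) (Finset.mem_univ j)).trans
    (Finset.single_le_sum (f := fun i => ∑ j, pnorm r (pderiv j (pb π (X i) P)))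
      (fun i _ => Finset.sum_nonneg fun j _ => pnorm_nonneg hr _) (Finset.mem_univ i))
  have hD0 : 0 ≤ D := Finset.sum_nonneg fun i _ => Finset.sum_nonneg fun j _ => pnorm_nonneg hr _
  refine ⟨⟨Fintype.card ι * D, mul_nonneg (Nat.cast_nonneg _) hD0⟩,
    LipschitzOnWith.of_dist_le_mul fun y hy z hz => ?_⟩
  rw [dist_eq_norm, dist_eq_norm]
  refine (pi_norm_le_iff_of_nonneg (mul_nonneg (NNReal.coe_nonneg _) (norm_nonneg _))).2
    fun i => ?_
  have := abs_eval_sub_le (hD' i) (mem_closedBall_zero_iff.1 hy) (mem_closedBall_zero_iff.1 hz)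
  rw [← mul_assoc] at this
  exact this

theorem pb_X_smul (π : ι → ι → MvPolynomial ι ℝ) (i : ι) (σ : ℝ) (P : MvPolynomial ι ℝ) :
    pb π (X i) (σ • P) = σ • pb π (X i) P :=
  ((pbL π) (X i)).map_smul σ P

/-- The distance of an approximate integral curve of a Hamiltonian vector field from an integral
curve. -/
theorem exists_flow_error (π : ι → ι → MvPolynomial ι ℝ) (P : MvPolynomial ι ℝ) (hr : 0 ≤ r) :
    ∃ K ≥ 0, ∀ (σ T ε : ℝ) (y g : ℝ → ι → ℝ), 0 ≤ T → T ≤ 1 → 0 ≤ ε → |σ| ≤ 1 →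
      (∀ t ∈ Icc 0 T, ‖y t‖ ≤ r) → (∀ t ∈ Icc 0 T, ‖g t‖ ≤ r) → ContinuousOn y (Icc 0 T) →
      (∀ t ∈ Ico 0 T, ∃ y', HasDerivWithinAt y y' (Ici t) t ∧
        ∀ i, |y' i - σ * eval (y t) (pb π (X i) P)| ≤ ε) →
      IsFlowLine π (σ • P) T g → y 0 = g 0 → ‖y T - g T‖ ≤ K * (ε * T) := by
  obtain ⟨K₀, hK₀⟩ := exists_lipschitzOnWith_flowField (π := π) (P := P) hr
  -- Increased by 1 to be positive, so that the Gronwall bound has the form (ε/K)(e^{KT} - 1), which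
  -- is at most e^K εT for T ≤ 1.
  set K : ℝ≥0 := K₀ + 1
  refine ⟨Real.exp K, (Real.exp_pos _).le, fun σ T ε y g hT hT1 hε hσ hy hg hyc hyd hgd h0 => ?_⟩
  have hv : LipschitzOnWith K (fun z i => σ * eval z (pb π (X i) P))
      (Metric.closedBall (0 : ι → ℝ) r) := by
    refine LipschitzOnWith.of_dist_le_mul fun a ha b hb => ?_
    have h1 := (hK₀.weaken (show K₀ ≤ K from le_self_add)).dist_le_mul a ha b hb
    rw [dist_eq_norm] at h1 ⊢
    refine le_trans ?_ h1
    have : ((fun i => σ * eval a (pb π (X i) P)) - fun i => σ * eval b (pb π (X i) P))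
        = σ • ((fun i => eval a (pb π (X i) P)) - fun i => eval b (pb π (X i) P)) := by
      ext i
      simp [mul_sub]
    rw [this, norm_smul, Real.norm_eq_abs]
    exact mul_le_of_le_one_left (norm_nonneg _) hσ
  have hgd' : ∀ t ∈ Icc 0 T, HasDerivWithinAt g (fun i => σ * eval (g t) (pb π (X i) P))
      (Icc 0 T) t := fun t ht => hasDerivWithinAt_pi.2 fun i => by
    have := hgd t ht i
    rwa [pb_X_smul, smul_eval] at this
  choose! y' hy' hy'' using hyd
  have key := dist_le_of_approx_trajectories_ODE_of_mem
    (v := fun _ z i => σ * eval z (pb π (X i) P)) (s := fun _ => Metric.closedBall (0 : ι → ℝ) r)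
    (K := K) (εf := ε) (εg := 0) (δ := 0) (a := 0) (b := T)
    (fun t _ => hv) hyc hy'
    (fun t ht => by
      rw [dist_eq_norm]
      exact (pi_norm_le_iff_of_nonneg hε).2 fun i => hy'' t ht i)
    (fun t ht => mem_closedBall_zero_iff.2 (hy t ⟨ht.1, ht.2.le⟩))
    (fun t ht => (hgd' t ht).continuousWithinAt)
    (fun t ht => (hgd' t ⟨ht.1, ht.2.le⟩).mono_of_mem_nhdsWithin (Icc_mem_nhdsGE_of_mem ht))
    (fun t ht => by rw [dist_self]) (fun t ht => mem_closedBall_zero_iff.2 (hg t ⟨ht.1, ht.2.le⟩))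
    (by rw [h0, dist_self]) T (right_mem_Icc.2 hT)
  have hK : (0 : ℝ) < K := by
    have : (0 : ℝ) ≤ K₀ := K₀.2
    simp only [K, NNReal.coe_add, NNReal.coe_one]
    linarith
  rw [dist_eq_norm, gronwallBound_of_K_ne_0 hK.ne', add_zero, sub_zero] at key
  simp only [zero_mul, zero_add] at key
  refine key.trans ?_
  have h1 := Real.add_one_le_exp (-(K * T))
  have h2 : Real.exp (-(K * T)) * Real.exp (K * T) = 1 := by rw [← Real.exp_add]; simp
  have h3 : Real.exp (K * T) - 1 ≤ K * T * Real.exp (K * T) := by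
    nlinarith [Real.exp_pos (K * T)]
  have h4 : Real.exp (K * T) ≤ Real.exp K := Real.exp_le_exp.2 (by nlinarith)
  calc ε / K * (Real.exp (K * T) - 1) ≤ ε / K * (K * T * Real.exp (K * T)) := by gcongr
    _ = Real.exp (K * T) * (ε * T) := by field_simp
    _ ≤ _ := by gcongr

end PolyPoisson

namespace Hazeltine

open Midpoint PolyPoisson MvPolynomial

variable {N : ℕ}

theorem norm_lie_le {A : Type*} [NormedRing A] (a b : A) : ‖⁅a, b⁆‖ ≤ 2 * (‖a‖ * ‖b‖) := by
  rw [Ring.lie_def]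
  have := norm_sub_le (a * b) (b * a)
  have := norm_mul_le a b
  have := norm_mul_le b a
  linarith [mul_comm ‖a‖ ‖b‖]

theorem emb_eq_sum (x : State N) : ∑ i, coords N x i • emb N (base i) = emb N x :=
  sum_coords_smul (emb N).toLinearMap x

theorem ham_eq_quad (α : ℝ) (x : State N) : ham α x = quad (tau N) (genMap N α) (emb N x) :=
  ham_eq α x

theorem IsScheme.mono {α R h₀ h₁ : ℝ} {Z : ℝ → State N → Tri N} {φ : ℝ → State N → State N}
    (H : IsScheme α R h₀ Z φ) (hpos : 0 < h₁) (hle : h₁ ≤ h₀) : IsScheme α R h₁ Z φ where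
  pos := hpos
  norm_stage hh hx := H.norm_stage (hh.trans_le hle) hx
  skew_stage hh hx := H.skew_stage (hh.trans_le hle) hx
  start hh hx := H.start (hh.trans_le hle) hx
  target hh hx := H.target (hh.trans_le hle) hx
  unique hh hx := H.unique (hh.trans_le hle) hx
  smooth_stage := H.smooth_stage.mono
    (prod_mono (Ioo_subset_Ioo (neg_le_neg hle) hle) subset_rfl)
  smooth := H.smooth.mono (prod_mono (Ioo_subset_Ioo (neg_le_neg hle) hle) subset_rfl)
  norm_target hh hx := H.norm_target (hh.trans_le hle) hx
  bijective hh hz := H.bijective (hh.trans_le hle) hz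

theorem IsScheme.zero {α R h₀ : ℝ} {Z : ℝ → State N → Tri N} {φ : ℝ → State N → State N}
    (H : IsScheme α R h₀ Z φ) {x : State N} (hx : ‖x‖ < R) : φ 0 x = x := by
  have h0 : |(0 : ℝ)| < h₀ := by rw [abs_zero]; exact H.pos
  apply emb_injective
  rw [H.target h0 hx, H.start h0 hx, neg_zero]

/-- The time-dependent Hamiltonian of the scheme: a series of polynomials in the coordinates. -/
theorem exists_hamSeries (N : ℕ) (α : ℝ) :
    ∃ κ : ℕ → MvPolynomial (Idx N) ℝ, (∀ d, (κ d).totalDegree ≤ d + 2) ∧ κ 1 = 0 ∧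
      polyFun (κ 0) = ham α ∧
      (∀ r, 0 ≤ r → ∃ M ≥ 0, ∃ B ≥ 0, ∀ d, pnorm r (κ d) ≤ M * B ^ d) ∧
      ∀ R > 0, ∃ M ≥ 0, ∃ B ≥ 0, ∃ h₁ > 0, ∀ {h₀ Z φ}, IsScheme α R h₀ Z φ →
        ∀ {s : ℝ} {x : State N}, |s| < h₀ → |s| < h₁ → s ≠ 0 → ‖x‖ < R →
          ∃ v, HasDerivAt (fun t => φ t x) v s ∧ ∀ i n, |coords N v i - eval (coords N (φ s x))
            (pb (bivector N) (X i) (∑ d ∈ Finset.range n, s ^ d • κ d))| ≤ M * (B * |s|) ^ n := by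
  obtain ⟨q, hq0, hq1, ⟨M, hM, B, hB, hMB⟩, hD⟩ :=
    exists_expansion (tau N) (genMap N α) tau_mul_comm (tau_genMap_mul α)
  have hpoly : ∀ d x, polyFun (ofMul (q d) fun i => emb N (base i)) x = q d fun _ => emb N x := by
    intro d x
    rw [polyFun, eval_ofMul, emb_eq_sum]
  refine ⟨fun d => ofMul (q d) fun i => emb N (base i), fun d => totalDegree_ofMul_le _ _,
    eval_funext fun x => ?_, funext fun x => ?_, fun r hr => ?_, fun R hR => ?_⟩
  · exact (hpoly 1 x).trans (by rw [hq1, map_zero])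
  · rw [hpoly, hq0, ham_eq_quad]
  · set S := ∑ i, ‖emb N (base i)‖ * r
    have hS : 0 ≤ S := Finset.sum_nonneg fun i _ => by positivity
    refine ⟨M * S ^ 2, by positivity, B * S, by positivity, fun d => ?_⟩
    refine (pnorm_ofMul_le hr _ _).trans ?_
    calc _ ≤ M * B ^ d * S ^ (d + 2) := by gcongr; exact hMB d
      _ = _ := by ring
  · set T : Tri N →L[ℝ] Amb N := (toAmbL N).toContinuousLinearMap with hT
    -- Bounds in the ambient algebra both the stage, of norm less than 2R, and the end point, of
    -- norm less than 3R; the summand 1 keeps it positive.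
    set ρ := ‖T‖ * (2 * R) + ‖emb N‖ * (3 * R) + 1 with hρ
    have hρ0 : 0 < ρ := by positivity
    obtain ⟨M', hM', B', hB', h₁, hh₁, hexp⟩ := hD ρ hρ0
    set S := ∑ i : Idx N, ‖hat (covec i)‖ with hS
    have hS0 : 0 ≤ S := Finset.sum_nonneg fun i _ => norm_nonneg _
    refine ⟨M' * (2 * (ρ * S)), by positivity, B', hB', h₁, hh₁,
      fun {h₀ Z φ} H {s x} hs hs1 hs0 hx => ?_⟩
    have hz : ‖toAmb N (Z s x)‖ ≤ ρ := by
      have h1 : toAmb N (Z s x) = T (Z s x) := (toAmbL_apply _).symm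
      rw [h1]
      calc _ ≤ ‖T‖ * ‖Z s x‖ := T.le_opNorm _
        _ ≤ ‖T‖ * (2 * R) := by gcongr; exact (H.norm_stage hs hx).le
        _ ≤ ρ := by rw [hρ]; have : 0 ≤ ‖emb N‖ * (3 * R) := by positivity
                    linarith
    have hy : ‖emb N (φ s x)‖ ≤ ρ := by
      calc _ ≤ ‖emb N‖ * ‖φ s x‖ := (emb N).le_opNorm _
        _ ≤ ‖emb N‖ * (3 * R) := by gcongr; exact (H.norm_target hs hx).le
        _ ≤ ρ := by rw [hρ]; have : 0 ≤ ‖T‖ * (2 * R) := by positivity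
                    linarith
    obtain ⟨D, hD1, hD2⟩ := hexp s _ hs0 hs1 hz (by rw [← H.target hs hx]; exact hy)
    obtain ⟨v, hv, hv'⟩ := H.exists_hasDerivAt hs hx hD1
    refine ⟨v, hv, fun i n => ?_⟩
    set G : Amb N → ℝ := fun w => ∑ d ∈ Finset.range n, s ^ d * q d fun _ => w with hG
    have hGd : ContDiff ℝ ω G := by
      refine ContDiff.sum fun d _ => contDiff_const.mul ?_
      exact (q d).contDiff.comp (contDiff_pi.2 fun _ => contDiff_id)
    have hPG : polyFun (∑ d ∈ Finset.range n, s ^ d • ofMul (q d) fun i => emb N (base i))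
        = G ∘ emb N := by
      funext x
      rw [polyFun, map_sum]
      refine Finset.sum_congr rfl fun d _ => ?_
      rw [smul_eval, ← hpoly]
      rfl
    rw [← pairing_covec, hv', eval_pb_X, hPG, fderiv_comp _
      (hGd.differentiable (by simp)).differentiableAt (emb N).differentiableAt,
      ContinuousLinearMap.fderiv, ContinuousLinearMap.comp_apply, ← _root_.sub_apply]
    have h1 := hD2 n
    rw [← H.target hs hx] at h1
    have h2 : ‖emb N (coad (covec i) (φ s x))‖ ≤ 2 * (ρ * S) := by
      rw [emb_coad]
      refine (norm_lie_le _ _).trans ?_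
      gcongr
      exact Finset.single_le_sum (f := fun i : Idx N => ‖hat (covec i)‖)
        (fun i _ => norm_nonneg _) (Finset.mem_univ i)
    calc _ ≤ ‖D - fderiv ℝ G (emb N (φ s x))‖ * ‖emb N (coad (covec i) (φ s x))‖ :=
          ContinuousLinearMap.le_opNorm _ _
      _ ≤ M' * (B' * |s|) ^ n * (2 * (ρ * S)) := by gcongr
      _ = _ := by ring

/-- The velocity of the scheme at step size `0`. -/
theorem IsScheme.exists_hasDerivAt_zero {α R h₀ : ℝ} {Z : ℝ → State N → Tri N}
    {φ : ℝ → State N → State N} (H : IsScheme α R h₀ Z φ) {x : State N} (hx : ‖x‖ < R)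
    {P : MvPolynomial (Idx N) ℝ} (hP : polyFun P = ham α) :
    ∃ v, HasDerivAt (fun t => φ t x) v 0 ∧
      ∀ i, coords N v i = eval (coords N (φ 0 x)) (pb (bivector N) (X i) P) := by
  have h0 : |(0 : ℝ)| < h₀ := by rw [abs_zero]; exact H.pos
  have hz : emb N x = toAmb N (Z 0 x) := by
    rw [H.start h0 hx]
    simp [mid]
  obtain ⟨v, hv, hv'⟩ := H.exists_hasDerivAt h0 hx (D := LinearMap.toContinuousLinearMap
    (tau N ∘ₗ LinearMap.mulLeft ℝ (genMap N α (toAmb N (Z 0 x))))) (fun ζ => by simp [dmid])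
  refine ⟨v, hv, fun i => ?_⟩
  rw [← pairing_covec, hv', eval_pb_X, hP, H.zero hx, fderiv_ham, hz]
  rfl

end Hazeltine

namespace Hazeltine

open Midpoint PolyPoisson MvPolynomial

variable {N : ℕ}

/-! ### The scheme as an integrator -/

theorem norm_coords_le {R : ℝ} {x : State N} (hx : ‖x‖ ≤ R) :
    ‖coords N x‖ ≤ ‖(coords N).toContinuousLinearMap‖ * R :=
  ((coords N).toContinuousLinearMap.le_opNorm x).trans (by gcongr)

theorem norm_sub_le_coords (x y : State N) :
    ‖x - y‖ ≤ ‖(coords N).symm.toContinuousLinearMap‖ * ‖coords N x - coords N y‖ := by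
  have := (coords N).symm.toContinuousLinearMap.le_opNorm (coords N x - coords N y)
  simpa using this

theorem IsScheme.continuousOn_coords {α R h₀ : ℝ} {Z : ℝ → State N → Tri N}
    {φ : ℝ → State N → State N} (H : IsScheme α R h₀ Z φ) {x : State N} (hx : ‖x‖ < R) :
    ContinuousOn (fun t => coords N (φ t x)) (Ioo (-h₀) h₀) := fun _ ht =>
  ((coords N).continuous.continuousAt.comp
    (differentiableAt_fst H.smooth (H.mem_nhds (abs_lt.2 ht) hx)).continuousAt).continuousWithinAt

theorem hasDerivAt_coords_comp {φ : ℝ → State N} {v : State N} {σ t : ℝ}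
    (h : HasDerivAt φ v (σ * t)) :
    HasDerivAt (fun t => coords N (φ (σ * t))) (σ • coords N v) t := by
  have h1 : HasDerivAt (fun t => σ * t) σ t := by simpa using (hasDerivAt_id t).const_mul σ
  have h2 := (coords N).toContinuousLinearMap.hasFDerivAt.comp_hasDerivAt t (h.scomp t h1)
  refine h2.congr_deriv ?_
  exact (coords N).map_smul σ v

theorem isFlowLine_of_isSolutionOn {α h σ : ℝ} {γ : ℝ → State N} {P : MvPolynomial (Idx N) ℝ}
    (hP : polyFun P = ham α) (hγ : IsSolutionOn α γ (uIcc 0 h))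
    (hσ : ∀ t ∈ Icc 0 |h|, σ * t ∈ uIcc 0 h) :
    IsFlowLine (bivector N) (σ • P) |h| fun t => coords N (γ (σ * t)) := by
  intro t ht i
  rw [isSolutionOn_iff, ← hP] at hγ
  let ℓ : State N →L[ℝ] ℝ := (ContinuousLinearMap.proj i).comp (coords N).toContinuousLinearMap
  have h1 := hγ ℓ ℓ.contDiff (σ * t) (hσ t ht)
  rw [show (ℓ : State N → ℝ) = fun x => coords N x i from rfl, lpBracket_polyFun_X] at h1
  have h2 : HasDerivWithinAt (fun t => σ * t) σ (Icc 0 |h|) t := by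
    simpa using ((hasDerivAt_id t).const_mul σ).hasDerivWithinAt
  refine (h1.comp t h2 hσ).congr_deriv ?_
  rw [pb_X_smul, smul_eval, mul_comm]

/-- The scheme is of order two. -/
theorem exists_order_two (N : ℕ) (α : ℝ) {R : ℝ} (hR : 0 < R) :
    ∃ h₂ > 0, ∃ C : ℝ, ∀ {h₀ Z φ}, IsScheme α R h₀ Z φ → h₀ ≤ h₂ →
      ∀ (h : ℝ) (γ : ℝ → State N), |h| < h₀ → ‖γ 0‖ < R → IsSolutionOn α γ (uIcc 0 h) →
        ‖φ h (γ 0) - γ h‖ ≤ C * |h| ^ 3 := by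
  obtain ⟨κ, -, hκ1, hκ0, -, hexp⟩ := exists_hamSeries N α
  obtain ⟨M, hM, B, hB, h₁, hh₁, hexp⟩ := hexp R hR
  set r₀ := ‖(coords N).toContinuousLinearMap‖ * (3 * R) with hr₀
  have hr₀0 : 0 ≤ r₀ := by positivity
  set r := r₀ + 1 with hr
  have hr0 : 0 ≤ r := by positivity
  set V := ∑ i, pnorm r (pb (bivector N) (X i) (κ 0)) with hV
  have hV' : ∀ i, pnorm r (pb (bivector N) (X i) (κ 0)) ≤ V := fun i =>
    Finset.single_le_sum (f := fun i => pnorm r (pb (bivector N) (X i) (κ 0)))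
      (fun i _ => pnorm_nonneg hr0 _) (Finset.mem_univ i)
  have hV0 : 0 ≤ V := Finset.sum_nonneg fun i _ => pnorm_nonneg hr0 _
  obtain ⟨K, hK, hflow⟩ := exists_flow_error (bivector N) (κ 0) hr0
  set c := ‖(coords N).symm.toContinuousLinearMap‖
  -- The three bounds are for the expansion of the velocity, for the constant of
  -- `exists_flow_error`, which supposes times at most 1, and for keeping the exact solution within
  -- distance 1 of the ball of radius r₀.
  refine ⟨min h₁ (min 1 (1 / (V + 1))), by positivity, c * (K * (M * B ^ 2)), ?_⟩
  intro h₀ Z φ H hh₂ h γ hh hx hγ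
  have hh1 : |h| < h₁ := hh.trans_le (hh₂.trans (min_le_left _ _))
  have hT1 : |h| ≤ 1 := (hh.trans_le (hh₂.trans ((min_le_right _ _).trans (min_le_left _ _)))).le
  have hTV : (V + 1) * |h| ≤ 1 := by
    have := (hh.trans_le (hh₂.trans ((min_le_right _ _).trans (min_le_right _ _)))).le
    rwa [le_div_iff₀ (by positivity), mul_comm] at this
  -- Negative step sizes are treated by reversing time: σ is the sign of h, and the system with
  -- Hamiltonian σH is followed over [0, |h|].
  obtain ⟨σ, hσ1, hσh, hσm⟩ : ∃ σ : ℝ, |σ| = 1 ∧ σ * |h| = h ∧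
      ∀ t ∈ Icc 0 |h|, σ * t ∈ uIcc 0 h := by
    rcases le_total 0 h with h0 | h0
    · refine ⟨1, by simp, by rw [abs_of_nonneg h0, one_mul], fun t ht => ?_⟩
      rw [abs_of_nonneg h0] at ht
      rwa [one_mul, uIcc_of_le h0]
    · refine ⟨-1, by simp, by rw [abs_of_nonpos h0]; ring, fun t ht => ?_⟩
      rw [abs_of_nonpos h0] at ht
      rw [uIcc_of_ge h0]
      constructor <;> linarith [ht.1, ht.2]
  have habs : ∀ t ∈ Icc 0 |h|, |σ * t| = t := fun t ht => by
    rw [abs_mul, hσ1, one_mul, abs_of_nonneg ht.1]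
  have hlt : ∀ t ∈ Icc 0 |h|, |σ * t| < h₀ := fun t ht => by
    rw [habs t ht]; exact ht.2.trans_lt hh
  have hgl := isFlowLine_of_isSolutionOn hκ0 hγ hσm
  have h0 : coords N (φ (σ * 0) (γ 0)) = coords N (γ (σ * 0)) := by
    rw [mul_zero, H.zero hx]
  have hεn : 0 ≤ M * (B * |h|) ^ 2 := by positivity
  have key := hflow σ |h| (M * (B * |h|) ^ 2) (fun t => coords N (φ (σ * t) (γ 0)))
    (fun t => coords N (γ (σ * t))) (abs_nonneg h) hT1 hεn hσ1.le
    (fun t ht => (norm_coords_le (H.norm_target (hlt t ht) hx).le).trans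
      (by rw [hr]; linarith))
    (hgl.norm_le hV0 (fun i => by rw [pb_X_smul, pnorm_smul, hσ1, one_mul]; exact hV' i)
      (r₀ := r₀) (by
        rw [mul_zero]
        exact norm_coords_le (by linarith)) (by rw [hr]; linarith))
    ((H.continuousOn_coords hx).comp (by fun_prop) fun t ht => abs_lt.1 (hlt t ht))
    (fun t ht => by
      have ht' : t ∈ Icc 0 |h| := ⟨ht.1, ht.2.le⟩
      -- The expansion holds only for nonzero step sizes. At 0 the velocity is exactly the
      -- Hamiltonian field of H.
      rcases ht.1.eq_or_lt with rfl | ht0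
      · obtain ⟨v, hv, hv'⟩ := H.exists_hasDerivAt_zero hx hκ0
        refine ⟨σ • coords N v, (hasDerivAt_coords_comp (φ := fun t => φ t (γ 0))
          (by rwa [mul_zero])).hasDerivWithinAt, fun i => ?_⟩
        simp only [mul_zero]
        rw [Pi.smul_apply, smul_eq_mul, hv', sub_self, abs_zero]
        exact hεn
      · obtain ⟨v, hv, hv'⟩ := hexp H (hlt t ht') (by rw [habs t ht']; exact ht.2.trans hh1)
          (by rw [← abs_pos, habs t ht']; exact ht0) hx
        refine ⟨σ • coords N v, (hasDerivAt_coords_comp hv).hasDerivWithinAt, fun i => ?_⟩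
        -- As κ 1 = 0, the truncation after two terms is H itself. The velocity therefore differs
        -- from the Hamiltonian field by O(s²), and integration gives O(h³).
        have h1 := hv' i 2
        rw [Finset.sum_range_succ, Finset.sum_range_one, hκ1, smul_zero, add_zero, pow_zero,
          one_smul, habs t ht'] at h1
        rw [Pi.smul_apply, smul_eq_mul, ← mul_sub, abs_mul, hσ1, one_mul]
        refine h1.trans ?_
        have := ht.1
        have := ht.2.le
        gcongr)
    hgl h0
  simp only [hσh] at key
  calc _ ≤ c * ‖coords N (φ h (γ 0)) - coords N (γ h)‖ := norm_sub_le_coords _ _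
    _ ≤ c * (K * (M * (B * |h|) ^ 2 * |h|)) := by gcongr
    _ = _ := by ring

/-! ### Backward error analysis -/

theorem exp_neg_div_le {c h : ℝ} (hc : 0 < c) (hh : 0 < h) :
    Real.exp (-c / (2 * h)) ≤ 8 / c ^ 2 * h ^ 2 := by
  have h1 : (c / (2 * h)) ^ 2 / 2 ≤ Real.exp (c / (2 * h)) := by
    have := Real.quadratic_le_exp_of_nonneg (show 0 ≤ c / (2 * h) by positivity)
    have : 0 ≤ c / (2 * h) := by positivity
    linarith
  rw [neg_div, Real.exp_neg]
  calc _ ≤ ((c / (2 * h)) ^ 2 / 2)⁻¹ := inv_anti₀ (by positivity) h1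
    _ = _ := by field_simp; norm_num

theorem abs_sub_le_of_steps {X : Type*} {F : X → ℝ} {φ : X → X} {D : Set X} {δ : ℝ}
    (hF : ∀ x ∈ D, |F (φ x) - F x| ≤ δ) {n : ℕ} {x : ℕ → X} (hx : ∀ k ≤ n, x k ∈ D)
    (hstep : ∀ k < n, x (k + 1) = φ (x k)) : |F (x n) - F (x 0)| ≤ n * δ := by
  induction n with
  | zero => simp
  | succ n ih =>
    have h1 := ih (fun k hk => hx k (by omega)) fun k hk => hstep k (by omega)
    have h2 := hF (x n) (hx n (by omega))
    rw [← hstep n (by omega)] at h2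
    have h3 := abs_add_le (F (x (n + 1)) - F (x n)) (F (x n) - F (x 0))
    rw [sub_add_sub_cancel] at h3
    push_cast
    linarith

/-- For each x the curve s ↦ φ_s(x) from 0 to h is an approximate trajectory of the Hamiltonian
series, so `exists_modified_hamiltonian` applies in coordinates. The curve starts in the ball of
radius R and stays in that of radius 3R, which fixes r₀. -/
theorem exists_nearlyPreserves (N : ℕ) (α : ℝ) {R : ℝ} (hR : 0 < R) :
    ∃ h₂ > 0, ∀ {h₀} {Z : ℝ → State N → Tri N} {φ}, IsScheme α R h₀ Z φ → h₀ ≤ h₂ →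
      NearlyPreservesHamiltonian α h₀ R φ := by
  obtain ⟨κ, hdeg, hκ1, hκ0, hbd, hexp⟩ := exists_hamSeries N α
  obtain ⟨M', hM', B', hB', h₁, hh₁, hexp⟩ := hexp R hR
  set r₀ := ‖(coords N).toContinuousLinearMap‖ * (3 * R) with hr₀
  have hr₀0 : 0 ≤ r₀ := by positivity
  obtain ⟨M, hM, B, hB, hMB⟩ := hbd (r₀ + 1) (by positivity)
  obtain ⟨h₂, hh₂, C, hC, c, hc, Hm, hHm⟩ := exists_modified_hamiltonian (r := r₀ + 1) (r₀ := r₀)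
    (by linarith) (isPoisson_bivector N) (fun i j => totalDegree_linPoly_le _) hdeg hM hB hMB hκ1
    hM' hB' (by linarith)
  refine ⟨min h₁ h₂, by positivity, fun {h₀ Z φ} H hle => ?_⟩
  set K := ‖(coords N).symm.toContinuousLinearMap‖
  have hK : 0 ≤ K := norm_nonneg (coords N).symm.toContinuousLinearMap
  have hc8 : 0 ≤ 8 / c ^ 2 := by positivity
  obtain ⟨C', hC'0, hC1, hCK, hC8⟩ : ∃ C' : ℝ, 0 < C' ∧ C ≤ C' ∧ K * C ≤ C' ∧
      C + C * (8 / c ^ 2) + C ≤ C' := by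
    refine ⟨C * (K + 3 + 8 / c ^ 2), by positivity, le_mul_of_one_le_right hC.le (by linarith), ?_,
      ?_⟩
    · rw [mul_comm]; exact mul_le_mul_of_nonneg_left (by linarith) hC.le
    · have : 0 ≤ C * K := by positivity
      linarith
  refine ⟨C', hC'0, c, hc, fun h => polyFun (Hm h), fun h hh hh0 => ?_⟩
  obtain ⟨hA, hB2, hC2⟩ := hHm h hh (hh0.trans_le (hle.trans (min_le_right _ _)))
  have habs : ∀ t ∈ Icc 0 h, |t| < h₀ := fun t ht => by
    rw [abs_of_nonneg ht.1]; exact ht.2.trans_lt hh0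
  have htraj : ∀ x : State N, ‖x‖ < R → ApproxTraj (r₀ + 1) (bivector N) κ M' B' h
      fun s => coords N (φ s x) := by
    intro x hx
    refine ⟨(H.continuousOn_coords hx).mono fun t ht => abs_lt.1 (habs t ht),
      fun s hs => (norm_coords_le (H.norm_target (habs s hs) hx).le).trans (by linarith),
      fun s hs => ?_⟩
    have hs' := habs s ⟨hs.1.le, hs.2.le⟩
    have hsa : |s| = s := abs_of_pos hs.1
    obtain ⟨v, hv, hv'⟩ := hexp H hs' (hs'.trans_le (hle.trans (min_le_left _ _))) hs.1.ne' hx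
    refine ⟨coords N v, fun i => ⟨?_, fun n => ?_⟩⟩
    · exact hasDerivAt_pi.1
        ((coords N).toContinuousLinearMap.hasFDerivAt.comp_hasDerivAt s hv) i
    · have := hv' i n
      rwa [hsa] at this
  have hinit : ∀ x : State N, ‖x‖ < R → ‖coords N (φ 0 x)‖ ≤ r₀ := fun x hx =>
    norm_coords_le (by rw [H.zero hx]; linarith)
  have hnear : ∀ x : State N, ‖x‖ < R → |polyFun (Hm h) x - ham α x| ≤ C * h ^ 2 := by
    intro x hx
    rw [← hκ0]
    have h1 : ‖coords N x‖ ≤ r₀ := norm_coords_le (by linarith)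
    exact hA _ (h1.trans (by linarith))
  have hpres : ∀ x : State N, ‖x‖ < R →
      |polyFun (Hm h) (φ h x) - polyFun (Hm h) x| ≤ C * h * Real.exp (-c / h) := by
    intro x hx
    have := hC2 (fun s => coords N (φ s x)) (hinit x hx) (htraj x hx)
    rwa [H.zero hx] at this
  have he : 0 ≤ h * Real.exp (-c / h) := by positivity
  have hmul : ∀ {a b e : ℝ}, a ≤ b → 0 ≤ e → a * e ≤ b * e :=
    fun hab he => mul_le_mul_of_nonneg_right hab he
  refine ⟨contDiff_polyFun _, fun x hx => (hnear x hx).trans (hmul hC1 (sq_nonneg h)), ?_,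
    fun x hx => (hpres x hx).trans ?_, ?_⟩
  · intro γ hx hγ
    have h1 := hB2 (fun s => coords N (φ s (γ 0))) (fun s => coords N (γ s)) (hinit _ hx) (htraj _ hx)
      (by rw [H.zero hx]) (isFlowLine_coords hγ)
    calc _ ≤ K * ‖coords N (φ h (γ 0)) - coords N (γ h)‖ := norm_sub_le_coords _ _
      _ ≤ K * (C * h * Real.exp (-c / h)) := by gcongr
      _ = K * C * (h * Real.exp (-c / h)) := by ring
      _ ≤ C' * (h * Real.exp (-c / h)) := hmul hCK he
      _ = _ := by ring
  · rw [mul_assoc, mul_assoc]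
    exact hmul hC1 he
  · intro n x hx hstep hn
    have h1 := abs_sub_le_of_steps (D := {x : State N | ‖x‖ < R}) hpres hx hstep
    have h2 : |polyFun (Hm h) (x n) - polyFun (Hm h) (x 0)| ≤ C * Real.exp (-c / (2 * h)) := by
      refine h1.trans ?_
      -- The n steps contribute at most C·nh·e^{-c/h}; the admissible length nh ≤ e^{c/(2h)} uses up
      -- half of the exponent.
      have e : Real.exp (c / (2 * h)) * Real.exp (-c / h) = Real.exp (-c / (2 * h)) := by
        rw [← Real.exp_add]
        congr 1
        field_simp
        ring
      calc _ = C * (n * h * Real.exp (-c / h)) := by ring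
        _ ≤ C * (Real.exp (c / (2 * h)) * Real.exp (-c / h)) := by gcongr
        _ = _ := by rw [e]
    refine ⟨h2.trans (hmul hC1 (Real.exp_pos _).le), ?_⟩
    have h3 := hnear (x n) (hx n le_rfl)
    have h4 := hnear (x 0) (hx 0 (Nat.zero_le n))
    have h5 := exp_neg_div_le hc hh
    have h6 : |ham α (x n) - ham α (x 0)| ≤ C * h ^ 2 + C * (8 / c ^ 2 * h ^ 2) + C * h ^ 2 := by
      have h7 : C * Real.exp (-c / (2 * h)) ≤ C * (8 / c ^ 2 * h ^ 2) := by gcongr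
      rw [abs_le] at h2 h3 h4 ⊢
      constructor <;> linarith [h2.1, h2.2, h3.1, h3.2, h4.1, h4.2]
    calc _ ≤ (C + C * (8 / c ^ 2) + C) * h ^ 2 := h6.trans (le_of_eq (by ring))
      _ ≤ C' * h ^ 2 := hmul hC8 (sq_nonneg h)

end Hazeltine

theorem mainTheorem2 (N : ℕ) (α : ℝ) :
    -- the equations are the Lie–Poisson system of the Hamiltonian
    (∀ (γ : ℝ → Hazeltine.State N) (s : Set ℝ),
      Hazeltine.IsSolutionOn α γ s ↔
        Hazeltine.IsHamiltonianSolutionOn (Hazeltine.ham α) γ s) ∧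
    -- the scheme consists of an isospectral midpoint step for `Ψ = W - χ` and a magnetic midpoint
    -- step for `(Θ, χ)`
    (∀ (h : ℝ) (W Θ χ Wt Θt χt W₁ Θ₁ χ₁ : Hazeltine.Mat N),
      Hazeltine.IsStep α h (W, Θ, χ) (Wt, Θt, χt) (W₁, Θ₁, χ₁) ↔
        Hazeltine.IsSkewTri (Wt, Θt, χt) ∧
        Hazeltine.IsIsospectralMidpointStep h (Hazeltine.lapInv N Wt)
          (W - χ) (Wt - χt) (W₁ - χ₁) ∧
        Hazeltine.IsMagneticMidpointStep h (Hazeltine.lapInv N Wt - α • χt) (Hazeltine.lap N Θt)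
          Θ χ Θt χt Θ₁ χ₁) ∧
    -- every step stays in the phase space and on the coadjoint orbit, and preserves the Casimirs
    (∀ (h : ℝ) (x : Hazeltine.State N) (xt y : Hazeltine.Tri N),
      Hazeltine.IsStep α h (Hazeltine.toTri x) xt y →
        (∃ y' : Hazeltine.State N, Hazeltine.toTri y' = y ∧ Hazeltine.SameCoadjointOrbit x y') ∧
        ∀ K F G : ℂ → ℂ,
          (cfc K (y.1 - y.2.2)).trace = (cfc K ((Hazeltine.toTri x).1 -
            (Hazeltine.toTri x).2.2)).trace ∧
          (cfc F y.2.1).trace = (cfc F (Hazeltine.toTri x).2.1).trace ∧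
          (y.2.2 * cfc G y.2.1).trace =
            ((Hazeltine.toTri x).2.2 * cfc G (Hazeltine.toTri x).2.1).trace) ∧
    -- for small steps the scheme defines a smooth Lie–Poisson integrator of order two, which nearly
    -- preserves the Hamiltonian
    (∀ R : ℝ, 0 < R → ∃ h₀ : ℝ, 0 < h₀ ∧ ∃ φ : ℝ → Hazeltine.State N → Hazeltine.State N,
      (∀ (h : ℝ) (x : Hazeltine.State N), |h| < h₀ → ‖x‖ < R →
        (∃! xt : Hazeltine.Tri N,
          ‖xt‖ < 2 * R ∧ Hazeltine.IsStage α h (Hazeltine.toTri x) xt) ∧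
        ∃ xt : Hazeltine.Tri N, ‖xt‖ < 2 * R ∧
          Hazeltine.IsStep α h (Hazeltine.toTri x) xt (Hazeltine.toTri (φ h x))) ∧
      ContDiffOn ℝ ∞ (fun p : ℝ × Hazeltine.State N => φ p.1 p.2)
        (Ioo (-h₀) h₀ ×ˢ Metric.ball 0 R) ∧
      (∃ C : ℝ, ∀ (h : ℝ) (γ : ℝ → Hazeltine.State N), |h| < h₀ → ‖γ 0‖ < R →
        Hazeltine.IsSolutionOn α γ (uIcc 0 h) → ‖φ h (γ 0) - γ h‖ ≤ C * |h| ^ 3) ∧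
      (∀ h : ℝ, |h| < h₀ → Hazeltine.IsLiePoissonMapOn (φ h) (Metric.ball 0 R)) ∧
      Hazeltine.NearlyPreservesHamiltonian α h₀ R φ) := by
  refine ⟨fun γ s => Hazeltine.isSolutionOn_iff, Hazeltine.isStep_iff α, fun h x xt y H => Hazeltine.step_orbit H, fun R hR => ?_⟩
  obtain ⟨h₁, Z, φ, H⟩ := Hazeltine.exists_isScheme N α hR
  obtain ⟨h₂, hh₂, C, hC⟩ := Hazeltine.exists_order_two N α hR
  obtain ⟨h₃, hh₃, hN⟩ := Hazeltine.exists_nearlyPreserves N α hR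
  have hh₁ := H.pos
  have H' := H.mono (h₁ := min h₁ (min h₂ h₃)) (by positivity) (min_le_left _ _)
  refine ⟨min h₁ (min h₂ h₃), H'.pos, φ, fun h x hh hx => ?_, H'.smooth,
    ⟨C, hC H' ((min_le_right _ _).trans (min_le_left _ _))⟩, fun h hh => H'.isLiePoissonMapOn hh,
    hN H' ((min_le_right _ _).trans (min_le_right _ _))⟩
  have hs := H'.isStep hh hx
  refine ⟨⟨Z h x, ⟨H'.norm_stage hh hx, hs.1⟩, fun z ⟨hz, hst⟩ => H'.unique hh hx hz ?_⟩,
    Z h x, H'.norm_stage hh hx, hs⟩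
  rw [Hazeltine.emb_apply]
  exact (Hazeltine.isStage_iff.1 hst).2
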